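/- **Norms.** For an open set $D\subset\mathbb R^d$ and $r=k+\beta>0$ with $k\in\mathbb N$, $0<\beta\le 1$, let $|u|_{D,r}=\|u\|_{C^k(D)}+\sup_{x,x+h,x+2h\in D,\,h\neq0}|h|^{-\beta}\,|\partial^ku(x)+\partial^ku(x+2h)-2\partial^ku(x+h)|$ be the Hölder–Zygmund norm of $\Lambda^r(D)$, let $\|u\|_{D,r}$, $r\ge0$, be the standard Hölder norm of $C^r(\overline D)$, and let $\mathcal N_t(D)=\{x:\operatorname{dist}(x,D)<t\}$. A bounded Lipschitz domain $D$ (an open set, not necessarily connected) is described by covering data $L$: finitely many boxes $B_i$ in rotated coordinates, an open set $W$ with a compact subset $Q\subset W$, and a bound $\Lambda$, such that $W\subset D$, the set $\overline D$ is covered by $Q$ and the boxes $\tfrac12B_i$, and $D\cap B_i$ is the part of $B_i$ above the graph of a function with Lipschitz constant $\le\Lambda$ whose absolute value is at most half the half-height of $B_i$. A constant is called *stable* if it depends on the covering data only; so it can be chosen uniformly for all small perturbations of $D$. Fix an integer $m_*\ge0$. **(1) Functions.** Given covering data $L$ in $\mathbb R^d$, there are stable constants $\tau\in(0,1]$, $A_a$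 and $C_{r,s}$ such that every Lipschitz domain $D$ described by $L$ admits a linear extension operator $E$ from $C^0(\overline D)$ to compactly supported continuous functions on $\mathbb R^d$, with $|Eu|_{\mathbb R^d,a}\le A_a|u|_{D,a}$ $(a>0)$ and $\|Eu\|_{\mathbb R^d,a}\le A_a\|u\|_{D,a}$ $(a\ge0)$, and linear operators $S^t:C^0(\overline D)\to C^\infty(\mathcal N_t(D))$, $0<t\le1$, with the following properties. For $t\le\tau$ one has $S^tu(x)=\sum_j\int(\chi_ju)(x-ty)\mu_j(y)\,dy$, a finite sum, where $\chi_ju:=0$ outside $D$, $\chi_j\geq0$ and $\mu_j$ are smooth with compact support, $\sum_j\chi_j=1$ on $\mathcal N_\tau(D)$, $\int\mu_j=1$, $\int y^I\mu_j(y)\,dy=0$ for $0<|I|\le m_*$, and $x-ty\in D$ whenever $x\in\mathcal N_t(D)$, $y\in\operatorname{supp}\mu_j$, $\chi_j(x-ty)\ne0$. For all $0<t\le1$ and $r,s>0$, $$|S^tu|_{\mathcal N_t(D),r}\le C_{r,s}t^{s-r}|u|_{D,s}\ \ (s\le r),\qquad |(I-S^t)Eu|_{\mathcal N_t(D),r}\le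 C_{r,s}t^{s-r}|u|_{D,s}\ \ (r\le s\le r+m_*),$$ $$|[\nabla,S^t]u|_{\mathcal N_t(D),s}\le C_{r,s}t^{r-s}|u|_{D,r}\ \ (|r-s|<m_*,\ u\in\Lambda^r(D)),$$ where $[\nabla,S^t]u:=\lim_{\varepsilon\to0^+}[\nabla,S^t]S^\varepsilon u$ pointwise on $\mathcal N_t(D)$, the limit exists, and it equals $\nabla S^tu-S^t\nabla u$ if $u\in C^1(\overline D)$. The same estimates hold with $\|\cdot\|$ in place of $|\cdot|$ for all $r,s\ge0$. **(2) Forms.** Let $V$ be a holomorphic vector bundle on a (Hausdorff) complex manifold $\mathcal M$ of dimension $n$. Fix finitely many holomorphic charts $\psi_k$, open sets $U_k$ whose closures are compact subsets of the domain of $\psi_k$, holomorphic frames $(e_{k,j})_j$ of $V$ over the domain of $\psi_k$, functions $\chi_k\ge0$ with $\chi_k^{1/2}$ smooth, $\operatorname{supp}\chi_k\subset U_k$ and $\sum_k\chi_k=1$ on an open set $\mathcal U$, a compact set $K\subset\mathcal U$, and covering data $L_k$ in $\mathbb C^n$. For an open set $M\subset K$ put $D_k=\psi_k(U_k\cap M)$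 and $\mathcal N_t(M)=\bigcup_k\psi_k^{-1}(\mathcal N_t(D_k))$. For a $V$-valued $(0,q)$-form $v=\sum v^j_{k,I}\,d\bar z_k^I\otimes e_{k,j}$ put $|v|_{M,r}=\max_{k,I,j}|v^j_{k,I}|_{D_k,r}$ and $|v|_{\mathcal N_t(M),r}=\max_{k,I,j}|v^j_{k,I}|_{\mathcal N_t(D_k),r}$. Then there are $\tau\in(0,1]$ and constants $C_{r,s}$, $A_a$, depending only on $m_*$, the charts, frames, $\chi_k$, $K$, the $L_k$ and the indices, such that for every open $M\subset K$ for which each $D_k$ is a Lipschitz domain described by $L_k$ (in particular for all small perturbations of one such $M$) the sets $\mathcal N_\tau(D_k)$ lie in the images of the charts, and there are operators $S_k^t$, $E_k$ on functions on $D_k$ as in (1), with the constants $\tau$, $A_a$, $C_{r,s}$, such that, for every $q\ge0$, the operators on $V$-valued $(0,q)$-forms on $\overline M$ $$S^tv=\sum_{k,I,j}\chi_k^{1/2}\,S_k^t\big((\chi_k^{1/2}\circ\psi_k^{-1})v^j_{k,I}\big)(z_k)\,d\bar z_k^I\otimes e_{k,j},\qquad Ev=\sum_{k,I,j}\chi_k^{1/2}\,E_k\big((\chi_k^{1/2}\circ\psi_k^{-1})v^j_{k,I}\big)(z_k)\,d\bar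 z_k^I\otimes e_{k,j}$$ satisfy $Ev=v$ on $M$ and $S^t:C^0_{0,q}(\overline M;V)\to C^\infty_{0,q}(\mathcal N_t(M);V)$ for $0<t\le\tau$, and for all $r,s>0$ and $0<t\le\tau$ $$|S^tv|_{\mathcal N_t(M),r}\le C_{r,s}t^{s-r}|v|_{M,s}\ \ (s\le r),\qquad |(I-S^t)Ev|_{\mathcal N_t(M),r}\le C_{r,s}t^{s-r}|v|_{M,s}\ \ (r\le s\le r+m_*),$$ $$|[\bar\partial,S^t]v|_{\mathcal N_t(M),s}\le C_{r,s}t^{r-s}|v|_{M,r}\ \ (s\le r<s+m_*,\ v\in\Lambda^r(M)),$$ where $[\bar\partial,S^t]v:=\lim_{\varepsilon\to0^+}[\bar\partial,S^t]S^\varepsilon v$ (pointwise on $\mathcal N_t(M)$), the limit exists and is a $(0,q+1)$-form on $\mathcal N_t(M)$, and it equals $\bar\partial S^tv-S^t\bar\partial v$ if $v\in C^1(\overline M)$. -/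

import Mathlib

open Set Filter MeasureTheory Bundle
open scoped Manifold ContDiff ENNReal NNReal Topology

noncomputable section

namespace MoserSmoothing

/-! ## Function spaces on open subsets of a Euclidean space -/

section Spaces

variable {E : Type*} [NormedAddCommGroup E] [NormedSpace ℝ E]
  {G : Type*} [NormedAddCommGroup G] [NormedSpace ℝ G]

/-- The restriction of `u` to `D` belongs to `C^0` of the closure of `D`.  Functions on `D` are
represented by total functions, whose values outside `D` are irrelevant. -/
def ContUpToBoundary (D : Set E) (u : E → G) : Prop :=
  ∃ g : E → G, ContinuousOn g (closure D) ∧ EqOn u g D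

/-- The restriction of `u` to `D` belongs to `C^1` of the closure of `D`. -/
def C1UpToBoundary (D : Set E) (u : E → G) : Prop :=
  ContDiffOn ℝ 1 u D ∧ ContUpToBoundary D u ∧
    ∀ w : E, ContUpToBoundary D (fun x => fderiv ℝ u x w)

/-- The supremum of the norm over `D`. -/
def supNorm (D : Set E) (u : E → G) : ℝ≥0∞ := ⨆ x ∈ D, ‖u x‖ₑ

/-- `sup |h|^{-β} |u(x) + u(x+2h) - 2 u(x+h)|` over `x, x+h, x+2h ∈ D`, `h ≠ 0`. -/
def zygmundSeminorm (β : ℝ) (D : Set E) (u : E → G) : ℝ≥0∞ :=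
  ⨆ (x : E) (h : E) (_ : h ≠ 0) (_ : x ∈ D) (_ : x + h ∈ D) (_ : x + (2 : ℝ) • h ∈ D),
    ‖u x + u (x + (2 : ℝ) • h) - (2 : ℝ) • u (x + h)‖ₑ / ENNReal.ofReal (‖h‖ ^ β)

/-- `sup |x-y|^{-β} |u(x) - u(y)|` over `x ≠ y` in `D`. -/
def holderSeminorm (β : ℝ) (D : Set E) (u : E → G) : ℝ≥0∞ :=
  ⨆ (x : E) (y : E) (_ : x ≠ y) (_ : x ∈ D) (_ : y ∈ D),
    ‖u x - u y‖ₑ / ENNReal.ofReal (‖x - y‖ ^ β)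

open Classical in
/-- The Hölder–Zygmund norm `|u|_{D,r}` on an open set `D`, for `r = k + β > 0` with `k ∈ ℕ` and
`0 < β ≤ 1`; it is `⊤` when `u ∉ Λ^r(D)`. -/
def zygmundNorm (r : ℝ) (D : Set E) (u : E → G) : ℝ≥0∞ :=
  if ContDiffOn ℝ (⌈r⌉₊ - 1 : ℕ) u D then
    (∑ i ∈ Finset.range (⌈r⌉₊ - 1 + 1), supNorm D (iteratedFDeriv ℝ i u)) +
      zygmundSeminorm (r - (⌈r⌉₊ - 1 : ℕ)) D (iteratedFDeriv ℝ (⌈r⌉₊ - 1) u)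
  else ⊤

open Classical in
/-- The Hölder norm `‖u‖_{D,r}` of `C^r` of the closure of an open set `D`, for `r = k + β ≥ 0`
with `k ∈ ℕ` and `0 ≤ β < 1` (for `β = 0` the last term is at most twice the `C^k` norm); it is
`⊤` when `u` is not in the space. -/
def holderNorm (r : ℝ) (D : Set E) (u : E → G) : ℝ≥0∞ :=
  if ContDiffOn ℝ ⌊r⌋₊ u D ∧ ∀ i ≤ ⌊r⌋₊, ContUpToBoundary D (iteratedFDeriv ℝ i u) then
    (∑ i ∈ Finset.range (⌊r⌋₊ + 1), supNorm D (iteratedFDeriv ℝ i u)) +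
      holderSeminorm (r - ⌊r⌋₊) D (iteratedFDeriv ℝ ⌊r⌋₊ u)
  else ⊤

end Spaces

/-! ## Lipschitz domains -/

section Lipschitz

variable {E : Type*} [NormedAddCommGroup E] [InnerProductSpace ℝ E]

/-- The component of `x` orthogonal to the unit vector `e`. -/
def horizontal (e x : E) : E := x - (inner ℝ e x : ℝ) • e

variable (E) in
/-- The covering data of a Lipschitz domain: finitely many boxes (a centre, a unit vector
playing the role of the vertical direction, a horizontal radius and a vertical height) that will
contain the boundary, an interior open set with a compact core, and an upper bound for
the Lipschitz constants of the graphs. -/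
structure LipschitzCover where
  num : ℕ
  center : Fin num → E
  axis : Fin num → E
  norm_axis : ∀ i, ‖axis i‖ = 1
  radius : Fin num → ℝ
  radius_pos : ∀ i, 0 < radius i
  height : Fin num → ℝ
  height_pos : ∀ i, 0 < height i
  core : Set E
  isCompact_core : IsCompact core
  inside : Set E
  isOpen_inside : IsOpen inside
  core_subset : core ⊆ inside
  lip : ℝ≥0

/-- The `i`-th box, scaled by the factor `c` about its centre. -/
def LipschitzCover.box (L : LipschitzCover E) (c : ℝ) (i : Fin L.num) : Set E :=
  {x | ‖horizontal (L.axis i) (x - L.center i)‖ < c * L.radius i ∧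
    |(inner ℝ (L.axis i) (x - L.center i) : ℝ)| < c * L.height i}

/-- `D` is a bounded Lipschitz domain described by the covering data `L`: in every box it is the
part lying above the graph of a function `h` with Lipschitz constant at most `L.lip`, the interior
set lies in `D`, and the core together with the boxes of half size covers the closure of `D`.
Every bounded Lipschitz domain is described by some `L`, and so are then all of its small
perturbations (in `C^0`, within a given bound of the Lipschitz constants) by the same `L`. -/
structure LipschitzCover.Describes (L : LipschitzCover E) (D : Set E) : Prop where
  isOpen : IsOpen D
  inside_subset : L.inside ⊆ D
  closure_subset : closure D ⊆ L.core ∪ ⋃ i, L.box (1 / 2) i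
  graph : ∀ i, ∃ h : E → ℝ, LipschitzWith L.lip h ∧ (∀ y, |h y| ≤ L.height i / 2) ∧
    ∀ x ∈ L.box 1 i, x ∈ D ↔
      h (horizontal (L.axis i) (x - L.center i)) < (inner ℝ (L.axis i) (x - L.center i) : ℝ)

end Lipschitz

/-! ## Moser's smoothing operators on a Lipschitz domain -/

section Local

variable {E : Type*} [NormedAddCommGroup E] [InnerProductSpace ℝ E] [FiniteDimensional ℝ E]
  [MeasurableSpace E] [BorelSpace E]

/-- The cut-off functions `χ_j` and kernels `μ_j` of a modified Moser smoothing operator of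
order `m` for the domain `D` and the parameters `0 < t ≤ τ`. -/
structure MoserKernel (m : ℕ) (τ : ℝ) (D : Set E) where
  num : ℕ
  χ : Fin num → E → ℝ
  μ : Fin num → E → ℝ
  χ_smooth : ∀ j, ContDiff ℝ ∞ (χ j)
  χ_supp : ∀ j, HasCompactSupport (χ j)
  χ_nonneg : ∀ j x, 0 ≤ χ j x
  χ_sum : ∀ x ∈ Metric.thickening τ D, ∑ j, χ j x = 1
  μ_smooth : ∀ j, ContDiff ℝ ∞ (μ j)
  μ_supp : ∀ j, HasCompactSupport (μ j)
  μ_integral : ∀ j, ∫ y, μ j y = 1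
  /-- all moments of the orders `1, …, m` vanish -/
  μ_moment : ∀ j, ∀ p : ℕ, 0 < p → p ≤ m → ∀ w : Fin p → E,
    ∫ y, (∏ a, (inner ℝ (w a) y : ℝ)) * μ j y = 0
  /-- the operator only uses values in `D` at points of the `t`-neighbourhood of `D` -/
  shift : ∀ j, ∀ t, 0 < t → t ≤ τ → ∀ x ∈ Metric.thickening t D, ∀ y ∈ tsupport (μ j),
    χ j (x - t • y) ≠ 0 → x - t • y ∈ D

/-- `S^t u (x) = ∑_j ∫ (χ_j u)(x - t y) μ_j(y) dy`, where `χ_j u` is zero outside `D`. -/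
def MoserKernel.smoothing {m : ℕ} {τ : ℝ} {D : Set E} (K : MoserKernel m τ D) (t : ℝ)
    (u : E → ℂ) (x : E) : ℂ :=
  ∑ j, ∫ y, ((K.μ j y * K.χ j (x - t • y) : ℝ) : ℂ) * D.indicator u (x - t • y)

/-- `T` is a linear operator on `C^0` of the closure of `D`. -/
structure IsOperatorOn (D : Set E) (T : (E → ℂ) → E → ℂ) : Prop where
  congr : ∀ u u', EqOn u u' D → T u = T u'
  add : ∀ u u', ContUpToBoundary D u → ContUpToBoundary D u' → T (u + u') = T u + T u'
  smul : ∀ (c : ℂ) u, ContUpToBoundary D u → T (c • u) = c • T u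

/-- `T` is a (universal, linear) extension operator from the closure of `D` to the whole space,
bounded with constants `A a` in all Hölder–Zygmund norms and all Hölder norms. -/
structure IsExtension (D : Set E) (A : ℝ → ℝ≥0) (T : (E → ℂ) → E → ℂ) : Prop where
  operator : IsOperatorOn D T
  eqOn : ∀ u, ContUpToBoundary D u → EqOn (T u) u D
  continuous : ∀ u, ContUpToBoundary D u → Continuous (T u)
  supp : ∀ u, ContUpToBoundary D u → HasCompactSupport (T u)
  zygmund : ∀ a, 0 < a → ∀ u, zygmundNorm a univ (T u) ≤ A a * zygmundNorm a D u
  holder : ∀ a, 0 ≤ a → ∀ u, holderNorm a univ (T u) ≤ A a * holderNorm a D u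

/-- `[∂_w, S^t] u = ∂_w (S^t u) - S^t (∂_w u)`. -/
def gradCommutator (S : ℝ → (E → ℂ) → E → ℂ) (t : ℝ) (w : E) (u : E → ℂ) (x : E) : ℂ :=
  fderiv ℝ (S t u) x w - S t (fun y => fderiv ℝ u y w) x

/-- `W` is the commutator `[∂_w, S^t] u` on the `t`-neighbourhood of `D`: it is the pointwise limit
of `[∂_w, S^t] S^ε u` as `ε → 0+`, and it is the usual commutator if `u` is `C^1` up to the
boundary. -/
def IsGradCommutator (D : Set E) (S : ℝ → (E → ℂ) → E → ℂ) (t : ℝ) (w : E) (u W : E → ℂ) : Prop :=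
  (∀ x ∈ Metric.thickening t D,
    Tendsto (fun ε => gradCommutator S t w (S ε u) x) (𝓝[>] (0 : ℝ)) (𝓝 (W x))) ∧
  (C1UpToBoundary D u → ∀ x ∈ Metric.thickening t D, W x = gradCommutator S t w u x)

/-- The three smoothing estimates with respect to a scale of norms `nrm r`, `r ∈ ord`. -/
structure SmoothingBounds (nrm : ℝ → Set E → (E → ℂ) → ℝ≥0∞) (ord : Set ℝ) (m : ℕ)
    (C : ℝ → ℝ → ℝ≥0) (D : Set E) (S : ℝ → (E → ℂ) → E → ℂ) (T : (E → ℂ) → E → ℂ) : Prop where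
  bound : ∀ r ∈ ord, ∀ s ∈ ord, s ≤ r → ∀ t, 0 < t → t ≤ 1 → ∀ u,
    nrm r (Metric.thickening t D) (S t u) ≤ C r s * ENNReal.ofReal (t ^ (s - r)) * nrm s D u
  approx : ∀ r ∈ ord, ∀ s ∈ ord, r ≤ s → s ≤ r + m → ∀ t, 0 < t → t ≤ 1 → ∀ u,
    nrm r (Metric.thickening t D) (T u - S t (T u)) ≤
      C r s * ENNReal.ofReal (t ^ (s - r)) * nrm s D u
  commutator : ∀ r ∈ ord, ∀ s ∈ ord, |r - s| < m → ∀ t, 0 < t → t ≤ 1 → ∀ w : E, ‖w‖ ≤ 1 →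
    ∀ u, nrm r D u ≠ ⊤ → ∃ W : E → ℂ, IsGradCommutator D S t w u W ∧
      nrm s (Metric.thickening t D) W ≤ C r s * ENNReal.ofReal (t ^ (r - s)) * nrm r D u

/-- `(S^t)_{0 < t ≤ 1}` is a modified Moser smoothing operator of order `m` for functions on `D`,
which is given by a Moser kernel for `t ≤ τ`, maps `C^0` of the closure of `D` to smooth functions
on the `t`-neighbourhood of `D`, and satisfies the smoothing estimates with constants `C r s`, for
Hölder–Zygmund norms (orders `> 0`) and for Hölder norms (orders `≥ 0`).
Here `T` is an extension operator, used to give a meaning to `(I - S^t) u` outside `D`. -/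
structure IsMoserSmoothing (m : ℕ) (τ : ℝ) (A : ℝ → ℝ≥0) (C : ℝ → ℝ → ℝ≥0) (D : Set E)
    (S : ℝ → (E → ℂ) → E → ℂ) (T : (E → ℂ) → E → ℂ) : Prop where
  extension : IsExtension D A T
  kernel : ∃ K : MoserKernel m τ D, ∀ t, 0 < t → t ≤ τ → S t = K.smoothing t
  operator : ∀ t, 0 < t → t ≤ 1 → IsOperatorOn D (S t)
  smooth : ∀ t, 0 < t → t ≤ 1 → ∀ u, ContUpToBoundary D u →
    ContDiffOn ℝ ∞ (S t u) (Metric.thickening t D)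
  zygmund : SmoothingBounds zygmundNorm (Ioi 0) m C D S T
  holder : SmoothingBounds holderNorm (Ici 0) m C D S T

end Local

/-! ## Forms of type `(0,q)` with values in a holomorphic vector bundle -/

/-- `ℂⁿ` with the Euclidean norm. -/
abbrev Cn (n : ℕ) : Type := EuclideanSpace ℂ (Fin n)

/-- Strictly increasing multi-indices `I = (i_1 < ⋯ < i_q)` in `{1, …, n}`. -/
abbrev MultiIndex (q n : ℕ) : Type := {I : Fin q → Fin n // StrictMono I}

instance (q n : ℕ) : Fintype (MultiIndex q n) := Fintype.ofFinite _

section Forms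

variable {n : ℕ} {X : Type*} [TopologicalSpace X] [ChartedSpace (Cn n) X]
  {F : Type*} [NormedAddCommGroup F] [NormedSpace ℂ F]
  {V : X → Type*} [TopologicalSpace (TotalSpace F V)] [∀ x, AddCommGroup (V x)]
  [∀ x, Module ℂ (V x)] [∀ x, TopologicalSpace (V x)] [FiberBundle F V]

variable (n V) in
/-- A not necessarily continuous field of `q`-ary functions on the tangent spaces with values in
the bundle `V`; the tangent space of the complex manifold is the real tangent space with its
complex structure. -/
abbrev FormField (q : ℕ) := ∀ x : X, (Fin q → TangentSpace 𝓘(ℂ, Cn n) x) → V x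

/-- The value at `x` is a form of type `(0,q)`: real multilinear, alternating, and antilinear in
every argument. -/
def IsZeroForm {q : ℕ} (v : FormField n V q) (x : X) : Prop :=
  ∃ α : AlternatingMap ℝ (TangentSpace 𝓘(ℂ, Cn n) x) (V x) (Fin q), (∀ w, v x w = α w) ∧
    ∀ w i, α (Function.update w i (Complex.I • w i)) = -(Complex.I • α w)

/-- The derivative `∂̄_w g = (∂_w g + i ∂_{iw} g) / 2`, so that `∂̄_w g = ∑ ∂g/∂z̄_j conj(w_j)`. -/
def dbarDir (g : Cn n → F) (z w : Cn n) : F :=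
  (1 / 2 : ℂ) • (fderiv ℝ g z w + Complex.I • fderiv ℝ g z (Complex.I • w))

/-- The operator `∂̄` from `(0,q)`-forms to `(0,q+1)`-forms, computed at `x` in the preferred
holomorphic chart and the preferred holomorphic trivialization at `x`:
`(∂̄v)(w_0, …, w_q) = ∑_a (-1)^a ∂̄_{w_a} (v(w_0, …, ŵ_a, …, w_q))` for vector fields `w_a` that are
constant in the chart. -/
def dbar {q : ℕ} (v : FormField n V q) : FormField n V (q + 1) := fun x w =>
  let φ := chartAt (Cn n) x
  let c : Fin (q + 1) → Cn n := fun a => mfderiv 𝓘(ℂ, Cn n) 𝓘(ℂ, Cn n) φ x (w a)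
  (trivializationAt F V x).symm x (∑ a : Fin (q + 1), (-1 : ℂ) ^ (a : ℕ) •
    dbarDir (fun z => ((trivializationAt F V x) ⟨φ.symm z, v (φ.symm z)
      (fun b => mfderiv 𝓘(ℂ, Cn n) 𝓘(ℂ, Cn n) φ.symm z (c (a.succAbove b)))⟩).2) (φ x) (c a))

variable (n F V) in
/-- The fixed covering of a part of the complex manifold `X` by coordinate charts:
holomorphic charts `ψ_k`, open sets `U_k` with compact closure in the domain of `ψ_k`, a partition
of unity `χ_k` with smooth square roots, subordinate to the `U_k`, with `∑ χ_k = 1` on the open set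
`region`, and holomorphic frames `e_{k,j}` of `V` over the domain of `ψ_k`. -/
structure ChartCover (κ : Type*) [Fintype κ] (rk : ℕ) where
  ψ : κ → OpenPartialHomeomorph X (Cn n)
  ψ_mem : ∀ k, ψ k ∈ IsManifold.maximalAtlas 𝓘(ℂ, Cn n) ω X
  U : κ → Set X
  isOpen_U : ∀ k, IsOpen (U k)
  isCompact_closure_U : ∀ k, IsCompact (closure (U k))
  closure_U_subset : ∀ k, closure (U k) ⊆ (ψ k).source
  χ : κ → X → ℝ
  χ_nonneg : ∀ k x, 0 ≤ χ k x
  χ_sqrt_smooth : ∀ k, ContMDiff 𝓘(ℝ, Cn n) 𝓘(ℝ, ℝ) ∞ (fun x => √(χ k x))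
  χ_supp : ∀ k, tsupport (χ k) ⊆ U k
  region : Set X
  isOpen_region : IsOpen region
  χ_sum : ∀ x ∈ region, ∑ k, χ k x = 1
  e : κ → Fin rk → (x : X) → V x
  frame : ∀ k, IsLocalFrameOn 𝓘(ℂ, Cn n) F ω (e k) (ψ k).source

namespace ChartCover

variable {κ : Type*} [Fintype κ] {rk : ℕ} (P : ChartCover n F V κ rk)

/-- `D_k = ψ_k(U_k ∩ M)`. -/
def D (M : Set X) (k : κ) : Set (Cn n) := P.ψ k '' (P.U k ∩ M)

/-- The `t`-neighbourhood `𝒩_t(D_k)` in `ℂⁿ`. -/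
def nbhdD (M : Set X) (t : ℝ) (k : κ) : Set (Cn n) := Metric.thickening t (P.D M k)

/-- The neighbourhood `𝒩_t(M) = ⋃_k ψ_k⁻¹(𝒩_t(D_k))` of `M` in the complex manifold. -/
def nbhd (M : Set X) (t : ℝ) : Set X := ⋃ k, (P.ψ k).symm '' P.nbhdD M t k

/-- The coefficient `v^j_{k,I}`, as a function on `ψ_k(domain)`, in the local representation
`v = ∑ v^j_{k,I} d z̄_k^I ⊗ e_{k,j}`: it is obtained by inserting `∂/∂z_k^{i_1}, …, ∂/∂z_k^{i_q}`. -/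
def coeff {q : ℕ} (v : FormField n V q) (k : κ) (I : MultiIndex q n) (j : Fin rk) (z : Cn n) : ℂ :=
  (P.frame k).coeff j ((P.ψ k).symm z) (v ((P.ψ k).symm z) (fun a =>
    mfderiv 𝓘(ℂ, Cn n) 𝓘(ℂ, Cn n) (P.ψ k).symm z (EuclideanSpace.single (I.1 a) (1 : ℂ))))

/-- The form `d z̄_k^I = d z̄_k^{i_1} ∧ ⋯ ∧ d z̄_k^{i_q}` at `x`. -/
def dzbar {q : ℕ} (k : κ) (I : MultiIndex q n) (x : X)
    (w : Fin q → TangentSpace 𝓘(ℂ, Cn n) x) : ℂ :=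
  Matrix.det (Matrix.of fun a b : Fin q => (starRingEnd ℂ)
    ((show Cn n from mfderiv 𝓘(ℂ, Cn n) 𝓘(ℂ, Cn n) (P.ψ k) x (w b)) (I.1 a)))

/-- The norm `max_{k,I,j} |v^j_{k,I}|_{B_k,r}`.  With `B_k = D_k` it is `|v|_{M,r}`, and with
`B_k = 𝒩_t(D_k)` it is `|v|_{𝒩_t(M),r}`. -/
def formNorm (B : κ → Set (Cn n)) (r : ℝ) {q : ℕ} (v : FormField n V q) : ℝ≥0∞ :=
  ⨆ (k : κ) (I : MultiIndex q n) (j : Fin rk), zygmundNorm r (B k) (P.coeff v k I j)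

/-- `v` is a `V`-valued `(0,q)`-form on `M`, continuous up to the boundary. -/
def IsContForm (M : Set X) {q : ℕ} (v : FormField n V q) : Prop :=
  (∀ x ∈ M, IsZeroForm v x) ∧ ∀ k I j, ContUpToBoundary (P.D M k) (P.coeff v k I j)

/-- `v` is a `V`-valued `(0,q)`-form on `M`, of class `C^1` up to the boundary. -/
def IsC1Form (M : Set X) {q : ℕ} (v : FormField n V q) : Prop :=
  (∀ x ∈ M, IsZeroForm v x) ∧ ∀ k I j, C1UpToBoundary (P.D M k) (P.coeff v k I j)

/-- `v` is a smooth `V`-valued `(0,q)`-form on `𝒩_t(M)`. -/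
def IsSmoothForm (M : Set X) (t : ℝ) {q : ℕ} (v : FormField n V q) : Prop :=
  (∀ x ∈ P.nbhd M t, IsZeroForm v x) ∧
    ∀ k I j, ContDiffOn ℝ ∞ (P.coeff v k I j) (P.nbhdD M t k)

/-- The form `∑_{k,I,j} χ_k^{1/2} T_k((χ_k^{1/2} ∘ ψ_k⁻¹) v^j_{k,I})(z_k) d z̄_k^I ⊗ e_{k,j}` made
from operators `T_k` on functions on `D_k`. -/
def glue (T : κ → (Cn n → ℂ) → Cn n → ℂ) {q : ℕ} (v : FormField n V q) : FormField n V q := fun x w =>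
  ∑ k, ∑ I : MultiIndex q n, ∑ j : Fin rk,
    (((√(P.χ k x) : ℝ) : ℂ) *
      T k (fun z => ((√(P.χ k ((P.ψ k).symm z)) : ℝ) : ℂ) * P.coeff v k I j z) (P.ψ k x) *
      P.dzbar k I x w) • P.e k j x

/-- The smoothing operator `S^t` on `V`-valued `(0,q)`-forms given by local operators `S_k^t`. -/
def smoothing (S : κ → ℝ → (Cn n → ℂ) → Cn n → ℂ) (t : ℝ) {q : ℕ} (v : FormField n V q) :
    FormField n V q :=
  P.glue (fun k => S k t) v

/-- `[∂̄, S^t] v = ∂̄ (S^t v) - S^t (∂̄ v)`. -/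
def dbarCommutator (S : κ → ℝ → (Cn n → ℂ) → Cn n → ℂ) (t : ℝ) {q : ℕ} (v : FormField n V q) :
    FormField n V (q + 1) := fun x w =>
  dbar (F := F) (P.smoothing S t v) x w - P.smoothing S t (dbar (F := F) v) x w

/-- `W` is the `(0,q+1)`-form `[∂̄, S^t] v` on `𝒩_t(M)`: it is the limit of `[∂̄, S^t] S^ε v` as
`ε → 0+` (pointwise, in all coefficients), and it is the usual commutator if `v` is `C^1` up to the
boundary. -/
def IsDbarCommutator (M : Set X) (S : κ → ℝ → (Cn n → ℂ) → Cn n → ℂ) (t : ℝ) {q : ℕ}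
    (v : FormField n V q) (W : FormField n V (q + 1)) : Prop :=
  (∀ x ∈ P.nbhd M t, IsZeroForm W x) ∧
  (∀ k J j, ∀ z ∈ P.nbhdD M t k,
    Tendsto (fun ε => P.coeff (P.dbarCommutator S t (P.smoothing S ε v)) k J j z) (𝓝[>] (0 : ℝ))
      (𝓝 (P.coeff W k J j z))) ∧
  (P.IsC1Form M v → ∀ x ∈ P.nbhd M t, ∀ w, W x w = P.dbarCommutator S t v x w)

end ChartCover

end Forms

end MoserSmoothing

end

set_option linter.unusedSectionVars false
noncomputable section
namespace MoserSmoothing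

open Metric hiding tendsto_atTop tendsto_nhds mem_nhds_iff
open Finset (range sum_congr mem_range mul_sum sum_mul sum_smul sum_range_succ sum_nonneg
  sum_add_distrib sum_comm smul_sum single_le_sum sum_sub_distrib sum_le_sum sum_eq_zero)
open ENNReal (ofReal ofReal_mul ofReal_le_ofReal ofReal_toReal toReal_nonneg)
open Real (norm_of_nonneg rpow_natCast rpow_add rpow_zero norm_eq_abs mul_rpow rpow_le_rpow rpow_mul)
local notation "∇" => iteratedFDeriv ℝ

/-! ## Averages against a radial bump function -/

section Averages

variable {E : Type} [NormedAddCommGroup E] [InnerProductSpace ℝ E] [FiniteDimensional ℝ E]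
  [MeasurableSpace E] [BorelSpace E]
variable {t B : ℝ} {p x : E} {O : Set E} {c : ℕ → ℝ} {n : ℕ}
  {W : Type} [NormedAddCommGroup W] [NormedSpace ℝ W] {f : E → W}

variable (E) in
/-- A radial smooth density supported in the unit ball. -/
def stdBump : E → ℝ := (⟨1 / 2, 1, by norm_num, by norm_num⟩ : ContDiffBump (0 : E)).normed volume

lemma stdBump_nonneg (y : E) : 0 ≤ stdBump E y := ContDiffBump.nonneg_normed _ _

lemma contDiff_stdBump {n : ℕ∞} : ContDiff ℝ n (stdBump E) := ContDiffBump.contDiff_normed _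

lemma integral_stdBump : ∫ y, stdBump E y = 1 := ContDiffBump.integral_normed _

lemma stdBump_neg (y : E) : stdBump E (-y) = stdBump E y := ContDiffBump.normed_neg _ _

lemma tsupport_stdBump : tsupport (stdBump E) = closedBall 0 1 := ContDiffBump.tsupport_normed_eq _

lemma hasCompactSupport_stdBump : HasCompactSupport (stdBump E) :=
  ContDiffBump.hasCompactSupport_normed _

lemma stdBump_eq_zero {y : E} (hy : y ∉ closedBall (0 : E) 1) : stdBump E y = 0 :=
  image_eq_zero_of_notMem_tsupport (by rwa [tsupport_stdBump])

lemma continuous_stdBump : Continuous (stdBump E) := (contDiff_stdBump (n := 0)).continuous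

lemma integrable_stdBump : Integrable (stdBump E) :=
  continuous_stdBump.integrable_of_hasCompactSupport hasCompactSupport_stdBump

/-- The average of `f` over the ball of radius `t` about `x + t p`. -/
def avg (p : E) (t : ℝ) (f : E → W) (x : E) : W := ∫ y, stdBump E y • f (x + t • (p + y))

/-- The average `avg p t f x` only involves values of `f` in `O`. -/
def Sees (p : E) (t : ℝ) (O : Set E) (x : E) : Prop := ∀ y ∈ closedBall (0 : E) 1, x + t • (p + y) ∈
  O

lemma avg_congr (hx : Sees p t O x) {g : E → W} (h : EqOn f g O) : avg p t f x = avg p t g x := by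
  refine integral_congr_ae (Eventually.of_forall fun y => ?_)
  by_cases hy : y ∈ closedBall (0 : E) 1
  · simp only [h (hx y hy)]
  · simp [stdBump_eq_zero hy]

lemma avg_indicator (hx : Sees p t O x) (f : E → W) : avg p t (O.indicator f) x = avg p t f x :=
  avg_congr hx fun _ hz => indicator_of_mem hz f

lemma norm_integral_bump_smul_le {g : E → W} (h : ∀ y ∈ closedBall (0 : E) 1, ‖g y‖ ≤ B) :
  ‖∫ y, stdBump E y • g y‖ ≤ B := by
  calc ‖∫ y, stdBump E y • g y‖ ≤ ∫ y, stdBump E y * B := by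
        refine norm_integral_le_of_norm_le (integrable_stdBump.mul_const B) (Eventually.of_forall
          fun y => ?_)
        rw [norm_smul, norm_of_nonneg (stdBump_nonneg y)]
        by_cases hy : y ∈ closedBall (0 : E) 1
        · exact mul_le_mul_of_nonneg_left (h y hy) (stdBump_nonneg y)
        · simp [stdBump_eq_zero hy]
    _ = B := by rw [integral_mul_const, integral_stdBump, one_mul]

lemma norm_avg_le (hx : Sees p t O x) (h : ∀ z ∈ O, ‖f z‖ ≤ B) : ‖avg p t f x‖ ≤ B :=
  norm_integral_bump_smul_le fun y hy => h _ (hx y hy)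

lemma isOpen_sees (p : E) (t : ℝ) (hO : IsOpen O) : IsOpen {x | Sees p t O x} := by
  refine isOpen_iff_mem_nhds.2 fun x hx => ?_
  refine (isCompact_closedBall (0 : E) 1).eventually_forall_of_forall_eventually (P := fun x y => x
    + t • (p + y) ∈ O) fun y hy => ?_
  have hc : Continuous fun z : E × E => z.1 + t • (p + z.2) := by fun_prop
  exact hc.continuousAt.preimage_mem_nhds (hO.mem_nhds (hx y hy))

lemma continuousOn_bump_smul (hO : IsOpen O) (hf : ContinuousOn f O) : ContinuousOn
  (fun z : E × E => stdBump E z.2 • f (z.1 + t • (p + z.2))) ({x | Sees p t O x} ×ˢ univ) := by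
  rintro ⟨x, y⟩ ⟨hx, -⟩
  refine ContinuousAt.continuousWithinAt ?_
  by_cases hy : y ∈ closedBall (0 : E) 1
  · exact (continuous_stdBump.comp continuous_snd).continuousAt.smul (ContinuousAt.comp
      (f := fun z : E × E => z.1 + t • (p + z.2)) (hf.continuousAt (hO.mem_nhds (hx y hy)))
      (by fun_prop))
  · refine (continuousAt_const (y := 0)).congr ?_
    filter_upwards [continuousAt_snd.preimage_mem_nhds (isClosed_closedBall.isOpen_compl.mem_nhds
      hy)] with z hz
    rw [stdBump_eq_zero hz, zero_smul]

lemma continuous_bump_smul (hO : IsOpen O) (hx : Sees p t O x) (hf : ContinuousOn f O) :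
  Continuous fun y => stdBump E y • f (x + t • (p + y)) :=
  continuousOn_univ.1 ((continuousOn_bump_smul hO hf).comp (f := fun y : E => (x, y)) (by fun_prop)
    fun y _ => ⟨hx, mem_univ y⟩)

lemma integrable_bump_smul (hO : IsOpen O) (hx : Sees p t O x) (hf : ContinuousOn f O) :
  Integrable fun y => stdBump E y • f (x + t • (p + y)) := (continuous_bump_smul hO hx
  hf).integrable_of_hasCompactSupport (hasCompactSupport_stdBump.smul_right)

lemma hasFDerivAt_avg (hO : IsOpen O) (hx : Sees p t O x) (hf : ContDiffOn ℝ 1 f O) :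
  HasFDerivAt (avg p t f) (avg p t (fderiv ℝ f) x) x := by
  have hfd : ContinuousOn (fderiv ℝ f) O := hf.continuousOn_fderiv_of_isOpen hO le_rfl
  have hc : Continuous fun y : E => x + t • (p + y) := by fun_prop
  set K := (fun y : E => x + t • (p + y)) '' closedBall (0 : E) 1 with hK
  have hKc : IsCompact K := (isCompact_closedBall _ _).image hc
  have hKO : K ⊆ O := by rintro _ ⟨y, hy, rfl⟩; exact hx y hy
  obtain ⟨ε, hε, hεO⟩ := hKc.exists_cthickening_subset_open hO hKO
  obtain ⟨B, hB⟩ := (hKc.cthickening (r := ε)).exists_bound_of_continuousOn (hfd.mono hεO)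
  have hmem : ∀ x' ∈ ball x ε, ∀ y ∈ closedBall (0 : E) 1, x' + t • (p + y) ∈ cthickening ε K := by
    intro x' hx' y hy
    refine mem_cthickening_of_dist_le _ _ _ _ (mem_image_of_mem _ hy) ?_
    simpa using (mem_ball.1 hx').le
  have hB0 : ∀ y ∈ closedBall (0 : E) 1, 0 ≤ B := fun y hy =>
    (norm_nonneg _).trans (hB _ (hmem x (mem_ball_self hε) y hy))
  refine hasFDerivAt_integral_of_dominated_of_fderiv_le (ball_mem_nhds x hε) (F' := fun x y =>
    stdBump E y • fderiv ℝ f (x + t • (p + y))) (bound := fun y => stdBump E y * B) ?_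
    (integrable_bump_smul hO hx hf.continuousOn) ?_ ?_ (integrable_stdBump.mul_const B) ?_
  · filter_upwards [ball_mem_nhds x hε] with x' hx'
    exact (continuous_bump_smul hO (fun y hy => hεO (hmem x' hx' y hy))
      hf.continuousOn).aestronglyMeasurable
  · exact (continuous_bump_smul hO hx hfd).aestronglyMeasurable
  · refine Eventually.of_forall fun y x' hx' => ?_
    rw [norm_smul, norm_of_nonneg (stdBump_nonneg y)]
    by_cases hy : y ∈ closedBall (0 : E) 1
    · exact mul_le_mul_of_nonneg_left (hB _ (hmem x' hx' y hy)) (stdBump_nonneg y)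
    · simp [stdBump_eq_zero hy]
  · refine Eventually.of_forall fun y x' hx' => ?_
    by_cases hy : y ∈ closedBall (0 : E) 1
    · have h1 : HasFDerivAt f (fderiv ℝ f (x' + t • (p + y))) (x' + t • (p + y)) := ((hf.contDiffAt
        (hO.mem_nhds (hεO (hmem x' hx' y hy)))).differentiableAt one_ne_zero).hasFDerivAt
      have h2 := (hasFDerivAt_comp_add_right (f := f) (x := x') (t • (p + y))).2 h1
      exact h2.const_smul (stdBump E y)
    · simpa [stdBump_eq_zero hy] using hasFDerivAt_const (0 : W) x'

lemma continuousOn_iterD (hO : IsOpen O) {k : ℕ} (hf : ContDiffOn ℝ k f O) :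
  ContinuousOn (∇ k f) O := fun z hz =>
  (ContDiffAt.iteratedFDeriv_right (m := 0) (hf.contDiffAt (hO.mem_nhds hz))
    (by simp)).continuousAt.continuousWithinAt

set_option synthInstance.maxHeartbeats 400000 in
set_option maxHeartbeats 1000000 in
lemma iterD_avg [CompleteSpace W] (hO : IsOpen O) (k : ℕ) (hf : ContDiffOn ℝ k f O) (hx
  : Sees p t O x) : ∇ k (avg p t f) x = avg p t (∇ k f) x := by
  induction k generalizing x with
  | zero =>
    simp only [iteratedFDeriv_zero_eq_comp, avg, Function.comp_def, ← map_smul]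
    exact ((continuousMultilinearCurryFin0 ℝ E W).symm.toLinearIsometry.integral_comp_comm _).symm
  | succ k ih =>
    have hfk : ContDiffOn ℝ 1 (∇ k f) O := by
      intro z hz
      refine (ContDiffAt.iteratedFDeriv_right (hf.contDiffAt (hO.mem_nhds hz)) ?_).contDiffWithinAt
      push_cast; rw [add_comm]
    have hev : ∇ k (avg p t f) =ᶠ[𝓝 x] avg p t (∇ k f) := by
      filter_upwards [(isOpen_sees p t hO).mem_nhds hx] with z hz
      exact ih (hf.of_le (by exact_mod_cast k.le_succ)) hz
    have hk2 : ContinuousOn (fderiv ℝ (∇ k f)) O := hfk.continuousOn_fderiv_of_isOpen hO le_rfl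
    ext m
    rw [iteratedFDeriv_succ_apply_left, hev.fderiv_eq, (hasFDerivAt_avg hO hx hfk).fderiv]
    simp only [avg]
    rw [ContinuousLinearMap.integral_apply (integrable_bump_smul hO hx hk2),
      ContinuousMultilinearMap.integral_apply (integrable_bump_smul hO hx (continuousOn_iterD hO hf)),
      ContinuousMultilinearMap.integral_apply]
    · simp [iteratedFDeriv_succ_apply_left]
    · exact (integrable_bump_smul hO hx hk2).apply_continuousLinearMap _

lemma norm_iterD_add {X : Type} [NormedAddCommGroup X] [NormedSpace ℝ X] {Y : Type}
  [NormedAddCommGroup Y] [NormedSpace ℝ Y] (k q : ℕ) (F : X → Y) (x : X) : ‖∇ (k + q) F x‖ = ‖∇ q (∇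
  k F) x‖ := by
  induction k generalizing Y with
  | zero =>
    rw [Nat.zero_add, iteratedFDeriv_zero_eq_comp,
      LinearIsometryEquiv.norm_iteratedFDeriv_comp_left]
  | succ k ih =>
    rw [show k + 1 + q = (k + q) + 1
      by ring, ← norm_iteratedFDeriv_fderiv, ih, show ∇ (k + 1) F = _ from funext fun _ => iteratedFDeriv_succ_eq_comp_right]
    exact (LinearIsometryEquiv.norm_iteratedFDeriv_comp_left _ _ _ _).symm

open scoped Convolution in
lemma norm_iterD_convolution_le {V Z : Type} [NormedAddCommGroup V] [NormedSpace ℝ V]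
  [NormedAddCommGroup Z] [NormedSpace ℝ Z] (q : ℕ) (hf : AEStronglyMeasurable f volume)
  (hB : ∀ x, ‖f x‖ ≤ B) {ψ : E → V} (hψ : ContDiff ℝ ∞ ψ) (hc : HasCompactSupport ψ) (L : W →L[ℝ] V
  →L[ℝ] Z) (x : E) : ‖∇ q (f ⋆[L, volume] ψ) x‖ ≤ ‖L‖ * B * ∫ y, ‖∇ q ψ y‖ := by
  have hloc : LocallyIntegrable f volume := (locallyIntegrable_const B).mono hf
    (Eventually.of_forall fun x =>
      (hB x).trans (le_abs_self B))
  have hB0 : 0 ≤ B := (norm_nonneg _).trans (hB 0)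
  induction q generalizing V Z with
  | zero =>
    simp only [norm_iteratedFDeriv_zero]
    have hint : Integrable fun y => ‖ψ y‖ := (hψ.continuous.integrable_of_hasCompactSupport hc).norm
    calc ‖(f ⋆[L, volume] ψ) x‖ ≤ ∫ y, ‖L‖ * B * ‖ψ (x - y)‖ := by
          refine norm_integral_le_of_norm_le ((hint.comp_sub_left x).const_mul _)
            (Eventually.of_forall fun y => ?_)
          exact (L.le_opNorm₂ _ _).trans (by gcongr; exact hB y)
      _ = _ := by
          rw [integral_const_mul, integral_sub_left_eq_self (fun y => ‖ψ y‖) volume x]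
  | succ q ih =>
    have hfd : fderiv ℝ (f ⋆[L, volume] ψ) = f ⋆[L.precompR E, volume] fderiv ℝ ψ := by
      ext1 z
      exact (hc.hasFDerivAt_convolution_right L hloc (hψ.of_le (by simp)) z).fderiv
    rw [← norm_iteratedFDeriv_fderiv, hfd]
    refine (ih (hψ.fderiv_right (by simp)) (hc.fderiv ℝ) _).trans ?_
    simp only [norm_iteratedFDeriv_fderiv]
    gcongr
    exact L.norm_precompR_le E

lemma norm_iterD_comp_affine_le {X : Type*} [NormedAddCommGroup X] [NormedSpace ℝ X] {Y : Type*}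
  [NormedAddCommGroup Y] [NormedSpace ℝ Y] {H : X → Y} (q : ℕ) (hH : ContDiff ℝ q H) (c : ℝ) (p x :
  X) : ‖∇ q (fun x => H (c • x + p)) x‖ ≤ |c| ^ q * ‖∇ q H (c • x + p)‖ := by
  have h1 : (fun x => H (c • x + p)) = (fun z => H (z + p)) ∘ (c • ContinuousLinearMap.id ℝ X) := by
    ext; simp
  rw [h1, ContinuousLinearMap.iteratedFDeriv_comp_right _ (f := fun z => H (z + p)) (n := q)
    (hH.comp (contDiff_id.add contDiff_const)) x le_rfl, iteratedFDeriv_comp_add_right]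
  refine (ContinuousMultilinearMap.norm_compContinuousLinearMap_le _ _).trans ?_
  rw [mul_comm, Finset.prod_const, Finset.card_univ, Fintype.card_fin]
  have : ‖c • ContinuousLinearMap.id ℝ X‖ ≤ |c| := by
    rw [norm_smul, norm_eq_abs]
    exact mul_le_of_le_one_right (abs_nonneg _) ContinuousLinearMap.norm_id_le
  gcongr
  simp

variable (E) in
/-- The `L¹` norm of the `q`-th derivative of the standard bump. -/
def bumpConst (q : ℕ) : ℝ := ∫ y, ‖∇ q (stdBump E) y‖

lemma bumpConst_nonneg (q : ℕ) : 0 ≤ bumpConst E q := integral_nonneg fun _ => norm_nonneg _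

open scoped Convolution in
lemma avg_eq_convolution (p : E) (ht : t ≠ 0) (f : E → W) : avg p t f = fun x => ((fun z => f (t •
  z)) ⋆[(ContinuousLinearMap.lsmul ℝ ℝ).flip, volume] stdBump E) (t⁻¹ • x + p) := by
  ext x
  rw [convolution_def]
  simp only [ContinuousLinearMap.flip_apply, ContinuousLinearMap.lsmul_apply]
  rw [← integral_add_left_eq_self (μ := volume) _ (t⁻¹ • x + p)]
  simp only [avg]
  refine integral_congr_ae (Eventually.of_forall fun y => ?_)
  simp only [sub_add_cancel_left, stdBump_neg]
  rw [add_assoc, smul_add t (t⁻¹ • x), smul_smul, mul_inv_cancel₀ ht, one_smul]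

lemma aestronglyMeasurable_comp_smul (hf : AEStronglyMeasurable f volume) (ht : t ≠ 0) :
  AEStronglyMeasurable (fun z => f (t • z)) volume := by
  refine AEStronglyMeasurable.comp_measurable (g := f) ?_ (measurable_const_smul t)
  rw [Measure.map_addHaar_smul volume ht]
  exact hf.smul_measure _

lemma contDiff_avg (p : E) (ht : t ≠ 0) (hf : AEStronglyMeasurable f volume) (hB : ∀ x,
  ‖f x‖ ≤ B) : ContDiff ℝ ∞ (avg p t f) := by
  have hloc : LocallyIntegrable (fun z => f (t • z)) volume := (locallyIntegrable_const B).mono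
    (aestronglyMeasurable_comp_smul hf ht) (Eventually.of_forall fun x => (hB _).trans (le_abs_self
    B))
  rw [avg_eq_convolution p ht f]
  exact (hasCompactSupport_stdBump.contDiff_convolution_right (n := ⊤) _ hloc contDiff_stdBump).comp
    ((contDiff_id.const_smul _).add contDiff_const)

lemma norm_iterD_avg_le (q : ℕ) (p : E) (ht : 0 < t) (hf : AEStronglyMeasurable f
  volume) (hB : ∀ x, ‖f x‖ ≤ B) (x : E) : ‖∇ q (avg p t f) x‖ ≤ bumpConst E q * B * t⁻¹ ^ q := by
  have hm := aestronglyMeasurable_comp_smul hf ht.ne'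
  have hloc : LocallyIntegrable (fun z => f (t • z)) volume := (locallyIntegrable_const B).mono hm
    (Eventually.of_forall fun x => (hB _).trans (le_abs_self B))
  have hB0 : 0 ≤ B := (norm_nonneg _).trans (hB 0)
  rw [avg_eq_convolution p ht.ne' f]
  refine (norm_iterD_comp_affine_le q ((hasCompactSupport_stdBump.contDiff_convolution_right (n :=
    q) _ hloc contDiff_stdBump)) _ _ _).trans ?_
  rw [abs_of_pos (inv_pos.2 ht), mul_comm]
  gcongr
  refine (norm_iterD_convolution_le q hm (fun x => hB _) contDiff_stdBump hasCompactSupport_stdBump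
    _ _).trans ?_
  rw [mul_comm, bumpConst]
  refine mul_le_mul_of_nonneg_left ?_ (integral_nonneg fun _ => norm_nonneg _)
  refine mul_le_of_le_one_left hB0 ?_
  rw [ContinuousLinearMap.opNorm_flip]
  exact ContinuousLinearMap.opNorm_lsmul_le

lemma norm_iterD_avg_of_contDiffOn_le [CompleteSpace W] (k q : ℕ) (ht : 0 < t) (hO : IsOpen O) (hf : ContDiffOn ℝ k f O) (hB0 : 0 ≤ B) (hB : ∀ z ∈ O, ‖∇ k f z‖ ≤ B) (hx : Sees p t O x) :
  ‖∇ (k + q) (avg p t f) x‖ ≤ bumpConst E q * B * t⁻¹ ^ q := by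
  have hev : ∇ k (avg p t f) =ᶠ[𝓝 x] avg p t (O.indicator (∇ k f)) := by
    filter_upwards [(isOpen_sees p t hO).mem_nhds hx] with z hz
    rw [avg_indicator hz, iterD_avg hO k hf hz]
  rw [norm_iterD_add, (hev.iteratedFDeriv ℝ q).eq_of_nhds]
  refine norm_iterD_avg_le q p ht ?_ (fun z => ?_) x
  · rw [aestronglyMeasurable_indicator_iff hO.measurableSet]
    refine ContinuousOn.aestronglyMeasurable ?_ hO.measurableSet
    refine (hf.continuousOn_iteratedFDerivWithin le_rfl hO.uniqueDiffOn).congr ?_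
    intro z hz; exact (iteratedFDerivWithin_of_isOpen k hO hz).symm
  · by_cases hz : z ∈ O
    · rw [indicator_of_mem hz]; exact hB z hz
    · simpa [hz] using hB0

end Averages

/-! ## Coefficients with vanishing moments -/

/-- The coefficients of `∏_{1 ≤ n ≤ N} (1 - z / 2^n) / (1 - 1 / 2^n)`. -/
def seeley : ℕ → ℕ → ℝ
  | 0, 0 => 1
  | 0, _ + 1 => 0
  | N + 1, 0 => (1 - (1 / 2) ^ (N + 1))⁻¹ * seeley N 0
  | N + 1, k + 1 => (1 - (1 / 2) ^ (N + 1))⁻¹ * (seeley N (k + 1) - (1 / 2) ^ (N + 1) * seeley N k)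

lemma seeley_eq_zero {N k : ℕ} (h : N < k) : seeley N k = 0 := by
  induction N generalizing k with
  | zero => obtain ⟨k, rfl⟩ := Nat.exists_eq_succ_of_ne_zero h.ne'; rfl
  | succ N ih =>
    obtain ⟨k, rfl⟩ := Nat.exists_eq_succ_of_ne_zero (Nat.ne_zero_of_lt h)
    rw [Nat.succ_eq_add_one, seeley, ih (by omega), ih (by omega)]; simp

lemma half_pow_succ_le (N : ℕ) : ((1 : ℝ) / 2) ^ (N + 1) ≤ 1 / 2 := by
  rw [pow_succ]
  exact mul_le_of_le_one_left (by norm_num) (pow_le_one₀ (by norm_num) (by norm_num))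

lemma sum_shift_succ {b : ℕ → ℝ} {N : ℕ} (hb : b (N + 1) = 0) (z : ℝ) : ∑ k ∈ range (N + 1), b (k +
  1) * z ^ (k + 1) + b 0 = ∑ k ∈ range (N + 1), b k * z ^ k := by
  have h := Finset.sum_range_succ' (fun k => b k * z ^ k) (N + 1)
  rw [sum_range_succ, hb] at h
  simpa using h.symm

lemma seeley_eval_succ (N : ℕ) (z : ℝ) : ∑ k ∈ range (N + 2), seeley (N + 1) k * z ^ k = (1 - (1 /
  2) ^ (N + 1))⁻¹ * (1 - (1 / 2) ^ (N + 1) * z) * ∑ k ∈ range (N + 1), seeley N k * z ^ k := by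
  have h1 := sum_shift_succ (seeley_eq_zero N.lt_succ_self) z
  rw [Finset.sum_range_succ', ← h1]
  have h2 : ∀ k ∈ range (N + 1), seeley (N + 1) (k + 1) * z ^ (k + 1) = (1 - (1 / 2) ^ (N + 1))⁻¹ *
    (seeley N (k + 1) * z ^ (k + 1)) - (1 - (1 / 2) ^ (N + 1))⁻¹ * (1 / 2) ^ (N + 1) * z * (seeley N
    k * z ^ k) := by
    intro k _; rw [seeley]; ring
  rw [sum_congr rfl h2, sum_sub_distrib, ← mul_sum, ← mul_sum, ← h1, seeley]
  ring

lemma seeley_moment_zero (N : ℕ) : ∑ k ∈ range (N + 1), seeley N k = 1 := by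
  induction N with
  | zero => simp [seeley]
  | succ N ih =>
    have h := seeley_eval_succ N 1
    simp only [one_pow, mul_one] at h
    rw [h, ih, mul_one, inv_mul_cancel₀]
    have := half_pow_succ_le N
    linarith

lemma seeley_moment {N q : ℕ} (hq : 0 < q) (hqN : q ≤ N) : ∑ k ∈ range (N + 1), seeley N k * (2 ^ k
  : ℝ) ^ q = 0 := by
  have hsw : ∀ k : ℕ, (2 ^ k : ℝ) ^ q = (2 ^ q) ^ k := fun k => by rw [← pow_mul, ← pow_mul,
    mul_comm]
  simp only [hsw]
  induction N with
  | zero => omega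
  | succ N ih =>
    rw [seeley_eval_succ]
    rcases Nat.lt_or_ge N q with h | h
    · obtain rfl : q = N + 1 := by omega
      rw [← mul_pow]; simp
    · rw [ih h, mul_zero]

/-- `∑_{k<n} |c_k| 2^{kM}`. -/
def absMoment (c : ℕ → ℝ) (n M : ℕ) : ℝ := ∑ k ∈ range n, |c k| * (2 ^ k : ℝ) ^ M

lemma absMoment_nonneg (c : ℕ → ℝ) (n M : ℕ) : 0 ≤ absMoment c n M := sum_nonneg fun _ _ => by
  positivity

/-- A bound for the absolute moments of order `M` of all the sequences `seeley N`. -/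
def seeleyConst (M : ℕ) : ℝ := Real.exp (2 + 2 ^ M)

lemma seeleyConst_pos (M : ℕ) : 0 < seeleyConst M := Real.exp_pos _

lemma absMoment_seeley_le (N M : ℕ) : absMoment (seeley N) (N + 1) M ≤ seeleyConst M := by
  have hsw : ∀ k : ℕ, (2 ^ k : ℝ) ^ M = (2 ^ M) ^ k := fun k => by
    rw [← pow_mul, ← pow_mul, mul_comm]
  simp only [absMoment, hsw]
  set z : ℝ := 2 ^ M with hz
  have hz0 : 0 < z := by positivity
  suffices h : ∑ k ∈ range (N + 1), |seeley N k| * z ^ k ≤ Real.exp ((2 + z) * (1 - (1 / 2) ^ N)) by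
    refine h.trans (Real.exp_le_exp.2 ?_)
    have : (0 : ℝ) < (1 / 2) ^ N := by positivity
    nlinarith
  induction N with
  | zero => simp [seeley]
  | succ N ih =>
    set β : ℝ := (1 / 2) ^ (N + 1) with hβ
    have hβ0 : 0 < β := by positivity
    have hβ1 : β ≤ 1 / 2 := half_pow_succ_le N
    have hα : (1 - β)⁻¹ ≤ Real.exp (2 * β) := by
      refine le_trans ?_ (Real.add_one_le_exp _)
      rw [inv_le_iff_one_le_mul₀ (by linarith)]
      nlinarith
    have hα0 : 0 < (1 - β)⁻¹ := inv_pos.2 (by linarith)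
    have h1 := sum_shift_succ (b := fun k => |seeley N k|) (N := N) (by simp [seeley_eq_zero]) z
    have h2 : ∀ k ∈ range (N + 1), |seeley (N + 1) (k + 1)| * z ^ (k + 1) ≤ (1 - β)⁻¹ * (|seeley N
      (k + 1)| * z ^ (k + 1)) + (1 - β)⁻¹ * β * z * (|seeley N k| * z ^ k) := by
      intro k _
      rw [seeley, ← hβ, abs_mul, abs_of_pos hα0]
      have h3 : |seeley N (k + 1) - β * seeley N k| ≤ |seeley N (k + 1)| + β * |seeley N k| := by
        refine (abs_sub _ _).trans ?_
        rw [abs_mul, abs_of_pos hβ0]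
      calc (1 - β)⁻¹ * |seeley N (k + 1) - β * seeley N k| * z ^ (k + 1) ≤ (1 - β)⁻¹ * (|seeley N (k
            + 1)| + β * |seeley N k|) * z ^ (k + 1) := by gcongr
        _ = _ := by ring
    have h4 : ∑ k ∈ range (N + 1 + 1), |seeley (N + 1) k| * z ^ k ≤ (1 - β)⁻¹ * (1 + β * z) * ∑ k ∈
      range (N + 1), |seeley N k| * z ^ k := by
      rw [Finset.sum_range_succ']
      refine (add_le_add_left (sum_le_sum h2) _).trans (le_of_eq ?_)
      rw [sum_add_distrib, ← mul_sum, ← mul_sum, seeley, ← hβ, abs_mul, abs_of_pos hα0]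
      conv_rhs => rw [mul_add, mul_one, add_mul]
      conv_rhs => enter [1]; rw [← h1]
      ring
    refine h4.trans ?_
    calc (1 - β)⁻¹ * (1 + β * z) * ∑ k ∈ range (N + 1), |seeley N k| * z ^ k ≤ Real.exp (2 * β) *
          Real.exp (β * z) * Real.exp ((2 + z) * (1 - (1 / 2) ^ N)) := by
          gcongr
          rw [add_comm]; exact Real.add_one_le_exp _
      _ = _ := by
          rw [← Real.exp_add, ← Real.exp_add]
          congr 1
          rw [hβ, pow_succ]; ring

/-- The coefficients of the difference of consecutive approximations to the identity, at the finer
of the two scales. -/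
def seeleyDiff (i : ℕ) : ℕ → ℝ
  | 0 => seeley (i + 1) 0
  | k + 1 => seeley (i + 1) (k + 1) - seeley i k

lemma seeleyDiff_moment {i q : ℕ} (hq : q ≤ i) : ∑ k ∈ range (i + 2), seeleyDiff i k * (2 ^ k : ℝ) ^
  q = 0 := by
  have h1 : ∑ k ∈ range (i + 2), seeleyDiff i k * (2 ^ k : ℝ) ^ q = ∑ k ∈ range (i + 2), seeley (i +
    1) k * (2 ^ k : ℝ) ^ q - 2 ^ q * ∑ k ∈ range (i + 1), seeley i k * (2 ^ k : ℝ) ^ q := by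
    rw [Finset.sum_range_succ', Finset.sum_range_succ' (fun k => seeley (i + 1) k * _), mul_sum,
      add_sub_right_comm, ← sum_sub_distrib]
    refine congrArg₂ _ (sum_congr rfl fun k _ => ?_) rfl
    rw [seeleyDiff, pow_succ (2 : ℝ) k, mul_pow]; ring
  rw [h1]
  rcases Nat.eq_zero_or_pos q with rfl | h
  · have ha := seeley_moment_zero (i + 1)
    have hb := seeley_moment_zero i
    simp [ha, hb]
  · rw [seeley_moment h (by omega), seeley_moment h hq]; simp

lemma absMoment_seeleyDiff_le (i M : ℕ) : absMoment (seeleyDiff i) (i + 2) M ≤ (1 + 2 ^ M) *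
  seeleyConst M := by
  have h1 : absMoment (seeleyDiff i) (i + 2) M ≤ absMoment (seeley (i + 1)) (i + 2) M + 2 ^ M *
    absMoment (seeley i) (i + 1) M := by
    simp only [absMoment]
    rw [Finset.sum_range_succ', Finset.sum_range_succ' (fun k => |seeley (i + 1) k| * _), mul_sum,
      add_right_comm, ← sum_add_distrib]
    refine add_le_add (sum_le_sum fun k _ => ?_) le_rfl
    rw [seeleyDiff, pow_succ (2 : ℝ) k, mul_pow]
    have := abs_sub (seeley (i + 1) (k + 1)) (seeley i k)
    calc _ ≤ (|seeley (i + 1) (k + 1)| + |seeley i k|) * ((2 ^ k : ℝ) ^ M * 2 ^ M) := by gcongr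
      _ = _ := by ring
  have h2 := absMoment_seeley_le (i + 1) M
  have h3 := absMoment_seeley_le i M
  have : (0 : ℝ) < 2 ^ M := by positivity
  nlinarith

/-! ## Combinations of averages at dyadic scales -/

section Combinations

variable {E : Type} [NormedAddCommGroup E] [InnerProductSpace ℝ E] [FiniteDimensional ℝ E]
  [MeasurableSpace E] [BorelSpace E]
variable {t B : ℝ} {p x : E} {O : Set E} {c : ℕ → ℝ} {n : ℕ}
  {W : Type} [NormedAddCommGroup W] [NormedSpace ℝ W] {f : E → W}

lemma exists_taylor_ray (hO : IsOpen O) (M : ℕ) (hf : ContDiffOn ℝ M f O) {v : E} {a :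
  ℝ} (hray : ∀ l, a ≤ l → x + l • v ∈ O) (hB : ∀ l, a ≤ l → ‖∇ M f (x + l • v)‖ ≤ B) : ∃ w : ℕ → W,
  ∀ l, a ≤ l → ‖f (x + l • v) - ∑ q ∈ range M, l ^ q • w q‖ ≤ B * ‖v‖ ^ M * (l - a) ^ M := by
  induction M generalizing f B with
  | zero => exact ⟨fun _ => 0, fun l hl => by simpa using hB l hl⟩
  | succ M ih =>
    have hB0 : 0 ≤ B := (norm_nonneg _).trans (hB a le_rfl)
    have hfd : ContDiffOn ℝ M (fun z => fderiv ℝ f z v) O := by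
      refine ContDiffOn.clm_apply (hf.fderiv_of_isOpen hO ?_) contDiffOn_const
      exact_mod_cast le_rfl
    obtain ⟨w, hw⟩ := ih (f := fun z => fderiv ℝ f z v) (B := ‖v‖ * B) hfd fun l hl => by
      have h1 : ContDiffAt ℝ M (fderiv ℝ f) (x + l • v) := ((hf.fderiv_of_isOpen hO (m := M)
        (by exact_mod_cast le_rfl)).contDiffAt (hO.mem_nhds (hray l hl)))
      refine (norm_iteratedFDeriv_clm_apply_const h1 le_rfl).trans ?_
      rw [norm_iteratedFDeriv_fderiv]
      gcongr
      exact hB l hl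
    have hderiv : ∀ l, a ≤ l → HasDerivAt (fun l : ℝ => f (x + l • v) - ∑ q ∈ range M, (l ^ (q + 1)
      / (q + 1 : ℝ)) • w q) (fderiv ℝ f (x + l • v) v - ∑ q ∈ range M, l ^ q • w q) l := by
      intro l hl
      have h1 : HasFDerivAt f (fderiv ℝ f (x + l • v)) (x + l • v) := ((hf.contDiffAt (hO.mem_nhds
        (hray l hl))).differentiableAt (by simp)).hasFDerivAt
      have h2 : HasDerivAt (fun l : ℝ => x + l • v) v l := by
        simpa using ((hasDerivAt_id l).smul_const v).const_add x
      refine (h1.comp_hasDerivAt l h2).sub (HasDerivAt.fun_sum fun q _ => ?_)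
      have h3 : HasDerivAt (fun l : ℝ => l ^ (q + 1) / (q + 1 : ℝ)) (l ^ q) l := by
        have := (hasDerivAt_pow (q + 1) l).div_const (q + 1 : ℝ)
        have hq : (q + 1 : ℝ) ≠ 0 := by positivity
        rw [Nat.add_sub_cancel] at this
        push_cast at this
        rwa [mul_div_cancel_left₀ _ hq] at this
      exact h3.smul_const _
    refine ⟨fun q => if q = 0 then f (x + a • v) - ∑ q ∈ range M, (a ^ (q + 1) / (q + 1 : ℝ)) • w q
      else (q : ℝ)⁻¹ • w (q - 1), fun l hl => ?_⟩
    have hmv := (convex_Icc a l).norm_image_sub_le_of_norm_hasDerivWithin_le (x := a) (y := l) (C :=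
      B * ‖v‖ ^ (M + 1) * (l - a) ^ M) (fun z hz => (hderiv z hz.1).hasDerivWithinAt) (fun z hz =>
      ?_) (left_mem_Icc.2 hl) (right_mem_Icc.2 hl)
    · rw [Finset.sum_range_succ']
      simp only [Nat.succ_ne_zero, if_false, if_true, Nat.add_sub_cancel, pow_zero, one_smul]
      have h5 : ∑ q ∈ range M, l ^ (q + 1) • (((q + 1 : ℕ) : ℝ)⁻¹ • w q) = ∑ q ∈ range M, (l ^ (q +
        1) / (q + 1 : ℝ)) • w q := by
        refine sum_congr rfl fun q _ => ?_
        rw [smul_smul]; push_cast; rw [div_eq_mul_inv]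
      rw [norm_of_nonneg (sub_nonneg.2 hl), mul_assoc, ← pow_succ] at hmv
      rw [h5]
      refine le_trans (le_of_eq ?_) hmv
      congr 1
      abel
    · refine (hw z hz.1).trans ?_
      have : (z - a) ^ M ≤ (l - a) ^ M := pow_le_pow_left₀ (sub_nonneg.2 hz.1) (by linarith [hz.2])
        M
      calc ‖v‖ * B * ‖v‖ ^ M * (z - a) ^ M = B * ‖v‖ ^ (M + 1) * (z - a) ^ M := by ring
        _ ≤ _ := by gcongr

/-- `∑_{k<n} c_k avg p (2^k t) f`. -/
def cavg (c : ℕ → ℝ) (n : ℕ) (p : E) (t : ℝ) (f : E → W) (x : E) : W := ∑ k ∈ range n, c k • avg p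
  (2 ^ k * t) f x

/-- All averages of `f` at scales at least `t` involve only values in `O`. -/
def SeesRay (p : E) (t : ℝ) (O : Set E) (x : E) : Prop := ∀ l : ℝ, 1 ≤ l → Sees p (l * t) O x

lemma SeesRay.sees (h : SeesRay p t O x) (k : ℕ) : Sees p (2 ^ k * t) O x := h _ (one_le_pow₀
  (by norm_num))

lemma cavg_congr (hx : ∀ k < n, Sees p (2 ^ k * t) O x) {g : E → W} (h : EqOn f g O) : cavg c n p
  t f x = cavg c n p t g x := sum_congr rfl fun k hk => by rw [avg_congr (hx k (mem_range.1 hk)) h]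

lemma norm_cavg_le (hx : ∀ k < n, Sees p (2 ^ k * t) O x) (h : ∀ z ∈ O, ‖f z‖ ≤ B) :
  ‖cavg c n p t f x‖ ≤ absMoment c n 0 * B := by
  rw [absMoment, sum_mul]
  refine norm_sum_le_of_le _ fun k hk => ?_
  rw [norm_smul, norm_eq_abs, pow_zero, mul_one]
  gcongr
  exact norm_avg_le (hx k (mem_range.1 hk)) h

lemma contDiff_cavg (c : ℕ → ℝ) (n : ℕ) (p : E) (ht : 0 < t) (hf : AEStronglyMeasurable
  f volume) (hB : ∀ x, ‖f x‖ ≤ B) : ContDiff ℝ ∞ (cavg c n p t f) := ContDiff.sum fun _ _ =>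
  (contDiff_avg p (by positivity) hf hB).const_smul _

lemma iterD_cavg_eq_sum (q : ℕ) (h : ∀ k < n, ContDiffAt ℝ q (avg p (2 ^ k * t) f) x) :
  ∇ q (cavg c n p t f) x = ∑ k ∈ range n, c k • ∇ q (avg p (2 ^ k * t) f) x := by
  have h1 : cavg c n p t f = ∑ k ∈ range n, (c k • avg p (2 ^ k * t) f) := by ext x; simp [cavg]
  rw [h1, iteratedFDeriv_sum_apply (f := fun k => c k • avg p (2 ^ k * t) f) fun k hk =>
    (h k (mem_range.1 hk)).const_smul (c k)]
  exact sum_congr rfl fun k hk =>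
    iteratedFDeriv_const_smul_apply (h k (mem_range.1 hk))

lemma contDiffAt_avg_of_sees (hO : IsOpen O) (k : ℕ) (hf : ContDiffOn ℝ k f O) (hx :
  Sees p t O x) : ContDiffAt ℝ k (avg p t f) x := by
  induction k generalizing x W with
  | zero =>
    have hcont := continuousOn_integral_of_compact_support (μ := volume)
      (f := fun z y : E => stdBump E y • f (z + t • (p + y))) (s := {x | Sees p t O x})
      (isCompact_closedBall (0 : E) 1) (continuousOn_bump_smul hO hf.continuousOn)
      fun z y _ hy => by simp [stdBump_eq_zero hy]
    have : ContDiffOn ℝ 0 (avg p t f) {x | Sees p t O x} := contDiffOn_zero.2 hcont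
    exact_mod_cast this.contDiffAt ((isOpen_sees p t hO).mem_nhds hx)
  | succ k ih =>
    have h : ContDiffOn ℝ ((k : ℕ∞ω) + 1) (avg p t f) {x | Sees p t O x} := by
      refine (contDiffOn_succ_iff_fderiv_of_isOpen (isOpen_sees p t hO)).2 ⟨?_, by simp, ?_⟩
      · intro z hz
        exact (hasFDerivAt_avg hO hz (hf.of_le
          (by exact_mod_cast Nat.succ_le_succ (Nat.zero_le k)))).differentiableAt.differentiableWithinAt
      · have h1 : ContDiffOn ℝ k (fderiv ℝ f) O := hf.fderiv_of_isOpen hO (by exact_mod_cast le_rfl)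
        intro z hz
        refine (ih h1 hz).contDiffWithinAt.congr (fun z' hz' => ?_) ?_
        · exact (hasFDerivAt_avg hO hz' (hf.of_le
            (by exact_mod_cast Nat.succ_le_succ (Nat.zero_le k)))).fderiv
        · exact (hasFDerivAt_avg hO hz (hf.of_le
            (by exact_mod_cast Nat.succ_le_succ (Nat.zero_le k)))).fderiv
    have := h.contDiffAt ((isOpen_sees p t hO).mem_nhds hx)
    exact_mod_cast this

lemma norm_iterD_cavg_of_contDiffOn_le [CompleteSpace W] (ht : 0 < t) (k q : ℕ) (hO : IsOpen O) (hsm : ∀ k < n, ContDiff ℝ ∞ (avg p (2 ^ k * t) f)) (hf : ContDiffOn ℝ k f O) (hB0 : 0 ≤ B)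
  (hB : ∀ z ∈ O, ‖∇ k f z‖ ≤ B) (hx : ∀ k < n, Sees p (2 ^ k * t) O x) : ‖∇ (k + q) (cavg c n p t f)
  x‖ ≤ absMoment c n 0 * (bumpConst E q * B * t⁻¹ ^ q) := by
  rw [iterD_cavg_eq_sum (k + q) fun k hk => (hsm k hk).contDiffAt.of_le (by exact_mod_cast le_top),
    absMoment, sum_mul]
  have hb := bumpConst_nonneg (E := E) q
  refine norm_sum_le_of_le _ fun j hj => ?_
  rw [norm_smul, norm_eq_abs, pow_zero, mul_one]
  gcongr
  refine (norm_iterD_avg_of_contDiffOn_le k q (by positivity) hO hf hB0 hB (hx j (mem_range.1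
    hj))).trans ?_
  gcongr
  exact le_mul_of_one_le_left ht.le (one_le_pow₀ (by norm_num))

lemma iterD_cavg [CompleteSpace W] (q : ℕ) (hO : IsOpen O) (hf : ContDiffOn ℝ q f O) (hx
  : ∀ k < n, Sees p (2 ^ k * t) O x) : ∇ q (cavg c n p t f) x = cavg c n p t (∇ q f) x := by
  rw [iterD_cavg_eq_sum q fun k hk => contDiffAt_avg_of_sees hO q hf (hx k hk)]
  exact sum_congr rfl fun k hk => by rw [iterD_avg hO q hf (hx k (mem_range.1 hk))]

lemma cavg_eq_integral (hO : IsOpen O) (hf : ContinuousOn f O) (hx : ∀ k < n, Sees p (2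
  ^ k * t) O x) : cavg c n p t f x = ∫ y, stdBump E y • ∑ k ∈ range n, c k • f (x + (2 ^ k * t) • (p
  + y)) := by
  simp only [smul_sum]
  rw [integral_finsetSum]
  · refine sum_congr rfl fun k _ => ?_
    rw [avg, ← integral_smul]
    exact integral_congr_ae (Eventually.of_forall fun y => smul_comm _ _ _)
  · intro k hk
    simp only [smul_comm _ (c k)]
    exact (integrable_bump_smul hO (hx k (mem_range.1 hk)) hf).smul _

lemma norm_smul_add_le (ht : 0 ≤ t) {y : E} (hy : y ∈ closedBall (0 : E) 1) :
  ‖t • (p + y)‖ ≤ t * (‖p‖ + 1) := by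
  rw [norm_smul, norm_of_nonneg ht]
  gcongr
  exact (norm_add_le _ _).trans (by gcongr; simpa using hy)

lemma norm_cavg_le_of_moments {M : ℕ} (ht : 0 < t) (hO : IsOpen O) (hf : ContDiffOn ℝ M
  f O) (hB0 : 0 ≤ B) (hB : ∀ z ∈ O, ‖∇ M f z‖ ≤ B) (hx : SeesRay p t O x) (hc : ∀ j < M, ∑ k ∈ range
  n, c k * (2 ^ k : ℝ) ^ j = 0) : ‖cavg c n p t f x‖ ≤ absMoment c n M * (B * (t * (‖p‖ + 1)) ^ M)
  := by
  rw [cavg_eq_integral hO hf.continuousOn fun k _ => hx.sees k]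
  refine norm_integral_bump_smul_le fun y hy => ?_
  have hray : ∀ l : ℝ, 1 ≤ l → x + l • (t • (p + y)) ∈ O := fun l hl => by
    rw [smul_smul]; exact hx l hl y hy
  obtain ⟨w, hw⟩ := exists_taylor_ray hO M hf hray fun l hl => hB _ (hray l hl)
  have h0 : ∑ k ∈ range n, c k • ∑ q ∈ range M, (2 ^ k : ℝ) ^ q • w q = 0 := by
    simp only [smul_sum, smul_smul]
    rw [sum_comm]
    refine sum_eq_zero fun q hq => ?_
    rw [← sum_smul, hc q (mem_range.1 hq), zero_smul]
  have h1 : ∑ k ∈ range n, c k • f (x + (2 ^ k * t) • (p + y)) = ∑ k ∈ range n, c k • (f (x + (2 :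
    ℝ) ^ k • (t • (p + y))) - ∑ q ∈ range M, (2 ^ k : ℝ) ^ q • w q) := by
    simp only [smul_sub, sum_sub_distrib, h0, sub_zero, smul_smul]
  rw [h1, absMoment, sum_mul]
  refine norm_sum_le_of_le _ fun k _ => ?_
  have h2k : (1 : ℝ) ≤ 2 ^ k := one_le_pow₀ (by norm_num)
  rw [norm_smul, norm_eq_abs, mul_assoc]
  gcongr
  refine (hw _ h2k).trans ?_
  have hv := norm_smul_add_le (p := p) ht.le hy
  calc B * ‖t • (p + y)‖ ^ M * (2 ^ k - 1) ^ M ≤ B * (t * (‖p‖ + 1)) ^ M * (2 ^ k) ^ M := by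
        gcongr
        linarith
    _ = _ := by ring

lemma norm_sub_cavg_le_of_moments {M : ℕ} (ht : 0 < t) [CompleteSpace W] (hf : ContDiff
  ℝ M f) (hB : ∀ z, ‖∇ M f z‖ ≤ B) (x : E) (hc0 : ∑ k ∈ range n, c k = 1) (hc : ∀ j < M, 0 < j → ∑ k
  ∈ range n, c k * (2 ^ k : ℝ) ^ j = 0) : ‖f x - cavg c n p t f x‖ ≤ (1 + absMoment c n M) * (B * (t
  * (‖p‖ + 1)) ^ M) := by
  have hB0 : 0 ≤ B := (norm_nonneg _).trans (hB 0)
  have hs : ∀ k < n, Sees p (2 ^ k * t) univ x := fun _ _ _ _ => mem_univ _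
  have hint := integral_finsetSum (μ := volume) (range n) (f := fun k y => c k • (stdBump E y • f (x
    + (2 ^ k * t) • (p + y)))) fun k hk =>
    (integrable_bump_smul isOpen_univ (hs k (mem_range.1 hk)) hf.continuous.continuousOn).smul (c k)
  have h1 : f x - cavg c n p t f x = ∫ y, stdBump E y • (f x - ∑ k ∈ range n, c k • f (x + (2 ^ k *
    t) • (p + y))) := by
    rw [cavg_eq_integral isOpen_univ hf.continuous.continuousOn hs]
    simp only [smul_sub]
    rw [integral_sub (integrable_stdBump.smul_const _), integral_smul_const, integral_stdBump,
      one_smul]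
    simp only [smul_sum, smul_comm _ (c _)]
    exact integrable_finsetSum _ fun k hk =>
      (integrable_bump_smul isOpen_univ (hs k (mem_range.1 hk)) hf.continuous.continuousOn).smul (c
        k)
  rw [h1]
  refine norm_integral_bump_smul_le fun y hy => ?_
  obtain ⟨w, hw⟩ := exists_taylor_ray isOpen_univ M hf.contDiffOn (x := x) (v := t • (p + y)) (a :=
    0) (fun _ _ => mem_univ _) fun l _ => hB _
  have hv := norm_smul_add_le (p := p) ht.le hy
  set P : ℝ → W := fun l => ∑ q ∈ range M, l ^ q • w q with hP
  have h0 : ∑ k ∈ range n, c k • P (2 ^ k : ℝ) = P 0 := by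
    simp only [hP, smul_sum, smul_smul]
    rw [sum_comm]
    refine sum_congr rfl fun q hq => ?_
    rw [← sum_smul]
    rcases Nat.eq_zero_or_pos q with rfl | hq0
    · simp [hc0]
    · rw [hc q (mem_range.1 hq) hq0, zero_pow hq0.ne']
  have h2 : f x - ∑ k ∈ range n, c k • f (x + (2 ^ k * t) • (p + y)) = (f (x + (0 : ℝ) • (t • (p +
    y))) - P 0) - ∑ k ∈ range n, c k • (f (x + (2 : ℝ) ^ k • (t • (p + y))) - P (2 ^ k)) := by
    simp only [smul_sub, sum_sub_distrib, h0, smul_smul, zero_mul, zero_smul, add_zero]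
    abel
  rw [h2, add_mul, one_mul]
  refine (norm_sub_le _ _).trans (add_le_add ?_ ?_)
  · refine (hw 0 le_rfl).trans ?_
    rw [sub_zero]
    calc B * ‖t • (p + y)‖ ^ M * 0 ^ M ≤ B * (t * (‖p‖ + 1)) ^ M * 1 := by
          gcongr
          rcases M.eq_zero_or_pos with rfl | h
          · simp
          · rw [zero_pow h.ne']; norm_num
      _ = _ := by ring
  · rw [absMoment, sum_mul]
    refine norm_sum_le_of_le _ fun k _ => ?_
    rw [norm_smul, norm_eq_abs, mul_assoc]
    gcongr
    refine (hw _ (by positivity)).trans ?_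
    calc B * ‖t • (p + y)‖ ^ M * (2 ^ k - 0) ^ M ≤ B * (t * (‖p‖ + 1)) ^ M * (2 ^ k) ^ M := by
          rw [sub_zero]; gcongr
      _ = _ := by ring

lemma norm_iterD_cavg_le_of_moments [CompleteSpace W] {M : ℕ} (q : ℕ) (ht : 0 < t) (hO : IsOpen O)
  (hf : ContDiffOn ℝ (q + M : ℕ) f O) (hB0 : 0 ≤ B) (hB : ∀ z ∈ O, ‖∇ (q + M) f z‖ ≤ B)
  (hx : SeesRay p t O x) (hc : ∀ j < M, ∑ k ∈ range n, c k * (2 ^ k : ℝ) ^ j = 0) : ‖∇ q (cavg c n p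
  t f) x‖ ≤ absMoment c n M * (B * (t * (‖p‖ + 1)) ^ M) := by
  rw [iterD_cavg q hO (hf.of_le (by exact_mod_cast Nat.le_add_right _ _)) fun k _ => hx.sees k]
  refine norm_cavg_le_of_moments ht hO (fun z hz => ?_) hB0 (fun z hz => ?_) hx hc
  · refine (ContDiffAt.iteratedFDeriv_right (hf.contDiffAt (hO.mem_nhds hz)) ?_).contDiffWithinAt
    push_cast; rw [add_comm]
  · rw [← norm_iterD_add]; exact hB z hz

end Combinations

/-! ## Quantitative forms of the norms -/

section Norms

variable {E : Type*} [NormedAddCommGroup E] [NormedSpace ℝ E]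
  {G : Type*} [NormedAddCommGroup G] [NormedSpace ℝ G]
  {r A β : ℝ} {D D' : Set E} {u v : E → G} {x : E}

/-- The integer part `k` of `r = k + β`, `0 < β ≤ 1`. -/
abbrev zk (r : ℝ) : ℕ := ⌈r⌉₊ - 1

lemma zk_lt (hr : 0 < r) : (zk r : ℝ) < r := by
  have h1 : 1 ≤ ⌈r⌉₊ := Nat.one_le_ceil_iff.2 hr
  have h2 := Nat.ceil_lt_add_one hr.le
  rw [zk, Nat.cast_sub h1]; push_cast; linarith

lemma le_zk_add_one (r : ℝ) : r ≤ zk r + 1 := by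
  have h1 : r ≤ ⌈r⌉₊ := Nat.le_ceil r
  have h2 : (⌈r⌉₊ : ℝ) ≤ ((⌈r⌉₊ - 1 + 1 : ℕ) : ℝ) := by exact_mod_cast Nat.le_add_of_sub_le le_rfl
  push_cast at h2; linarith

lemma supNorm_le (h : ∀ x ∈ D, ‖u x‖ ≤ A) : supNorm D u ≤ ofReal A
  := by
  refine iSup₂_le fun x hx => ?_
  rw [← ofReal_norm]
  exact ofReal_le_ofReal (h x hx)

lemma norm_le_of_supNorm_le (hA : 0 ≤ A) (h : supNorm D u ≤ ofReal
  A) (hx : x ∈ D) : ‖u x‖ ≤ A := by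
  have h1 : ‖u x‖ₑ ≤ ofReal A := (le_iSup₂ (f := fun x _ => ‖u x‖ₑ) x hx).trans h
  rw [← ofReal_norm] at h1
  exact (ENNReal.ofReal_le_ofReal_iff hA).1 h1

lemma enorm_div_le_iff {v : G} {ρ : ℝ} (hρ : 0 < ρ) (hA : 0 ≤ A) : ‖v‖ₑ / ofReal ρ ≤ ofReal A ↔
  ‖v‖ ≤ A * ρ := by
  rw [← ofReal_norm, ← ENNReal.ofReal_div_of_pos hρ, ENNReal.ofReal_le_ofReal_iff hA, div_le_iff₀
    hρ]

lemma zygmundSeminorm_le_iff (hA : 0 ≤ A) : zygmundSeminorm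
  β D u ≤ ofReal A ↔ ∀ x h : E, h ≠ 0 → x ∈ D → x + h ∈ D → x + (2 : ℝ) • h ∈ D → ‖u x + u (x + (2 :
  ℝ) • h) - (2 : ℝ) • u (x + h)‖ ≤ A * ‖h‖ ^ β := by
  simp only [zygmundSeminorm, iSup_le_iff]
  refine forall₂_congr fun x h => forall_congr' fun hh => ?_
  refine forall₃_congr fun _ _ _ => ?_
  exact enorm_div_le_iff (Real.rpow_pos_of_pos (norm_pos_iff.2 hh) _) hA

lemma holderSeminorm_le_iff (hA : 0 ≤ A) : holderSeminorm β
  D u ≤ ofReal A ↔ ∀ x y : E, x ≠ y → x ∈ D → y ∈ D → ‖u x - u y‖ ≤ A * ‖x - y‖ ^ β := by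
  simp only [holderSeminorm, iSup_le_iff]
  refine forall₂_congr fun x y => forall_congr' fun hh => ?_
  refine forall₂_congr fun _ _ => ?_
  exact enorm_div_le_iff (Real.rpow_pos_of_pos (norm_pos_iff.2 (sub_ne_zero.2 hh)) _) hA

lemma sum_ofReal_add (k : ℕ) (hA : 0 ≤ A) :
  ∑ _i ∈ range (k + 1), ofReal A + ofReal A = ofReal ((k + 2) * A) := by
  rw [Finset.sum_const, Finset.card_range, nsmul_eq_mul, ← ENNReal.ofReal_natCast, ← ofReal_mul
    (by positivity), ← ENNReal.ofReal_add (by positivity) hA]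
  congr 1; push_cast; ring

lemma zygmundNorm_le (hA : 0 ≤ A) (hc : ContDiffOn ℝ (zk r)
  u D) (hs : ∀ i ≤ zk r, ∀ x ∈ D, ‖∇ i u x‖ ≤ A) (hz : ∀ x h : E, h ≠ 0 → x ∈ D → x + h ∈ D → x + (2
  : ℝ) • h ∈ D → ‖∇ (zk r) u x + ∇ (zk r) u (x + (2 : ℝ) • h) - (2 : ℝ) • ∇ (zk r) u (x + h)‖ ≤ A *
  ‖h‖ ^ (r - zk r)) : zygmundNorm r D u ≤ ofReal ((zk r + 2) * A) := by
  rw [zygmundNorm, if_pos hc]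
  exact (add_le_add (sum_le_sum fun i hi => supNorm_le (hs i (Nat.lt_succ_iff.1 (mem_range.1 hi))))
    ((zygmundSeminorm_le_iff hA).2 hz)).trans_eq (sum_ofReal_add _ hA)

lemma of_zygmundNorm_le (hA : 0 ≤ A) (h : zygmundNorm r D u
  ≤ ofReal A) : ContDiffOn ℝ (zk r) u D ∧ (∀ i ≤ zk r, ∀ x ∈ D, ‖∇ i u x‖ ≤ A) ∧ (∀ x h : E, h ≠ 0 →
  x ∈ D → x + h ∈ D → x + (2 : ℝ) • h ∈ D → ‖∇ (zk r) u x + ∇ (zk r) u (x + (2 : ℝ) • h) - (2 : ℝ) •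
  ∇ (zk r) u (x + h)‖ ≤ A * ‖h‖ ^ (r - zk r)) := by
  rw [zygmundNorm] at h
  split_ifs at h with hc
  · refine ⟨hc, fun i hi x hx => ?_, ?_⟩
    · refine norm_le_of_supNorm_le hA (le_trans ?_ h) hx
      exact (single_le_sum (f := fun i => supNorm D (∇ i u)) (fun _ _ => zero_le) (mem_range.2
        (Nat.lt_succ_iff.2 hi))).trans le_self_add
    · exact (zygmundSeminorm_le_iff hA).1 (le_trans le_add_self h)
  · exact absurd h (by simp)

lemma holderNorm_le (hA : 0 ≤ A) (hc : ContDiffOn ℝ ⌊r⌋₊ u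
  D) (hb : ∀ i ≤ ⌊r⌋₊, ContUpToBoundary D (∇ i u)) (hs : ∀ i ≤ ⌊r⌋₊, ∀ x ∈ D, ‖∇ i u x‖ ≤ A) (hz : ∀
  x y : E, x ≠ y → x ∈ D → y ∈ D → ‖∇ ⌊r⌋₊ u x - ∇ ⌊r⌋₊ u y‖ ≤ A * ‖x - y‖ ^ (r - ⌊r⌋₊)) :
  holderNorm r D u ≤ ofReal ((⌊r⌋₊ + 2) * A) := by
  rw [holderNorm, if_pos ⟨hc, hb⟩]
  exact (add_le_add (sum_le_sum fun i hi => supNorm_le (hs i (Nat.lt_succ_iff.1 (mem_range.1 hi))))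
    ((holderSeminorm_le_iff hA).2 hz)).trans_eq (sum_ofReal_add _ hA)

lemma of_holderNorm_le (hA : 0 ≤ A) (h : holderNorm r D u ≤
  ofReal A) : ContDiffOn ℝ ⌊r⌋₊ u D ∧ (∀ i ≤ ⌊r⌋₊, ContUpToBoundary D (∇ i u)) ∧ (∀ i ≤ ⌊r⌋₊, ∀ x ∈
  D, ‖∇ i u x‖ ≤ A) ∧ (∀ x y : E, x ≠ y → x ∈ D → y ∈ D → ‖∇ ⌊r⌋₊ u x - ∇ ⌊r⌋₊ u y‖ ≤ A * ‖x - y‖ ^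
  (r - ⌊r⌋₊)) := by
  rw [holderNorm] at h
  split_ifs at h with hc
  · refine ⟨hc.1, hc.2, fun i hi x hx => ?_, ?_⟩
    · refine norm_le_of_supNorm_le hA (le_trans ?_ h) hx
      exact (single_le_sum (f := fun i => supNorm D (∇ i u)) (fun _ _ => zero_le) (mem_range.2
        (Nat.lt_succ_iff.2 hi))).trans le_self_add
    · exact (holderSeminorm_le_iff hA).1 (le_trans le_add_self h)
  · exact absurd h (by simp)

lemma supNorm_mono (h : D ⊆ D') (u : E → G) : supNorm D u ≤ supNorm D' u :=
  biSup_mono h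

lemma zygmundNorm_mono (h : D ⊆ D') (u : E → G) : zygmundNorm r D u ≤
  zygmundNorm r D' u := by
  rw [zygmundNorm, zygmundNorm]
  by_cases hc : ContDiffOn ℝ (⌈r⌉₊ - 1 : ℕ) u D'
  · rw [if_pos hc, if_pos (hc.mono h)]
    refine add_le_add (sum_le_sum fun i _ => supNorm_mono h _) ?_
    refine iSup₂_le fun x y => iSup₂_le fun hy hx => iSup₂_le fun hx1 hx2 => ?_
    exact le_iSup₂_of_le x y (le_iSup₂_of_le hy (h hx) (le_iSup₂_of_le (h hx1) (h hx2) le_rfl))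
  · rw [if_neg hc]; exact le_top

lemma ContUpToBoundary.mono (h : D ⊆ D') (hu : ContUpToBoundary D' u) :
  ContUpToBoundary D u := by
  obtain ⟨g, hg, hgu⟩ := hu
  exact ⟨g, hg.mono (closure_mono h), hgu.mono h⟩

lemma ContUpToBoundary.congr (hu : ContUpToBoundary D u) (h : EqOn u v D)
  : ContUpToBoundary D v := by
  obtain ⟨g, hg, hgu⟩ := hu
  exact ⟨g, hg, h.symm.trans hgu⟩

lemma Continuous.contUpToBoundary (hu : Continuous u) : ContUpToBoundary D u
  := ⟨u, hu.continuousOn, fun _ _ => rfl⟩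

lemma holderNorm_mono (h : D ⊆ D') (u : E → G) : holderNorm r D u ≤
  holderNorm r D' u := by
  rw [holderNorm, holderNorm]
  by_cases hc : ContDiffOn ℝ ⌊r⌋₊ u D' ∧ ∀ i ≤ ⌊r⌋₊, ContUpToBoundary D' (∇ i u)
  · rw [if_pos hc, if_pos ⟨hc.1.mono h, fun i hi => (hc.2 i hi).mono h⟩]
    refine add_le_add (sum_le_sum fun i _ => supNorm_mono h _) ?_
    refine iSup₂_le fun x y => iSup₂_le fun hy hx => iSup_le fun hx1 => ?_
    exact le_iSup₂_of_le x y (le_iSup₂_of_le hy (h hx) (le_iSup_of_le (h hx1) le_rfl))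
  · rw [if_neg hc]; exact le_top

lemma eqOn_iterD (hD : IsOpen D) (h : EqOn u v D) (i : ℕ) : EqOn (∇ i u)
  (∇ i v) D := fun _ hx =>
  ((h.eventuallyEq_of_mem (hD.mem_nhds hx)).iteratedFDeriv ℝ i).eq_of_nhds

lemma supNorm_congr (h : EqOn u v D) : supNorm D u = supNorm D v :=
  biSup_congr fun x hx => by rw [h hx]

lemma zygmundNorm_congr (hD : IsOpen D) (h : EqOn u v D) :
  zygmundNorm r D u = zygmundNorm r D v := by
  have h1 := eqOn_iterD hD h
  have h2 : zygmundSeminorm (r - (⌈r⌉₊ - 1 : ℕ)) D (∇ (⌈r⌉₊ - 1) u) = zygmundSeminorm (r - (⌈r⌉₊ - 1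
    : ℕ)) D (∇ (⌈r⌉₊ - 1) v) := by
    refine iSup_congr fun x => iSup_congr fun y => iSup_congr fun _ => iSup_congr fun hx =>
      iSup_congr fun hx1 => iSup_congr fun hx2 => ?_
    rw [h1 _ hx, h1 _ hx1, h1 _ hx2]
  rw [zygmundNorm, zygmundNorm, contDiffOn_congr (fun x hx => h hx), h2, sum_congr rfl fun i _ =>
    supNorm_congr (h1 i)]

lemma contUpToBoundary_congr (h : EqOn u v D) : ContUpToBoundary D u ↔
  ContUpToBoundary D v := ⟨fun hu => hu.congr h, fun hv => hv.congr h.symm⟩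

lemma holderNorm_congr (hD : IsOpen D) (h : EqOn u v D) :
  holderNorm r D u = holderNorm r D v := by
  have h1 := eqOn_iterD hD h
  have h2 : holderSeminorm (r - ⌊r⌋₊) D (∇ ⌊r⌋₊ u) = holderSeminorm (r - ⌊r⌋₊) D (∇ ⌊r⌋₊ v) := by
    refine iSup_congr fun x => iSup_congr fun y => iSup_congr fun _ => iSup_congr fun hx =>
      iSup_congr fun hx1 => ?_
    rw [h1 _ hx, h1 _ hx1]
  have hb : (ContDiffOn ℝ ⌊r⌋₊ u D ∧ ∀ i ≤ ⌊r⌋₊, ContUpToBoundary D (∇ i u)) ↔ (ContDiffOn ℝ ⌊r⌋₊ v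
    D ∧ ∀ i ≤ ⌊r⌋₊, ContUpToBoundary D (∇ i v)) := and_congr (contDiffOn_congr fun x hx => h hx)
    (forall₂_congr fun i _ => contUpToBoundary_congr (h1 i))
  have h3 := sum_congr rfl fun i (_ : i ∈ range (⌊r⌋₊ + 1)) => supNorm_congr (h1 i)
  by_cases hc : ContDiffOn ℝ ⌊r⌋₊ u D ∧ ∀ i ≤ ⌊r⌋₊, ContUpToBoundary D (∇ i u)
  · rw [holderNorm, holderNorm, if_pos hc, if_pos (hb.1 hc), h2, h3]
  · rw [holderNorm, holderNorm, if_neg hc, if_neg (fun h' => hc (hb.2 h'))]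

end Norms

/-! ## Dyadic sums -/

lemma exists_dyadic_sum_le {α β : ℝ} (hα : 0 < α) (hβ : 0 < β) : ∃ C : ℝ, 0 < C ∧ ∀ h : ℝ, 0 < h → ∀
  A : ℝ, 0 ≤ A → ∀ a : ℕ → ℝ, (∀ j, 0 ≤ a j) → (∀ j, a j ≤ A * (h * 2 ^ j) ^ α) → (∀ j, a j ≤ A * (h
  * 2 ^ j) ^ (-β)) → Summable a ∧ ∑' j, a j ≤ C * A := by
  set γ := min α β with hγ
  have hγ0 : 0 < γ := lt_min hα hβ
  set q : ℝ := 2 ^ (-γ) with hq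
  have hq0 : 0 < q := Real.rpow_pos_of_pos two_pos _
  have hq1 : q < 1 := Real.rpow_lt_one_of_one_lt_of_neg one_lt_two (by linarith)
  have hsum : Summable fun k : ℤ => q ^ k.natAbs := Summable.of_nat_of_neg
    (by simpa using summable_geometric_of_lt_one hq0.le hq1)
    (by simpa using summable_geometric_of_lt_one hq0.le hq1)
  have hS : 0 < ∑' k : ℤ, q ^ k.natAbs := hsum.tsum_pos (fun k => by positivity) 0 (by simp)
  refine ⟨2 ^ γ * ∑' k : ℤ, q ^ k.natAbs, by positivity, fun h hh A hA a ha h1 h2 => ?_⟩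
  obtain ⟨n, hn1, hn2⟩ := exists_mem_Ico_zpow hh one_lt_two
  have hqpow : ∀ k : ℕ, q ^ k = ((2 : ℝ) ^ k) ^ (-γ) := fun k => by
    rw [hq, ← rpow_natCast, ← rpow_mul two_pos.le, mul_comm, rpow_mul two_pos.le, rpow_natCast]
  have hle : ∀ j : ℕ, a j ≤ A * 2 ^ γ * q ^ (n + j).natAbs := fun j => by
    have e1 : h * 2 ^ j < 2 ^ (n + j + 1) := by
      rw [add_right_comm, zpow_add₀ two_ne_zero, zpow_natCast]
      gcongr
    have e2 : 2 ^ (n + j) ≤ h * 2 ^ j := by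
      rw [zpow_add₀ two_ne_zero, zpow_natCast]
      gcongr
    rw [mul_assoc]
    cases hm : n + (j : ℤ) with
    | ofNat k =>
      rw [hm, Int.ofNat_eq_natCast, zpow_natCast] at e2
      refine (h2 j).trans (mul_le_mul_of_nonneg_left ?_ hA)
      calc (h * 2 ^ j) ^ (-β) ≤ (h * 2 ^ j) ^ (-γ) := Real.rpow_le_rpow_of_exponent_le
            ((one_le_pow₀ (M₀ := ℝ) one_le_two (n := k)).trans e2) (neg_le_neg (min_le_right _ _))
        _ ≤ ((2 : ℝ) ^ k) ^ (-γ) :=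
            Real.rpow_le_rpow_of_nonpos (by positivity) e2 (neg_nonpos.2 hγ0.le)
        _ = 1 * q ^ k := by rw [hqpow, one_mul]
        _ ≤ _ := mul_le_mul_of_nonneg_right (Real.one_le_rpow one_le_two hγ0.le) (by positivity)
    | negSucc k =>
      rw [hm, Int.negSucc_eq, neg_add_rev, neg_add_cancel_comm, zpow_neg, zpow_natCast] at e1
      refine (h1 j).trans (mul_le_mul_of_nonneg_left ?_ hA)
      calc (h * 2 ^ j) ^ α ≤ (h * 2 ^ j) ^ γ := Real.rpow_le_rpow_of_exponent_ge (by positivity)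
            (e1.le.trans (inv_le_one_of_one_le₀ (one_le_pow₀ (M₀ := ℝ) one_le_two (n := k)))) (min_le_left _ _)
        _ ≤ ((2 : ℝ) ^ k)⁻¹ ^ γ := by gcongr
        _ = q ^ k := by rw [hqpow, Real.rpow_neg_eq_inv_rpow]
        _ = _ := by
            rw [Int.natAbs_negSucc, pow_succ' q, ← mul_assoc, hq, ← rpow_add two_pos]; simp
  have hinj : Function.Injective fun j : ℕ => n + (j : ℤ) := fun i j hij => by simpa using hij
  have hsA : Summable fun j : ℕ => A * 2 ^ γ * q ^ (n + (j : ℤ)).natAbs := (hsum.comp_injective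
    hinj).mul_left _
  have hsa : Summable a := Summable.of_nonneg_of_le ha hle hsA
  refine ⟨hsa, (hsa.tsum_le_tsum hle hsA).trans ?_⟩
  rw [tsum_mul_left]
  have := tsum_comp_le_tsum_of_inj hsum (fun k => by positivity) hinj
  calc A * 2 ^ γ * ∑' j : ℕ, q ^ (n + (j : ℤ)).natAbs ≤ A * 2 ^ γ * ∑' k : ℤ, q ^ k.natAbs := by
        gcongr
        exact this
    _ = _ := by ring

/-! ## Dyadic decompositions of functions on the whole space -/

section Dyadic

variable {E : Type} [NormedAddCommGroup E] [NormedSpace ℝ E]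
variable {r s A B b : ℝ} {N k : ℕ} {f g : E → ℂ} {e : ℕ → E → ℂ} {x : E}

/-- `f` is of class `C^k` with all derivatives up to the order `k` bounded by `A`. -/
def CkBound (k : ℕ) (A : ℝ) (f : E → ℂ) : Prop := ContDiff ℝ k f ∧ ∀ i ≤ k, ∀ x, ‖∇ i f x‖ ≤ A

lemma CkBound.norm_le (h : CkBound k A f) (x : E) : ‖f x‖ ≤ A := by
  simpa only [norm_iteratedFDeriv_zero] using h.2 0 (Nat.zero_le _) x

lemma CkBound.nonneg (h : CkBound k A f) : 0 ≤ A := (norm_nonneg _).trans (h.norm_le 0)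

/-- The pieces `e j` form a dyadic decomposition of `f` of order `r`. -/
structure IsDyadic (r : ℝ) (N : ℕ) (A : ℝ) (e : ℕ → E → ℂ) (f : E → ℂ) : Prop where
  smooth : ∀ j, ContDiff ℝ ∞ (e j)
  bound : ∀ j i, i ≤ N → ∀ x, ‖∇ i (e j) x‖ ≤ A * (2 ^ j : ℝ) ^ ((i : ℝ) - r)
  hasSum : ∀ x, HasSum (fun j => e j x) (f x)

/-- `f` has a dyadic decomposition of order `r`. -/
def HasDyadic (r : ℝ) (N : ℕ) (A : ℝ) (f : E → ℂ) : Prop := ∃ e, IsDyadic r N A e f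

lemma nat_le_infty (k : ℕ) : (k : ℕ∞ω) ≤ (∞ : ℕ∞ω) := by exact_mod_cast le_top

lemma one_le_two_pow (j : ℕ) : (1 : ℝ) ≤ 2 ^ j := one_le_pow₀ (by norm_num)

lemma dyadic_rpow_le {a : ℝ} (h : a ≤ b) (j : ℕ) : (2 ^ j : ℝ) ^ a ≤ (2 ^ j : ℝ) ^ b :=
  Real.rpow_le_rpow_of_exponent_le (one_le_two_pow j) h

lemma summable_dyadic_rpow {a : ℝ} (ha : a < 0) : Summable fun j : ℕ => (2 ^ j : ℝ) ^ a := by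
  have h : (fun j : ℕ => (2 ^ j : ℝ) ^ a) = fun j => (2 ^ a : ℝ) ^ j := by
    ext j
    rw [← rpow_natCast, ← rpow_mul two_pos.le, mul_comm, rpow_mul two_pos.le, rpow_natCast]
  rw [h]
  exact summable_geometric_of_lt_one (by positivity) (Real.rpow_lt_one_of_one_lt_of_neg one_lt_two
    ha)

lemma hasSum_iterD {a : ℕ → ℝ} (he : ∀ j, ContDiff ℝ k (e j)) (hb : ∀ j, ∀ i ≤ k, ∀ x, ‖∇ i (e j) x‖
  ≤ a j) (ha : Summable a) (hf : ∀ x, HasSum (fun j => e j x) (f x)) : CkBound k (∑' j, a j) f ∧ ∀ i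
  ≤ k, ∀ x, HasSum (fun j => ∇ i (e j) x) (∇ i f x) := by
  have hfe : f = fun x => ∑' j, e j x := funext fun x => (hf x).tsum_eq.symm
  have hle : ∀ i : ℕ, ((i : ℕ∞) ≤ (k : ℕ∞)) → i ≤ k := fun i hi => by exact_mod_cast hi
  have h1 : ContDiff ℝ k f := by
    rw [hfe]
    exact contDiff_tsum (N := (k : ℕ∞)) (v := fun _ j => a j) (fun j => he j) (fun _ _ => ha) fun i
      j x hi => hb j i (hle i hi) x
  have h2 : ∀ i ≤ k, ∀ x, HasSum (fun j => ∇ i (e j) x) (∇ i f x) := by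
    intro i hi x
    have hs : Summable fun j => ∇ i (e j) x := Summable.of_norm_bounded ha fun j => hb j i hi x
    have h3 := iteratedFDeriv_tsum_apply (N := (k : ℕ∞)) (v := fun _ j => a j) (fun j => he j) (fun
      _ _ => ha) (fun i j x hi => hb j i (hle i hi) x) (k := i) (by exact_mod_cast hi) x
    rw [hfe, h3]
    exact hs.hasSum
  refine ⟨⟨h1, fun i hi x => ?_⟩, h2⟩
  rw [← (h2 i hi x).tsum_eq]
  exact tsum_of_norm_bounded ha.hasSum fun j => hb j i hi x

/-- `∑_j 2^{-jb}`. -/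
def dyadicSum (b : ℝ) : ℝ := ∑' j : ℕ, (2 ^ j : ℝ) ^ (-b)

lemma dyadicSum_nonneg (b : ℝ) : 0 ≤ dyadicSum b := tsum_nonneg fun _ => by positivity

lemma IsDyadic.nonneg (h : IsDyadic r N A e f) : 0 ≤ A := by
  have := (norm_nonneg _).trans (h.bound 0 0 (Nat.zero_le _) 0)
  simpa using this

lemma IsDyadic.hasSum_iterD (h : IsDyadic r N A e f) (hk : k ≤ N) (hkr : (k : ℝ) < r) : CkBound k (A
  * dyadicSum (r - k)) f ∧ ∀ i ≤ k, ∀ x, HasSum (fun j => ∇ i (e j) x) (∇ i f x) := by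
  have hA := h.nonneg
  have hs : Summable fun j : ℕ => A * (2 ^ j : ℝ) ^ (-(r - k)) := (summable_dyadic_rpow
    (by linarith)).mul_left A
  have := MoserSmoothing.hasSum_iterD (k := k) (a := fun j => A * (2 ^ j : ℝ) ^ (-(r - k))) (fun j
    => (h.smooth j).of_le (nat_le_infty _)) (fun j i hi x => ?_) hs h.hasSum
  · rwa [tsum_mul_left] at this
  · refine (h.bound j i (hi.trans hk) x).trans ?_
    gcongr A * ?_
    refine dyadic_rpow_le ?_ j
    have : (i : ℝ) ≤ k := by exact_mod_cast hi
    linarith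

lemma HasDyadic.ckBound (h : HasDyadic r N A f) (hk : k ≤ N) (hkr : (k : ℝ) < r) : CkBound k (A *
  dyadicSum (r - k)) f := by
  obtain ⟨e, he⟩ := h
  exact (he.hasSum_iterD hk hkr).1

lemma HasDyadic.nonneg (h : HasDyadic r N A f) : 0 ≤ A := by
  obtain ⟨e, he⟩ := h
  exact he.nonneg

lemma HasDyadic.mono {N' : ℕ} {A' : ℝ} (h : HasDyadic r N A f) (hN : N' ≤ N) (hA : A ≤ A') :
  HasDyadic r N' A' f := by
  obtain ⟨e, he⟩ := h
  exact ⟨e, he.smooth, fun j i hi x => (he.bound j i (hi.trans hN) x).trans (by gcongr), he.hasSum⟩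

lemma HasDyadic.add {A' : ℝ} (hf : HasDyadic r N A f) (hg : HasDyadic r N A' g) : HasDyadic r N (A +
  A') (fun x => f x + g x) := by
  obtain ⟨e, he⟩ := hf
  obtain ⟨d, hd⟩ := hg
  refine ⟨fun j x => e j x + d j x, fun j => (he.smooth j).add (hd.smooth j), fun j i hi x => ?_,
    fun x => (he.hasSum x).add (hd.hasSum x)⟩
  have h1 := fun_iteratedFDeriv_add_apply (x := x) (i := i) ((he.smooth j).contDiffAt.of_le
    (nat_le_infty _)) ((hd.smooth j).contDiffAt.of_le (nat_le_infty _))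
  rw [h1, add_mul]
  exact (norm_add_le _ _).trans (add_le_add (he.bound j i hi x) (hd.bound j i hi x))

lemma norm_iterD_zero_le (i : ℕ) (x : E) (hA : 0 ≤ A) : ‖∇ i (fun _ : E => (0 : ℂ)) x‖ ≤ A := by
  rwa [show ∇ i (fun _ : E => (0 : ℂ)) = 0 from iteratedFDeriv_fun_zero, Pi.zero_apply, norm_zero]

lemma hasDyadic_zero (r : ℝ) (N : ℕ) (hA : 0 ≤ A) : HasDyadic r N A (fun _ : E => (0 : ℂ)) :=
  ⟨fun _ _ => 0, fun _ => contDiff_const, fun _ i _ x => norm_iterD_zero_le i x (by positivity),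
    fun _ => hasSum_zero⟩

lemma HasDyadic.sum {ι : Type*} (s : Finset ι) {A : ι → ℝ} {f : ι → E → ℂ} (h : ∀ a ∈ s, HasDyadic r
  N (A a) (f a)) : HasDyadic r N (∑ a ∈ s, A a) (fun x => ∑ a ∈ s, f a x) := by
  classical
  induction s using Finset.induction_on with
  | empty => simpa using hasDyadic_zero (E := E) r N le_rfl
  | insert a s ha ih =>
    simp only [Finset.sum_insert ha]
    exact (h a (Finset.mem_insert_self a s)).add (ih fun b hb => h b (Finset.mem_insert_of_mem hb))

lemma norm_iterD_smul_le_of_bounds {𝕜' : Type*} [NormedField 𝕜'] [NormedAlgebra ℝ 𝕜'] {F : Type*}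
  [NormedAddCommGroup F] [NormedSpace ℝ F] [NormedSpace 𝕜' F] [IsScalarTower ℝ 𝕜' F] {a : E → 𝕜'} {f
  : E → F} {O : Set E} (hO : IsOpen O) {i : ℕ} {K : ℝ} (hx : x ∈ O) (ha : ContDiffOn ℝ i a O) (hf :
  ContDiffOn ℝ i f O) (hB : ∀ l ≤ i, ‖∇ l a x‖ ≤ B) (hK : ∀ l ≤ i, ‖∇ l f x‖ ≤ K) : ‖∇ i (fun y => a
  y • f y) x‖ ≤ 2 ^ i * B * K := by
  have hB0 : 0 ≤ B := (norm_nonneg _).trans (hB 0 (Nat.zero_le _))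
  have h := norm_iteratedFDerivWithin_smul_le (𝕜 := ℝ) ha hf hO.uniqueDiffOn hx (n := i) le_rfl
  simp only [iteratedFDerivWithin_of_isOpen _ hO hx] at h
  refine h.trans ?_
  calc _ ≤ ∑ l ∈ range (i + 1), (i.choose l : ℝ) * B * K := by
        refine sum_le_sum fun l hl => ?_
        have hl' := Nat.lt_succ_iff.1 (mem_range.1 hl)
        gcongr
        · exact hB l hl'
        · exact hK _ (Nat.sub_le _ _)
    _ = _ := by
        rw [← sum_mul, ← sum_mul]
        congr 2
        exact_mod_cast Nat.sum_range_choose i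

lemma IsDyadic.bound' (h : IsDyadic r N A e f) (j : ℕ) {l i : ℕ} (hl : l ≤ i) (hi : i ≤ N) (x : E) :
  ‖∇ l (e j) x‖ ≤ A * (2 ^ j : ℝ) ^ ((i : ℝ) - r) := by
  have hA := h.nonneg
  refine (h.bound j l (hl.trans hi) x).trans ?_
  gcongr A * ?_
  refine dyadic_rpow_le ?_ j
  have : (l : ℝ) ≤ i := by exact_mod_cast hl
  linarith

lemma HasDyadic.mul {a : E → ℂ} (hf : HasDyadic r N A f) (ha : ContDiff ℝ ∞ a) (hB : ∀ i ≤ N, ∀ x,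
  ‖∇ i a x‖ ≤ B) : HasDyadic r N (2 ^ N * B * A) (fun x => a x * f x) := by
  obtain ⟨e, he⟩ := hf
  have hA := he.nonneg
  have hB0 : 0 ≤ B := (norm_nonneg _).trans (hB 0 (Nat.zero_le _) 0)
  refine ⟨fun j x => a x * e j x, fun j => ha.mul (he.smooth j), fun j i hi x => ?_, fun x =>
    (he.hasSum x).mul_left _⟩
  have h := norm_iterD_smul_le_of_bounds (a := a) (f := e j) isOpen_univ (mem_univ x) (i := i)
    (ha.contDiffOn.of_le (nat_le_infty _)) ((he.smooth j).contDiffOn.of_le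
    (nat_le_infty _)) (fun l hl => hB l (hl.trans hi) x) (fun l hl => he.bound' j hl hi x)
  simp only [smul_eq_mul] at h
  refine h.trans ?_
  rw [← mul_assoc]
  gcongr
  norm_num

lemma HasDyadic.comp (hB1 : 1 ≤ B) {Φ : E → E} (hf : HasDyadic r N A f) (hΦ : ContDiff ℝ ∞ Φ) (hB :
  ∀ i ≤ N, ∀ x, ‖∇ i Φ x‖ ≤ B) : HasDyadic r N ((N.factorial : ℝ) * B ^ N * A) (fun x => f (Φ x)) :=
  by
  obtain ⟨e, he⟩ := hf
  have hA := he.nonneg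
  refine ⟨fun j x => e j (Φ x), fun j => (he.smooth j).comp hΦ, fun j i hi x => ?_, fun x =>
    he.hasSum (Φ x)⟩
  refine (norm_iteratedFDeriv_comp_le (g := e j) (f := Φ) (N := i) (n := i) (D := B) ((he.smooth
    j).of_le (nat_le_infty _)) (hΦ.of_le (nat_le_infty _)) le_rfl x (fun l hl =>
    he.bound' j hl hi (Φ x)) fun l hl1 hl => ?_).trans ?_
  · exact (hB l (hl.trans hi) x).trans (le_self_pow₀ hB1 (by omega))
  · have h1 : (i.factorial : ℝ) ≤ N.factorial := by exact_mod_cast Nat.factorial_le hi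
    have h2 : B ^ i ≤ B ^ N := pow_le_pow_right₀ hB1 hi
    calc _ = (i.factorial * B ^ i) * (A * (2 ^ j : ℝ) ^ ((i : ℝ) - r)) := by ring
      _ ≤ (N.factorial * B ^ N) * (A * (2 ^ j : ℝ) ^ ((i : ℝ) - r)) := by gcongr
      _ = _ := by ring

lemma CkBound.mul {a : E → ℂ} (ha : CkBound k B a) (hf : CkBound k A f) : CkBound k (2 ^ k * B * A)
  (fun x => a x * f x) := by
  have hB0 : 0 ≤ B := ha.nonneg
  have hA0 : 0 ≤ A := hf.nonneg
  refine ⟨ha.1.mul hf.1, fun i hi x => ?_⟩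
  have h := norm_iterD_smul_le_of_bounds (a := a) (f := f) isOpen_univ (mem_univ x) (i := i)
    (ha.1.contDiffOn.of_le (by exact_mod_cast hi)) (hf.1.contDiffOn.of_le (by exact_mod_cast hi))
    (fun l hl => ha.2 l (hl.trans hi) x) (fun l hl => hf.2 l (hl.trans hi) x)
  simp only [smul_eq_mul] at h
  refine h.trans ?_
  gcongr
  norm_num

lemma CkBound.sum {ι : Type*} (s : Finset ι) {A : ι → ℝ} {f : ι → E → ℂ} (h : ∀ a ∈ s, CkBound k (A
  a) (f a)) : CkBound k (∑ a ∈ s, A a) (fun x => ∑ a ∈ s, f a x) := by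
  refine ⟨ContDiff.sum fun a ha => (h a ha).1, fun i hi x => ?_⟩
  rw [iteratedFDeriv_fun_sum_apply fun a ha => (h a ha).1.contDiffAt.of_le (by exact_mod_cast hi)]
  exact norm_sum_le_of_le _ fun a ha => (h a ha).2 i hi x

lemma CkBound.mono {k' : ℕ} {A' : ℝ} (h : CkBound k A f) (hk : k' ≤ k) (hA : A ≤ A') : CkBound k' A'
  f := ⟨h.1.of_le (by exact_mod_cast hk), fun i hi x => (h.2 i (hi.trans hk) x).trans hA⟩

lemma norm_second_difference_le {G : Type} [NormedAddCommGroup G] [NormedSpace ℝ G] {F : E → G} (hF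
  : ContDiff ℝ 2 F) (hB : ∀ x, ‖∇ 2 F x‖ ≤ B) (x h : E) : ‖F x + F (x + (2 : ℝ) • h) - (2 : ℝ) • F
  (x + h)‖ ≤ B * ‖h‖ ^ 2 := by
  have hd : Differentiable ℝ F := hF.differentiable two_ne_zero
  have hd1 : Differentiable ℝ (fderiv ℝ F) := (hF.fderiv_right (m := 1)
    (by norm_num)).differentiable one_ne_zero
  have h1 : ∀ z, ‖fderiv ℝ F (z + h) - fderiv ℝ F z‖ ≤ B * ‖h‖ := fun z => by
    have := (convex_univ (𝕜 := ℝ) (E := E)).norm_image_sub_le_of_norm_fderiv_le (C := B) (fun y _ =>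
      hd1 y) (fun y _ => ?_) (mem_univ z) (mem_univ (z + h))
    · simpa using this
    · rw [← norm_iteratedFDeriv_zero (𝕜 := ℝ) (f := fderiv ℝ (fderiv ℝ F)),
        norm_iteratedFDeriv_fderiv, norm_iteratedFDeriv_fderiv]
      exact hB y
  have hd2 : ∀ z, HasFDerivAt (fun z => F (z + h) - F z) (fderiv ℝ F (z + h) - fderiv ℝ F z) z :=
    fun z => ((hasFDerivAt_comp_add_right h).2 (hd _).hasFDerivAt).sub (hd z).hasFDerivAt
  have h2 := (convex_univ (𝕜 := ℝ) (E := E)).norm_image_sub_le_of_norm_hasFDerivWithin_le (f := fun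
    z => F (z + h) - F z) (C := B * ‖h‖) (fun z _ => (hd2 z).hasFDerivWithinAt) (fun z _ => h1 z)
    (mem_univ x) (mem_univ (x + h))
  have e : F x + F (x + (2 : ℝ) • h) - (2 : ℝ) • F (x + h) = (F (x + h + h) - F (x + h)) - (F (x +
    h) - F x) := by
    rw [two_smul, two_smul, add_assoc]; abel
  rw [e]
  refine h2.trans (le_of_eq ?_)
  simp; ring

lemma norm_iterD_one_eq {G : Type} [NormedAddCommGroup G] [NormedSpace ℝ G] (F : E → G) (x : E) :
  ‖fderiv ℝ F x‖ = ‖∇ 1 F x‖ := by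
  rw [← norm_iteratedFDeriv_fderiv, norm_iteratedFDeriv_zero]

lemma norm_sub_le_of_iterD {G : Type} [NormedAddCommGroup G] [NormedSpace ℝ G] {F : E → G} (hF :
  ContDiff ℝ 1 F) (hB : ∀ x, ‖∇ 1 F x‖ ≤ B) (x y : E) : ‖F x - F y‖ ≤ B * ‖x - y‖ := (convex_univ (𝕜
  := ℝ) (E := E)).norm_image_sub_le_of_norm_fderiv_le (fun z _ => hF.differentiable one_ne_zero z)
  (fun z _ => (norm_iterD_one_eq F z).trans_le (hB z)) (mem_univ y) (mem_univ x)

lemma rpow_scale {h l β δ : ℝ} (hh : 0 < h) (hl : 0 < l) : h ^ δ * l ^ (δ - β) = h ^ β * (h * l) ^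
  (δ - β) := by
  rw [mul_rpow hh.le hl.le, ← mul_assoc, ← rpow_add hh]
  congr 2; ring

lemma exists_norm_le_of_dyadic {β δ : ℝ} (hβ : 0 < β) (hδ : β < δ) : ∃ C : ℝ, 0 < C ∧ ∀ {G : Type}
  [NormedAddCommGroup G] {A η : ℝ} {Δ : ℕ → G} {S : G}, 0 ≤ A → 0 < η → HasSum Δ S → (∀ j, ‖Δ j‖ ≤ A
  * (2 ^ j : ℝ) ^ (-β)) → (∀ j, ‖Δ j‖ ≤ A * (2 ^ j : ℝ) ^ (δ - β) * η ^ δ) → ‖S‖ ≤ C * A * η ^ β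
  := by
  obtain ⟨C, hC, H⟩ := exists_dyadic_sum_le (sub_pos.2 hδ) hβ
  refine ⟨C, hC, fun {G} _ A η Δ S hA hη hS h1 h2 => ?_⟩
  have e := fun (j : ℕ) d => rpow_scale (β := β) (δ := d) hη (pow_pos two_pos j)
  obtain ⟨h3, h4⟩ := H η hη (A * η ^ β) (by positivity) (fun j => ‖Δ j‖) (fun j => norm_nonneg _)
    (fun j => (h2 j).trans_eq (by
      rw [mul_assoc, mul_assoc, mul_comm _ (η ^ δ), e j δ]))
    fun j => (h1 j).trans_eq (by
      have := e j 0
      rw [rpow_zero, one_mul, zero_sub] at this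
      rw [this, mul_assoc])
  rw [← hS.tsum_eq]
  exact (norm_tsum_le_tsum_norm h3).trans (h4.trans_eq (by ring))

lemma zygmundNorm_le_of_hasDyadic (hr : 0 < r) (hN : zk r + 2 ≤ N) : ∃ C : ℝ, 0 < C ∧ ∀ (A : ℝ) (f :
  E → ℂ), HasDyadic r N A f → zygmundNorm r univ f ≤ ofReal (C * A) := by
  set k := zk r with hk
  have hkr : (k : ℝ) < r := zk_lt hr
  have hkr1 : r ≤ k + 1 := le_zk_add_one r
  obtain ⟨C₀, hC₀, H⟩ := exists_norm_le_of_dyadic (β := r - k) (δ := 2) (by linarith) (by linarith)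
  have hd0 := dyadicSum_nonneg (r - k)
  refine ⟨(k + 2) * (dyadicSum (r - k) + 4 * C₀), by positivity, fun A f ⟨e, he⟩ => ?_⟩
  have hA := he.nonneg
  obtain ⟨hck, hder⟩ := he.hasSum_iterD (k := k) (by omega) hkr
  have hb : ∀ j y, ‖∇ k (e j) y‖ ≤ A * (2 ^ j : ℝ) ^ (-(r - k)) := fun j y => by
    rw [neg_sub]; exact he.bound j k (by omega) y
  rw [mul_assoc]
  refine zygmundNorm_le (by positivity) hck.1.contDiffOn (fun i hi x _ => (hck.2 i hi x).trans
    (by nlinarith)) fun x h hh _ _ _ => (H (A := 4 * A) (by positivity) (norm_pos_iff.2 hh) (((hder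
    k le_rfl x).add (hder k le_rfl _)).sub ((hder k le_rfl _).const_smul (2 : ℝ))) (fun j => ?_) fun
    j => ?_).trans ?_
  · refine (norm_sub_le _ _).trans ?_
    rw [norm_smul, Real.norm_ofNat]
    linarith [norm_add_le (∇ k (e j) x) (∇ k (e j) (x + (2 : ℝ) • h)), hb j x, hb j (x + (2 : ℝ) •
      h), hb j (x + h)]
  · refine (norm_second_difference_le (((he.smooth j).of_le (m := ((2 + k : ℕ) : ℕ∞ω)) (nat_le_infty
      _)).iteratedFDeriv_right (by push_cast; rfl)) (B := A * (2 ^ j : ℝ) ^ (2 - (r - k))) (fun y =>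
      ?_) x h).trans ?_
    · rw [← norm_iterD_add]
      convert he.bound j (k + 2) hN y using 3; push_cast; ring
    · rw [Real.rpow_two]
      gcongr
      linarith
  · have : 0 ≤ dyadicSum (r - k) * A * ‖h‖ ^ (r - k) := by positivity
    nlinarith

lemma holderNorm_le_of_hasDyadic (hr' : (⌊r⌋₊ : ℝ) < r) (hN : ⌊r⌋₊ + 1 ≤ N) : ∃ C : ℝ, 0 < C ∧ ∀ (A
  : ℝ) (f : E → ℂ), HasDyadic r N A f → holderNorm r univ f ≤ ofReal (C * A) := by
  set k := ⌊r⌋₊ with hk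
  have hkr1 : r < k + 1 := Nat.lt_floor_add_one r
  obtain ⟨C₀, hC₀, H⟩ := exists_norm_le_of_dyadic (β := r - k) (δ := 1) (by linarith) (by linarith)
  have hd0 := dyadicSum_nonneg (r - k)
  refine ⟨(k + 2) * (dyadicSum (r - k) + 2 * C₀), by positivity, fun A f ⟨e, he⟩ => ?_⟩
  have hA := he.nonneg
  obtain ⟨hck, hder⟩ := he.hasSum_iterD (k := k) (by omega) hr'
  have hb : ∀ j y, ‖∇ k (e j) y‖ ≤ A * (2 ^ j : ℝ) ^ (-(r - k)) := fun j y => by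
    rw [neg_sub]; exact he.bound j k (by omega) y
  rw [mul_assoc]
  refine holderNorm_le (by positivity) hck.1.contDiffOn (fun i hi =>
    Continuous.contUpToBoundary (hck.1.continuous_iteratedFDeriv (by exact_mod_cast hi)))
    (fun i hi x _ => (hck.2 i hi x).trans (by nlinarith)) fun x y hxy _ _ => (H (A := 2 * A)
    (by positivity) (norm_pos_iff.2 (sub_ne_zero.2 hxy)) ((hder k le_rfl x).sub (hder k le_rfl _))
    (fun j => ?_) fun j => ?_).trans ?_
  · exact (norm_sub_le _ _).trans (by linarith [hb j x, hb j y])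
  · refine (norm_sub_le_of_iterD ((he.smooth j).iteratedFDeriv_right (nat_le_infty (1 + k))) (B := A
      * (2 ^ j : ℝ) ^ (1 - (r - k))) (fun z => ?_) x y).trans ?_
    · rw [← norm_iterD_add]
      convert he.bound j (k + 1) hN z using 3; push_cast; ring
    · rw [Real.rpow_one]
      gcongr
      linarith
  · have : 0 ≤ dyadicSum (r - k) * A * ‖x - y‖ ^ (r - k) := by positivity
    nlinarith

lemma holderNorm_natCast_le (h : CkBound k A f) (D : Set E) : holderNorm k D f ≤ ofReal ((k + 2) *
  (2 * A)) := by
  have hA : 0 ≤ A := h.nonneg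
  have hfl : ⌊(k : ℝ)⌋₊ = k := Nat.floor_natCast k
  have := holderNorm_le (r := k) (D := D) (u := f) (A := 2 * A) (by positivity)
    (by rw [hfl]; exact h.1.contDiffOn) (fun i hi => Continuous.contUpToBoundary
    (h.1.continuous_iteratedFDeriv (by
      rw [hfl] at hi; exact_mod_cast hi))) (fun i hi x _ =>
        by rw [hfl] at hi; linarith [h.2 i hi x]) (fun x y _ _ _ => by
      rw [hfl, sub_self, rpow_zero, mul_one]
      refine (norm_sub_le _ _).trans ?_
      linarith [h.2 k le_rfl x, h.2 k le_rfl y])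
  rwa [hfl] at this

lemma zk_natCast_add {β : ℝ} (h0 : 0 < β) (h1 : β ≤ 1) : zk (k + β) = k := by
  have : ⌈(k : ℝ) + β⌉₊ = k + 1 := by
    rw [Nat.ceil_eq_iff (by omega)]; push_cast
    constructor <;> simp <;> linarith
  rw [zk, this, Nat.add_sub_cancel]

lemma zk_eq_floor (hr : (⌊r⌋₊ : ℝ) < r) : zk r = ⌊r⌋₊ := by
  have h := zk_natCast_add (k := ⌊r⌋₊) (β := r - ⌊r⌋₊) (by linarith)
    (by linarith [Nat.lt_floor_add_one r])
  rwa [add_sub_cancel] at h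

end Dyadic

section Operators

variable {E : Type} [NormedAddCommGroup E] [InnerProductSpace ℝ E] [FiniteDimensional ℝ E]
  [MeasurableSpace E] [BorelSpace E]
variable {t r s A B c : ℝ} {N k m : ℕ} {f g u : E → ℂ} {e : ℕ → E → ℂ} {x p : E} {G O D : Set E}
  {χ : E → ℝ}

/-! ## Smoothing operators on the whole space -/

/-- The average of order `m` at the scale `t`. -/
def moserAvg (m : ℕ) (p : E) (t : ℝ) (f : E → ℂ) : E → ℂ := cavg (seeley m) (m + 1) p t f

/-- A constant for the bounds of `moserAvg m p` on derivatives of orders at most `N`. -/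
def moserConst (m N : ℕ) (p : E) : ℝ := 1 + ∑ q ∈ range (N + 1), absMoment (seeley m) (m + 1) 0 *
  bumpConst E q + ∑ M ∈ range (m + 1), (1 + absMoment (seeley m) (m + 1) M) * (‖p‖ + 1) ^ M

lemma moserConst_aux (m : ℕ) (p : E) : (∀ q, 0 ≤ absMoment (seeley m) (m + 1) 0 * bumpConst E q) ∧
  (∀ M, 0 ≤ (1 + absMoment (seeley m) (m + 1) M) * (‖p‖ + 1) ^ M) :=
  ⟨fun q => mul_nonneg (absMoment_nonneg _ _ _) (bumpConst_nonneg q), fun M => by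
    have := absMoment_nonneg (seeley m) (m + 1) M; positivity⟩

lemma one_le_moserConst (m N : ℕ) (p : E) : 1 ≤ moserConst m N p := by
  obtain ⟨h1, h2⟩ := moserConst_aux m p
  rw [moserConst, add_assoc]
  exact le_add_of_nonneg_right (add_nonneg (sum_nonneg fun q _ => h1 q) (sum_nonneg fun q _ => h2 q))

lemma moserConst_ge_bump {q : ℕ} (hq : q ≤ N) (p : E) : absMoment (seeley m) (m + 1) 0 * bumpConst E
  q ≤ moserConst m N p := by
  obtain ⟨h1, h2⟩ := moserConst_aux m p
  have h3 := single_le_sum (fun q _ => h1 q) (mem_range.2 (Nat.lt_succ_of_le hq))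
  have h4 := sum_nonneg fun M (_ : M ∈ range (m + 1)) => h2 M
  rw [moserConst]; linarith

lemma moserConst_ge_moment {M : ℕ} (hM : M ≤ m) (p : E) : (1 + absMoment (seeley m) (m + 1) M) *
  (‖p‖ + 1) ^ M ≤ moserConst m N p := by
  obtain ⟨h1, h2⟩ := moserConst_aux m p
  have h3 := single_le_sum (fun M _ => h2 M) (mem_range.2 (Nat.lt_succ_of_le hM))
  have h4 := sum_nonneg fun q (_ : q ∈ range (N + 1)) => h1 q
  rw [moserConst]; linarith

lemma contDiff_moserAvg (m : ℕ) (p : E) (ht : 0 < t) (hf : Continuous f) (hB : ∀ x, ‖f x‖ ≤ B) :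
  ContDiff ℝ ∞ (moserAvg m p t f) := contDiff_cavg _ _ p ht hf.aestronglyMeasurable hB

lemma norm_iterD_moserAvg_le (ht : 0 < t) {l q : ℕ} (hq : q ≤ N) (hf : ContDiff ℝ l f) {B₀ : ℝ} (hB₀
  : ∀ x, ‖f x‖ ≤ B₀) (hB : ∀ x, ‖∇ l f x‖ ≤ B) (x : E) : ‖∇ (l + q) (moserAvg m p t f) x‖ ≤
  moserConst m N p * B * t⁻¹ ^ q := by
  have hB0 : 0 ≤ B := (norm_nonneg _).trans (hB 0)
  refine (norm_iterD_cavg_of_contDiffOn_le ht l q isOpen_univ (fun k _ =>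
    contDiff_avg p (by positivity) hf.continuous.aestronglyMeasurable hB₀) hf.contDiffOn hB0
    (fun z _ => hB z) fun _ _ _ _ => mem_univ _).trans ?_
  rw [← mul_assoc, ← mul_assoc]
  gcongr
  exact moserConst_ge_bump hq p

lemma norm_iterD_sub_moserAvg_le (ht : 0 < t) {q M : ℕ} (hM : M ≤ m) (hf : ContDiff ℝ (q + M : ℕ) f)
  (hB : ∀ x, ‖∇ (q + M) f x‖ ≤ B) (x : E) : ‖∇ q (fun x => f x - moserAvg m p t f x) x‖ ≤ moserConst
  m N p * B * t ^ M := by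
  have hB0 : 0 ≤ B := (norm_nonneg _).trans (hB 0)
  have hfq : ContDiff ℝ q f := hf.of_le (by exact_mod_cast Nat.le_add_right _ _)
  have hs : ∀ k < m + 1, Sees p (2 ^ k * t) univ x := fun _ _ _ _ => mem_univ _
  have hav : ContDiffAt ℝ q (moserAvg m p t f) x := ContDiffAt.sum fun k hk =>
    (contDiffAt_avg_of_sees isOpen_univ q hfq.contDiffOn (hs k (mem_range.1 hk))).const_smul _
  have h1 := fun_iteratedFDeriv_sub_apply (i := q) (x := x) hfq.contDiffAt hav
  rw [h1, moserAvg, iterD_cavg q isOpen_univ hfq.contDiffOn hs]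
  refine (norm_sub_cavg_le_of_moments ht (M := M) (hf.iteratedFDeriv_right
    (by push_cast; rw [add_comm])) (B := B) (fun z => ?_) x (seeley_moment_zero m) fun j hj hj0 =>
    seeley_moment hj0 (by omega)).trans ?_
  · rw [← norm_iterD_add]; exact hB z
  · rw [mul_pow]
    calc _ = ((1 + absMoment (seeley m) (m + 1) M) * (‖p‖ + 1) ^ M) * B * t ^ M := by ring
      _ ≤ _ := by gcongr; exact moserConst_ge_moment hM p

lemma hasSum_avg {a : ℕ → ℝ} (he : ∀ j, Continuous (e j)) (hb : ∀ j x, ‖e j x‖ ≤ a j) (ha : Summable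
  a) (hf : ∀ x, HasSum (fun j => e j x) (f x)) (x : E) : HasSum (fun j => avg p t (e j) x) (avg p t
  f x) := by
  have hi : ∀ j, Integrable (fun y => stdBump E y • e j (x + t • (p + y))) := fun j =>
    integrable_bump_smul (O := univ) isOpen_univ (fun _ _ => mem_univ _) (he j).continuousOn
  have h := hasSum_integral_of_summable_integral_norm (μ := volume) hi (Summable.of_nonneg_of_le
    (fun j => integral_nonneg fun _ => norm_nonneg _) (fun j => ?_) ha)
  · have h1 : avg p t f x = ∫ y, ∑' j, stdBump E y • e j (x + t • (p + y)) := by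
      refine integral_congr_ae (Eventually.of_forall fun y => ?_)
      simp only
      rw [((hf (x + t • (p + y))).const_smul (stdBump E y)).tsum_eq]
    rw [h1]
    exact h
  · calc ∫ y, ‖stdBump E y • e j (x + t • (p + y))‖ ≤ ∫ y, stdBump E y * a j := by
          refine integral_mono (hi j).norm (integrable_stdBump.mul_const _) fun y => ?_
          simp only [norm_smul, norm_of_nonneg (stdBump_nonneg y)]
          exact mul_le_mul_of_nonneg_left (hb _ _) (stdBump_nonneg y)
      _ = a j := by rw [integral_mul_const, integral_stdBump, one_mul]

lemma hasSum_moserAvg {a : ℕ → ℝ} (he : ∀ j, Continuous (e j)) (hb : ∀ j x, ‖e j x‖ ≤ a j) (ha :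
  Summable a) (hf : ∀ x, HasSum (fun j => e j x) (f x)) (x : E) : HasSum (fun j => moserAvg m p t (e
  j) x) (moserAvg m p t f x) := by
  simp only [moserAvg, cavg]
  exact hasSum_sum fun k _ => (hasSum_avg he hb ha hf x).const_smul _

lemma IsDyadic.norm_le (h : IsDyadic r N A e f) (j : ℕ) (x : E) : ‖e j x‖ ≤ A * (2 ^ j : ℝ) ^ (-r)
  := by
  have := h.bound j 0 (Nat.zero_le _) x
  simpa [norm_iteratedFDeriv_zero] using this

lemma IsDyadic.summable (hr : 0 < r) (A : ℝ) : Summable fun j : ℕ => A * (2 ^ j : ℝ) ^ (-r) :=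
  (summable_dyadic_rpow (by linarith)).mul_left A

lemma dyadicSum_pos {b : ℝ} (hb : 0 < b) : 1 ≤ dyadicSum b := by
  have := (summable_dyadic_rpow (neg_lt_zero.2 hb)).le_tsum 0 fun _ _ => by positivity
  simpa [dyadicSum] using this

lemma inv_pow_le_of_lt (ht : 0 < t) {i j : ℕ} (h : t⁻¹ ≤ 2 ^ (j + 1)) (hi : i ≤ N) : t⁻¹ ^ i ≤ 2 ^ N *
  (2 ^ j : ℝ) ^ (i : ℝ) := by
  rw [rpow_natCast]
  calc t⁻¹ ^ i ≤ (2 ^ (j + 1)) ^ i := by gcongr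
    _ = 2 ^ i * (2 ^ j) ^ i := by rw [pow_succ, mul_pow, mul_comm]
    _ ≤ _ := by gcongr; norm_num

lemma exists_isDyadic_moserAvg (m N : ℕ) (p : E) (hs : 0 < s) : ∃ K : ℝ, 0 < K ∧ ∀ t : ℝ, 0 < t → t
  ≤ 1 → ∃ J : ℕ, (2 : ℝ) ^ J ≤ t⁻¹ ∧ ∀ (A : ℝ) (e : ℕ → E → ℂ) (f : E → ℂ), IsDyadic s N A e f → ∃
  d, IsDyadic s N (K * A) d (moserAvg m p t f) ∧ ∀ j, J < j → d j = fun _ => 0 := by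
  have hK1 := one_le_moserConst m N p
  have hd1 := dyadicSum_pos hs
  refine ⟨moserConst m N p * dyadicSum s * 2 ^ N, by positivity, fun t ht ht1 => ?_⟩
  obtain ⟨J, hJ1, hJ2⟩ := exists_nat_pow_near (one_le_inv₀ ht |>.2 ht1) one_lt_two
  refine ⟨J, hJ1, fun A e f he => ?_⟩
  have hA := he.nonneg
  have hec : ∀ j, Continuous (e j) := fun j => (he.smooth j).continuous
  have hKA : moserConst m N p * A ≤ moserConst m N p * dyadicSum s * 2 ^ N * A := by
    have h2 := one_le_two_pow N
    have : 1 ≤ dyadicSum s * 2 ^ N := by nlinarith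
    have h3 : 0 ≤ moserConst m N p * A := by positivity
    nlinarith
  set g : E → ℂ := fun x => f x - ∑ j ∈ range J, e j x with hg
  have hgs : ∀ x, HasSum (fun j => e (j + J) x) (g x) := fun x =>
    (hasSum_nat_add_iff' (f := fun j => e j x) J).2 (he.hasSum x)
  have hck := he.hasSum_iterD (k := 0) (Nat.zero_le _) (by simpa using hs)
  have hfc : Continuous f := hck.1.1.continuous
  have hgc : Continuous g := hfc.sub (continuous_finsetSum _ fun j _ => hec j)
  have hpow : ∀ j : ℕ, (2 ^ (j + J) : ℝ) ^ (-s) = (2 ^ j : ℝ) ^ (-s) * (2 ^ J : ℝ) ^ (-s) := fun j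
    => by rw [pow_add, mul_rpow (by positivity) (by positivity)]
  have hgb : ∀ x, ‖g x‖ ≤ dyadicSum s * (A * (2 ^ J : ℝ) ^ (-s)) := by
    intro x
    rw [← (hgs x).tsum_eq]
    refine tsum_of_norm_bounded ((summable_dyadic_rpow (neg_lt_zero.2 hs)).hasSum.mul_right _) fun j
      => ?_
    refine (he.norm_le _ x).trans (le_of_eq ?_)
    rw [hpow]; ring
  refine ⟨fun j => if j < J then moserAvg m p t (e j) else if j = J then moserAvg m p t g else fun _
    => 0, ⟨fun j => ?_, fun j i hi x => ?_, fun x => ?_⟩, fun j hj => ?_⟩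
  · split_ifs
    · exact contDiff_moserAvg m p ht (hec j) (he.norm_le j)
    · exact contDiff_moserAvg m p ht hgc hgb
    · exact contDiff_const
  · split_ifs with h1 h2
    · have := norm_iterD_moserAvg_le (m := m) (p := p) ht (l := i) (Nat.zero_le N) ((he.smooth
        j).of_le (nat_le_infty _)) (he.norm_le j) (he.bound j i hi) x
      rw [add_zero, pow_zero, mul_one] at this
      refine this.trans ?_
      rw [← mul_assoc]
      gcongr
    · subst h2
      have := norm_iterD_moserAvg_le (m := m) (p := p) ht (l := 0) hi (contDiff_zero.2 hgc) hgb (fun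
        x => by rw [norm_iteratedFDeriv_zero]; exact hgb x) x
      rw [zero_add] at this
      refine this.trans ?_
      have h3 := inv_pow_le_of_lt ht hJ2.le hi
      have h4 : (2 ^ j : ℝ) ^ ((i : ℝ) - s) = (2 ^ j : ℝ) ^ (-s) * (2 ^ j : ℝ) ^ (i : ℝ) := by
        rw [← rpow_add (by positivity)]; congr 1; ring
      rw [h4]
      calc _ ≤ moserConst m N p * (dyadicSum s * (A * (2 ^ j : ℝ) ^ (-s))) * (2 ^ N * (2 ^ j : ℝ) ^
            (i : ℝ)) := by gcongr
        _ = _ := by ring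
    · exact norm_iterD_zero_le i x (by positivity)
  · have hb := hasSum_moserAvg (m := m) (p := p) (t := t) hec he.norm_le (IsDyadic.summable hs A)
      he.hasSum x
    have hbg := hasSum_moserAvg (m := m) (p := p) (t := t) (fun j => hec (j + J)) (fun j =>
      he.norm_le (j + J)) ((summable_nat_add_iff (f := fun j : ℕ => A * (2 ^ j : ℝ) ^ (-s)) J).2
      (IsDyadic.summable hs A)) hgs x
    have h5 : moserAvg m p t f x = ∑ j ∈ range J, moserAvg m p t (e j) x + moserAvg m p t g x := by
      have h6 := (hasSum_nat_add_iff' (f := fun j => moserAvg m p t (e j) x) J).2 hb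
      rw [hbg.unique h6]; ring
    rw [h5]
    have h7 := hasSum_sum_of_ne_finset_zero (L := .unconditional ℕ) (s := range (J + 1)) (f := fun j
      =>
      (if j < J then moserAvg m p t (e j) else if j = J then moserAvg m p t g else fun _ => 0) x)
      (fun j hj => by
        have : J < j := by simpa [Nat.lt_succ_iff] using hj
        rw [if_neg (by omega), if_neg (by omega)])
    convert h7 using 1
    rw [sum_range_succ]
    congr 1
    · exact sum_congr rfl fun j hj => by rw [if_pos (mem_range.1 hj)]
    · simp
  · simp only [if_neg (not_lt.2 hj.le), if_neg hj.ne']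

lemma rpow_neg_exp {a : ℝ} (ht : 0 < t) : t⁻¹ ^ a = t ^ (-a) := by
  rw [Real.inv_rpow ht.le, Real.rpow_neg ht.le]

lemma HasDyadic.exists_moserAvg (m N : ℕ) (p : E) (hs : 0 < s) (hsr : s ≤ r) : ∃ K : ℝ, 0 < K ∧ ∀ t
  : ℝ, 0 < t → t ≤ 1 → ∀ (A : ℝ) (f : E → ℂ), HasDyadic s N A f → HasDyadic r N (K * t ^ (s - r) *
  A) (moserAvg m p t f) := by
  obtain ⟨K, hK, h⟩ := exists_isDyadic_moserAvg m N p hs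
  refine ⟨K, hK, fun t ht ht1 A f ⟨e, he⟩ => ?_⟩
  obtain ⟨J, hJ, h1⟩ := h t ht ht1
  obtain ⟨d, hd, hd0⟩ := h1 A e f he
  have hA := he.nonneg
  refine ⟨d, hd.smooth, fun j i hi x => ?_, hd.hasSum⟩
  rcases le_or_gt j J with hj | hj
  · refine (hd.bound j i hi x).trans ?_
    have h2 : (2 ^ j : ℝ) ^ (r - s) ≤ t ^ (s - r) := by
      rw [← neg_sub r s, ← rpow_neg_exp ht]
      refine rpow_le_rpow (by positivity) (le_trans ?_ hJ) (by linarith)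
      exact pow_le_pow_right₀ one_le_two hj
    have h3 : (2 ^ j : ℝ) ^ ((i : ℝ) - s) = (2 ^ j : ℝ) ^ (r - s) * (2 ^ j : ℝ) ^ ((i : ℝ) - r) :=
      by
      rw [← rpow_add (by positivity)]; congr 1; ring
    rw [h3]
    calc _ = K * (2 ^ j : ℝ) ^ (r - s) * A * (2 ^ j : ℝ) ^ ((i : ℝ) - r) := by ring
      _ ≤ _ := by gcongr
  · rw [hd0 j hj]
    exact norm_iterD_zero_le i x (by positivity)

lemma CkBound.exists_moserAvg_of_hasDyadic (m N : ℕ) (p : E) (hkN : k ≤ N) (hs : 0 < s) (hsk : s <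
  k) : ∃ K : ℝ, 0 < K ∧ ∀ t : ℝ, 0 < t → t ≤ 1 → ∀ (A : ℝ) (f : E → ℂ), HasDyadic s N A f → CkBound
  k (K * t ^ (s - k) * A) (moserAvg m p t f) := by
  obtain ⟨K, hK, h⟩ := exists_isDyadic_moserAvg m N p hs
  have hd1 := dyadicSum_pos (sub_pos.2 hsk)
  refine ⟨K * dyadicSum (k - s), by positivity, fun t ht ht1 A f ⟨e, he⟩ => ?_⟩
  obtain ⟨J, hJ, h1⟩ := h t ht ht1
  obtain ⟨d, hd, hd0⟩ := h1 A e f he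
  have hA := he.nonneg
  have hfs : moserAvg m p t f = fun x => ∑ j ∈ range (J + 1), d j x := by
    ext x
    refine (hd.hasSum x).unique (hasSum_sum_of_ne_finset_zero fun j hj => ?_)
    rw [hd0 j (by simpa [Nat.lt_succ_iff] using hj)]
  rw [hfs]
  have hsum := CkBound.sum (range (J + 1)) (k := k) (A := fun j => K * A * (2 ^ j : ℝ) ^ ((k : ℝ) -
    s)) (f := d) fun j _ =>
    ⟨(hd.smooth j).of_le (nat_le_infty _), fun i hi x => hd.bound' j hi hkN x⟩
  refine hsum.mono le_rfl ?_
  rw [← mul_sum, ← Finset.sum_range_reflect]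
  have h2 : ∀ j ∈ range (J + 1), (2 ^ (J + 1 - 1 - j) : ℝ) ^ ((k : ℝ) - s) = (2 ^ J : ℝ) ^ ((k : ℝ)
    - s) * (2 ^ j : ℝ) ^ (-((k : ℝ) - s)) := by
    intro j hj
    have hj' : j ≤ J := Nat.lt_succ_iff.1 (mem_range.1 hj)
    rw [Real.rpow_neg (by positivity), ← div_eq_mul_inv, ← Real.div_rpow (by positivity)
      (by positivity), Nat.add_sub_cancel, pow_sub₀ _ two_ne_zero hj', div_eq_mul_inv]
  rw [sum_congr rfl h2, ← mul_sum]
  have h3 : ∑ j ∈ range (J + 1), (2 ^ j : ℝ) ^ (-((k : ℝ) - s)) ≤ dyadicSum (k - s) :=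
    (summable_dyadic_rpow (by linarith)).sum_le_tsum _ fun _ _ => by positivity
  have h4 : (2 ^ J : ℝ) ^ ((k : ℝ) - s) ≤ t ^ (s - k) := by
    rw [← neg_sub (k : ℝ) s, ← rpow_neg_exp ht]
    exact rpow_le_rpow (by positivity) hJ (by linarith)
  calc _ ≤ K * A * (t ^ (s - k) * dyadicSum (k - s)) := by gcongr
    _ = _ := by ring

lemma norm_iterD_sub_moserAvg_dyadic {i : ℕ} (he : IsDyadic s (N + m) A e f) (hi : i ≤ N) (ht : 0 <
  t) {σ : ℝ} (h0 : 0 ≤ σ) (hσ : σ ≤ m) (j : ℕ) (x : E) : ‖∇ i (fun x => e j x - moserAvg m p t (e j)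
  x) x‖ ≤ moserConst m N p * A * (2 ^ j : ℝ) ^ ((i : ℝ) - s) * (t * 2 ^ j) ^ σ := by
  have hA := he.nonneg
  have hK1 := one_le_moserConst m N p
  have hM : ∀ M ≤ m, ‖∇ i (fun x => e j x - moserAvg m p t (e j) x) x‖ ≤ moserConst m N p * A * (2 ^
    j : ℝ) ^ ((i : ℝ) - s) * (t * 2 ^ j) ^ M := by
    intro M hM
    refine (norm_iterD_sub_moserAvg_le (N := N) ht hM ((he.smooth j).of_le
      (nat_le_infty _)) (he.bound j (i + M) (by omega)) x).trans (le_of_eq ?_)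
    have : (2 ^ j : ℝ) ^ (((i + M : ℕ) : ℝ) - s) = (2 ^ j : ℝ) ^ ((i : ℝ) - s) * (2 ^ j) ^ M := by
      rw [← rpow_natCast _ M, ← rpow_add (by positivity)]; congr 1; push_cast; ring
    rw [this, mul_pow]; ring
  rcases le_total 1 (t * 2 ^ j) with h1 | h1
  · refine (hM 0 (Nat.zero_le _)).trans ?_
    gcongr
    rw [pow_zero]; exact Real.one_le_rpow h1 h0
  · refine (hM m le_rfl).trans ?_
    gcongr
    rw [← rpow_natCast]
    exact Real.rpow_le_rpow_of_exponent_ge (by positivity) h1 hσ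

lemma HasDyadic.sub_moserAvg (hs : 0 < s) (hrs : r ≤ s) (hsr : s ≤ r + m) (ht : 0 < t) (h :
  HasDyadic s (N + m) A f) : HasDyadic r N (moserConst m N p * t ^ (s - r) * A) (fun x => f x -
  moserAvg m p t f x) := by
  obtain ⟨e, he⟩ := h
  refine ⟨fun j x => e j x - moserAvg m p t (e j) x, fun j => (he.smooth j).sub (contDiff_moserAvg m
    p ht (he.smooth j).continuous (he.norm_le j)), fun j i hi x => ?_, fun x => (he.hasSum x).sub
    (hasSum_moserAvg (fun j => (he.smooth j).continuous) he.norm_le (IsDyadic.summable hs A)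
    he.hasSum x)⟩
  refine (norm_iterD_sub_moserAvg_dyadic he hi ht (σ := s - r) (by linarith) (by linarith) j
    x).trans (le_of_eq ?_)
  rw [mul_rpow ht.le (by positivity)]
  have : (2 ^ j : ℝ) ^ ((i : ℝ) - r) = (2 ^ j : ℝ) ^ ((i : ℝ) - s) * (2 ^ j : ℝ) ^ (s - r) := by
    rw [← rpow_add (by positivity)]; congr 1; ring
  rw [this]; ring

lemma CkBound.exists_sub_moserAvg_of_hasDyadic (m N : ℕ) (p : E) (hkN : k ≤ N) (hks : k < s) (hsk :
  s < k + m) : ∃ K : ℝ, 0 < K ∧ ∀ t : ℝ, 0 < t → ∀ (A : ℝ) (f : E → ℂ), HasDyadic s (N + m) A f →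
  CkBound k (K * t ^ (s - k) * A) (fun x => f x - moserAvg m p t f x) := by
  have hs : 0 < s := (Nat.cast_nonneg k).trans_lt hks
  obtain ⟨C, hC, hsum⟩ := exists_dyadic_sum_le (α := m - (s - k)) (β := s - k) (by linarith)
    (by linarith)
  have hK1 := one_le_moserConst m N p
  refine ⟨C * moserConst m N p, by positivity, fun t ht A f ⟨e, he⟩ => ?_⟩
  have hA := he.nonneg
  set a : ℕ → ℝ := fun j => moserConst m N p * A * (2 ^ j : ℝ) ^ ((k : ℝ) - s) * min 1 ((t * 2 ^ j)
    ^ (m : ℝ)) with ha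
  have ha0 : ∀ j, 0 ≤ a j := fun j => by
    have : 0 ≤ min 1 ((t * 2 ^ j) ^ (m : ℝ)) := le_min zero_le_one (by positivity)
    positivity
  have hsc : ∀ (δ : ℝ) (j : ℕ), (2 ^ j : ℝ) ^ ((k : ℝ) - s) * (t * 2 ^ j) ^ δ = t ^ (s - k) * (t * 2
    ^ j) ^ (δ - (s - k)) := fun δ j => by
    rw [sub_eq_add_neg δ, rpow_add (by positivity), neg_sub, mul_rpow (z := (k : ℝ) - s) ht.le
      (by positivity)]
    have : t ^ (s - k) * t ^ ((k : ℝ) - s) = 1 := by rw [← rpow_add ht]; simp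
    linear_combination (-((2 ^ j : ℝ) ^ ((k : ℝ) - s) * (t * 2 ^ j) ^ δ)) * this
  obtain ⟨hs1, hs2⟩ := hsum t ht (moserConst m N p * A * t ^ (s - k)) (by positivity) a ha0 (fun j
    => by
      rw [mul_assoc, ← hsc, ← mul_assoc]
      simp only [ha]
      gcongr
      exact min_le_right _ _) (fun j => by
      rw [mul_assoc, ← zero_sub, ← hsc, ← mul_assoc, rpow_zero]
      simp only [ha]
      gcongr
      exact min_le_left _ _)
  have := MoserSmoothing.hasSum_iterD (k := k) (a := a) (e := fun j x => e j x - moserAvg m p t (e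
    j) x) (f := fun x => f x - moserAvg m p t f x) (fun j => ((he.smooth j).sub (contDiff_moserAvg m
    p ht (he.smooth j).continuous (he.norm_le j))).of_le (nat_le_infty _)) (fun j i hi x
    => ?_) hs1 fun x => (he.hasSum x).sub (hasSum_moserAvg (fun j => (he.smooth j).continuous)
    he.norm_le (IsDyadic.summable hs A) he.hasSum x)
  · refine this.1.mono le_rfl (hs2.trans (le_of_eq (by ring)))
  · have h1 : ∀ σ : ℝ, 0 ≤ σ → σ ≤ m → _ := fun σ h0 hσ =>
      norm_iterD_sub_moserAvg_dyadic (p := p) he (hi.trans hkN) ht h0 hσ j x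
    have hik : (2 ^ j : ℝ) ^ ((i : ℝ) - s) ≤ (2 ^ j : ℝ) ^ ((k : ℝ) - s) := dyadic_rpow_le
      (sub_le_sub_right (by exact_mod_cast hi) s) j
    simp only [ha]
    rcases min_choice 1 ((t * 2 ^ j) ^ (m : ℝ)) with h | h <;> rw [h]
    · refine (h1 0 le_rfl (Nat.cast_nonneg m)).trans ?_
      rw [rpow_zero]; gcongr
    · refine (h1 m (Nat.cast_nonneg m) le_rfl).trans ?_
      gcongr

lemma CkBound.moserAvg (p : E) {q : ℕ} (hq : k + q ≤ N) (ht : 0 < t) (ht1 : t ≤ 1) (hf : CkBound k A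
  f) : CkBound (k + q) (moserConst m N p * t⁻¹ ^ q * A) (moserAvg m p t f) := by
  have hb := hf.norm_le
  have hA := hf.nonneg
  have hK1 := one_le_moserConst m N p
  refine ⟨(contDiff_moserAvg m p ht hf.1.continuous hb).of_le (nat_le_infty _), fun i hi x
    => ?_⟩
  obtain ⟨a, b, rfl, ha, hb'⟩ : ∃ a b, i = a + b ∧ a ≤ k ∧ b ≤ q := by
    rcases le_total i k with h | h
    · exact ⟨i, 0, rfl, h, Nat.zero_le _⟩
    · exact ⟨k, i - k, by omega, le_rfl, by omega⟩
  refine (norm_iterD_moserAvg_le ht (N := N) (by omega) (hf.1.of_le (by exact_mod_cast ha)) hb (hf.2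
    a ha) x).trans ?_
  rw [mul_right_comm]
  gcongr
  exact one_le_inv₀ ht |>.2 ht1

lemma CkBound.sub_moserAvg (p : E) {M : ℕ} (hM : M ≤ m) (ht : 0 < t) (hf : CkBound (k + M) A f) :
  CkBound k (moserConst m N p * t ^ M * A) (fun x => f x - MoserSmoothing.moserAvg m p t f x) := by
  have hb := hf.norm_le
  refine ⟨(hf.1.of_le (by exact_mod_cast Nat.le_add_right _ _)).sub ((contDiff_moserAvg m p ht
    hf.1.continuous hb).of_le (nat_le_infty _)), fun i hi x => ?_⟩
  refine (norm_iterD_sub_moserAvg_le ht (N := N) hM (hf.1.of_le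
    (by exact_mod_cast (by omega : i + M ≤ k + M))) (hf.2 _ (by omega)) x).trans (le_of_eq ?_)
  ring

lemma HasDyadic.exists_moserAvg_of_ckBound_zero (m N : ℕ) (p : E) (hr : 0 ≤ r) : ∃ K : ℝ, 0 < K ∧ ∀
  t : ℝ, 0 < t → t ≤ 1 → ∀ (A : ℝ) (f : E → ℂ), CkBound 0 A f → HasDyadic r N (K * t ^ (-r) * A)
  (moserAvg m p t f) := by
  have hK1 := one_le_moserConst m N p
  refine ⟨moserConst m N p * 2 ^ N, by positivity, fun t ht ht1 A f hf => ?_⟩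
  have hA : 0 ≤ A := hf.nonneg
  have hb := hf.norm_le
  obtain ⟨J, hJ1, hJ2⟩ := exists_nat_pow_near (one_le_inv₀ ht |>.2 ht1) one_lt_two
  refine ⟨fun j => if j = J then moserAvg m p t f else fun _ => 0, fun j => ?_, fun j i hi x => ?_,
    fun x => ?_⟩
  · split_ifs
    · exact contDiff_moserAvg m p ht hf.1.continuous hb
    · exact contDiff_const
  · split_ifs with h2
    · subst h2
      have := norm_iterD_moserAvg_le (m := m) (p := p) ht (l := 0) hi (contDiff_zero.2
        hf.1.continuous) hb (fun x => hf.2 0 le_rfl x) x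
      rw [zero_add] at this
      refine this.trans ?_
      have h3 := inv_pow_le_of_lt ht hJ2.le hi
      have h4 : (2 ^ j : ℝ) ^ (i : ℝ) = (2 ^ j : ℝ) ^ r * (2 ^ j : ℝ) ^ ((i : ℝ) - r) := by
        rw [← rpow_add (by positivity)]; congr 1; ring
      have h5 : (2 ^ j : ℝ) ^ r ≤ t ^ (-r) := by
        rw [← rpow_neg_exp ht]
        exact rpow_le_rpow (by positivity) hJ1 hr
      calc _ ≤ moserConst m N p * A * (2 ^ N * (t ^ (-r) * (2 ^ j : ℝ) ^ ((i : ℝ) - r))) := by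
            gcongr
            refine h3.trans ?_
            rw [h4]; gcongr
        _ = _ := by ring
    · exact norm_iterD_zero_le i x (by positivity)
  · have := hasSum_sum_of_ne_finset_zero (L := .unconditional ℕ) (s := {J}) (f := fun j =>
      (if j = J then moserAvg m p t f else fun _ => 0) x)
      (fun j hj => by rw [if_neg (by simpa using hj)])
    simpa using this

/-! ## Smoothing on the scale of Hölder spaces -/

/-- Regularity of order `r` in the scale of Hölder spaces. -/
def HolderReg (N : ℕ) (r A : ℝ) (f : E → ℂ) : Prop := ((⌊r⌋₊ : ℝ) < r → HasDyadic r N A f) ∧ ∀ k :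
  ℕ, (k : ℝ) = r → CkBound k A f

/-- Dyadic decompositions together with, for integral orders, bounded derivatives. -/
def HolderData (N : ℕ) (r A : ℝ) (f : E → ℂ) : Prop := (0 < r → HasDyadic r N A f) ∧ ∀ k : ℕ, (k :
  ℝ) = r → CkBound k A f

lemma HolderReg.sum {ι : Type*} (s : Finset ι) {A : ι → ℝ} {f : ι → E → ℂ} (h : ∀ a ∈ s, HolderReg N
  r (A a) (f a)) : HolderReg N r (∑ a ∈ s, A a) (fun x => ∑ a ∈ s, f a x) := ⟨fun hr =>
  HasDyadic.sum s fun a ha => (h a ha).1 hr, fun k hk => CkBound.sum s fun a ha => (h a ha).2 k hk⟩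

lemma HolderData.mul {a : E → ℂ} (hf : HolderData N r A f) (hN : ⌊r⌋₊ ≤ N) (ha : ContDiff ℝ ∞ a) (hB
  : ∀ i ≤ N, ∀ x, ‖∇ i a x‖ ≤ B) : HolderData N r (2 ^ N * B * A) (fun x => a x * f x) := by
  refine ⟨fun hr => (hf.1 hr).mul ha hB, fun k hk => ?_⟩
  have hB0 : 0 ≤ B := (norm_nonneg _).trans (hB 0 (Nat.zero_le _) 0)
  have hkN : k ≤ N := by rw [← hk, Nat.floor_natCast] at hN; exact hN
  have hA0 : 0 ≤ A := (hf.2 k hk).nonneg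
  have h1 : CkBound k B a := ⟨ha.of_le (nat_le_infty k), fun i hi x => hB i (hi.trans hkN) x⟩
  refine (h1.mul (hf.2 k hk)).mono le_rfl ?_
  gcongr
  norm_num

lemma HolderReg.exists_holderNorm_le (hr : 0 ≤ r) (hN : ⌊r⌋₊ + 1 ≤ N) : ∃ C : ℝ, 0 < C ∧ ∀ (A : ℝ)
  (f : E → ℂ), HolderReg N r A f → holderNorm r univ f ≤ ofReal (C * A) := by
  rcases (Nat.floor_le hr).lt_or_eq with h | h
  · obtain ⟨C, hC, h1⟩ := holderNorm_le_of_hasDyadic (E := E) h hN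
    exact ⟨C, hC, fun A f hf => h1 A f (hf.1 h)⟩
  · refine ⟨(⌊r⌋₊ + 2) * 2, by positivity, fun A f hf => ?_⟩
    have := holderNorm_natCast_le (hf.2 _ h) univ
    rw [← mul_assoc, h] at this
    rwa [h]

lemma HolderReg.of_lt (h : (⌊r⌋₊ : ℝ) < r) (hf : HasDyadic r N A f) : HolderReg N r A f :=
  ⟨fun _ => hf, fun k hk => by rw [← hk, Nat.floor_natCast] at h; exact absurd h (lt_irrefl _)⟩

lemma HolderReg.natCast (hf : CkBound k A f) : HolderReg N k A f :=
  ⟨fun h => by rw [Nat.floor_natCast] at h; exact absurd h (lt_irrefl _),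
    fun l hl => Nat.cast_injective hl ▸ hf⟩

lemma HolderData.exists_moserAvg (m N : ℕ) (p : E) (hs : 0 ≤ s) (hsr : s ≤ r) (hN : ⌊r⌋₊ ≤ N) : ∃ K
  : ℝ, 0 < K ∧ ∀ t : ℝ, 0 < t → t ≤ 1 → ∀ (A : ℝ) (f : E → ℂ), HolderData N s A f → HolderReg N r (K
  * t ^ (s - r) * A) (moserAvg m p t f) := by
  have hK1 := one_le_moserConst m N p
  have hr : 0 ≤ r := hs.trans hsr
  rcases (Nat.floor_le hr).lt_or_eq with h | h
  · rcases hs.lt_or_eq with h0 | rfl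
    · obtain ⟨K, hK, h1⟩ := HasDyadic.exists_moserAvg m N p h0 hsr
      exact ⟨K, hK, fun t ht ht1 A f hf => .of_lt h (h1 t ht ht1 A f (hf.1 h0))⟩
    · obtain ⟨K, hK, h1⟩ := HasDyadic.exists_moserAvg_of_ckBound_zero m N p hr
      exact ⟨K, hK, fun t ht ht1 A f hf => .of_lt h (by
        rw [zero_sub]; exact h1 t ht ht1 A f (hf.2 0 (by simp)))⟩
  · obtain ⟨k, rfl⟩ : ∃ k : ℕ, (k : ℝ) = r := ⟨_, h⟩
    rw [Nat.floor_natCast] at hN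
    suffices ∃ K : ℝ, 0 < K ∧ ∀ t : ℝ, 0 < t → t ≤ 1 → ∀ (A : ℝ) (f : E → ℂ), HolderData N s A f →
      CkBound k (K * t ^ (s - k) * A) (moserAvg m p t f) by
      obtain ⟨K, hK, h1⟩ := this
      exact ⟨K, hK, fun t ht ht1 A f hf => .natCast (h1 t ht ht1 A f hf)⟩
    rcases hsr.lt_or_eq with h2 | rfl
    · rcases hs.lt_or_eq with h0 | rfl
      · obtain ⟨K, hK, h1⟩ := CkBound.exists_moserAvg_of_hasDyadic m N p hN h0 h2
        exact ⟨K, hK, fun t ht ht1 A f hf => h1 t ht ht1 A f (hf.1 h0)⟩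
      · refine ⟨moserConst m N p, by positivity, fun t ht ht1 A f hf => ?_⟩
        have := CkBound.moserAvg (m := m) p (q := k) (by omega : 0 + k ≤ N) ht ht1 (hf.2 0
          (by simp))
        rw [zero_add] at this
        rwa [zero_sub, ← rpow_neg_exp ht, rpow_natCast]
    · refine ⟨moserConst m N p, by positivity, fun t ht ht1 A f hf => ?_⟩
      have := CkBound.moserAvg (m := m) p (q := 0) (by omega : k + 0 ≤ N) ht ht1 (hf.2 k rfl)
      rwa [pow_zero, add_zero, ← rpow_zero t, ← sub_self (k : ℝ)] at this

lemma HolderData.exists_sub_moserAvg (m N : ℕ) (p : E) (hr : 0 ≤ r) (hrs : r ≤ s) (hsr : s ≤ r + m)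
  (hN : ⌊r⌋₊ ≤ N) : ∃ K : ℝ, 0 < K ∧ ∀ t : ℝ, 0 < t → ∀ (A : ℝ) (f : E → ℂ), HolderData (N + m) s A
  f → HolderReg N r (K * t ^ (s - r) * A) (fun x => f x - moserAvg m p t f x) := by
  have hK1 := one_le_moserConst m N p
  rcases (Nat.floor_le hr).lt_or_eq with h | h
  · have hr0 : 0 < r := (Nat.cast_nonneg _).trans_lt h
    exact ⟨moserConst m N p, by positivity, fun t ht A f hf => .of_lt h
      ((hf.1 (hr0.trans_le hrs)).sub_moserAvg (hr0.trans_le hrs) hrs hsr ht)⟩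
  · obtain ⟨k, rfl⟩ : ∃ k : ℕ, (k : ℝ) = r := ⟨_, h⟩
    rw [Nat.floor_natCast] at hN
    suffices ∃ K : ℝ, 0 < K ∧ ∀ t : ℝ, 0 < t → ∀ (A : ℝ) (f : E → ℂ), HolderData (N + m) s A f →
      CkBound k (K * t ^ (s - k) * A) (fun x => f x - moserAvg m p t f x) by
      obtain ⟨K, hK, h1⟩ := this
      exact ⟨K, hK, fun t ht A f hf => .natCast (h1 t ht A f hf)⟩
    rcases hrs.lt_or_eq with h1 | rfl
    · rcases hsr.lt_or_eq with h2 | rfl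
      · obtain ⟨K, hK, h3⟩ := CkBound.exists_sub_moserAvg_of_hasDyadic m N p hN h1 h2
        exact ⟨K, hK, fun t ht A f hf =>
          h3 t ht A f (hf.1 ((Nat.cast_nonneg k).trans_lt h1))⟩
      · refine ⟨moserConst m N p, by positivity, fun t ht A f hf => ?_⟩
        have := CkBound.sub_moserAvg (N := N) p le_rfl ht (hf.2 (k + m) (by push_cast; rfl))
        rwa [add_sub_cancel_left, rpow_natCast]
    · refine ⟨moserConst m N p, by positivity, fun t ht A f hf => ?_⟩
      have := CkBound.sub_moserAvg (N := N) p (Nat.zero_le m) ht (k := k) (M := 0) (hf.2 k rfl)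
      rwa [pow_zero, ← rpow_zero t, ← sub_self (k : ℝ)] at this

/-! ## Extension from a set with the cone property -/

lemma exists_forall_le (N : ℕ) (a : ℕ → ℝ) : ∃ C : ℝ, 1 ≤ C ∧ ∀ l ≤ N, a l ≤ C := by
  refine ⟨1 + ∑ l ∈ range (N + 1), |a l|, by
    have := sum_nonneg fun l (_ : l ∈ range (N + 1)) => abs_nonneg (a l)
    linarith, fun l hl => ?_⟩
  have := single_le_sum (f := fun l => |a l|) (fun l _ => abs_nonneg _) (mem_range.2
    (Nat.lt_succ_of_le hl))
  linarith [le_abs_self (a l)]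

/-- The open set `G` contains `x + t (p + y)`, `|y| ≤ 1`, for all `x` in its `c t`-neighbourhood. -/
structure IsConeSet (c : ℝ) (p : E) (G : Set E) : Prop where
  isOpen : IsOpen G
  sees : ∀ t, 0 < t → ∀ x ∈ thickening (c * t) G, Sees p t G x

lemma IsConeSet.seesRay (hc : 1 ≤ c) (h : IsConeSet c p G) (ht : 0 < t) (hx : x ∈ thickening t G) :
  SeesRay p t G x := fun l hl =>
  h.sees (l * t) (by positivity) x (thickening_mono (by
    have : t ≤ l * t := by nlinarith
    nlinarith) G hx)

/-- `2^{-i}`. -/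
def scale (i : ℕ) : ℝ := (2 ^ i : ℝ)⁻¹

lemma scale_pos (i : ℕ) : 0 < scale i := by unfold scale; positivity

lemma scale_succ (i : ℕ) : scale i = 2 * scale (i + 1) := by unfold scale; rw [pow_succ]; field_simp

lemma scale_le_one (i : ℕ) : scale i ≤ 1 := inv_le_one_of_one_le₀ (one_le_two_pow i)

lemma scale_anti {i j : ℕ} (h : i ≤ j) : scale j ≤ scale i := inv_anti₀ (by positivity)
  (pow_le_pow_right₀ one_le_two h)

lemma scale_inv (i : ℕ) : (scale i)⁻¹ = 2 ^ i := by simp [scale]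

/-- A smooth cut-off function, equal to one near `G` and supported in the `2^{-i}`-neighbourhood
of `G`. -/
def cutoff (G : Set E) (i : ℕ) : E → ℝ := avg 0 (scale i / 8) ((thickening (scale i / 2)
  G).indicator fun _ => (1 : ℝ))

lemma aestronglyMeasurable_cutoff_indicator (G : Set E) (r : ℝ) : AEStronglyMeasurable ((thickening
  r G).indicator fun _ => (1 : ℝ)) volume := (stronglyMeasurable_const.indicator
  isOpen_thickening.measurableSet).aestronglyMeasurable

lemma norm_cutoff_indicator_le (G : Set E) (r : ℝ) (x : E) : ‖(thickening r G).indicator (fun _ =>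
  (1 : ℝ)) x‖ ≤ 1 := by
  by_cases h : x ∈ thickening r G <;> simp [h]

lemma contDiff_cutoff (G : Set E) (i : ℕ) : ContDiff ℝ ∞ (cutoff G i) := contDiff_avg 0
  (by have := scale_pos i; positivity) (aestronglyMeasurable_cutoff_indicator G _)
  (norm_cutoff_indicator_le G _)

lemma norm_iterD_cutoff_le (G : Set E) (i q : ℕ) (x : E) : ‖∇ q (cutoff G i) x‖ ≤ bumpConst E q * 8
  ^ q * (scale i)⁻¹ ^ q := by
  have h0 := scale_pos i
  refine (norm_iterD_avg_le q 0 (by positivity) (aestronglyMeasurable_cutoff_indicator G _)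
    (norm_cutoff_indicator_le G _) x).trans (le_of_eq ?_)
  rw [inv_div, mul_one, div_eq_mul_inv, mul_pow, mul_assoc]

lemma cutoff_eventuallyEq_one {i : ℕ} (hx : x ∈ thickening (scale i / 4) G) : cutoff G i =ᶠ[𝓝 x] fun
  _ => 1 := by
  have h0 := scale_pos i
  filter_upwards [isOpen_thickening.mem_nhds hx] with z hz
  have hs : Sees 0 (scale i / 8) (thickening (scale i / 2) G) z := by
    intro y hy
    obtain ⟨g, hg, hgz⟩ := mem_thickening_iff.1 hz
    refine mem_thickening_iff.2 ⟨g, hg, ?_⟩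
    have := norm_smul_add_le (p := 0) (show 0 ≤ scale i / 8 by positivity) hy
    rw [norm_zero, zero_add (1 : ℝ), mul_one, ← dist_self_add_left _ z] at this
    linarith [dist_triangle (z + (scale i / 8) • (0 + y)) z g]
  rw [cutoff, avg_indicator hs, avg]
  simp [integral_stdBump]

lemma cutoff_eventuallyEq_zero {i : ℕ} (hx : x ∉ thickening (scale i) G) : cutoff G i =ᶠ[𝓝 x] fun _
  => 0 := by
  have h0 := scale_pos i
  filter_upwards [ball_mem_nhds x (show (0 : ℝ) < scale i / 8 by positivity)] with z hz
  have hs : Sees 0 (scale i / 8) (thickening (scale i / 2) G)ᶜ z := by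
    intro y hy hmem
    refine hx ?_
    obtain ⟨g, hg, hgz⟩ := mem_thickening_iff.1 hmem
    refine mem_thickening_iff.2 ⟨g, hg, ?_⟩
    have := norm_smul_add_le (p := 0) (show 0 ≤ scale i / 8 by positivity) hy
    rw [norm_zero, zero_add (1 : ℝ), mul_one, ← dist_self_add_left _ z] at this
    have h3 := dist_triangle4 x z (z + (scale i / 8) • (0 + y)) g
    rw [dist_comm x z, dist_comm z (z + _)] at h3
    linarith [mem_ball.1 hz]
  rw [cutoff, avg_congr hs (g := fun _ => 0) fun w hw => indicator_of_notMem hw _]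
  simp [avg]

lemma iterD_eq_zero_of_eventuallyEq {W : Type*} [NormedAddCommGroup W] [NormedSpace ℝ W] {f : E → W}
  (h : f =ᶠ[𝓝 x] fun _ => 0) (q : ℕ) : ∇ q f x = 0 := by
  rw [(h.iteratedFDeriv ℝ q).eq_of_nhds]
  have : ∇ q (fun _ : E => (0 : W)) = 0 := iteratedFDeriv_fun_zero
  rw [this]; rfl

lemma norm_iterD_smul_le_scaled {W : Type*} [NormedAddCommGroup W] [NormedSpace ℝ W] {a : E → ℝ} {f
  : E → W} {i : ℕ} {K ρ : ℝ} (hρ : 0 ≤ ρ) (ha : ContDiff ℝ i a) (hf : ContDiff ℝ i f) (hB : ∀ l ≤ i,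
  ‖∇ l a x‖ ≤ B * ρ ^ l) (hK : ∀ l ≤ i, ‖∇ l f x‖ ≤ K * ρ ^ l) : ‖∇ i (fun y => a y • f y) x‖ ≤ 2 ^
  i * B * K * ρ ^ i := by
  have hB0 : 0 ≤ B := by simpa using (norm_nonneg _).trans (hB 0 (Nat.zero_le _))
  refine (norm_iteratedFDeriv_smul_le ha hf x (n := i) le_rfl).trans ?_
  calc _ ≤ ∑ l ∈ range (i + 1), (i.choose l : ℝ) * (B * K * ρ ^ i) := by
        refine sum_le_sum fun l hl => ?_
        have hl' := Nat.lt_succ_iff.1 (mem_range.1 hl)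
        have : B * K * ρ ^ i = (B * ρ ^ l) * (K * ρ ^ (i - l)) := by
          rw [mul_mul_mul_comm, ← pow_add, Nat.add_sub_cancel' hl']
        rw [this, mul_assoc]
        gcongr
        · exact hB l hl'
        · exact hK _ (Nat.sub_le _ _)
    _ = _ := by
        rw [← sum_mul]
        have : ∑ l ∈ range (i + 1), (i.choose l : ℝ) = 2 ^ i := by
          exact_mod_cast Nat.sum_range_choose i
        rw [this]; ring

/-- The coefficients of the difference of the approximations to the identity at the scales
`2^{-i}` and `2^{1-i}`. -/
def diffCoef : ℕ → ℕ → ℝ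
  | 0 => seeley 0
  | i + 1 => seeleyDiff i

lemma diffCoef_moment {i q : ℕ} (hq : q < i) :
  ∑ k ∈ range (i + 1), diffCoef i k * (2 ^ k : ℝ) ^ q = 0 := by
  obtain ⟨i, rfl⟩ := Nat.exists_eq_succ_of_ne_zero (Nat.ne_zero_of_lt hq)
  exact seeleyDiff_moment (Nat.lt_succ_iff.1 hq)

lemma absMoment_diffCoef_le (i M : ℕ) :
  absMoment (diffCoef i) (i + 1) M ≤ (1 + 2 ^ M) * seeleyConst M := by
  cases i with
  | zero =>
    exact (absMoment_seeley_le 0 M).trans (le_mul_of_one_le_left (seeleyConst_pos M).le (by simp))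
  | succ i => exact absMoment_seeleyDiff_le i M

lemma cavg_diffCoef_succ (p : E) (i : ℕ) (f : E → ℂ) (x : E) : cavg (diffCoef (i + 1)) (i + 2) p
  (scale (i + 1)) f x = cavg (seeley (i + 1)) (i + 2) p (scale (i + 1)) f x - cavg (seeley i)
  (i + 1) p (scale i) f x := by
  simp only [cavg, diffCoef]
  rw [Finset.sum_range_succ', Finset.sum_range_succ' (fun k => seeley (i + 1) k • _),
    add_sub_right_comm, ← sum_sub_distrib]
  refine congrArg₂ _ (sum_congr rfl fun k _ => ?_) rfl
  rw [seeleyDiff, sub_smul, scale_succ i, pow_succ (2 : ℝ) k, mul_assoc]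

/-- The terms of the series for the extension of `f` from `G`. -/
def extPiece (G : Set E) (p : E) (f : E → ℂ) (i : ℕ) (x : E) : ℂ :=
  cutoff G i x • cavg (diffCoef i) (i + 1) p (scale i) f x

lemma extPiece_eventuallyEq_zero {j : ℕ} (f : E → ℂ) (hx : x ∉ thickening (scale j) G) : extPiece G
  p f j =ᶠ[𝓝 x] fun _ => 0 := by
  filter_upwards [cutoff_eventuallyEq_zero hx] with z hz
  rw [extPiece, hz, zero_smul]

/-- The extension of `f` from `G`. -/
def coneExt (G : Set E) (p : E) (f : E → ℂ) (x : E) : ℂ := limUnder atTop fun J : ℕ => ∑ i ∈ range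
  J, extPiece G p f i x

/-- `f` is measurable and bounded. -/
def BddMeas (f : E → ℂ) : Prop := AEStronglyMeasurable f volume ∧ ∃ B : ℝ, ∀ x, ‖f x‖ ≤ B

lemma BddMeas.add (hf : BddMeas f) (hg : BddMeas g) : BddMeas (fun x => f x + g x) := by
  obtain ⟨hf, B, hB⟩ := hf
  obtain ⟨hg, B', hB'⟩ := hg
  exact ⟨hf.add hg, B + B', fun x => (norm_add_le _ _).trans (add_le_add (hB x) (hB' x))⟩

lemma BddMeas.smul (c : ℂ) (hf : BddMeas f) : BddMeas (fun x => c * f x) := by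
  obtain ⟨hf, B, hB⟩ := hf
  exact ⟨hf.const_mul c, ‖c‖ * B, fun x => by rw [norm_mul]; gcongr; exact hB x⟩

lemma BddMeas.sub (hf : BddMeas f) (hg : BddMeas g) : BddMeas (fun x => f x - g x) := by
  simpa [sub_eq_add_neg] using hf.add (hg.smul (-1))

lemma BddMeas.integrable (hf : BddMeas f) (p : E) (ht : 0 < t) (x : E) : Integrable fun y => stdBump
  E y • f (x + t • (p + y)) := by
  obtain ⟨hf, B, hB⟩ := hf
  have hm : AEStronglyMeasurable (fun y => f (x + t • (p + y))) volume := by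
    have h1 := aestronglyMeasurable_comp_smul hf ht.ne'
    have h2 := h1.comp_measurePreserving (measurePreserving_add_left (volume : Measure E) (t⁻¹ • x +
      p))
    refine h2.congr (Eventually.of_forall fun y => ?_)
    simp only [Function.comp]
    rw [add_assoc, smul_add t (t⁻¹ • x), smul_smul, mul_inv_cancel₀ ht.ne', one_smul]
  refine (integrable_stdBump.mul_const B).mono' (continuous_stdBump.aestronglyMeasurable.smul hm)
    (Eventually.of_forall fun y => ?_)
  rw [norm_smul, norm_of_nonneg (stdBump_nonneg y)]
  exact mul_le_mul_of_nonneg_left (hB _) (stdBump_nonneg y)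

lemma BddMeas.contDiff_avg (hf : BddMeas f) (p : E) (ht : 0 < t) : ContDiff ℝ ∞ (avg p t f) :=
  hf.2.elim fun _ hB => MoserSmoothing.contDiff_avg p ht.ne' hf.1 hB

lemma BddMeas.bddMeas_avg (hf : BddMeas f) (p : E) (ht : 0 < t) : BddMeas (avg p t f) :=
  ⟨(hf.contDiff_avg p ht).continuous.aestronglyMeasurable, hf.2.imp fun _ hB _ =>
    norm_avg_le (O := univ) (fun _ _ => mem_univ _) fun z _ => hB z⟩

lemma avg_add (hf : BddMeas f) (hg : BddMeas g) (p : E) (ht : 0 < t) (x : E) : avg p t (fun x => f x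
  + g x) x = avg p t f x + avg p t g x := by
  rw [avg, avg, avg, ← integral_add (hf.integrable p ht x) (hg.integrable p ht x)]
  simp only [smul_add]

lemma avg_const_mul (f : E → ℂ) (c : ℂ) (p : E) (t : ℝ) (x : E) : avg p t (fun x => c * f x) x = c *
  avg p t f x := by
  rw [avg, avg, ← integral_const_mul]
  simp only [mul_smul_comm]

lemma cavg_add (hf : BddMeas f) (hg : BddMeas g) (c : ℕ → ℝ) (n : ℕ) (p : E) (ht : 0 < t) (x : E) :
  cavg c n p t (fun x => f x + g x) x = cavg c n p t f x + cavg c n p t g x := by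
  simp only [cavg, avg_add hf hg p (mul_pos (pow_pos two_pos _) ht), smul_add, sum_add_distrib]

lemma cavg_const_mul (f : E → ℂ) (a : ℂ) (c : ℕ → ℝ) (n : ℕ) (p : E) (t : ℝ) (x : E) : cavg c n p t
  (fun x => a * f x) x = a * cavg c n p t f x := by
  simp only [cavg, avg_const_mul, mul_sum, mul_smul_comm]

lemma extPiece_add (hf : BddMeas f) (hg : BddMeas g) (G : Set E) (p : E) (i : ℕ) (x : E) : extPiece
  G p (fun x => f x + g x) i x = extPiece G p f i x + extPiece G p g i x := by
  simp only [extPiece, cavg_add hf hg _ _ p (scale_pos _), smul_add]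

lemma extPiece_const_mul (f : E → ℂ) (a : ℂ) (G : Set E) (p : E) (i : ℕ) (x : E) : extPiece G p (fun
  x => a * f x) i x = a * extPiece G p f i x := by
  simp only [extPiece, cavg_const_mul, mul_smul_comm]

lemma contDiff_extPiece (hf : BddMeas f) (G : Set E) (p : E) (i : ℕ) : ContDiff ℝ ∞ (extPiece G p f
  i) := hf.2.elim fun _ hB => (contDiff_cutoff G i).smul (contDiff_cavg _ _ p (scale_pos _) hf.1 hB)

variable (E) in
lemma exists_cutoff_bound (N : ℕ) : ∃ C : ℝ, 1 ≤ C ∧ ∀ (G : Set E) (i q : ℕ), q ≤ N → ∀ x, ‖∇ q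
  (cutoff G i) x‖ ≤ C * (scale i)⁻¹ ^ q := by
  obtain ⟨C, hC, h⟩ := exists_forall_le N fun q => bumpConst E q * 8 ^ q
  refine ⟨C, hC, fun G i q hq x => (norm_iterD_cutoff_le G i q x).trans ?_⟩
  have := scale_pos i
  gcongr
  exact h q hq

lemma exists_extPiece_bound (N M : ℕ) (p : E) : ∃ C : ℝ, 1 ≤ C ∧ ∀ (c : ℝ), 1 ≤ c → ∀ (G : Set E),
  IsConeSet c p G → ∀ f : E → ℂ, BddMeas f → ContDiffOn ℝ M f G → ∀ B : ℝ, 0 ≤ B → (∀ z ∈ G, ‖∇ M f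
  z‖ ≤ B) → ∀ i, M ≤ i → ∀ q ≤ N, ∀ x, ‖∇ q (extPiece G p f i) x‖ ≤ C * B * scale i ^ M
  * (scale i)⁻¹ ^ q := by
  obtain ⟨C₁, hC₁, h₁⟩ := exists_cutoff_bound E N
  obtain ⟨C₂, hC₂, h₂⟩ := exists_forall_le M fun l => (1 + 2 ^ l) * seeleyConst l * (‖p‖ + 1) ^ l
  obtain ⟨C₃, hC₃, h₃⟩ := exists_forall_le N fun l => (1 + 2 ^ 0) * seeleyConst 0 * bumpConst E l
  refine ⟨2 ^ N * C₁ * (C₂ * C₃), ?_, fun c hc G hG f hf hfM B hB0 hB i hi q hq x => ?_⟩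
  · exact one_le_mul_of_one_le_of_one_le (one_le_mul_of_one_le_of_one_le (one_le_two_pow N) hC₁)
      (one_le_mul_of_one_le_of_one_le hC₂ hC₃)
  have ht := scale_pos i
  set t := scale i with ht'
  by_cases hx : x ∈ thickening t G
  swap
  · rw [iterD_eq_zero_of_eventuallyEq (extPiece_eventuallyEq_zero f hx), norm_zero]
    positivity
  have hray := hG.seesRay hc ht hx
  obtain ⟨hfm, B₀, hB₀⟩ := hf
  have hD : ∀ l ≤ q, ‖∇ l (cavg (diffCoef i) (i + 1) p t f) x‖ ≤ (C₂ * C₃ * B * t ^ M) * t⁻¹ ^ l := by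
    intro l hl
    rcases le_or_gt l M with hlM | hlM
    · obtain ⟨a, rfl⟩ := Nat.exists_eq_add_of_le hlM
      refine (norm_iterD_cavg_le_of_moments l ht hG.isOpen hfM hB0 hB hray fun j hj =>
        diffCoef_moment (by omega)).trans ?_
      have e : t ^ (l + a) * t⁻¹ ^ l = t ^ a := by rw [pow_add, inv_pow]; field_simp
      calc _ ≤ ((1 + 2 ^ a) * seeleyConst a) * (B * (t * (‖p‖ + 1)) ^ a) := by
            gcongr; exact absMoment_diffCoef_le i a
        _ = ((1 + 2 ^ a) * seeleyConst a * (‖p‖ + 1) ^ a) * (B * t ^ a) := by rw [mul_pow]; ring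
        _ ≤ C₂ * (B * t ^ a) := by gcongr; exact h₂ a (by omega)
        _ ≤ C₂ * C₃ * (B * t ^ a) := by gcongr; exact le_mul_of_one_le_right (by positivity) hC₃
        _ = _ := by rw [← e]; ring
    · obtain ⟨a, rfl⟩ := Nat.exists_eq_add_of_lt hlM
      have h0 := bumpConst_nonneg (E := E) (a + 1)
      rw [add_assoc]
      refine (norm_iterD_cavg_of_contDiffOn_le ht M (a + 1) hG.isOpen (fun k _ =>
        contDiff_avg p (by positivity) hfm hB₀) hfM hB0 hB fun k _ => hray.sees k).trans ?_
      have e : t ^ M * t⁻¹ ^ (M + (a + 1)) = t⁻¹ ^ (a + 1) := by rw [pow_add, inv_pow]; field_simp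
      calc _ ≤ ((1 + 2 ^ 0) * seeleyConst 0) * (bumpConst E (a + 1) * B * t⁻¹ ^ (a + 1)) := by
            gcongr; exact absMoment_diffCoef_le i 0
        _ = ((1 + 2 ^ 0) * seeleyConst 0 * bumpConst E (a + 1)) * (B * t⁻¹ ^ (a + 1)) := by ring
        _ ≤ C₃ * (B * t⁻¹ ^ (a + 1)) := by gcongr; exact h₃ (a + 1) (by omega)
        _ ≤ C₂ * C₃ * (B * t⁻¹ ^ (a + 1)) := by
          gcongr; exact le_mul_of_one_le_left (by positivity) hC₂
        _ = _ := by rw [← e]; ring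
  have := norm_iterD_smul_le_scaled (x := x) (inv_nonneg.2 ht.le) ((contDiff_cutoff G i).of_le
    (nat_le_infty q)) ((contDiff_cavg _ _ p ht hfm hB₀).of_le (nat_le_infty q)) (fun l hl =>
    h₁ G i l (hl.trans hq) x) hD
  refine this.trans ?_
  calc 2 ^ q * C₁ * (C₂ * C₃ * B * t ^ M) * t⁻¹ ^ q ≤ 2 ^ N * C₁ * (C₂ * C₃ * B * t ^ M) * t⁻¹ ^ q
        := by
        gcongr; norm_num
    _ = _ := by ring

lemma sum_extPiece_eventuallyEq {n : ℕ} (f : E → ℂ) (hx : x ∈ thickening (scale n / 4) G) : (fun z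
  => ∑ i ∈ range (n + 1), extPiece G p f i z) =ᶠ[𝓝 x] cavg (seeley n) (n + 1) p (scale n) f := by
  induction n with
  | zero =>
    filter_upwards [cutoff_eventuallyEq_one hx] with z hz
    rw [zero_add, Finset.sum_range_one, extPiece, hz, one_smul, diffCoef]
  | succ n ih =>
    have h1 := ih (thickening_mono (by
      have := scale_succ n
      have := scale_pos (n + 1)
      linarith) G hx)
    filter_upwards [h1, cutoff_eventuallyEq_one hx] with z hz1 hz2
    rw [sum_range_succ, hz1, extPiece, hz2, one_smul, cavg_diffCoef_succ, add_sub_cancel]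

/-- `f` is measurable, bounded, and has derivatives on `G` of orders at most `k` bounded by `B`. -/
structure ConeBound (k : ℕ) (B : ℝ) (G : Set E) (f : E → ℂ) : Prop where
  bddMeas : BddMeas f
  contDiffOn : ContDiffOn ℝ k f G
  nonneg : 0 ≤ B
  bound : ∀ l ≤ k, ∀ z ∈ G, ‖∇ l f z‖ ≤ B

lemma ConeBound.mono {l : ℕ} (h : ConeBound k B G f) (hl : l ≤ k) : ConeBound l B G f := ⟨h.bddMeas,
  h.contDiffOn.of_le (mod_cast hl), h.nonneg, fun i hi => h.bound i (hi.trans hl)⟩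

lemma ConeBound.norm_le (h : ConeBound k B G f) {z : E} (hz : z ∈ G) : ‖f z‖ ≤ B := by
  simpa using h.bound 0 (Nat.zero_le _) z hz

lemma ConeBound.sub (hG : IsOpen G) (hf : ConeBound k A G f) (hg : ConeBound k B G g) :
  ConeBound k (A + B) G fun x => f x - g x := by
  refine ⟨hf.bddMeas.sub hg.bddMeas, hf.contDiffOn.sub hg.contDiffOn, add_nonneg hf.nonneg
    hg.nonneg, fun l hl z hz => ?_⟩
  rw [fun_iteratedFDeriv_sub_apply ((hf.mono hl).contDiffOn.contDiffAt (hG.mem_nhds hz))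
    ((hg.mono hl).contDiffOn.contDiffAt (hG.mem_nhds hz))]
  exact (norm_sub_le _ _).trans (add_le_add (hf.bound l hl z hz) (hg.bound l hl z hz))

lemma exists_extPiece_bound_all (N M : ℕ) (p : E) : ∃ C : ℝ, 1 ≤ C ∧ ∀ (c : ℝ), 1 ≤ c → ∀ (G : Set
  E), IsConeSet c p G → ∀ (f : E → ℂ) (B : ℝ), ConeBound M B G f → ∀ j, ∀ q ≤ N, ∀ x, ‖∇ q (extPiece
  G p f j) x‖ ≤ C * B * scale j ^ M * (scale j)⁻¹ ^ q := by
  obtain ⟨C₁, hC₁, h₁⟩ := exists_extPiece_bound N M p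
  obtain ⟨C₂, hC₂, h₂⟩ := exists_extPiece_bound N 0 p
  have hpow : (1 : ℝ) ≤ (2 ^ M) ^ M := one_le_pow₀ (one_le_two_pow M)
  refine ⟨C₁ * (C₂ * (2 ^ M) ^ M), one_le_mul_of_one_le_of_one_le hC₁
    (one_le_mul_of_one_le_of_one_le hC₂ hpow), fun c hc G hG f B hf j q hq x => ?_⟩
  have hB := hf.nonneg
  have ht := scale_pos j
  rcases le_or_gt M j with hj | hj
  · refine (h₁ c hc G hG f hf.bddMeas hf.contDiffOn B hB (hf.bound M le_rfl) j hj q hq x).trans ?_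
    gcongr
    exact le_mul_of_one_le_right (by positivity) (one_le_mul_of_one_le_of_one_le hC₂ hpow)
  · refine (h₂ c hc G hG f hf.bddMeas (hf.mono (Nat.zero_le M)).contDiffOn B hB (hf.bound 0
      (Nat.zero_le M)) j (Nat.zero_le _) q hq x).trans ?_
    rw [pow_zero, mul_one]
    have h3 : (1 : ℝ) ≤ (2 ^ M) ^ M * scale j ^ M := by
      rw [← mul_pow]
      refine one_le_pow₀ ?_
      have := scale_anti hj.le
      calc (1 : ℝ) = 2 ^ M * scale M := by rw [scale, mul_inv_cancel₀ (by positivity)]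
        _ ≤ _ := by gcongr
    refine mul_le_mul_of_nonneg_right ?_ (by positivity)
    calc C₂ * B = 1 * (C₂ * B) * 1 := by ring
      _ ≤ C₁ * (C₂ * B) * ((2 ^ M) ^ M * scale j ^ M) := by gcongr
      _ = _ := by ring

lemma exists_sum_extPiece_bound (k : ℕ) (p : E) : ∃ C : ℝ, 1 ≤ C ∧ ∀ (c : ℝ), 1 ≤ c → ∀ (G : Set E),
  IsConeSet c p G → ∀ (f : E → ℂ) (B : ℝ), ConeBound k B G f → ∀ J, ∀ q ≤ k, ∀ x, ‖∇ q (fun z => ∑ i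
  ∈ range J, extPiece G p f i z) x‖ ≤ C * B := by
  choose C₁ hC₁ h₁ using fun q => exists_extPiece_bound_all (E := E) k q p
  obtain ⟨C₂, hC₂, h₂⟩ := exists_forall_le k C₁
  set C₃ := seeleyConst 0 * bumpConst E 0 with hC₃
  have hC₃0 : 0 ≤ C₃ := mul_nonneg (seeleyConst_pos 0).le (bumpConst_nonneg 0)
  refine ⟨C₃ + 8 * C₂, by linarith, fun c hc G hG f B hf J q hq x => ?_⟩
  have hB := hf.nonneg
  obtain ⟨hfm, B₀, hB₀⟩ := hf.bddMeas
  have hsm : ∀ i, ContDiff ℝ q (extPiece G p f i) := fun i =>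
    (contDiff_extPiece hf.bddMeas G p i).of_le (nat_le_infty q)
  have hpiece : ∀ i, ‖∇ q (extPiece G p f i) x‖ ≤ C₂ * B := by
    intro i
    have hs := scale_pos i
    refine (h₁ q c hc G hG f B (hf.mono hq) i q hq x).trans ?_
    rw [mul_assoc, ← mul_pow, mul_inv_cancel₀ hs.ne', one_pow, mul_one]
    gcongr
    exact h₂ q hq
  have hinit : ∀ n, (∀ i < n, x ∈ thickening (scale i / 4) G) → ‖∇ q (fun z => ∑ i ∈ range n,
    extPiece G p f i z) x‖ ≤ C₃ * B := by
    intro n hn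
    rcases n with _ | n
    · simp only [Finset.range_zero, Finset.sum_empty]
      rw [iterD_eq_zero_of_eventuallyEq (EventuallyEq.refl _ _), norm_zero]
      positivity
    · have hx := hn n (Nat.lt_succ_self n)
      have hs := scale_pos n
      rw [((sum_extPiece_eventuallyEq f hx).iteratedFDeriv ℝ q).eq_of_nhds]
      have hray := hG.seesRay hc hs (thickening_mono (by linarith) G hx)
      have := norm_iterD_cavg_of_contDiffOn_le (c := seeley n) (n := n + 1) hs q 0 hG.isOpen (fun k
        _ => contDiff_avg p (by positivity) hfm hB₀) (hf.mono hq).contDiffOn hB (hf.bound q hq) (x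
        := x) fun k _ => hray.sees k
      rw [add_zero, pow_zero, mul_one] at this
      refine this.trans ?_
      have h0 := bumpConst_nonneg (E := E) 0
      rw [hC₃, mul_assoc]
      gcongr
      exact absMoment_seeley_le n 0
  have htail : ∀ i₀ n, x ∉ thickening (scale i₀ / 4) G → ‖∇ q (fun z => ∑ i ∈ range n, extPiece G p
    f (i₀ + i) z) x‖ ≤ 8 * C₂ * B := by
    intro i₀ n hx
    rw [iteratedFDeriv_fun_sum_apply fun i _ => (hsm _).contDiffAt]
    calc _ ≤ ∑ i ∈ range n, 4 * C₂ * B * (1 / 2) ^ i := by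
          refine norm_sum_le_of_le _ fun i _ => ?_
          rcases lt_or_ge i 2 with h | h
          · refine (hpiece _).trans ?_
            have : (1 : ℝ) ≤ 4 * (1 / 2) ^ i := by interval_cases i <;> norm_num
            have h0 : 0 ≤ C₂ * B := by positivity
            nlinarith
          · obtain ⟨l, rfl⟩ := Nat.exists_eq_add_of_le' h
            rw [iterD_eq_zero_of_eventuallyEq, norm_zero]
            · positivity
            · refine extPiece_eventuallyEq_zero f fun h' => hx (thickening_mono ?_ G h')
              have h3 : scale (i₀ + (l + 2)) ≤ scale (i₀ + 2) := scale_anti (by omega)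
              have h4 := scale_succ i₀
              have h5 := scale_succ (i₀ + 1)
              linarith
      _ ≤ _ := by
          rw [← mul_sum]
          have := sum_geometric_two_le n
          have h0 : 0 ≤ C₂ * B := by positivity
          nlinarith
  have hCB : 0 ≤ C₂ * B := by positivity
  by_cases hall : ∀ i < J, x ∈ thickening (scale i / 4) G
  · refine (hinit J hall).trans ?_
    nlinarith
  · push Not at hall
    obtain ⟨i₀, hi₀, hx₀, hmin⟩ : ∃ i₀ < J, x ∉ thickening (scale i₀ / 4) G ∧ ∀ i < i₀, x ∈
      thickening (scale i / 4) G := by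
      classical
      have h := Nat.find_spec hall
      exact ⟨Nat.find hall, h.1, h.2, fun i hi => of_not_not fun h' =>
        Nat.find_min hall hi ⟨hi.trans h.1, h'⟩⟩
    obtain ⟨n, rfl⟩ := Nat.exists_eq_add_of_le hi₀.le
    have hsplit : (fun z => ∑ i ∈ range (i₀ + n), extPiece G p f i z) = fun z =>
        ∑ i ∈ range i₀, extPiece G p f i z +
        ∑ i ∈ range n, extPiece G p f (i₀ + i) z := by ext z; rw [Finset.sum_range_add]
    rw [hsplit, fun_iteratedFDeriv_add_apply (ContDiff.sum fun i _ => hsm _).contDiffAt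
      (ContDiff.sum fun i _ => hsm _).contDiffAt]
    refine (norm_add_le _ _).trans ((add_le_add (hinit i₀ hmin) (htail i₀ n hx₀)).trans (le_of_eq
      (by ring)))

lemma norm_avg_sub_le (hO : IsOpen O) (hx : Sees p t O x) {W : Type} [NormedAddCommGroup W]
  [NormedSpace ℝ W] [CompleteSpace W] {g : E → W} (hg : ContinuousOn g O) {w : W} {ε : ℝ} (h : ∀ y ∈
  closedBall (0 : E) 1, ‖g (x + t • (p + y)) - w‖ ≤ ε) : ‖avg p t g x - w‖ ≤ ε := by
  have : avg p t g x - w = ∫ y, stdBump E y • (g (x + t • (p + y)) - w) := by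
    simp only [smul_sub]
    rw [integral_sub (integrable_bump_smul hO hx hg) (integrable_stdBump.smul_const _),
      integral_smul_const, integral_stdBump, one_smul, avg]
  rw [this]
  exact norm_integral_bump_smul_le h

lemma tendsto_sum_extPiece_of_mem (hc : 1 ≤ c) (hG : IsConeSet c p G) (hf : ContinuousOn f G) (hB :
  ∀ z ∈ G, ‖f z‖ ≤ B) (hx : x ∈ G) : Tendsto (fun J : ℕ => ∑ i ∈ range J, extPiece G p f i x) atTop
  (𝓝 (f x)) := by
  rw [← tendsto_add_atTop_iff_nat 1]
  have hxt : ∀ t : ℝ, 0 < t → x ∈ thickening t G := fun t ht =>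
    self_subset_thickening ht G hx
  have heq : ∀ n, ∑ i ∈ range (n + 1), extPiece G p f i x = cavg (seeley n) (n + 1) p (scale n) f x
    := fun n =>
    (sum_extPiece_eventuallyEq f (hxt _ (by have := scale_pos n; positivity))).eq_of_nhds
  simp only [heq]
  have hB0 : 0 ≤ B := (norm_nonneg _).trans (hB x hx)
  rw [Metric.tendsto_atTop]
  intro ε hε
  have hs0 := seeleyConst_pos 0
  have hs1 := seeleyConst_pos 1
  set ε₁ : ℝ := ε / (2 * seeleyConst 0) with hε₁
  have hε₁0 : 0 < ε₁ := by positivity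
  obtain ⟨δ, hδ, hδf⟩ := continuousAt_iff.1 (hf.continuousAt (hG.isOpen.mem_nhds hx)) ε₁ hε₁0
  set P := ‖p‖ + 1 with hP
  have hP0 : 0 < P := by positivity
  have hbd : ∀ n, ‖cavg (seeley n) (n + 1) p (scale n) f x - f x‖ ≤ seeleyConst 0 * ε₁ + seeleyConst
    1 * (2 * B / δ * P) * scale n := by
    intro n
    have ht := scale_pos n
    have hray := hG.seesRay hc ht (hxt _ ht)
    have h1 : cavg (seeley n) (n + 1) p (scale n) f x - f x = ∑ k ∈ range (n + 1), seeley n k • (avg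
      p (2 ^ k * scale n) f x - f x) := by
      simp only [smul_sub, sum_sub_distrib, ← sum_smul, seeley_moment_zero, one_smul, cavg]
    rw [h1]
    calc _ ≤ ∑ k ∈ range (n + 1), |seeley n k| * (ε₁ + 2 * B / δ * P * scale n * 2 ^ k) := by
          refine norm_sum_le_of_le _ fun k _ => ?_
          rw [norm_smul, norm_eq_abs]
          gcongr
          refine norm_avg_sub_le hG.isOpen (hray.sees k) hf fun y hy => ?_
          have hv := norm_smul_add_le (p := p) (show 0 ≤ 2 ^ k * scale n by positivity) hy
          rcases lt_or_ge ‖(2 ^ k * scale n) • (p + y)‖ δ with h | h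
          · have := hδf (x := x + (2 ^ k * scale n) • (p + y)) (by simpa using h)
            rw [dist_eq_norm] at this
            have h2 : 0 ≤ 2 * B / δ * P * scale n * 2 ^ k := by positivity
            linarith
          · have h2 : ‖f (x + (2 ^ k * scale n) • (p + y)) - f x‖ ≤ 2 * B := by
              have h3 := hB _ (hray.sees k y hy)
              have h4 := hB _ hx
              linarith [norm_sub_le (f (x + (2 ^ k * scale n) • (p + y))) (f x)]
            have h5 : 2 * B ≤ 2 * B / δ * P * scale n * 2 ^ k := by
              rw [show 2 * B / δ * P * scale n * 2 ^ k = 2 * B * ((2 ^ k * scale n * P) / δ)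
                by ring]
              refine le_mul_of_one_le_right (by positivity) ?_
              rw [le_div_iff₀ hδ]; linarith
            linarith
      _ = absMoment (seeley n) (n + 1) 0 * ε₁ + absMoment (seeley n) (n + 1) 1 * (2 * B / δ * P) *
        scale n := by
          simp only [absMoment, pow_zero, mul_one, pow_one, sum_mul, mul_add, sum_add_distrib]
          congr 1
          exact sum_congr rfl fun k _ => by ring
      _ ≤ _ := by
          gcongr
          · exact absMoment_seeley_le n 0
          · exact absMoment_seeley_le n 1
  have hlim : Tendsto (fun n => seeleyConst 1 * (2 * B / δ * P) * scale n) atTop (𝓝 0) := by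
    have : Tendsto (fun n => ((1 : ℝ) / 2) ^ n) atTop (𝓝 0) := tendsto_pow_atTop_nhds_zero_of_lt_one
      (by norm_num) (by norm_num)
    have h2 := this.const_mul (seeleyConst 1 * (2 * B / δ * P))
    rw [mul_zero] at h2
    refine h2.congr fun n => ?_
    rw [scale, one_div, inv_pow]
  obtain ⟨n₀, hn₀⟩ := (hlim.eventually (gt_mem_nhds (show 0 < ε / 2
    by positivity))).exists_forall_of_atTop
  refine ⟨n₀, fun n hn => ?_⟩
  rw [dist_eq_norm]
  have h3 : seeleyConst 0 * ε₁ = ε / 2 := by rw [hε₁]; field_simp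
  linarith [hbd n, hn₀ n hn]

lemma coneExt_eq_of_mem (hc : 1 ≤ c) (hG : IsConeSet c p G) (hf : ContinuousOn f G) (hB : ∀ z ∈ G,
  ‖f z‖ ≤ B) (hx : x ∈ G) : coneExt G p f x = f x := (tendsto_sum_extPiece_of_mem hc hG hf hB
  hx).limUnder_eq

lemma isDyadic_coneExt (hf : BddMeas f) (hr : 0 < r) (hA : ∀ j, ∀ i ≤ N, ∀ x, ‖∇ i (extPiece G p f
  j) x‖ ≤ A * (2 ^ j : ℝ) ^ ((i : ℝ) - r)) : IsDyadic r N A (extPiece G p f) (coneExt G p f) := by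
  refine ⟨fun j => contDiff_extPiece hf G p j, hA, fun x => ?_⟩
  have hs : Summable fun j => extPiece G p f j x := Summable.of_norm_bounded (IsDyadic.summable hr
    A) fun j => by
      simpa using hA j 0 (Nat.zero_le _) x
  have h2 : coneExt G p f x = ∑' j, extPiece G p f j x := hs.hasSum.tendsto_sum_nat.limUnder_eq
  rw [h2]; exact hs.hasSum

lemma scale_rpow (j M q : ℕ) : scale j ^ M * (scale j)⁻¹ ^ q = (2 ^ j : ℝ) ^ ((q : ℝ) - M) := by
  rw [scale_inv, scale, inv_pow, Real.rpow_sub (by positivity), rpow_natCast, rpow_natCast,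
    div_eq_mul_inv, mul_comm]

lemma exists_isDyadic_coneExt_of_coneBound (N : ℕ) {M : ℕ} (hM : 0 < M) (p : E) : ∃ C : ℝ, 1 ≤ C ∧ ∀
  (c : ℝ), 1 ≤ c → ∀ (G : Set E), IsConeSet c p G → ∀ (f : E → ℂ) (B : ℝ), ConeBound M B G f →
  IsDyadic M N (C * B) (extPiece G p f) (coneExt G p f) := by
  obtain ⟨C, hC, h⟩ := exists_extPiece_bound_all N M p
  refine ⟨C, hC, fun c hc G hG f B hf => isDyadic_coneExt hf.bddMeas (mod_cast hM) fun j i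
    hi x => ?_⟩
  rw [← scale_rpow, ← mul_assoc]
  exact h c hc G hG f B hf j i hi x

lemma sum_extPiece_sub (hf : BddMeas f) (hg : BddMeas g) (G : Set E) (p : E) (J : ℕ) (x : E) : ∑ i ∈
  range J, extPiece G p (fun x => f x - g x) i x = ∑ i ∈ range J, extPiece G p f i x - ∑ i ∈ range
  J, extPiece G p g i x := by
  rw [← sum_sub_distrib]
  refine sum_congr rfl fun i _ => ?_
  have h1 := extPiece_add hf (hg.smul (-1)) G p i x
  rw [extPiece_const_mul] at h1
  simpa [← sub_eq_add_neg] using h1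

lemma exists_forall_dist_lt {Y : ℕ → Type*} [∀ l, PseudoMetricSpace (Y l)] {F : ∀ l, E → Y l}
  (hF : ∀ l ≤ k, UniformContinuousOn (F l) G) {ε : ℝ} (hε : 0 < ε) : ∃ δ > 0, ∀ l ≤ k, ∀ x ∈ G,
  ∀ y ∈ G, dist x y < δ → dist (F l x) (F l y) < ε := by
  choose! δ hδ h using fun l hl => uniformContinuousOn_iff.1 (hF l hl) ε hε
  refine ⟨(range (k + 1)).inf' Finset.nonempty_range_add_one δ, ?_, fun l hl x hx y hy hxy =>
    h l hl x hx y hy (hxy.trans_le (Finset.inf'_le _ (mem_range.2 (Nat.lt_succ_of_le hl))))⟩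
  rw [gt_iff_lt, Finset.lt_inf'_iff]
  exact fun l hl => hδ l (Nat.lt_succ_iff.1 (mem_range.1 hl))

lemma exists_coneBound_approx (hc : 1 ≤ c) (hG : IsConeSet c p G) (hf : ConeBound k B G f) (hu : ∀ l
  ≤ k, UniformContinuousOn (∇ l f) G) {ε : ℝ} (hε : 0 < ε) : ∃ g : E → ℂ, ConeBound k B G g ∧ (∃ B',
  ConeBound (k + 1) B' G g) ∧ ConeBound k ε G (fun x => g x - f x) := by
  obtain ⟨δ, hδ, h⟩ := exists_forall_dist_lt hu hε
  set P := ‖p‖ + 1 with hP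
  have hP0 : 0 < P := by positivity
  set t := δ / (2 * P) with ht'
  have ht : 0 < t := by positivity
  have hsees : ∀ x ∈ G, Sees p t G x := fun x hx =>
    hG.sees t ht x (self_subset_thickening (by positivity) G hx)
  obtain ⟨hfm, B₀, hB₀⟩ := hf.bddMeas
  have hsm := hf.bddMeas.contDiff_avg p ht
  have hbm := hf.bddMeas.bddMeas_avg p ht
  have hfl : ∀ l ≤ k, ContDiffOn ℝ l f G := fun l hl => (hf.mono hl).contDiffOn
  refine ⟨avg p t f, ⟨hbm, hsm.contDiffOn.of_le (nat_le_infty k), hf.nonneg, fun l hl z hz => ?_⟩, ?_,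
    ⟨hbm.sub hf.bddMeas, (hsm.contDiffOn.of_le (nat_le_infty k)).sub hf.contDiffOn, hε.le, fun l hl
    z hz => ?_⟩⟩
  · rw [iterD_avg hG.isOpen l (hfl l hl) (hsees z hz)]
    exact norm_avg_le (hsees z hz) (hf.bound l hl)
  · obtain ⟨C, hC, h1⟩ := exists_forall_le (k + 1) fun q => bumpConst E q * B₀ * t⁻¹ ^ q
    exact ⟨C, hbm, hsm.contDiffOn.of_le (nat_le_infty _), by linarith, fun l hl z _ =>
      (norm_iterD_avg_le l p ht hfm hB₀ z).trans (h1 l hl)⟩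
  · have hcl : ContDiffAt ℝ l f z := (hfl l hl).contDiffAt (hG.isOpen.mem_nhds hz)
    rw [fun_iteratedFDeriv_sub_apply (hsm.contDiffAt.of_le (nat_le_infty l)) hcl, iterD_avg
      hG.isOpen l (hfl l hl) (hsees z hz)]
    refine norm_avg_sub_le hG.isOpen (hsees z hz) (continuousOn_iterD hG.isOpen (hfl l hl)) fun y hy
      => ?_
    rw [← dist_eq_norm]
    refine (h l hl _ (hsees z hz y hy) z hz ?_).le
    rw [dist_self_add_left]
    calc _ ≤ t * P := norm_smul_add_le ht.le hy
      _ = δ / 2 := by rw [ht']; field_simp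
      _ < δ := by linarith

lemma exists_ckBound_coneExt (k : ℕ) (p : E) : ∃ C : ℝ, 1 ≤ C ∧
    ∀ (c : ℝ), 1 ≤ c → ∀ (G : Set E), IsConeSet c p G → ∀ (f : E → ℂ) (B : ℝ), ConeBound k B G f →
      (∀ l ≤ k, UniformContinuousOn (∇ l f) G) →
      CkBound k (C * B) (coneExt G p f) ∧
      ∀ x, Tendsto (fun J : ℕ => ∑ i ∈ range J, extPiece G p f i x) atTop
        (𝓝 (coneExt G p f x)) := by
  obtain ⟨C, hC, hsum⟩ := exists_sum_extPiece_bound k p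
  obtain ⟨C₁, -, hdy⟩ := exists_isDyadic_coneExt_of_coneBound (k + 1) (Nat.succ_pos k) p
  refine ⟨C, hC, fun c hc G hG f B hf hu => ?_⟩
  have hB0 := hf.nonneg
  have hreg : ∀ g B' ε, ConeBound (k + 1) B' G g → ConeBound k ε G g →
      CkBound k (C * ε) (coneExt G p g) ∧ ∀ x, Tendsto
        (fun J : ℕ => ∑ i ∈ range J, extPiece G p g i x) atTop (𝓝 (coneExt G p g x)) := by
    intro g B' ε hg hgε
    have hd := hdy c hc G hG g B' hg
    obtain ⟨h1, h2⟩ := hd.hasSum_iterD (k := k) (Nat.le_succ k) (by push_cast; linarith)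
    refine ⟨⟨h1.1, fun i hi x => ?_⟩, fun x => (hd.hasSum x).tendsto_sum_nat⟩
    refine le_of_tendsto ((h2 i hi x).tendsto_sum_nat.norm) (Eventually.of_forall fun J => ?_)
    rw [← iteratedFDeriv_fun_sum_apply fun j _ =>
      ((contDiff_extPiece hg.bddMeas G p j).of_le (nat_le_infty i)).contDiffAt]
    exact hsum c hc G hG g ε hgε J i hi x
  choose g hg1 hg2 hg3 using fun n : ℕ =>
    exists_coneBound_approx hc hG hf hu (show (0 : ℝ) < (1 / 2) ^ n by positivity)
  choose Bn hBn using hg2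
  have hgn := fun n => hreg (g n) (Bn n) B (hBn n) (hg1 n)
  have hdiff : ∀ n, ConeBound k ((1 / 2) ^ (n + 1) + (1 / 2) ^ n) G fun x => g (n + 1) x - g n x :=
    fun n => by simpa using (hg3 (n + 1)).sub hG.isOpen (hg3 n)
  have hdiff' := fun n => (hBn (n + 1)).sub hG.isOpen (hBn n)
  have hlin : ∀ n x, coneExt G p (fun x => g (n + 1) x - g n x) x =
      coneExt G p (g (n + 1)) x - coneExt G p (g n) x := by
    intro n x
    refine tendsto_nhds_unique ((hreg _ _ _ (hdiff' n) (hdiff n)).2 x) ?_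
    simp only [sum_extPiece_sub (hg1 _).bddMeas (hg1 _).bddMeas]
    exact ((hgn _).2 x).sub ((hgn _).2 x)
  set e : ℕ → E → ℂ := fun n x => coneExt G p (g (n + 1)) x - coneExt G p (g n) x with he
  have hce : ∀ n, CkBound k (C * ((1 / 2) ^ (n + 1) + (1 / 2) ^ n)) (e n) := by
    intro n
    have := (hreg _ _ _ (hdiff' n) (hdiff n)).1
    rwa [show coneExt G p (fun x => g (n + 1) x - g n x) = e n from funext (hlin n)] at this
  have hsm : Summable fun n : ℕ => C * ((1 / 2 : ℝ) ^ (n + 1) + (1 / 2) ^ n) :=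
    (((summable_nat_add_iff 1).2 summable_geometric_two).add summable_geometric_two).mul_left C
  have hes : ∀ x, Summable fun n => e n x := fun x =>
    Summable.of_norm_bounded hsm fun n => (hce n).norm_le x
  set F : E → ℂ := fun x => coneExt G p (g 0) x + ∑' n, e n x with hF
  obtain ⟨hF1, hF2⟩ := hasSum_iterD (fun n => (hce n).1)
    (fun n i hi x => (hce n).2 i hi x) hsm fun x => (hes x).hasSum
  have htele : ∀ n x, coneExt G p (g 0) x + ∑ i ∈ range n, e i x = coneExt G p (g n) x := by
    intro n x
    simp only [he]
    rw [Finset.sum_range_sub (fun n => coneExt G p (g n) x)]; ring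
  have hFn : ∀ x, Tendsto (fun n => coneExt G p (g n) x) atTop (𝓝 (F x)) := fun x => by
    rw [show (fun n => coneExt G p (g n) x) = fun n => coneExt G p (g 0) x +
      ∑ i ∈ range n, e i x from funext fun n => (htele n x).symm]
    exact (hes x).hasSum.tendsto_sum_nat.const_add _
  have hlim : ∀ x, Tendsto (fun J : ℕ => ∑ i ∈ range J, extPiece G p f i x) atTop
      (𝓝 (F x)) := by
    intro x
    rw [Metric.tendsto_atTop]
    intro ε hε
    have h0 : Tendsto (fun n : ℕ => C * (1 / 2 : ℝ) ^ n) atTop (𝓝 0) := by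
      simpa using (tendsto_pow_atTop_nhds_zero_of_lt_one (by norm_num)
        (by norm_num : (1 / 2 : ℝ) < 1)).const_mul C
    obtain ⟨n, hn1, hn2⟩ := ((h0.eventually (gt_mem_nhds (show 0 < ε / 3 by positivity))).and
      ((Metric.tendsto_nhds.1 (hFn x)) (ε / 3) (by positivity))).exists
    obtain ⟨J₀, hJ₀⟩ := Metric.tendsto_atTop.1 ((hgn n).2 x) (ε / 3) (by positivity)
    refine ⟨J₀, fun J hJ => ?_⟩
    have h1 := hJ₀ J hJ
    have h2 := hsum c hc G hG _ _ (hg3 n) J 0 (Nat.zero_le _) x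
    rw [norm_iteratedFDeriv_zero, sum_extPiece_sub (hg1 n).bddMeas hf.bddMeas,
      ← dist_eq_norm, dist_comm] at h2
    have := dist_triangle4 (∑ i ∈ range J, extPiece G p f i x)
      (∑ i ∈ range J, extPiece G p (g n) i x) (coneExt G p (g n) x) (F x)
    linarith
  have hext : coneExt G p f = F := funext fun x => (hlim x).limUnder_eq
  refine ⟨?_, fun x => by rw [hext]; exact hlim x⟩
  rw [hext]
  have hF0 := (hgn 0).1.1
  refine ⟨hF0.add hF1.1, fun i hi x => ?_⟩
  have hadd : ∇ i F x = ∇ i (coneExt G p (g 0)) x +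
      ∇ i (fun x => ∑' n, e n x) x :=
    fun_iteratedFDeriv_add_apply (hF0.contDiffAt.of_le (mod_cast hi))
      (hF1.1.contDiffAt.of_le (mod_cast hi))
  have ht := ((hF2 i hi x).tendsto_sum_nat.const_add
    (∇ i (coneExt G p (g 0)) x)).norm
  rw [← hadd] at ht
  refine le_of_tendsto ht (Eventually.of_forall fun n => ?_)
  have hei : ∀ j, ContDiffAt ℝ i (e j) x := fun j =>
    (hce j).1.contDiffAt.of_le (mod_cast hi)
  rw [← iteratedFDeriv_fun_sum_apply fun j _ => hei j, ← fun_iteratedFDeriv_add_apply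
    (hF0.contDiffAt.of_le (mod_cast hi)) (ContDiffAt.sum fun j _ => hei j)]
  exact le_of_eq_of_le (congrArg (fun φ => ‖∇ i φ x‖) (funext (htele n)))
    ((hgn n).1.2 i hi x)

variable {W : Type} [NormedAddCommGroup W] [NormedSpace ℝ W]

lemma avg_reflect (p : E) (t : ℝ) (f : E → W) (x z : E) : avg p t (fun w => f ((2 : ℝ) • (x + t • p)
  - w)) z = avg p t f ((2 : ℝ) • x - z) := by
  rw [avg, avg, ← integral_neg_eq_self]
  refine integral_congr_ae (Eventually.of_forall fun y => ?_)
  simp only [stdBump_neg]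
  congr 2
  simp only [smul_add, smul_neg, two_smul]
  abel

lemma iterD_two_reflect {f : E → W} (hf : ContDiff ℝ 2 f) (a x : E) : ∇ 2 (fun z => f (a - z)) x = ∇
  2 f (a - x) := by
  have h1 : (fun z => f (a - z)) = (fun z => f (a + z)) ∘ (-ContinuousLinearMap.id ℝ E) := by
    ext z; simp [sub_eq_add_neg]
  have h2 : ContDiff ℝ 2 (fun z => f (a + z)) := hf.comp (contDiff_const.add contDiff_id)
  rw [h1, ContinuousLinearMap.iteratedFDeriv_comp_right (-ContinuousLinearMap.id ℝ E) h2 x (i := 2)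
    le_rfl, iteratedFDeriv_comp_add_left]
  ext v
  rw [ContinuousMultilinearMap.compContinuousLinearMap_apply]
  have h3 : (fun i => (-ContinuousLinearMap.id ℝ E) (v i)) = fun i => (-1 : ℝ) • v i := by
    ext i; simp
  rw [h3, ContinuousMultilinearMap.map_smul_univ]
  simp [sub_eq_add_neg]

lemma norm_iterD_two_avg_le [CompleteSpace W] (ht : 0 < t) (hO : IsOpen O) {F : E → W} (hF :
  ContinuousOn F O) (hB : ∀ z ∈ O, ‖F z‖ ≤ B) {β : ℝ} (hA0 : 0 ≤ A) (hβ : 0 ≤ β) (hA : ∀ z h, h ≠ 0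
  → z ∈ O → z + h ∈ O → z + (2 : ℝ) • h ∈ O → ‖F z + F (z + (2 : ℝ) • h) - (2 : ℝ) • F (z + h)‖ ≤ A
  * ‖h‖ ^ β) (hx : ∀ y ∈ closedBall (0 : E) 2, x + t • (p + y) ∈ O) : ‖∇ 2 (avg p t F) x‖ ≤
  bumpConst E 2 * (A * (2 * t) ^ β) * t⁻¹ ^ 2 := by
  set a := x + t • p with ha
  set Q := ball a (2 * t) with hQ
  have hQo : IsOpen Q := isOpen_ball
  have hQO : Q ⊆ O := by
    intro z hz
    have := hx (t⁻¹ • (z - a)) (by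
      rw [mem_closedBall_zero_iff, norm_smul, norm_inv, norm_of_nonneg ht.le, inv_mul_le_iff₀ ht, ←
        dist_eq_norm]
      linarith [mem_ball.1 hz])
    rwa [smul_add, smul_smul, mul_inv_cancel₀ ht.ne', one_smul, ← add_assoc, ← ha, add_sub_cancel]
      at this
  have hQs : ∀ z ∈ ball x t, Sees p t Q z := by
    intro z hz y hy
    rw [mem_closedBall_zero_iff] at hy
    rw [hQ, mem_ball, dist_eq_norm, ha]
    have e : z + t • (p + y) - (x + t • p) = (z - x) + t • y := by rw [smul_add]; abel
    rw [e]
    refine (norm_add_le _ _).trans_lt ?_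
    rw [norm_smul, norm_of_nonneg ht.le]
    have := mem_ball_iff_norm.1 hz
    nlinarith
  have hrefl : ∀ z ∈ Q, (2 : ℝ) • a - z ∈ Q := by
    intro z hz
    rw [hQ, mem_ball_iff_norm] at hz ⊢
    rw [show (2 : ℝ) • a - z - a = -(z - a) by rw [two_smul]; abel, norm_neg]
    exact hz
  have hFr : ContinuousOn (fun z => F ((2 : ℝ) • a - z)) Q := (hF.mono hQO).comp (by fun_prop) hrefl
  set Ψ : E → W := fun z => F z + F ((2 : ℝ) • a - z) - (2 : ℝ) • F a with hΨ
  have hΨc : ContinuousOn Ψ Q := ((hF.mono hQO).add hFr).sub continuousOn_const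
  have hΨb : ∀ z ∈ Q, ‖∇ 0 Ψ z‖ ≤ A * (2 * t) ^ β := by
    intro z hz
    rw [norm_iteratedFDeriv_zero]
    rcases eq_or_ne (a - z) 0 with h0 | h0
    · rw [sub_eq_zero] at h0
      simp only [hΨ, ← h0, two_smul]
      rw [show a + a - a = a by abel, sub_self, norm_zero]; positivity
    · have h1 := hA z (a - z) h0 (hQO hz) (by
        rw [add_sub_cancel]; exact hQO (mem_ball_self (by positivity))) (by
        rw [show z + (2 : ℝ) • (a - z) = (2 : ℝ) • a - z by rw [smul_sub, two_smul, two_smul]; abel]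
        exact hQO (hrefl z hz))
      rw [show z + (2 : ℝ) • (a - z) = (2 : ℝ) • a - z by
        rw [smul_sub, two_smul, two_smul]; abel, add_sub_cancel] at h1
      refine h1.trans ?_
      gcongr
      rw [← dist_eq_norm, dist_comm]
      exact (mem_ball.1 hz).le
  have hB0 : 0 ≤ B := (norm_nonneg _).trans (hB a (hQO (mem_ball_self (by positivity))))
  set K : E → W := avg p t (O.indicator F) with hK
  have hKs : ContDiff ℝ 2 K := by
    refine (contDiff_avg p ht.ne' ((aestronglyMeasurable_indicator_iff hO.measurableSet).2
      (hF.aestronglyMeasurable hO.measurableSet)) (B := B) fun z => ?_).of_le (nat_le_infty 2)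
    by_cases hz : z ∈ O
    · rw [indicator_of_mem hz]; exact hB z hz
    · simpa [hz] using hB0
  have hev : avg p t F =ᶠ[𝓝 x] K := by
    filter_upwards [ball_mem_nhds x ht] with z hz
    exact (avg_indicator (fun y hy => hQO (hQs z hz y hy)) F).symm
  have hH : avg p t Ψ =ᶠ[𝓝 x] fun z => K z + K ((2 : ℝ) • x - z) - (2 : ℝ) • F a := by
    filter_upwards [ball_mem_nhds x ht] with z hz
    have hz' : (2 : ℝ) • x - z ∈ ball x t := by
      rw [mem_ball_iff_norm] at hz ⊢
      rw [show (2 : ℝ) • x - z - x = -(z - x) by rw [two_smul]; abel, norm_neg]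
      exact hz
    have i1 := integrable_bump_smul hQo (hQs z hz) (hF.mono hQO)
    have i2 := integrable_bump_smul hQo (hQs z hz) hFr
    have e1 : avg p t Ψ z = avg p t F z + avg p t (fun z => F ((2 : ℝ) • a - z)) z - (2 : ℝ) • F a
      := by
      simp only [avg, hΨ, smul_sub, smul_add (stdBump E _)]
      rw [integral_sub (by exact i1.add i2) (integrable_stdBump.smul_const _), integral_add
        (by exact i1) (by exact i2), integral_smul_const, integral_stdBump, one_smul]
    rw [e1, ha, avg_reflect, hK, avg_indicator (fun y hy => hQO (hQs z hz y hy)), avg_indicator (fun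
      y hy => hQO (hQs _ hz' y hy))]
  have h2 : ∇ 2 (avg p t Ψ) x = (2 : ℝ) • ∇ 2 K x := by
    rw [(hH.iteratedFDeriv ℝ 2).eq_of_nhds]
    have hr : ContDiff ℝ 2 fun z => K ((2 : ℝ) • x - z) := hKs.comp (contDiff_const.sub contDiff_id)
    have e2 : ∇ 2 (fun _ : E => (2 : ℝ) • F a) x = 0 := by
      rw [iteratedFDeriv_const_of_ne (by norm_num)]; rfl
    rw [fun_iteratedFDeriv_sub_apply (hKs.add hr).contDiffAt contDiffAt_const,
      fun_iteratedFDeriv_add_apply hKs.contDiffAt hr.contDiffAt, iterD_two_reflect hKs, e2,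
      sub_zero, two_smul, two_smul, add_sub_cancel_right]
  have h3 := norm_iterD_avg_of_contDiffOn_le 0 2 ht hQo (contDiffOn_zero.2 hΨc) (by positivity) hΨb (hQs x (mem_ball_self ht))
  rw [zero_add, h2, norm_smul, Real.norm_ofNat] at h3
  rw [(hev.iteratedFDeriv ℝ 2).eq_of_nhds]
  linarith [norm_nonneg (∇ 2 K x)]

/-- The data of a `C^k` function whose `k`-th derivatives satisfy a Zygmund condition. -/
structure ZygmundOn (k : ℕ) (β A : ℝ) (D : Set E) (u : E → ℂ) : Prop where
  contDiffOn : ContDiffOn ℝ k u D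
  bound : ∀ i ≤ k, ∀ x ∈ D, ‖∇ i u x‖ ≤ A
  second : ∀ x h : E, h ≠ 0 → x ∈ D → x + h ∈ D → x + (2 : ℝ) • h ∈ D →
    ‖∇ k u x + ∇ k u (x + (2 : ℝ) • h) -
      (2 : ℝ) • ∇ k u (x + h)‖ ≤ A * ‖h‖ ^ β

/-- The smooth part of the decomposition of a Zygmund function at the scale `t`. -/
def smoothPart (p : E) (t : ℝ) (u : E → ℂ) (x : E) : ℂ := (2 : ℝ) • avg p t u x - avg p (2 * t) u x

lemma BddMeas.contDiff_smoothPart (hu : BddMeas u) (p : E) (ht : 0 < t) :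
  ContDiff ℝ ∞ (smoothPart p t u) :=
  ((hu.contDiff_avg p ht).const_smul (2 : ℝ)).sub (hu.contDiff_avg p (by positivity))

lemma BddMeas.iterD_smoothPart (hu : BddMeas u) (p : E) (ht : 0 < t) (l : ℕ) (x : E) :
  ∇ l (smoothPart p t u) x = (2 : ℝ) • ∇ l (avg p t u) x - ∇ l (avg p (2 * t) u) x := by
  have h : ∀ s, 0 < s → ContDiffAt ℝ l (avg p s u) x := fun s hs =>
    ((hu.contDiff_avg p hs).of_le (nat_le_infty l)).contDiffAt
  have e : smoothPart p t u = (2 : ℝ) • avg p t u - avg p (2 * t) u := rfl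
  have h2 : ContDiffAt ℝ l ((2 : ℝ) • avg p t u) x := (h t ht).const_smul (2 : ℝ)
  rw [e, iteratedFDeriv_sub_apply h2 (h _ (by positivity)), iteratedFDeriv_const_smul_apply (h t
    ht)]

/-- All points near the ray in the direction `p` are in `D`. -/
def SeesWide (p : E) (t : ℝ) (D : Set E) (x : E) : Prop := x ∈ D ∧ ∀ s, 0 < s → s ≤ 2 * t → ∀ y ∈
  closedBall (0 : E) 2, x + s • (p + y) ∈ D

lemma SeesWide.sees (h : SeesWide p t D x) (hs : 0 < s) (hst : s ≤ 2 * t) : Sees p s D x := fun y hy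
  =>
  h.2 s hs hst y (closedBall_subset_closedBall (by norm_num) hy)

lemma rpow_le_rpow_sub_two {β : ℝ} (ht : 0 < t) (ht1 : t ≤ 1) (hβ1 : β ≤ 1) {q : ℕ} (hq : q ≤ 1) :
  t⁻¹ ^ q ≤ t ^ (β - 2) := by
  rw [← rpow_natCast, rpow_neg_exp ht]
  refine Real.rpow_le_rpow_of_exponent_ge ht ht1 ?_
  have : (q : ℝ) ≤ 1 := by exact_mod_cast hq
  linarith

variable (E) in
lemma exists_smoothPart_bound : ∃ C : ℝ, 1 ≤ C ∧ ∀ (k : ℕ) (β : ℝ), 0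
  < β → β ≤ 1 → ∀ (D : Set E), IsOpen D → ∀ (p : E) (t : ℝ), 0 < t → t ≤ 1 → ∀ (u : E → ℂ) (A : ℝ),
  0 ≤ A → ZygmundOn k β A D u → BddMeas u → ∀ x, SeesWide p t D x → ∀ l ≤ k + 2, ‖∇ l (smoothPart p
  t u) x‖ ≤ C * t ^ (β - 2) * A := by
  have hb0 := bumpConst_nonneg (E := E) 0
  have hb1 := bumpConst_nonneg (E := E) 1
  have hb2 := bumpConst_nonneg (E := E) 2
  refine ⟨1 + 3 * bumpConst E 0 + 3 * bumpConst E 1 + 12 * bumpConst E 2,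
    by linarith, fun k β hβ hβ1 D hD p t ht ht1 u A hA hu hum x hx l hl => ?_⟩
  have h1 : ‖∇ l (smoothPart p t u) x‖ ≤ 2 * ‖∇ l (avg p t u) x‖ + ‖∇ l (avg p (2 * t) u) x‖ := by
    rw [hum.iterD_smoothPart p ht]
    exact (norm_sub_le _ _).trans_eq (by rw [norm_smul, Real.norm_ofNat])
  have key : ∀ s, t ≤ s → s ≤ 2 * t → ‖∇ l (avg p s u) x‖ ≤ (bumpConst E 0 + bumpConst E 1 + 4 *
    bumpConst E 2) * t ^ (β - 2) * A := by
    intro s hts hs2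
    have hs : 0 < s := ht.trans_le hts
    have hinv : s⁻¹ ≤ t⁻¹ := inv_anti₀ ht hts
    have hT : 0 < t ^ (β - 2) := by positivity
    have hlow : ∀ i q, i ≤ k → q ≤ 1 → i + q = l → ‖∇ l (avg p s u) x‖ ≤ bumpConst E q * t ^ (β - 2)
      * A := by
      rintro i q hi hq rfl
      refine (norm_iterD_avg_of_contDiffOn_le i q hs hD (hu.contDiffOn.of_le (mod_cast hi))
        hA (hu.bound i hi) (hx.sees hs hs2)).trans ?_
      have h3 : s⁻¹ ^ q ≤ t ^ (β - 2) := (pow_le_pow_left₀ (by positivity) hinv q).trans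
        (rpow_le_rpow_sub_two ht ht1 hβ1 hq)
      have h4 := bumpConst_nonneg (E := E) q
      calc _ ≤ bumpConst E q * A * t ^ (β - 2) := by gcongr
        _ = _ := by ring
    rcases Nat.lt_or_ge k l with hkl | hkl
    · rcases Nat.lt_or_ge (k + 1) l with hkl' | hkl'
      · obtain rfl : l = k + 2 := by omega
        have hev : ∇ k (avg p s u) =ᶠ[𝓝 x] avg p s (∇ k u) := by
          filter_upwards [(isOpen_sees p s hD).mem_nhds (hx.sees hs hs2)] with z hz
          exact iterD_avg hD k hu.contDiffOn hz
        rw [norm_iterD_add, (hev.iteratedFDeriv ℝ 2).eq_of_nhds]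
        refine (norm_iterD_two_avg_le hs hD (continuousOn_iterD hD hu.contDiffOn) (hu.bound k
          le_rfl) hA hβ.le hu.second (fun y hy => hx.2 s hs hs2 y hy)).trans ?_
        have h5 : (2 * s) ^ β ≤ 4 * t ^ β := by
          calc (2 * s) ^ β ≤ (4 * t) ^ β := rpow_le_rpow (by positivity) (by linarith) hβ.le
            _ = 4 ^ β * t ^ β := mul_rpow (by norm_num) ht.le
            _ ≤ 4 ^ (1 : ℝ) * t ^ β := by gcongr; norm_num
            _ = _ := by rw [Real.rpow_one]
        have h6 : t ^ β * t⁻¹ ^ 2 = t ^ (β - 2) := by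
          rw [← rpow_natCast, rpow_neg_exp ht, ← rpow_add ht]; norm_num; rfl
        calc _ ≤ bumpConst E 2 * (A * (4 * t ^ β)) * t⁻¹ ^ 2 := by gcongr
          _ = 4 * bumpConst E 2 * (t ^ β * t⁻¹ ^ 2) * A := by ring
          _ ≤ _ := by rw [h6]; gcongr; linarith
      · refine (hlow k 1 le_rfl le_rfl (by omega)).trans ?_
        gcongr; linarith
    · refine (hlow l 0 hkl (by norm_num) (by omega)).trans ?_
      gcongr; linarith
  have k1 := key t le_rfl (by linarith)
  have k2 := key (2 * t) (by linarith) le_rfl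
  have hTA : 0 ≤ t ^ (β - 2) * A := by positivity
  calc _ ≤ 3 * ((bumpConst E 0 + bumpConst E 1 + 4 * bumpConst E 2) * t ^ (β - 2) * A) := by
        linarith
    _ ≤ _ := by nlinarith

lemma contDiffAt_sub_smoothPart (hD : IsOpen D) (ht : 0 < t) (hu : ContDiffOn ℝ k u D) (hum :
  BddMeas u) (hx : x ∈ D) : ContDiffAt ℝ k (fun z => u z - smoothPart p t u z) x :=
  (hu.contDiffAt (hD.mem_nhds hx)).sub
    ((hum.contDiff_smoothPart p ht).of_le (nat_le_infty k)).contDiffAt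

lemma norm_sub_smoothPart_le {β : ℝ} (hβ : 0 < β) (hβ1 : β ≤ 1) (hD : IsOpen D) (ht : 0 < t) (ht1 :
  t ≤ 1) (hA : 0 ≤ A) (hu : ZygmundOn k β A D u) (hum : BddMeas u) (hx : SeesWide p t D x) {l : ℕ}
  (hl : l ≤ k) : ‖∇ l (fun z => u z - smoothPart p t u z) x‖ ≤ 2 * (‖p‖ + 1) * t ^ β * A := by
  set P := ‖p‖ + 1 with hP
  have hP1 : 1 ≤ P := by rw [hP]; linarith [norm_nonneg p]
  have hul : ContDiffOn ℝ l u D := hu.contDiffOn.of_le (mod_cast hl)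
  have hs1 := hx.sees ht (by linarith)
  have hs2 := hx.sees (s := 2 * t) (by positivity) le_rfl
  set w := ∇ l u with hw
  have hwc : ContinuousOn w D := continuousOn_iterD hD hul
  have e1 : ∇ l (fun z => u z - smoothPart p t u z) x = w x - ((2 : ℝ) • avg p t w x - avg p (2 * t)
    w x) := by
    rw [fun_iteratedFDeriv_sub_apply (hul.contDiffAt (hD.mem_nhds hx.1))
      ((hum.contDiff_smoothPart p ht).of_le (nat_le_infty l)).contDiffAt, hum.iterD_smoothPart p ht,
      iterD_avg hD l hul hs1, iterD_avg hD l hul hs2]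
  have i1 := integrable_bump_smul hD hs1 hwc
  have i2 := integrable_bump_smul hD hs2 hwc
  have e2 : w x - ((2 : ℝ) • avg p t w x - avg p (2 * t) w x) = ∫ y, stdBump E y • (w x + w (x + (2
    * t) • (p + y)) - (2 : ℝ) • w (x + t • (p + y))) := by
    simp only [smul_sub, smul_add (stdBump E _), smul_comm _ (2 : ℝ)]
    rw [integral_sub (by exact (integrable_stdBump.smul_const (w x)).add i2)
      (by exact i1.smul (2 : ℝ)), integral_add (by exact integrable_stdBump.smul_const (w x))
      (by exact i2), integral_smul_const, integral_stdBump, one_smul, integral_smul, avg, avg]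
    abel
  rw [e1, e2]
  refine norm_integral_bump_smul_le fun y hy => ?_
  set v := t • (p + y) with hv
  have hvn : ‖v‖ ≤ t * P := norm_smul_add_le ht.le hy
  have hmem : ∀ s : ℝ, 0 ≤ s → s ≤ 2 → x + s • v ∈ D := by
    intro s hs0 hs2
    rcases hs0.lt_or_eq with h | rfl
    · rw [hv, smul_smul]
      exact hx.sees (by positivity) (by nlinarith) y hy
    · simpa using hx.1
  have e3 : (2 * t) • (p + y) = (2 : ℝ) • v := by rw [hv, smul_smul]
  rw [e3]
  have htβ : t ≤ t ^ β := by
    calc t = t ^ (1 : ℝ) := (Real.rpow_one t).symm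
      _ ≤ t ^ β := Real.rpow_le_rpow_of_exponent_ge ht ht1 hβ1
  rcases hl.lt_or_eq with hlk | rfl
  · have hul1 : ContDiffOn ℝ (l + 1 : ℕ) u D := hu.contDiffOn.of_le (mod_cast hlk)
    have hdiff : ∀ z ∈ D, DifferentiableAt ℝ w z := fun z hz =>
      ((hul1.contDiffAt (hD.mem_nhds hz)).iteratedFDeriv_right (m := 1) (i := l)
        (by push_cast; rw [add_comm])).differentiableAt one_ne_zero
    have hbd : ∀ z ∈ D, ‖fderiv ℝ w z‖ ≤ A := fun z hz => by
      rw [norm_iterD_one_eq, hw, ← norm_iterD_add]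
      exact hu.bound (l + 1) hlk z hz
    have hseg : ∀ a : ℝ, 0 ≤ a → a ≤ 1 → ‖w (x + (a + 1) • v) - w (x + a • v)‖ ≤ A * ‖v‖ := by
      intro a ha ha1
      have hsub : ∀ z ∈ segment ℝ (x + a • v) (x + (a + 1) • v), z ∈ D := by
        rintro z ⟨b, c, hb, hc, hbc, rfl⟩
        have e5 : b • (x + a • v) + c • (x + (a + 1) • v) = x + (a + c) • v := by
          have hb' : b = 1 - c := by linarith
          rw [hb']; module
        rw [e5]
        exact hmem _ (by positivity) (by linarith)
      have := (convex_segment (x + a • v) (x + (a + 1) • v)).norm_image_sub_le_of_norm_fderiv_le (𝕜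
        := ℝ) (f := w) (C := A) (fun z hz => hdiff z (hsub z hz)) (fun z hz => hbd z (hsub z hz))
        (left_mem_segment ℝ _ _) (right_mem_segment ℝ _ _)
      refine this.trans (le_of_eq ?_)
      congr 2; module
    have h1 := hseg 0 le_rfl zero_le_one
    have h2 := hseg 1 zero_le_one le_rfl
    rw [zero_smul, zero_add, one_smul, add_zero] at h1
    rw [one_smul, one_add_one_eq_two] at h2
    have e4 : w x + w (x + (2 : ℝ) • v) - (2 : ℝ) • w (x + v) = (w (x + (2 : ℝ) • v) - w (x + v)) -
      (w (x + v) - w x) := by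
      rw [two_smul ℝ (w (x + v))]; abel
    rw [e4]
    have hAv : A * ‖v‖ ≤ A * (t ^ β * P) := by gcongr; exact hvn.trans (by gcongr)
    calc _ ≤ A * ‖v‖ + A * ‖v‖ := (norm_sub_le _ _).trans (add_le_add h2 h1)
      _ ≤ A * (t ^ β * P) + A * (t ^ β * P) := add_le_add hAv hAv
      _ = _ := by ring
  · rcases eq_or_ne v 0 with h0 | h0
    · rw [h0, smul_zero, add_zero, two_smul, sub_self, norm_zero]; positivity
    · have h1 := hmem 1 zero_le_one one_le_two
      rw [one_smul] at h1
      refine (hu.second x v h0 hx.1 h1 (hmem 2 zero_le_two le_rfl)).trans ?_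
      have h5 : ‖v‖ ^ β ≤ t ^ β * P := by
        calc ‖v‖ ^ β ≤ (t * P) ^ β := rpow_le_rpow (norm_nonneg _) hvn hβ.le
          _ = t ^ β * P ^ β := mul_rpow ht.le (by linarith)
          _ ≤ t ^ β * P ^ (1 : ℝ) := by gcongr
          _ = _ := by rw [Real.rpow_one]
      calc _ ≤ A * (t ^ β * P) := by gcongr
        _ ≤ _ := by
          have : 0 ≤ A * (t ^ β * P) := by positivity
          linarith

/-- The function `χ u`, extended by zero outside `D`. -/
def localize (χ : E → ℝ) (D : Set E) (u : E → ℂ) (x : E) : ℂ := χ x • D.indicator u x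

/-- Near the support of `χ`, the set `D` coincides with the cone set `G`. -/
structure PieceFit (c : ℝ) (p : E) (G D : Set E) (χ : E → ℝ) (ρ : ℝ) : Prop where
  one_le : 1 ≤ c
  cone : IsConeSet c p G
  isOpen : IsOpen D
  mem_iff : ∀ x ∈ tsupport χ, ∀ z ∈ ball x ρ, z ∈ G ↔ z ∈ D

lemma exists_bound_iterD {V : Type*} [NormedAddCommGroup V] [NormedSpace ℝ V] {χ : E → V} (hχ :
  ContDiff ℝ ∞ χ) (hc : HasCompactSupport χ) (N : ℕ) : ∃ B : ℝ, 1 ≤ B ∧ ∀ i ≤ N, ∀ x, ‖∇ i χ x‖ ≤ B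
  := by
  have h : ∀ i : ℕ, ∃ B : ℝ, ∀ x, ‖∇ i χ x‖ ≤ B := fun i =>
    (hχ.continuous_iteratedFDeriv (nat_le_infty i)).bounded_above_of_compact_support
      (hc.iteratedFDeriv (𝕜 := ℝ) i)
  choose B hB using h
  obtain ⟨C, hC, h1⟩ := exists_forall_le N B
  exact ⟨C, hC, fun i hi x => (hB i x).trans (h1 i hi)⟩

lemma norm_iterD_smul_le_of_contDiffAt {a : E → ℝ} {i : ℕ} {K : ℝ} (ha : ContDiff ℝ i a) (hf :
  ContDiffAt ℝ i f x) (hB : ∀ l ≤ i, ‖∇ l a x‖ ≤ B) (hK : ∀ l ≤ i, ‖∇ l f x‖ ≤ K) : ‖∇ i (fun y => a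
  y • f y) x‖ ≤ 2 ^ i * B * K := by
  obtain ⟨v, hv, hfv⟩ := hf.contDiffOn le_rfl (by simp)
  obtain ⟨O, hOv, hO, hxO⟩ := mem_nhds_iff.1 hv
  exact norm_iterD_smul_le_of_bounds hO hxO ha.contDiffOn (hfv.mono hOv) hB hK

lemma BddMeas.smul_cutoff (hf : BddMeas f) (hχ : ContDiff ℝ ∞ χ) (hc : HasCompactSupport χ) :
  BddMeas fun x => χ x • f x := by
  obtain ⟨hm, B, hB⟩ := hf
  obtain ⟨K, hK, h⟩ := exists_bound_iterD hχ hc 0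
  refine ⟨hχ.continuous.aestronglyMeasurable.smul hm, K * B, fun x => ?_⟩
  rw [norm_smul]
  exact mul_le_mul (by simpa using h 0 le_rfl x) (hB x) (norm_nonneg _) (by linarith)

lemma BddMeas.smoothPart (hf : BddMeas f) (p : E) (ht : 0 < t) : BddMeas (smoothPart p t f) := by
  have e : MoserSmoothing.smoothPart p t f = fun x => 2 * avg p t f x - avg p (2 * t) f x := by
    ext x; simp [MoserSmoothing.smoothPart]
  rw [e]; exact ((hf.bddMeas_avg p ht).smul 2).sub (hf.bddMeas_avg p (by positivity))

lemma bddMeas_indicator (hD : IsOpen D) (hu : ContinuousOn u D) (hB0 : 0 ≤ B) (hB : ∀ x ∈ D, ‖u x‖ ≤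
  B) : BddMeas (D.indicator u) := by
  refine ⟨(aestronglyMeasurable_indicator_iff hD.measurableSet).2 (hu.aestronglyMeasurable
    hD.measurableSet), B, fun x => ?_⟩
  by_cases hx : x ∈ D
  · rw [indicator_of_mem hx]; exact hB x hx
  · simpa [hx] using hB0

lemma coneBound_smul {K : ℝ} (hB1 : 0 ≤ B) (hK0 : 0 ≤ K) (hχ : ContDiff ℝ ∞ χ) (hc :
  HasCompactSupport χ) (hB : ∀ i ≤ k, ∀ x, ‖∇ i χ x‖ ≤ B) (hf : BddMeas f) (hfc : ∀ z ∈ G, z ∈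
  tsupport χ → ContDiffAt ℝ k f z) (hfb : ∀ z ∈ G, z ∈ tsupport χ → ∀ l ≤ k, ‖∇ l f z‖ ≤ K) :
  ConeBound k (2 ^ k * B * K) G fun x => χ x • f x := by
  have hz : ∀ z, z ∉ tsupport χ → (fun x => χ x • f x) =ᶠ[𝓝 z] fun _ => 0 := fun z hz => by
    filter_upwards [notMem_tsupport_iff_eventuallyEq.1 hz] with y hy
    rw [hy, Pi.zero_apply, zero_smul]
  refine ⟨hf.smul_cutoff hχ hc, fun z hzG => ?_, by positivity, fun l hl z hzG => ?_⟩
  · by_cases h : z ∈ tsupport χ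
    · exact ((hχ.of_le (nat_le_infty k)).contDiffAt.smul (hfc z hzG h)).contDiffWithinAt
    · exact (contDiffAt_const.congr_of_eventuallyEq (hz z h)).contDiffWithinAt
  · by_cases h : z ∈ tsupport χ
    · refine (norm_iterD_smul_le_of_contDiffAt (hχ.of_le (nat_le_infty l)) ((hfc z hzG h).of_le
        (mod_cast hl)) (fun i hi => hB i (hi.trans hl) z) (fun i hi => hfb z hzG h i
        (hi.trans hl))).trans ?_
      gcongr; norm_num
    · rw [iterD_eq_zero_of_eventuallyEq (hz z h), norm_zero]; positivity

lemma ZygmundOn.of_zygmundNorm_le (hA : 0 ≤ A) (h : zygmundNorm r D u ≤ ofReal A) : ZygmundOn (zk r)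
  (r - zk r) A D u := by
  obtain ⟨h1, h2, h3⟩ := MoserSmoothing.of_zygmundNorm_le hA h
  exact ⟨h1, h2, h3⟩

lemma eqOn_indicator (D : Set E) (u : E → ℂ) : EqOn (D.indicator u) u D := fun _ hx =>
  indicator_of_mem hx u

lemma PieceFit.coneBound_localize {ρ : ℝ} (hfit : PieceFit c p G D χ ρ) (hρ : 0 < ρ) (hB0 : 0 ≤ B)
  (hA : 0 ≤ A) (hχ : ContDiff ℝ ∞ χ) (hc : HasCompactSupport χ) (hB : ∀ i ≤ k, ∀ x, ‖∇ i χ x‖ ≤ B)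
  (hu : ContDiffOn ℝ k u D) (hb : ∀ i ≤ k, ∀ x ∈ D, ‖∇ i u x‖ ≤ A) :
  ConeBound k (2 ^ k * B * A) G (localize χ D u) := by
  have hD := hfit.isOpen
  have hmem : ∀ z ∈ G, z ∈ tsupport χ → z ∈ D := fun z hz hzχ =>
    (hfit.mem_iff z hzχ z (mem_ball_self hρ)).1 hz
  refine coneBound_smul hB0 hA hχ hc hB (bddMeas_indicator hD hu.continuousOn hA fun x hx => by
    simpa using hb 0 (Nat.zero_le _) x hx) (fun z hz hzχ => ?_) fun z hz hzχ l hl => ?_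
  · have hzD := hD.mem_nhds (hmem z hz hzχ)
    exact (hu.contDiffAt hzD).congr_of_eventuallyEq ((eqOn_indicator D u).eventuallyEq_of_mem hzD)
  · rw [eqOn_iterD hD (eqOn_indicator D u) l (hmem z hz hzχ)]
    exact hb l hl z (hmem z hz hzχ)

lemma exists_isDyadic_localize (hr : 0 < r) (N : ℕ) (p : E) (hχ : ContDiff ℝ ∞ χ) (hc :
  HasCompactSupport χ) {ρ : ℝ} (hρ : 0 < ρ) : ∃ C : ℝ, 1 ≤ C ∧ ∀ (c : ℝ) (G D : Set E) (u : E → ℂ)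
  (A : ℝ), PieceFit c p G D χ ρ → 0 ≤ A → zygmundNorm r D u ≤ ofReal A → IsDyadic r N (C * A)
  (extPiece G p (localize χ D u)) (coneExt G p (localize χ D u)) := by
  set k := zk r with hk
  set β := r - k with hβ
  have hβ0 : 0 < β := sub_pos.2 (zk_lt hr)
  have hβ1 : β ≤ 1 := by linarith [le_zk_add_one r]
  set P := ‖p‖ + 1 with hP
  have hP0 : 0 < P := by positivity
  set κ := min 1 (ρ / (16 * P)) with hκ
  have hκ0 : 0 < κ := lt_min one_pos (by positivity)
  have hκ1 : κ ≤ 1 := min_le_left _ _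
  obtain ⟨Bχ, hBχ, hB⟩ := exists_bound_iterD hχ hc (k + 2)
  obtain ⟨C₁, hC₁, h₁⟩ := exists_smoothPart_bound E
  obtain ⟨C₂, hC₂, h₂⟩ := exists_extPiece_bound_all N (k + 2) p
  obtain ⟨C₃, hC₃, h₃⟩ := exists_extPiece_bound_all N k p
  set Q := 2 * (‖(2 : ℝ) • p‖ + 1) with hQ
  have hQ0 : 0 < Q := by positivity
  set C := C₂ * (2 ^ (k + 2) * Bχ * (C₁ * κ ^ (β - 2))) + C₃ * (2 ^ k * Bχ * (Q * κ ^ β)) with hC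
  refine ⟨C + 1, by
    have : 0 ≤ C := by positivity
    linarith, fun c G D u A hfit hA hu => ?_⟩
  have hG := hfit.cone
  have hD := hfit.isOpen
  set U := D.indicator u with hU
  have hzu : ZygmundOn k β A D U := ZygmundOn.of_zygmundNorm_le hA
    (by rwa [zygmundNorm_congr hD (eqOn_indicator D u)])
  have hUm : BddMeas U := by
    have := bddMeas_indicator hD hzu.contDiffOn.continuousOn hA fun x hx => by
      simpa using hzu.bound 0 (Nat.zero_le _) x hx
    rwa [hU, indicator_indicator, inter_self] at this
  have hfm : BddMeas (localize χ D u) := hUm.smul_cutoff hχ hc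
  refine isDyadic_coneExt hfm hr fun j q hq x => ?_
  set s := scale j with hs
  have hs0 : 0 < s := scale_pos j
  have hs1 : s ≤ 1 := scale_le_one j
  set t := κ * s with ht
  have ht0 : 0 < t := by positivity
  have ht1 : t ≤ 1 := by nlinarith
  have htρ : 16 * t * P ≤ ρ := by
    have h1 : t ≤ ρ / (16 * P) := by
      calc t ≤ κ * 1 := mul_le_mul_of_nonneg_left hs1 hκ0.le
        _ ≤ _ := by rw [mul_one]; exact min_le_right _ _
    rw [le_div_iff₀ (by positivity)] at h1
    linarith
  have hwide : ∀ z ∈ G, z ∈ tsupport χ → SeesWide ((2 : ℝ) • p) t D z := by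
    intro z hzG hzχ
    refine ⟨(hfit.mem_iff z hzχ z (mem_ball_self (by nlinarith [mul_pos ht0 hP0]))).1 hzG, fun a ha
      hat y hy => ?_⟩
    have e : z + a • ((2 : ℝ) • p + y) = z + (2 * a) • (p + (1 / 2 : ℝ) • y) := by module
    rw [mem_closedBall_zero_iff] at hy
    have hy' : ‖(1 / 2 : ℝ) • y‖ ≤ 1 := by rw [norm_smul, norm_of_nonneg (by norm_num)]; linarith
    rw [e]
    refine (hfit.mem_iff z hzχ _ ?_).1 (hG.sees (2 * a) (by positivity) z (self_subset_thickening
      (by have := hfit.one_le; positivity) G hzG) _ (by rwa [mem_closedBall_zero_iff]))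
    rw [mem_ball, dist_self_add_left, norm_smul, norm_of_nonneg (by positivity)]
    have hn : ‖p + (1 / 2 : ℝ) • y‖ ≤ P := (norm_add_le _ _).trans (add_le_add le_rfl hy')
    calc 2 * a * ‖p + (1 / 2 : ℝ) • y‖ ≤ 2 * (2 * t) * P := by gcongr
      _ < ρ := by nlinarith [mul_pos ht0 hP0]
  set g : E → ℂ := fun x => χ x • smoothPart ((2 : ℝ) • p) t U x with hg
  set h : E → ℂ := fun x => χ x • (U x - smoothPart ((2 : ℝ) • p) t U x) with hh
  have hgb : ConeBound (k + 2) (2 ^ (k + 2) * Bχ * (C₁ * t ^ (β - 2) * A)) G g := by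
    exact coneBound_smul (by linarith) (by positivity) hχ hc hB (hUm.smoothPart _ ht0) (fun z _ _ =>
      ((hUm.contDiff_smoothPart _ ht0).of_le (nat_le_infty _)).contDiffAt) fun z hzG hzχ l hl =>
      h₁ k β hβ0 hβ1 D hD _ t ht0 ht1 U A hA hzu hUm z (hwide z hzG hzχ) l hl
  have hhb : ConeBound k (2 ^ k * Bχ * (Q * t ^ β * A)) G h := coneBound_smul (by linarith)
    (by positivity) hχ hc (fun i hi => hB i (by omega)) (hUm.sub (hUm.smoothPart _ ht0)) (fun z hzG
    hzχ => contDiffAt_sub_smoothPart hD ht0 hzu.contDiffOn hUm (hwide z hzG hzχ).1) fun z hzG hzχ l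
    hl => norm_sub_smoothPart_le hβ0 hβ1 hD ht0 ht1 hA hzu hUm (hwide z hzG hzχ) hl
  have hsplit : localize χ D u = fun x => g x + h x := by
    ext x; simp only [localize, hg, hh, ← smul_add, add_sub_cancel]; rfl
  have hpe : extPiece G p (localize χ D u) j = fun x => extPiece G p g j x + extPiece G p h j x :=
    by
    rw [hsplit]; exact funext fun x => extPiece_add hgb.bddMeas hhb.bddMeas G p j x
  rw [hpe, fun_iteratedFDeriv_add_apply ((contDiff_extPiece hgb.bddMeas G p j).of_le (nat_le_infty
    q)).contDiffAt ((contDiff_extPiece hhb.bddMeas G p j).of_le (nat_le_infty q)).contDiffAt]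
  have b1 := h₂ c hfit.one_le G hG g _ hgb j q hq x
  have b2 := h₃ c hfit.one_le G hG h _ hhb j q hq x
  rw [mul_assoc _ (scale j ^ _), scale_rpow] at b1 b2
  have hsr : ∀ δ : ℝ, s ^ δ = (2 ^ j : ℝ) ^ (-δ) := fun δ => by
    rw [hs, scale, rpow_neg_exp (by positivity)]
  have p1 : t ^ (β - 2) * (2 ^ j : ℝ) ^ ((q : ℝ) - (k + 2 : ℕ)) = κ ^ (β - 2) * (2 ^ j : ℝ) ^ ((q :
    ℝ) - r) := by
    rw [ht, mul_rpow hκ0.le hs0.le, mul_assoc, hsr, ← rpow_add (by positivity)]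
    congr 2; push_cast; rw [hβ]; ring
  have p2 : t ^ β * (2 ^ j : ℝ) ^ ((q : ℝ) - k) = κ ^ β * (2 ^ j : ℝ) ^ ((q : ℝ) - r) := by
    rw [ht, mul_rpow hκ0.le hs0.le, mul_assoc, hsr, ← rpow_add (by positivity)]
    congr 2; rw [hβ]; ring
  refine (norm_add_le _ _).trans ((add_le_add b1 b2).trans ?_)
  calc _ = C₂ * (2 ^ (k + 2) * Bχ * C₁) * A * (t ^ (β - 2) * (2 ^ j : ℝ) ^ ((q : ℝ) - (k + 2 : ℕ)))
        + C₃ * (2 ^ k * Bχ * Q) * A * (t ^ β * (2 ^ j : ℝ) ^ ((q : ℝ) - k)) := by ring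
    _ = C * A * (2 ^ j : ℝ) ^ ((q : ℝ) - r) := by rw [p1, p2, hC]; ring
    _ ≤ _ := by gcongr; linarith

lemma uniformContinuousOn_of_contUpToBoundary {W : Type*} [NormedAddCommGroup W] [NormedSpace ℝ W]
  (hD : IsCompact (closure D)) {u : E → W} (hu : ContUpToBoundary D u) : UniformContinuousOn u D :=
  by
  obtain ⟨g, hg, hgu⟩ := hu
  exact ((hD.uniformContinuousOn_of_continuous hg).mono subset_closure).congr hgu.symm

lemma uniformContinuousOn_iterD_localize {ρ : ℝ} (hρ : 0 < ρ) (hχ : ContDiff ℝ ∞ χ) (hc :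
  HasCompactSupport χ) (hfit : PieceFit c p G D χ ρ) (hu : ContDiffOn ℝ k u D) (hA : 0 ≤ A) (hb : ∀
  i ≤ k, ∀ x ∈ D, ‖∇ i u x‖ ≤ A) (huc : ∀ i ≤ k, UniformContinuousOn (∇ i u) D) {l : ℕ} (hl : l ≤ k)
  : UniformContinuousOn (∇ l (localize χ D u)) G := by
  have hD := hfit.isOpen
  obtain ⟨Bχ, hBχ, hB⟩ := exists_bound_iterD hχ hc (k + 1)
  set U := D.indicator u with hU
  have hUe : ∀ i, EqOn (∇ i U) (∇ i u) D := eqOn_iterD hD (eqOn_indicator D u)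
  have hUc : ∀ x ∈ D, ContDiffAt ℝ l U x := fun x hx =>
    ((hu.of_le (mod_cast hl)).contDiffAt (hD.mem_nhds hx)).congr_of_eventuallyEq
      ((eqOn_indicator D u).eventuallyEq_of_mem (hD.mem_nhds hx))
  have hz : ∀ z, z ∉ tsupport χ → ∇ l (localize χ D u) z = 0 := fun z hz =>
    iterD_eq_zero_of_eventuallyEq (by
      filter_upwards [notMem_tsupport_iff_eventuallyEq.1 hz] with y hy
      rw [localize, hy, Pi.zero_apply, zero_smul]) l
  rw [uniformContinuousOn_iff]
  intro ε hε
  set M : ℝ := 2 ^ l * Bχ + 2 ^ l * Bχ * A + 1 with hM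
  have hM0 : 0 < M := by positivity
  set η := ε / M with hη
  have hη0 : 0 < η := by positivity
  obtain ⟨δ, hδ, hδu⟩ := exists_forall_dist_lt huc hη0
  refine ⟨min ρ (min δ η), lt_min hρ (lt_min hδ hη0), ?_⟩
  suffices H : ∀ x ∈ G, ∀ y ∈ G, dist x y < min ρ (min δ η) → x ∈ tsupport χ → dist (∇ l (localize χ
    D u) x) (∇ l (localize χ D u) y) < ε by
    intro x hx y hy hxy
    by_cases h1 : x ∈ tsupport χ
    · exact H x hx y hy hxy h1
    · by_cases h2 : y ∈ tsupport χ
      · rw [dist_comm]; exact H y hy x hx (by rwa [dist_comm]) h2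
      · rw [hz x h1, hz y h2, dist_self]; exact hε
  intro x hx y hy hxy hxχ
  have hxD : x ∈ D := (hfit.mem_iff x hxχ x (mem_ball_self hρ)).1 hx
  have hyD : y ∈ D := (hfit.mem_iff x hxχ y (by
    rw [mem_ball, dist_comm]; exact hxy.trans_le (min_le_left _ _))).1 hy
  set v := y - x with hv
  have hvn : ‖v‖ < η := by
    rw [hv, ← dist_eq_norm, dist_comm]
    exact hxy.trans_le ((min_le_right _ _).trans (min_le_right _ _))
  have hxv : v + x = y := by rw [hv]; abel
  have hχl : ContDiff ℝ l χ := hχ.of_le (nat_le_infty l)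
  have hχv : ContDiff ℝ l fun z => χ (v + z) := hχl.comp (contDiff_const.add contDiff_id)
  have hUv : ContDiffAt ℝ l (fun z => U (v + z)) x := ContDiffAt.comp (g := U) x
    (by rw [hxv]; exact hUc y hyD) (contDiffAt_const.add contDiffAt_id)
  have hterm : ∇ l (localize χ D u) y - ∇ l (localize χ D u) x = ∇ l (fun z => χ (v + z) • (U (v +
    z) - U z)) x + ∇ l (fun z => (χ (v + z) - χ z) • U z) x := by
    have e1 : ∇ l (localize χ D u) y = ∇ l (fun z => localize χ D u (v + z)) x := by
      rw [iteratedFDeriv_comp_add_left, hxv]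
    have hloc : ContDiffAt ℝ l (localize χ D u) x := hχl.contDiffAt.smul (hUc x hxD)
    have c0 : ContDiffAt ℝ l (fun z => localize χ D u (v + z)) x := hχv.contDiffAt.smul hUv
    have c1 : ContDiffAt ℝ l (fun z => χ (v + z) • (U (v + z) - U z)) x := hχv.contDiffAt.smul
      (hUv.sub (hUc x hxD))
    have c2 : ContDiffAt ℝ l (fun z => (χ (v + z) - χ z) • U z) x := (hχv.sub hχl).contDiffAt.smul
      (hUc x hxD)
    rw [e1, ← fun_iteratedFDeriv_sub_apply c0 hloc, ← fun_iteratedFDeriv_add_apply c1 c2]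
    congr 1
    ext z
    simp only [localize, ← hU, smul_sub, sub_smul]; ring
  rw [dist_comm, dist_eq_norm, hterm]
  have t1 := norm_iterD_smul_le_of_contDiffAt (i := l) (x := x) (B := Bχ) (K := η) hχv (hUv.sub (hUc
    x hxD)) (fun i hi => by
      rw [iteratedFDeriv_comp_add_left]; exact hB i (by omega) _) (fun i hi => by
      rw [fun_iteratedFDeriv_sub_apply (hUv.of_le (mod_cast hi)) ((hUc x hxD).of_le
        (mod_cast hi)), iteratedFDeriv_comp_add_left, hxv, hUe i hyD, hUe i hxD, ←
        dist_eq_norm]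
      exact (hδu i (by omega) y hyD x hxD (by
        rw [dist_comm]; exact hxy.trans_le ((min_le_right _ _).trans (min_le_left _ _)))).le)
  have t2 := norm_iterD_smul_le_of_contDiffAt (i := l) (x := x) (B := Bχ * η) (K := A) (hχv.sub hχl)
    (hUc x hxD) (fun i hi => by
      rw [fun_iteratedFDeriv_sub_apply (hχv.of_le (mod_cast hi)).contDiffAt (hχl.of_le
        (mod_cast hi)).contDiffAt, iteratedFDeriv_comp_add_left, hxv]
      have h1 := norm_sub_le_of_iterD (F := ∇ i χ) (B := Bχ) ((hχ.of_le (nat_le_infty (1 +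
        i))).iteratedFDeriv_right (by push_cast; rfl)) (fun z =>
        by rw [← norm_iterD_add]; exact hB _ (by omega) z) y x
      refine h1.trans ?_
      gcongr) (fun i hi => by rw [hUe i hxD]; exact hb i (by omega) x hxD)
  refine (norm_add_le _ _).trans_lt ((add_le_add t1 t2).trans_lt ?_)
  calc 2 ^ l * Bχ * η + 2 ^ l * (Bχ * η) * A = (M - 1) * η := by rw [hM]; ring
    _ < M * η := by nlinarith
    _ = ε := by rw [hη]; field_simp

lemma exists_ckBound_localize (N k : ℕ) (p : E) (hχ : ContDiff ℝ ∞ χ) (hc : HasCompactSupport χ) {ρ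
  : ℝ} (hρ : 0 < ρ) : ∃ C : ℝ, 1 ≤ C ∧ ∀ (c : ℝ) (G D : Set E) (u : E → ℂ) (A : ℝ), PieceFit c p G D
  χ ρ → IsCompact (closure D) → 0 ≤ A → holderNorm k D u ≤ ofReal A → BddMeas (localize χ D u) ∧
  CkBound k (C * A) (coneExt G p (localize χ D u)) ∧ (0 < k → HasDyadic k N (C * A) (coneExt G p
  (localize χ D u))) ∧ ∀ x, Tendsto (fun J : ℕ => ∑ i ∈ range J, extPiece G p (localize χ D u) i x)
  atTop (𝓝 (coneExt G p (localize χ D u) x)) := by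
  obtain ⟨Bχ, hBχ, hB⟩ := exists_bound_iterD hχ hc k
  obtain ⟨C₁, hC₁, h⟩ := exists_ckBound_coneExt k p
  obtain ⟨C₂, hC₂, h'⟩ : ∃ C : ℝ, 1 ≤ C ∧ (0 < k → ∀ (c : ℝ), 1 ≤ c → ∀ (G : Set E), IsConeSet c p G
    → ∀ (f : E → ℂ) (B : ℝ), ConeBound k B G f → IsDyadic k N (C * B) (extPiece G p f) (coneExt G p
    f)) := by
    by_cases hk : 0 < k
    · obtain ⟨C, hC, h⟩ := exists_isDyadic_coneExt_of_coneBound N hk p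
      exact ⟨C, hC, fun _ => h⟩
    · exact ⟨1, le_rfl, fun h => absurd h hk⟩
  have hB2 : 1 ≤ 2 ^ k * Bχ := one_le_mul_of_one_le_of_one_le (one_le_two_pow k) hBχ
  refine ⟨(C₁ + C₂) * (2 ^ k * Bχ), one_le_mul_of_one_le_of_one_le (by linarith) hB2, fun c G D u A
    hfit hDc hA hu => ?_⟩
  obtain ⟨h1, h2, h3, -⟩ := of_holderNorm_le hA hu
  rw [Nat.floor_natCast] at h1 h2 h3
  have hcb := hfit.coneBound_localize hρ (by linarith) hA hχ hc hB h1 h3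
  have := h c hfit.one_le G hfit.cone _ _ hcb fun l hl =>
    uniformContinuousOn_iterD_localize hρ hχ hc hfit h1 hA h3 (fun i hi =>
      uniformContinuousOn_of_contUpToBoundary hDc (h2 i hi)) hl
  have hBA : 0 ≤ 2 ^ k * Bχ * A := by positivity
  refine ⟨hcb.bddMeas, this.1.mono le_rfl ?_, fun hk => HasDyadic.mono ⟨_, h' hk c hfit.one_le G
    hfit.cone _ _ hcb⟩ le_rfl ?_, this.2⟩
  · nlinarith
  · nlinarith

lemma exists_partition {K : Set E} (hK : IsCompact K) (Ω : Fin N → Set E) (hΩ : ∀ j, IsOpen (Ω j))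
  (hKΩ : K ⊆ ⋃ j, Ω j) : ∃ (χ : Fin N → E → ℝ) (δ : ℝ), 0 < δ ∧ (∀ j, ContDiff ℝ ∞ (χ j)) ∧ (∀ j,
  HasCompactSupport (χ j)) ∧ (∀ j, tsupport (χ j) ⊆ Ω j) ∧ (∀ j x, 0 ≤ χ j x) ∧ ∀ x ∈ thickening δ
  K, ∑ j, χ j x = 1 := by
  obtain ⟨δ, hδ, hδK⟩ := hK.exists_cthickening_subset_open (isOpen_iUnion hΩ) hKΩ
  have hcomp : IsCompact (cthickening δ K) := hK.cthickening
  obtain ⟨R, hR⟩ := hcomp.isBounded.subset_ball (0 : E)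
  obtain ⟨f, hf⟩ := SmoothPartitionOfUnity.exists_isSubordinate 𝓘(ℝ, E) hcomp.isClosed (fun j => Ω j
    ∩ ball 0 R) (fun j => (hΩ j).inter isOpen_ball) (fun x hx => by
      obtain ⟨j, hj⟩ := mem_iUnion.1 (hδK hx)
      exact mem_iUnion.2 ⟨j, hj, hR hx⟩)
  refine ⟨fun j => f j, δ, hδ, fun j => (f j).contMDiff.contDiff, fun j => ?_, fun j => (hf j).trans
    inter_subset_left, fun j x => f.nonneg j x, fun x hx => ?_⟩
  · exact isCompact_of_isClosed_isBounded (isClosed_tsupport _) (isBounded_ball.subset ((hf j).trans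
      inter_subset_right))
  · rw [← finsum_eq_sum_of_fintype]
    exact f.sum_eq_one (thickening_subset_cthickening _ _ hx)

lemma exists_cutoff {K : Set E} (hK : IsCompact K) (hO : IsOpen O) (hKO : K ⊆ O) : ∃ χ : E → ℝ,
  ContDiff ℝ ∞ χ ∧ HasCompactSupport χ ∧ tsupport χ ⊆ O ∧ ∃ δ > 0, ∀ x ∈ thickening δ K, χ x = 1 :=
  by
  obtain ⟨χ, δ, hδ, h1, h2, h3, -, h4⟩ := exists_partition hK (fun _ : Fin 1 => O) (fun _ => hO)
    (fun x hx => mem_iUnion.2 ⟨0, hKO hx⟩)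
  exact ⟨χ 0, h1 0, h2 0, h3 0, δ, hδ, fun x hx => by simpa using h4 x hx⟩

variable (E) in
/-- Cut-off functions and directions for the construction of smoothing operators of order `m`. -/
structure LocalCover (m : ℕ) where
  num : ℕ
  χ : Fin num → E → ℝ
  χ' : Fin num → E → ℝ
  p : Fin num → E
  c : ℝ
  one_le_c : 1 ≤ c
  ρ : ℝ
  ρ_pos : 0 < ρ
  τ : ℝ
  τ_pos : 0 < τ
  τ_le_one : τ ≤ 1
  smooth : ∀ j, ContDiff ℝ ∞ (χ j)
  supp : ∀ j, HasCompactSupport (χ j)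
  nonneg : ∀ j x, 0 ≤ χ j x
  smooth' : ∀ j, ContDiff ℝ ∞ (χ' j)
  supp' : ∀ j, HasCompactSupport (χ' j)
  eq_one : ∀ j, ∀ x ∈ tsupport (χ j), χ' j x = 1
  small : ∀ j, c * τ + 2 ^ m * τ * (‖p j‖ + 1) < ρ

/-- `D` is, near the supports of the cut-off functions, equal to the cone sets `G j`. -/
structure LocalCover.Fits {m : ℕ} (P : LocalCover E m) (D : Set E) (G : Fin P.num → Set E) :
    Prop where
  isCompact_closure : IsCompact (closure D)
  isOpen : IsOpen D
  fit : ∀ j, PieceFit P.c (P.p j) (G j) D (P.χ j) P.ρ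
  mem_iff : ∀ j, ∀ x ∈ tsupport (P.χ' j), x ∈ G j ↔ x ∈ D
  sum : ∀ x ∈ thickening (P.c * P.τ) D, ∑ j, P.χ j x = 1

/-- The same cover with a smaller range of parameters. -/
def LocalCover.shrink (P : LocalCover E m) (τ : ℝ) (h0 : 0 < τ) (h : τ ≤ P.τ) : LocalCover E m := {
  P with
    τ := τ
    τ_pos := h0
    τ_le_one := h.trans P.τ_le_one
    small := fun j => lt_of_le_of_lt (by
      have := P.one_le_c
      have : 0 ≤ ‖P.p j‖ + 1 := by positivity
      gcongr) (P.small j) }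

lemma LocalCover.Fits.shrink {P : LocalCover E m} {G : Fin P.num → Set E} (hG : P.Fits D G) {τ : ℝ}
  (h0 : 0 < τ) (h : τ ≤ P.τ) : (P.shrink τ h0 h).Fits D G := ⟨hG.isCompact_closure, hG.isOpen,
  hG.fit, hG.mem_iff, fun x hx => hG.sum x (thickening_mono (mul_le_mul_of_nonneg_left h
  (by linarith [P.one_le_c])) _ hx)⟩

lemma horizontal_add (e x y : E) : horizontal e (x + y) = horizontal e x + horizontal e y := by
  simp only [horizontal, inner_add_right, add_smul]; abel

lemma horizontal_smul (e x : E) (a : ℝ) : horizontal e (a • x) = a • horizontal e x := by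
  simp only [horizontal, inner_smul_right, smul_sub, mul_smul]

lemma horizontal_self {e : E} (he : ‖e‖ = 1) : horizontal e e = 0 := by simp [horizontal, he]

lemma norm_horizontal_le {e : E} (he : ‖e‖ = 1) (x : E) : ‖horizontal e x‖ ≤ ‖x‖ := by
  have h : ‖horizontal e x‖ ^ 2 = ‖x‖ ^ 2 - (inner ℝ e x) ^ 2 := by
    rw [horizontal, norm_sub_sq_real, inner_smul_right, norm_smul, he, real_inner_comm e x, mul_one,
      norm_eq_abs, sq_abs]
    ring
  exact abs_le_of_sq_le_sq' (by nlinarith [sq_nonneg (inner ℝ e x : ℝ)]) (norm_nonneg _) |>.2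

lemma isConeSet_epigraph {e : E} (he : ‖e‖ = 1) (a : E) {Λ : ℝ≥0} {h : E → ℝ} (hh : LipschitzWith Λ
  h) (c : ℝ) : IsConeSet c (((1 + (Λ : ℝ)) * (1 + c)) • e) {x | h (horizontal e (x - a)) < (inner ℝ
  e (x - a) : ℝ)} := by
  constructor
  · have h1 : Continuous fun x => h (horizontal e (x - a)) := hh.continuous.comp
      (by unfold horizontal; fun_prop)
    exact isOpen_lt h1 (by fun_prop)
  · intro t ht x hx y hy
    obtain ⟨z, hz, hxz⟩ := mem_thickening_iff.1 hx
    change h _ < _ at hz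
    change h _ < _
    rw [mem_closedBall_zero_iff] at hy
    rw [dist_eq_norm] at hxz
    set R := (1 + (Λ : ℝ)) * (1 + c) with hR
    set x' := x + t • (R • e + y) with hx'
    have e1 : x' - a = (z - a) + (x - z) + (t * R) • e + t • y := by rw [hx']; module
    have e2 : horizontal e (x' - a) - horizontal e (z - a) = horizontal e (x - z) + t • horizontal e
      y := by
      rw [e1, horizontal_add, horizontal_add, horizontal_add, horizontal_smul, horizontal_smul,
        horizontal_self he]; simp only [smul_zero, add_zero]; abel
    have h1 := hh.dist_le_mul (horizontal e (x' - a)) (horizontal e (z - a))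
    rw [dist_eq_norm, dist_eq_norm, e2, norm_eq_abs] at h1
    have h2 : ‖horizontal e (x - z) + t • horizontal e y‖ ≤ c * t + t := by
      refine (norm_add_le _ _).trans (add_le_add ((norm_horizontal_le he _).trans hxz.le) ?_)
      rw [norm_smul, norm_of_nonneg ht.le]
      nlinarith [norm_horizontal_le he y]
    have h3 := (abs_le.1 h1).2
    have i1 : |(inner ℝ e (x - z) : ℝ)| ≤ c * t := by
      refine (abs_real_inner_le_norm _ _).trans ?_
      rw [he, one_mul]; exact hxz.le
    have i2 : |(inner ℝ e y : ℝ)| ≤ 1 := by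
      refine (abs_real_inner_le_norm _ _).trans ?_
      rw [he, one_mul]; exact hy
    have i3 : (inner ℝ e (x' - a) : ℝ) = inner ℝ e (z - a) + inner ℝ e (x - z) + t * R + t * inner ℝ
      e y := by
      rw [e1, inner_add_right, inner_add_right, inner_add_right, inner_smul_right, inner_smul_right,
        real_inner_self_eq_norm_sq, he]; ring
    rw [i3]
    have h4 : (Λ : ℝ) * ‖horizontal e (x - z) + t • horizontal e y‖ ≤ Λ * (c * t + t) := by gcongr
    have i4 : -t ≤ t * (inner ℝ e y : ℝ) := by nlinarith [(abs_le.1 i2).1]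
    have i5 := (abs_le.1 i1).1
    have : t * R = Λ * (c * t + t) + (c * t + t) := by rw [hR]; ring
    linarith

lemma LipschitzCover.continuous_box (L : LipschitzCover E) (i : Fin L.num) :
  (Continuous fun x => ‖horizontal (L.axis i) (x - L.center i)‖) ∧
  Continuous fun x => |(inner ℝ (L.axis i) (x - L.center i) : ℝ)| := by
  unfold horizontal
  exact ⟨by fun_prop, by fun_prop⟩

lemma LipschitzCover.isOpen_box (L : LipschitzCover E) (c : ℝ) (i : Fin L.num) : IsOpen (L.box c i)
  :=
  (isOpen_lt (L.continuous_box i).1 continuous_const).inter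
    (isOpen_lt (L.continuous_box i).2 continuous_const)

lemma LipschitzCover.exists_compact_box (L : LipschitzCover E) (i : Fin L.num) : ∃ K : Set E,
  IsCompact K ∧ L.box (1 / 2) i ⊆ K ∧ K ⊆ L.box 1 i := by
  refine ⟨{x | ‖horizontal (L.axis i) (x - L.center i)‖ ≤ 1 / 2 * L.radius i ∧ |(inner ℝ (L.axis i)
    (x - L.center i) : ℝ)| ≤ 1 / 2 * L.height i}, ?_, fun x hx => ⟨hx.1.le, hx.2.le⟩, fun x hx =>
    ⟨?_, ?_⟩⟩
  · refine isCompact_of_isClosed_isBounded ((isClosed_le (L.continuous_box i).1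
      continuous_const).inter (isClosed_le (L.continuous_box i).2 continuous_const)) ?_
    refine (isBounded_iff_subset_closedBall (L.center i)).2 ⟨1 / 2 * L.radius i + 1 / 2 * L.height
      i, fun x hx => ?_⟩
    rw [mem_closedBall, dist_eq_norm]
    have : x - L.center i = horizontal (L.axis i) (x - L.center i) + (inner ℝ (L.axis i) (x -
      L.center i) : ℝ) • L.axis i := by simp [horizontal]
    rw [this]
    refine (norm_add_le _ _).trans (add_le_add hx.1 ?_)
    rw [norm_smul, L.norm_axis, mul_one]; exact hx.2
  · have := L.radius_pos i
    exact hx.1.trans_lt (by linarith)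
  · have := L.height_pos i
    exact hx.2.trans_lt (by linarith)

theorem LipschitzCover.exists_localCover (L : LipschitzCover E) (m : ℕ) (hc : 1 ≤ c) : ∃ P :
  LocalCover E m, P.c = c ∧ ∀ D, L.Describes D → ∃ G, P.Fits D G := by
  choose Kb hKb hbK hKb1 using L.exists_compact_box
  set K : Set E := L.core ∪ ⋃ i, Kb i with hKdef
  have hK : IsCompact K := L.isCompact_core.union (isCompact_iUnion hKb)
  set Ω : Fin (L.num + 1) → Set E := Fin.cons L.inside (L.box 1) with hΩdef
  have hΩ : ∀ j, IsOpen (Ω j) := fun j => by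
    refine Fin.cases ?_ (fun i => ?_) j
    · exact L.isOpen_inside
    · exact L.isOpen_box 1 i
  have hKΩ : K ⊆ ⋃ j, Ω j := by
    rintro x (hx | hx)
    · exact mem_iUnion.2 ⟨0, L.core_subset hx⟩
    · obtain ⟨i, hi⟩ := mem_iUnion.1 hx
      exact mem_iUnion.2 ⟨i.succ, hKb1 i hi⟩
  obtain ⟨χ, δ, hδ, hχ, hχc, hχΩ, hχ0, hχ1⟩ := exists_partition hK Ω hΩ hKΩ
  choose χ' hχ' hχc' hχΩ' δ' hδ' hone using fun j => exists_cutoff (hχc j) (hΩ j) (hχΩ j)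
  have hρ : ∀ᶠ ρ in 𝓝[>] (0 : ℝ), ∀ j, thickening ρ (tsupport (χ j)) ⊆ Ω j := by
    refine eventually_all.2 fun j => ?_
    obtain ⟨ρ, hρ, h⟩ := (hχc j).isCompact.exists_thickening_subset_open (hΩ j) (hχΩ j)
    filter_upwards [Ioo_mem_nhdsGT hρ] with ρ' h'
    exact (thickening_mono h'.2.le _).trans h
  obtain ⟨ρ, hρΩ, hρ0⟩ := (hρ.and self_mem_nhdsWithin).exists
  replace hρ0 : 0 < ρ := hρ0
  set p : Fin (L.num + 1) → E := Fin.cons 0 fun i => ((1 + (L.lip : ℝ)) * (1 + c)) • L.axis i with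
    hp
  have hτ : ∀ᶠ τ in 𝓝[>] (0 : ℝ), τ ≤ 1 ∧ c * τ ≤ δ ∧ ∀ j, c * τ + 2 ^ m * τ * (‖p j‖ + 1) < ρ := by
    have hlim : ∀ f : ℝ → ℝ, Continuous f → f 0 = 0 → ∀ b > 0, ∀ᶠ τ in 𝓝[>] (0 : ℝ), f τ < b := fun
      f hf h0 b hb => (hf.tendsto' 0 0 h0).eventually_lt_const hb |>.filter_mono nhdsWithin_le_nhds
    refine ((hlim (fun τ => τ) continuous_id rfl 1 one_pos).mono fun _ h => h.le).and (((hlim (fun τ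
      => c * τ) (by fun_prop) (by simp) δ hδ).mono fun _ h => h.le).and (eventually_all.2 fun j =>
      hlim (fun τ => c * τ + 2 ^ m * τ * (‖p j‖ + 1)) (by fun_prop) (by simp) ρ hρ0))
  obtain ⟨τ, ⟨hτ1, hτδ, hτρ⟩, hτ0⟩ := (hτ.and self_mem_nhdsWithin).exists
  refine ⟨⟨L.num + 1, χ, χ', p, c, hc, ρ, hρ0, τ, hτ0, hτ1, hχ, hχc, hχ0, hχ', hχc', fun j x hx =>
    hone j x (self_subset_thickening (hδ' j) _ hx), hτρ⟩, rfl, fun D hD => ?_⟩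
  choose h hlip hle hgraph using hD.graph
  set G : Fin (L.num + 1) → Set E := Fin.cons univ fun i => {x | h i (horizontal (L.axis i) (x -
    L.center i)) < (inner ℝ (L.axis i) (x - L.center i) : ℝ)} with hG
  have hcone : ∀ j, IsConeSet c (p j) (G j) := fun j => by
    refine Fin.cases ?_ (fun i => ?_) j
    · exact ⟨isOpen_univ, fun _ _ _ _ _ _ => mem_univ _⟩
    · exact isConeSet_epigraph (L.norm_axis i) (L.center i) (hlip i) c
  have hiff : ∀ j, ∀ x ∈ Ω j, x ∈ G j ↔ x ∈ D := fun j => by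
    refine Fin.cases ?_ (fun i => ?_) j
    · exact fun x hx => ⟨fun _ => hD.inside_subset hx, fun _ => mem_univ _⟩
    · exact fun x hx => (hgraph i x hx).symm
  have hclos : closure D ⊆ K := fun x hx => by
    rcases hD.closure_subset hx with h | h
    · exact Or.inl h
    · obtain ⟨i, hi⟩ := mem_iUnion.1 h
      exact Or.inr (mem_iUnion.2 ⟨i, hbK i hi⟩)
  refine ⟨G, hK.of_isClosed_subset isClosed_closure hclos, hD.isOpen, fun j => ⟨hc, hcone j,
    hD.isOpen, fun x hx z hz => hiff j z (hρΩ j ?_)⟩, fun j x hx => hiff j x (hχΩ' j hx), fun x hx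
    => hχ1 x ?_⟩
  · exact mem_thickening_iff.2 ⟨x, hx, hz⟩
  · exact thickening_mono hτδ _ (thickening_subset_of_subset _ (subset_closure.trans hclos) hx)

section

variable {W : Type*} [NormedAddCommGroup W] [NormedSpace ℝ W]

lemma scaled_bump_smul (p : E) {R : ℝ} (hR : 0 < R) (F : E → W) : (fun y => ((R ^ Module.finrank ℝ
  E)⁻¹ * stdBump E (-R⁻¹ • y - p)) • F y) = fun y => (R ^ Module.finrank ℝ E)⁻¹ • (fun z =>
  (fun u => stdBump E u • F (-(R • (p + u)))) (z - p)) (-R⁻¹ • y) := funext fun y => by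
  simp only [mul_smul, add_sub_cancel, neg_smul, smul_neg, neg_neg, smul_inv_smul₀ hR.ne']

lemma integral_scaled_bump (p : E) {R : ℝ} (hR : 0 < R) (F : E → W) : ∫ y, ((R ^ Module.finrank ℝ
  E)⁻¹ * stdBump E (-R⁻¹ • y - p)) • F y = ∫ u, stdBump E u • F (-(R • (p + u))) := by
  rw [scaled_bump_smul p hR, integral_smul, Measure.integral_comp_smul volume (fun z =>
    (fun u => stdBump E u • F (-(R • (p + u)))) (z - p)) (-R⁻¹), integral_sub_right_eq_self
    (fun u => stdBump E u • F (-(R • (p + u)))) p, smul_smul, neg_pow, mul_inv, abs_mul, abs_inv,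
    abs_pow, abs_neg, abs_one, one_pow, inv_one, one_mul, inv_pow, inv_inv, abs_of_pos
    (by positivity), inv_mul_cancel₀ (by positivity), one_smul]

lemma integrable_scaled_bump (p : E) {R : ℝ} (hR : 0 < R) {F : E → W} (h : Integrable fun u =>
  stdBump E u • F (-(R • (p + u)))) : Integrable fun y => ((R ^ Module.finrank ℝ E)⁻¹ * stdBump E
  (-R⁻¹ • y - p)) • F y := by
  rw [scaled_bump_smul p hR]
  exact ((h.comp_sub_right p).comp_smul (neg_ne_zero.2 (inv_ne_zero hR.ne'))).smul _

/-- The kernel of the averages `moserAvg m p`. -/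
def moserKernel (m : ℕ) (p y : E) : ℝ := ∑ k ∈ range (m + 1), seeley m k * (((2 ^ k : ℝ) ^
  Module.finrank ℝ E)⁻¹ * stdBump E (-(2 ^ k : ℝ)⁻¹ • y - p))

lemma contDiff_moserKernel (m : ℕ) (p : E) : ContDiff ℝ ∞ (moserKernel m p) := by
  unfold moserKernel
  refine ContDiff.sum fun k _ => contDiff_const.mul (contDiff_const.mul ?_)
  exact (contDiff_stdBump (n := ⊤)).comp ((contDiff_const.smul contDiff_id).sub contDiff_const)

lemma integral_moserKernel_smul (m : ℕ) (p : E)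
  {F : E → W} (h : ∀ k : ℕ, Integrable fun u => stdBump E u • F (-((2 : ℝ) ^ k • (p + u)))) : ∫ y,
  moserKernel m p y • F y = ∑ k ∈ range (m + 1), seeley m k • ∫ u, stdBump E u • F (-((2 : ℝ) ^ k •
  (p + u))) := by
  simp_rw [moserKernel, sum_smul, mul_smul (seeley m _)]
  have hi : ∀ k ∈ range (m + 1), Integrable fun y => seeley m k • (((2 ^ k : ℝ) ^ Module.finrank ℝ
    E)⁻¹ * stdBump E (-(2 ^ k : ℝ)⁻¹ • y - p)) • F y := fun k _ => (integrable_scaled_bump p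
    (by positivity) (h k)).smul (seeley m k)
  rw [integral_finsetSum _ hi]
  refine sum_congr rfl fun k _ => ?_
  rw [integral_smul, integral_scaled_bump p (by positivity)]

lemma exists_of_mem_tsupport_moserKernel {y : E} (hy : y ∈ tsupport (moserKernel m p)) : ∃ k ≤ m, ∃
  u ∈ closedBall (0 : E) 1, y = -((2 : ℝ) ^ k • (p + u)) := by
  set Z : Set E := ⋃ k ∈ range (m + 1), (fun u : E => -((2 : ℝ) ^ k • (p + u))) '' closedBall 0 1
    with hZ
  have hZc : IsCompact Z := (range (m + 1)).isCompact_biUnion fun k _ =>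
    (isCompact_closedBall 0 1).image (by fun_prop)
  have hs : Function.support (moserKernel m p) ⊆ Z := fun x hx => by
    obtain ⟨k, hk, hne⟩ := Finset.exists_ne_zero_of_sum_ne_zero hx
    refine mem_biUnion hk ⟨-(2 ^ k : ℝ)⁻¹ • x - p, ?_, ?_⟩
    · by_contra h
      exact hne (by rw [stdBump_eq_zero h, mul_zero, mul_zero])
    · simp
  have := closure_minimal hs hZc.isClosed hy
  simp only [hZ, mem_iUnion, mem_image, exists_prop, @Finset.mem_range] at this
  obtain ⟨k, hk, u, hu, rfl⟩ := this
  exact ⟨k, by omega, u, hu, rfl⟩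

lemma hasCompactSupport_moserKernel (m : ℕ) (p : E) : HasCompactSupport (moserKernel m p) := by
  refine isCompact_of_isClosed_isBounded (isClosed_tsupport _) ((isBounded_iff_subset_closedBall
    0).2 ⟨2 ^ m * (‖p‖ + 1), fun y hy => ?_⟩)
  obtain ⟨k, hk, u, hu, rfl⟩ := exists_of_mem_tsupport_moserKernel hy
  rw [mem_closedBall_zero_iff] at hu ⊢
  rw [norm_neg, norm_smul, norm_of_nonneg (by positivity)]
  exact mul_le_mul (pow_le_pow_right₀ (by norm_num) hk) ((norm_add_le _ _).trans (add_le_add le_rfl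
    hu)) (norm_nonneg _) (by positivity)

lemma integrable_bump_smul_of_continuous {F : E → W} (hF : Continuous F) : Integrable fun u =>
  stdBump E u • F u := (continuous_stdBump.smul hF).integrable_of_hasCompactSupport
  (hasCompactSupport_stdBump.smul_right)

end

lemma integral_moserKernel (m : ℕ) (p : E) : ∫ y, moserKernel m p y = 1 := by
  have := integral_moserKernel_smul m p (F := fun _ => (1 : ℝ)) fun k =>
    integrable_bump_smul_of_continuous continuous_const
  simpa [integral_stdBump, seeley_moment_zero] using this

lemma integral_moserKernel_moment (p : E) {q : ℕ} (hq : 0 < q) (hqm : q ≤ m) (w : Fin q → E) : ∫ y,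
  (∏ a, (inner ℝ (w a) y : ℝ)) * moserKernel m p y = 0 := by
  have h := integral_moserKernel_smul m p (F := fun y => ∏ a, (inner ℝ (w a) y : ℝ)) fun k =>
    integrable_bump_smul_of_continuous (by fun_prop)
  have e : ∀ k : ℕ, ∫ u, stdBump E u • ∏ a, (inner ℝ (w a) (-((2 : ℝ) ^ k • (p + u))) : ℝ) = (2 ^ k
    : ℝ) ^ q * ∫ u, stdBump E u • ∏ a, (inner ℝ (w a) (-(p + u)) : ℝ) := fun k => by
    rw [← integral_const_mul]
    congr 1; ext u
    simp only [← smul_neg, inner_smul_right, Finset.prod_mul_distrib, Finset.prod_const,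
      Finset.card_univ, Fintype.card_fin, smul_eq_mul]
    ring
  simp_rw [e] at h
  rw [show (∑ k ∈ range (m + 1), seeley m k • ((2 ^ k : ℝ) ^ q * ∫ u, stdBump E u • ∏ a, (inner ℝ (w
    a) (-(p + u)) : ℝ))) = 0 by
    simp_rw [smul_eq_mul, ← mul_assoc]
    rw [← sum_mul, seeley_moment hq hqm, zero_mul]] at h
  rw [← h]
  congr 1; ext y; rw [smul_eq_mul, mul_comm]

namespace LocalCover

variable (P : LocalCover E m)

variable {P} in
lemma Fits.mem {G : Fin P.num → Set E} (hG : P.Fits D G) (ht : 0 < t) (htτ : t ≤ P.τ) (hx : x ∈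
  thickening (P.c * t) D) {j : Fin P.num} (hk : k ≤ m) {u : E} (hu : u ∈ closedBall (0 : E) 1) (hz :
  x + (2 ^ k * t) • (P.p j + u) ∈ tsupport (P.χ j)) : x + (2 ^ k * t) • (P.p j + u) ∈ D := by
  obtain ⟨w, hwD, hxw⟩ := mem_thickening_iff.1 hx
  set z := x + (2 ^ k * t) • (P.p j + u) with hzdef
  have hc := P.one_le_c
  have hzx : ‖z - x‖ ≤ 2 ^ m * P.τ * (‖P.p j‖ + 1) := by
    rw [hzdef, add_sub_cancel_left, norm_smul, norm_of_nonneg (by positivity)]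
    rw [mem_closedBall_zero_iff] at hu
    refine mul_le_mul (mul_le_mul (pow_le_pow_right₀ (by norm_num) hk) htτ ht.le (by positivity))
      ((norm_add_le _ _).trans (add_le_add le_rfl hu)) (norm_nonneg _) (mul_nonneg (by positivity)
      P.τ_pos.le)
  have hwz : w ∈ ball z P.ρ := by
    rw [mem_ball]
    calc dist w z ≤ dist w x + dist x z := dist_triangle _ _ _
      _ ≤ P.c * P.τ + 2 ^ m * P.τ * (‖P.p j‖ + 1) := by
        refine add_le_add ?_ ?_
        · rw [dist_comm]; exact hxw.le.trans (mul_le_mul_of_nonneg_left htτ (by linarith))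
        · rw [dist_comm, dist_eq_norm]; exact hzx
      _ < P.ρ := P.small j
  have hwG : w ∈ G j := ((hG.fit j).mem_iff z hz w hwz).2 hwD
  have h2k : (1 : ℝ) ≤ 2 ^ k := one_le_two_pow k
  have hzG : z ∈ G j := (hG.fit j).cone.sees (2 ^ k * t) (by positivity) x (mem_thickening_iff.2 ⟨w,
    hwG, hxw.trans_le (by
      refine mul_le_mul_of_nonneg_left ?_ (by linarith)
      nlinarith)⟩) u hu
  exact ((hG.fit j).mem_iff z hz z (mem_ball_self P.ρ_pos)).1 hzG

variable {P} in
/-- The Moser kernel given by a local cover. -/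
def Fits.kernel {G : Fin P.num → Set E} (hG : P.Fits D G) : MoserKernel m P.τ D where
  num := P.num
  χ := P.χ
  μ := fun j => moserKernel m (P.p j)
  χ_smooth := P.smooth
  χ_supp := P.supp
  χ_nonneg := P.nonneg
  χ_sum := fun x hx => hG.sum x (thickening_mono (by
    have := P.τ_pos
    have := P.one_le_c
    nlinarith) _ hx)
  μ_smooth := fun j => contDiff_moserKernel m _
  μ_supp := fun j => hasCompactSupport_moserKernel m _
  μ_integral := fun j => integral_moserKernel m _
  μ_moment := fun j q hq hqm w => integral_moserKernel_moment _ hq hqm w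
  shift := fun j t ht htτ x hx y hy hne => by
    obtain ⟨k, hk, u, hu, rfl⟩ := exists_of_mem_tsupport_moserKernel hy
    have e : x - t • -((2 : ℝ) ^ k • (P.p j + u)) = x + (2 ^ k * t) • (P.p j + u) := by module
    rw [e] at hne ⊢
    exact hG.mem ht htτ (thickening_mono (by
      have := P.one_le_c
      nlinarith) _ hx) hk hu (subset_tsupport _ hne)

/-- The smoothing operators given by a local cover. -/
def op (D : Set E) (t : ℝ) (u : E → ℂ) (x : E) : ℂ := if t ≤ P.τ then ∑ j, ∫ y, ((moserKernel m (P.p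
  j) y * P.χ j (x - t • y) : ℝ) : ℂ) * D.indicator u (x - t • y) else 0

/-- The smoothing operators with the cut-off functions replaced by `ψ`, for global functions. -/
def globalOp (ψ : Fin P.num → E → ℝ) (t : ℝ) (f : E → ℂ) (x : E) : ℂ := ∑ j, moserAvg m (P.p j) t
  (fun z => ψ j z • f z) x

lemma op_eq_smoothing {G : Fin P.num → Set E} (hG : P.Fits D G) (ht : t ≤ P.τ) : P.op D t =
  hG.kernel.smoothing t := by
  ext u x
  rw [op, if_pos ht]; rfl

lemma op_of_lt (ht : P.τ < t) (u : E → ℂ) : P.op D t u = fun _ => 0 := by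
  ext x; rw [op, if_neg ht.not_ge]

lemma op_congr {u' : E → ℂ} (h : EqOn u u' D) : P.op D t u = P.op D t u' := by
  have : D.indicator u = D.indicator u' := indicator_congr h
  ext x; simp only [op, this]

lemma op_eq (h0 : 0 < t) (ht : t ≤ P.τ) (hu : BddMeas (D.indicator u)) (x : E) : P.op D t u x =
  P.globalOp P.χ t (D.indicator u) x := by
  rw [op, if_pos ht, globalOp]
  refine sum_congr rfl fun j _ => ?_
  set F : E → ℂ := fun y => P.χ j (x - t • y) • D.indicator u (x - t • y) with hF
  have e : ∀ k : ℕ, ∀ v, F (-((2 : ℝ) ^ k • (P.p j + v))) = (fun z => P.χ j z • D.indicator u z) (x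
    + (2 ^ k * t) • (P.p j + v)) := fun k v => by
    have e1 : x - t • -((2 : ℝ) ^ k • (P.p j + v)) = x + (2 ^ k * t) • (P.p j + v) := by module
    simp only [hF, e1]
  have hl := hu.smul_cutoff (P.smooth j) (P.supp j)
  have h1 : ∀ y, ((moserKernel m (P.p j) y * P.χ j (x - t • y) : ℝ) : ℂ) * D.indicator u (x - t • y)
    = moserKernel m (P.p j) y • F y := fun y => by
    simp only [hF, Complex.real_smul, Complex.ofReal_mul]; ring
  simp_rw [h1]
  rw [integral_moserKernel_smul m (P.p j) fun k => by
    simp_rw [e]; exact hl.integrable _ (by positivity) x]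
  simp_rw [e]
  rfl

variable {P} in
lemma Fits.globalOp_congr {G : Fin P.num → Set E} (hG : P.Fits D G) (ht : 0 < t) (htτ : t ≤ P.τ) {ψ
  : Fin P.num → E → ℝ} (hψ : ∀ j, tsupport (ψ j) ⊆ tsupport (P.χ j)) (hfg : EqOn f g D) (hx : x ∈
  thickening (P.c * t) D) : P.globalOp ψ t f x = P.globalOp ψ t g x := by
  refine sum_congr rfl fun j _ => ?_
  refine cavg_congr (O := {z | ψ j z • f z = ψ j z • g z}) (fun k hk u hu => ?_) fun z hz => hz
  by_cases h : x + (2 ^ k * t) • (P.p j + u) ∈ tsupport (ψ j)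
  · change _ • _ = _ • _
    rw [hfg (hG.mem ht htτ hx (by omega) hu (hψ j h))]
  · change _ • _ = _ • _
    rw [image_eq_zero_of_notMem_tsupport h, zero_smul, zero_smul]

/-- The extension operator given by a local cover. -/
def ext (D : Set E) (G : Fin P.num → Set E) (u : E → ℂ) (x : E) : ℂ := ∑ j, P.χ' j x • coneExt (G j)
  (P.p j) (localize (P.χ j) D u) x

lemma ext_congr (G : Fin P.num → Set E) {u' : E → ℂ} (h : EqOn u u' D) : P.ext D G u = P.ext D G u'
  := by
  have : ∀ χ, localize χ D u = localize χ D u' := fun χ => by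
    ext x; rw [localize, localize, indicator_congr h]
  ext x; simp only [ext, this]

variable {P} in
lemma Fits.ext_eqOn {G : Fin P.num → Set E} (hG : P.Fits D G) (hu : ContinuousOn u D) (hB : ∀ x ∈ D,
  ‖u x‖ ≤ B) : EqOn (P.ext D G u) u D := by
  intro x hx
  have hB0 : 0 ≤ B := (norm_nonneg _).trans (hB x hx)
  have key : ∀ j, P.χ' j x • coneExt (G j) (P.p j) (localize (P.χ j) D u) x = P.χ j x • u x := by
    intro j
    by_cases h' : x ∈ tsupport (P.χ' j)
    · have hxG : x ∈ G j := (hG.mem_iff j x h').2 hx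
      have hfit := hG.fit j
      obtain ⟨Bχ, hBχ, hb⟩ := exists_bound_iterD (P.smooth j) (P.supp j) 0
      have hcb := hfit.coneBound_localize P.ρ_pos (by linarith) hB0 (P.smooth j) (P.supp j) hb
        (k := 0) (contDiffOn_zero.2 hu) fun i hi z hz => by
          obtain rfl := Nat.le_zero.1 hi
          simpa using hB z hz
      rw [coneExt_eq_of_mem (f := localize (P.χ j) D u) hfit.one_le hfit.cone
        hcb.contDiffOn.continuousOn (fun z hz => hcb.norm_le hz) hxG, localize, indicator_of_mem hx]
      by_cases h : x ∈ tsupport (P.χ j)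
      · rw [P.eq_one j x h, one_smul]
      · rw [image_eq_zero_of_notMem_tsupport h, zero_smul, smul_zero]
    · have h : x ∉ tsupport (P.χ j) := fun h => by
        have h1 := P.eq_one j x h
        rw [image_eq_zero_of_notMem_tsupport h'] at h1
        exact zero_ne_one h1
      rw [image_eq_zero_of_notMem_tsupport h, image_eq_zero_of_notMem_tsupport h', zero_smul,
        zero_smul]
  rw [ext, sum_congr rfl fun j _ => key j, ← sum_smul, hG.sum x (self_subset_thickening (mul_pos
    (by linarith [P.one_le_c]) P.τ_pos) _ hx), one_smul]

end LocalCover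

lemma zygmundNorm_le_of_holderNorm_le (hs : (⌊s⌋₊ : ℝ) < s) (hA : 0 ≤ A) (h : holderNorm s D u ≤
  ofReal A) : zygmundNorm s D u ≤ ofReal ((zk s + 2) * (2 * A)) := by
  obtain ⟨h1, -, h3, h4⟩ := of_holderNorm_le hA h
  have hz := zk_eq_floor hs
  rw [← hz] at h1 h3 h4
  refine zygmundNorm_le (by positivity) h1 (fun i hi x hx => (h3 i hi x hx).trans (by linarith)) fun
    x v hv hx hxv hx2 => ?_
  have e : x + (2 : ℝ) • v - (x + v) = v := by module
  have a1 := h4 x (x + v) (by simpa using hv) hx hxv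
  have a2 := h4 (x + (2 : ℝ) • v) (x + v) (fun h => hv (by rw [← e, h, sub_self])) hx2 hxv
  rw [e] at a2
  rw [sub_add_cancel_left, norm_neg] at a1
  rw [show ∇ (zk s) u x + ∇ (zk s) u (x + (2 : ℝ) • v) - (2 : ℝ) • ∇ (zk s) u (x + v) = (∇ (zk s) u
    x - ∇ (zk s) u (x + v)) + (∇ (zk s) u (x + (2 : ℝ) • v) - ∇ (zk s) u (x + v)) by module]
  refine (norm_add_le _ _).trans ((add_le_add a1 a2).trans_eq (by ring))

lemma HolderData.sum {ι : Type*} (s : Finset ι) {A : ι → ℝ} {f : ι → E → ℂ} (h : ∀ a ∈ s, HolderData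
  N r (A a) (f a)) : HolderData N r (∑ a ∈ s, A a) (fun x => ∑ a ∈ s, f a x) := ⟨fun hr =>
  HasDyadic.sum s fun a ha => (h a ha).1 hr, fun k hk => CkBound.sum s fun a ha => (h a ha).2 k hk⟩

lemma HolderData.mono {A' : ℝ} (h : HolderData N r A f) (hA : A ≤ A') : HolderData N r A' f := ⟨fun
  hr => (h.1 hr).mono le_rfl hA, fun k hk => (h.2 k hk).mono le_rfl hA⟩

lemma exists_holderData_localize (hs : 0 ≤ s) (N : ℕ) (p : E) (hχ : ContDiff ℝ ∞ χ) (hc :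
  HasCompactSupport χ) {ρ : ℝ} (hρ : 0 < ρ) : ∃ C : ℝ, 1 ≤ C ∧ ∀ (c : ℝ) (G D : Set E) (u : E → ℂ)
  (A : ℝ), PieceFit c p G D χ ρ → IsCompact (closure D) → 0 ≤ A → holderNorm s D u ≤ ofReal A →
  HolderData N s (C * A) (coneExt G p (localize χ D u)) := by
  by_cases h : (⌊s⌋₊ : ℝ) = s
  · obtain ⟨C, hC, h1⟩ := exists_ckBound_localize N ⌊s⌋₊ p hχ hc hρ
    refine ⟨C, hC, fun c G D u A hfit hDc hA hu => ?_⟩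
    rw [← h] at hu
    obtain ⟨-, h2, h3, -⟩ := h1 c G D u A hfit hDc hA hu
    refine ⟨fun hs0 => ?_, fun k hk => ?_⟩
    · have := h3 (by rw [← h] at hs0; exact_mod_cast hs0)
      rwa [h] at this
    · obtain rfl : k = ⌊s⌋₊ := by rw [← hk, Nat.floor_natCast]
      exact h2
  · have hlt : (⌊s⌋₊ : ℝ) < s := lt_of_le_of_ne (Nat.floor_le hs) h
    have hs0 : 0 < s := lt_of_le_of_lt (Nat.cast_nonneg _) hlt
    obtain ⟨C, hC, h1⟩ := exists_isDyadic_localize hs0 N p hχ hc hρ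
    refine ⟨C * ((zk s + 2) * 2), one_le_mul_of_one_le_of_one_le hC (by
      have : (0 : ℝ) ≤ zk s := Nat.cast_nonneg _
      linarith), fun c G D u A hfit hDc hA hu => ⟨fun _ => ?_, fun k hk => ?_⟩⟩
    · have := h1 c G D u _ hfit (by positivity) (zygmundNorm_le_of_holderNorm_le hlt hA hu)
      exact HasDyadic.mono ⟨_, this⟩ le_rfl (le_of_eq (by ring))
    · exact absurd (by rw [← hk, Nat.floor_natCast]) h

variable (E) in
/-- A scale of norms with the properties that are needed for the smoothing estimates: the
predicates `Data N r A f` and `Reg N r A f` express the regularity of order `r` of a function on the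
whole space, before and after smoothing. -/
structure NormScale where
  nrm : ℝ → Set E → (E → ℂ) → ℝ≥0∞
  ord : Set ℝ
  Data : ℕ → ℝ → ℝ → (E → ℂ) → Prop
  Reg : ℕ → ℝ → ℝ → (E → ℂ) → Prop
  congr : ∀ r (D : Set E), IsOpen D → ∀ u v, EqOn u v D → nrm r D u = nrm r D v
  mono : ∀ r (D D' : Set E), D ⊆ D' → ∀ u, nrm r D u ≤ nrm r D' u
  zero : ∀ r D, nrm r D (fun _ => 0) = 0
  bdd : ∀ r ∈ ord, ∀ (D : Set E) u A, 0 ≤ A → nrm r D u ≤ ofReal A →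
    ContinuousOn u D ∧ ∀ x ∈ D, ‖u x‖ ≤ A
  continuous : ∀ r ∈ ord, ∀ N A f, Data N r A f → Continuous f
  le_of_reg : ∀ r ∈ ord, ∀ N, ⌊r⌋₊ + 2 ≤ N → ∃ C : ℝ, 0 < C ∧ ∀ A f, Reg N r A f →
    nrm r univ f ≤ ofReal (C * A)
  reg_sum : ∀ N r (n : ℕ) (A : Fin n → ℝ) (f : Fin n → E → ℂ), (∀ j, Reg N r (A j) (f j)) →
    Reg N r (∑ j, A j) fun x => ∑ j, f j x
  reg_mono : ∀ N r A A' f, A ≤ A' → Reg N r A f → Reg N r A' f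
  reg_of_data : ∀ r ∈ ord, ∀ s ∈ ord, r ≤ s → ∀ N, ⌊r⌋₊ + 2 ≤ N → ∃ C : ℝ, 0 < C ∧ ∀ A f,
    Data N s A f → Reg N r (C * A) f
  data_mul : ∀ r ∈ ord, ∀ N, ⌊r⌋₊ + 2 ≤ N → ∀ (A B : ℝ) (a f : E → ℂ), ContDiff ℝ ∞ a →
    (∀ i ≤ N, ∀ x, ‖∇ i a x‖ ≤ B) → Data N r A f →
    Data N r (2 ^ N * B * A) fun x => a x * f x
  avg : ∀ (m N : ℕ) (p : E), ∀ r ∈ ord, ∀ s ∈ ord, s ≤ r → ⌊r⌋₊ + 2 ≤ N → ∃ K : ℝ, 0 < K ∧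
    ∀ t : ℝ, 0 < t → t ≤ 1 → ∀ A f, Data N s A f →
      Reg N r (K * t ^ (s - r) * A) (moserAvg m p t f)
  sub_avg : ∀ (m N : ℕ) (p : E), ∀ r ∈ ord, ∀ s ∈ ord, r ≤ s → s ≤ r + m → ⌊r⌋₊ + 2 ≤ N →
    ∃ K : ℝ, 0 < K ∧ ∀ t : ℝ, 0 < t → ∀ A f, Data (N + m) s A f →
      Reg N r (K * t ^ (s - r) * A) fun x => f x - moserAvg m p t f x
  data_sum : ∀ N r (n : ℕ) (A : Fin n → ℝ) (f : Fin n → E → ℂ), (∀ j, Data N r (A j) (f j)) →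
    Data N r (∑ j, A j) fun x => ∑ j, f j x
  data_mono : ∀ N r A A' f, A ≤ A' → Data N r A f → Data N r A' f
  localize : ∀ r ∈ ord, ∀ (N : ℕ) (p : E) (χ : E → ℝ), ContDiff ℝ ∞ χ → HasCompactSupport χ →
    ∀ ρ : ℝ, 0 < ρ → ∃ C : ℝ, 1 ≤ C ∧ ∀ (c : ℝ) (G D : Set E) (u : E → ℂ) (A : ℝ),
      PieceFit c p G D χ ρ → IsCompact (closure D) → 0 ≤ A → nrm r D u ≤ ofReal A →
        Data N r (C * A) (coneExt G p (localize χ D u))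

lemma zygmundNorm_zero (D : Set E) : zygmundNorm r D (fun _ : E => (0 : ℂ)) = 0 := by
  have := zygmundNorm_le (r := r) (D := D) (u := fun _ : E => (0 : ℂ)) (A := 0) le_rfl
    contDiff_const.contDiffOn (fun i _ x _ => by simp) (fun x h _ _ _ _ => by simp)
  simpa using this

lemma holderNorm_zero (D : Set E) : holderNorm r D (fun _ : E => (0 : ℂ)) = 0 := by
  have := holderNorm_le (r := r) (D := D) (u := fun _ : E => (0 : ℂ)) (A := 0) le_rfl
    contDiff_const.contDiffOn (fun i _ => Continuous.contUpToBoundary ((contDiff_const (n :=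
    ∞)).continuous_iteratedFDeriv (nat_le_infty i))) (fun i _ x _ => by simp) (fun x h _ _ _ =>
    by simp)
  simpa using this

lemma HasDyadic.of_order_le (h : r ≤ s) (hf : HasDyadic s N A f) : HasDyadic r N A f := by
  have hA := hf.nonneg
  obtain ⟨e, he⟩ := hf
  exact ⟨e, he.smooth, fun j i hi x => (he.bound j i hi x).trans (mul_le_mul_of_nonneg_left
    (dyadic_rpow_le (by linarith) j) hA), he.hasSum⟩

variable (E) in
/-- The scale of Hölder–Zygmund norms. -/
def zygmundScale : NormScale E where
  nrm := zygmundNorm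
  ord := Ioi 0
  Data := fun N r A f => HasDyadic r N A f
  Reg := fun N r A f => HasDyadic r N A f
  congr := fun r D hD u v h => zygmundNorm_congr hD h
  mono := fun r D D' h u => zygmundNorm_mono h u
  zero := fun r D => zygmundNorm_zero D
  bdd := fun r hr D u A hA h => by
    obtain ⟨h1, h2, -⟩ := of_zygmundNorm_le hA h
    exact ⟨h1.continuousOn, fun x hx => by simpa using h2 0 (Nat.zero_le _) x hx⟩
  continuous := fun r hr N A f h =>
    (h.ckBound (k := 0) (Nat.zero_le _) (by simpa using hr)).1.continuous
  le_of_reg := fun r hr N hN => zygmundNorm_le_of_hasDyadic hr (le_trans (by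
    have := Nat.le_floor (zk_lt hr).le
    omega) hN)
  reg_sum := fun N r n A f h => HasDyadic.sum _ fun j _ => h j
  reg_mono := fun N r A A' f hA h => h.mono le_rfl hA
  reg_of_data := fun r _ s _ hrs N _ => ⟨1, one_pos, fun A f h => by
    rw [one_mul]; exact h.of_order_le hrs⟩
  data_mul := fun r _ N _ A B a f ha hB hf => hf.mul ha hB
  avg := fun m N p r _ s hs hsr _ => HasDyadic.exists_moserAvg m N p hs hsr
  sub_avg := fun m N p r _ s hs hrs hsr _ => ⟨moserConst m N p, lt_of_lt_of_le one_pos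
    (one_le_moserConst m N p), fun t ht A f h => h.sub_moserAvg hs hrs hsr ht⟩
  data_sum := fun N r n A f h => HasDyadic.sum _ fun j _ => h j
  data_mono := fun N r A A' f hA h => h.mono le_rfl hA
  localize := fun r hr N p χ hχ hc ρ hρ => by
    obtain ⟨C, hC, h⟩ := exists_isDyadic_localize hr N p hχ hc hρ
    exact ⟨C, hC, fun c G D u A hfit _ hA hu => ⟨_, h c G D u A hfit hA hu⟩⟩

variable (E) in
/-- The scale of Hölder norms. -/
def holderScale : NormScale E where
  nrm := holderNorm
  ord := Ici 0
  Data := HolderData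
  Reg := HolderReg
  congr := fun r D hD u v h => holderNorm_congr hD h
  mono := fun r D D' h u => holderNorm_mono h u
  zero := fun r D => holderNorm_zero D
  bdd := fun r hr D u A hA h => by
    obtain ⟨h1, -, h2, -⟩ := of_holderNorm_le hA h
    exact ⟨h1.continuousOn, fun x hx => by simpa using h2 0 (Nat.zero_le _) x hx⟩
  continuous := fun r hr N A f h => by
    rcases (show (0 : ℝ) ≤ r from hr).eq_or_lt with h0 | h0
    · exact (h.2 0 (by simpa using h0)).1.continuous
    · exact ((h.1 h0).ckBound (k := 0) (Nat.zero_le _) (by simpa using h0)).1.continuous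
  le_of_reg := fun r hr N hN => HolderReg.exists_holderNorm_le hr (by omega)
  reg_sum := fun N r n A f h => HolderReg.sum _ fun j _ => h j
  reg_mono := fun N r A A' f hA h => ⟨fun hr => (h.1 hr).mono le_rfl hA, fun k hk => (h.2 k hk).mono
    le_rfl hA⟩
  reg_of_data := fun r hr s hs hrs N hN => by
    by_cases hk : (⌊r⌋₊ : ℝ) < s
    · have hs0 : 0 < s := lt_of_le_of_lt (Nat.cast_nonneg _) hk
      refine ⟨1 + dyadicSum (s - ⌊r⌋₊), by
        have := dyadicSum_nonneg (s - ⌊r⌋₊)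
        linarith, fun A f h => ?_⟩
      have hd := h.1 hs0
      have hA := hd.nonneg
      have hds := dyadicSum_nonneg (s - ⌊r⌋₊)
      refine ⟨fun _ => (hd.of_order_le hrs).mono le_rfl (by nlinarith), fun k hkr => ?_⟩
      obtain rfl : k = ⌊r⌋₊ := by rw [← hkr, Nat.floor_natCast]
      exact (hd.ckBound (by omega) hk).mono le_rfl (by nlinarith)
    · have h1 := Nat.floor_le (show (0 : ℝ) ≤ r from hr)
      obtain rfl : r = s := by linarith
      refine ⟨1, one_pos, fun A f h => ⟨fun h2 => absurd h2 hk, fun k hk => ?_⟩⟩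
      rw [one_mul]; exact h.2 k hk
  data_mul := fun r _ N hN A B a f ha hB hf => hf.mul (by omega) ha hB
  avg := fun m N p r _ s hs hsr hN => HolderData.exists_moserAvg m N p hs hsr (by omega)
  sub_avg := fun m N p r hr s _ hrs hsr hN =>
    HolderData.exists_sub_moserAvg m N p hr hrs hsr (by omega)
  data_sum := fun N r n A f h => HolderData.sum _ fun j _ => h j
  data_mono := fun N r A A' f hA h => h.mono hA
  localize := fun r hr N p χ hχ hc ρ hρ => exists_holderData_localize hr N p hχ hc hρ

lemma tendsto_integral_bump_smul {ι : Type*} {l : Filter ι} [l.IsCountablyGenerated] {F : ι → E → ℂ}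
  (hm : ∀ᶠ i in l, AEStronglyMeasurable (fun y => stdBump E y • F i y) volume) (hB : ∀ᶠ i in l, ∀ y,
  ‖F i y‖ ≤ B) (h : ∀ y, Tendsto (fun i => F i y) l (𝓝 (g y))) : Tendsto (fun i => ∫ y, stdBump E y
  • F i y) l (𝓝 (∫ y, stdBump E y • g y)) := by
  refine tendsto_integral_filter_of_dominated_convergence (fun y => stdBump E y * B) hm ?_
    (integrable_stdBump.mul_const B) (Eventually.of_forall fun y => (h y).const_smul _)
  filter_upwards [hB] with i hi
  refine Eventually.of_forall fun y => ?_
  rw [norm_smul, norm_of_nonneg (stdBump_nonneg y)]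
  exact mul_le_mul_of_nonneg_left (hi y) (stdBump_nonneg y)

lemma bddMeas_of_contUpToBoundary (hD : IsOpen D) (hc : IsCompact (closure D)) (hu :
  ContUpToBoundary D u) : BddMeas (D.indicator u) := by
  obtain ⟨g, hg, hgu⟩ := hu
  obtain ⟨B, hB⟩ := hc.exists_bound_of_continuousOn hg
  refine bddMeas_indicator hD ((hg.mono subset_closure).congr hgu) (B := max B 0) (le_max_right _ _)
    fun x hx => ?_
  rw [hgu hx]
  exact (hB x (subset_closure hx)).trans (le_max_left _ _)

lemma exists_holderNorm_zero_le (hc : IsCompact (closure D)) (hu : ContUpToBoundary D u) : ∃ A : ℝ,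
  0 ≤ A ∧ holderNorm ((0 : ℕ) : ℝ) D u ≤ ofReal A := by
  obtain ⟨g, hg, hgu⟩ := hu
  obtain ⟨B, hB⟩ := hc.exists_bound_of_continuousOn hg
  have hb : ∀ x ∈ D, ‖u x‖ ≤ |B| := fun x hx => by
    rw [hgu hx]; exact (hB x (subset_closure hx)).trans (le_abs_self B)
  refine ⟨_, ?_, holderNorm_le (A := 2 * |B|) (by positivity) ?_ ?_ ?_ ?_⟩
  · positivity
  · rw [Nat.floor_natCast]
    exact contDiffOn_zero.2 ((hg.mono subset_closure).congr hgu)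
  · intro i hi
    obtain rfl : i = 0 := by rw [Nat.floor_natCast] at hi; omega
    refine ⟨fun x => (continuousMultilinearCurryFin0 ℝ E ℂ).symm (g x),
      (continuousMultilinearCurryFin0 ℝ E ℂ).symm.continuous.comp_continuousOn hg, fun x hx => ?_⟩
    rw [iteratedFDeriv_zero_eq_comp, Function.comp_apply, hgu hx]
  · intro i hi x hx
    obtain rfl : i = 0 := by rw [Nat.floor_natCast] at hi; omega
    rw [norm_iteratedFDeriv_zero]
    exact (hb x hx).trans (by linarith [abs_nonneg B])
  · intro x y _ hx hy
    rw [Nat.floor_natCast, sub_self, rpow_zero, mul_one, iteratedFDeriv_zero_eq_comp,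
      Function.comp_apply, Function.comp_apply, ← map_sub, LinearIsometryEquiv.norm_map]
    exact (norm_sub_le _ _).trans (by linarith [hb x hx, hb y hy])

lemma fderiv_moserAvg_apply (hO : IsOpen O) (hf : ContDiffOn ℝ 1 f O) (hx : ∀ k ≤ m, Sees p (2 ^ k *
  t) O x) (w : E) : fderiv ℝ (moserAvg m p t f) x w = moserAvg m p t (fun z => fderiv ℝ f z w) x :=
  by
  have h : HasFDerivAt (moserAvg m p t f) (∑ k ∈ range (m + 1), seeley m k • avg p (2 ^ k * t)
    (fderiv ℝ f) x) x := HasFDerivAt.fun_sum fun k hk => (hasFDerivAt_avg hO (hx k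
    (Nat.lt_succ_iff.1 (mem_range.1 hk))) hf).const_smul (seeley m k)
  rw [h.fderiv, sum_apply, moserAvg, cavg]
  refine sum_congr rfl fun k hk => ?_
  have hk' := hx k (Nat.lt_succ_iff.1 (mem_range.1 hk))
  rw [smul_apply, avg, ContinuousLinearMap.integral_apply (integrable_bump_smul hO hk'
    (hf.continuousOn_fderiv_of_isOpen hO le_rfl))]
  rfl

namespace LocalCover

variable (P : LocalCover E m)

lemma contDiff_globalOp {ψ : Fin P.num → E → ℝ} (hψ : ∀ j, ContDiff ℝ ∞ (ψ j)) (hc : ∀ j,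
  HasCompactSupport (ψ j)) (hf : BddMeas f) (ht : 0 < t) : ContDiff ℝ ∞ (P.globalOp ψ t f) := by
  refine ContDiff.sum fun j _ => ?_
  obtain ⟨hm, B, hB⟩ := hf.smul_cutoff (hψ j) (hc j)
  exact contDiff_cavg _ _ _ ht hm hB

lemma norm_globalOp_le {ψ : Fin P.num → E → ℝ} {Bψ : ℝ} (hψ : ∀ j x, ‖ψ j x‖ ≤ Bψ) (hB : ∀ x, ‖f x‖
  ≤ B) (t : ℝ) (x : E) : ‖P.globalOp ψ t f x‖ ≤ P.num * (absMoment (seeley m) (m + 1) 0 * (Bψ * B))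
  := by
  refine (norm_sum_le_of_le _ fun j _ => norm_cavg_le (O := univ) (fun _ _ _ _ => mem_univ _) fun z
    _ => ?_).trans_eq (by rw [Finset.sum_const, Finset.card_univ, Fintype.card_fin, nsmul_eq_mul])
  rw [norm_smul]
  exact mul_le_mul (hψ j z) (hB z) (norm_nonneg _) ((norm_nonneg _).trans (hψ j z))

lemma tendsto_globalOp {ι : Type*} {l : Filter ι} [l.IsCountablyGenerated] {ψ : Fin P.num → E → ℝ}
  (hψ : ∀ j, ContDiff ℝ ∞ (ψ j)) (hc : ∀ j, HasCompactSupport (ψ j)) {F : ι → E → ℂ} (ht : 0 < t)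
  (hm : ∀ᶠ i in l, BddMeas (F i)) (hB : ∀ᶠ i in l, ∀ y, ‖F i y‖ ≤ B) (h : ∀ y, Tendsto (fun i => F i
  y) l (𝓝 (g y))) (x : E) : Tendsto (fun i => P.globalOp ψ t (F i) x) l (𝓝 (P.globalOp ψ t g x)) :=
  by
  refine tendsto_finsetSum _ fun j _ => ?_
  unfold moserAvg cavg
  refine tendsto_finsetSum _ fun k _ => Tendsto.const_smul ?_ _
  obtain ⟨Bψ, -, hb⟩ := exists_bound_iterD (hψ j) (hc j) 0
  refine tendsto_integral_bump_smul (B := Bψ * B) ?_ ?_ fun y => (h _).const_smul _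
  · filter_upwards [hm] with i hi
    exact ((hi.smul_cutoff (hψ j) (hc j)).integrable _ (by positivity) x).aestronglyMeasurable
  · filter_upwards [hB] with i hi y
    have := hb 0 le_rfl (x + (2 ^ k * t) • (P.p j + y))
    rw [norm_iteratedFDeriv_zero] at this
    rw [norm_smul]
    exact mul_le_mul this (hi _) (norm_nonneg _) ((norm_nonneg _).trans this)

lemma tendsto_globalOp_self {ψ : Fin P.num → E → ℝ} (hψ : ∀ j, ContDiff ℝ ∞ (ψ j)) (hc : ∀ j,
  HasCompactSupport (ψ j)) (hf : Continuous f) (hB : ∀ x, ‖f x‖ ≤ B) (x : E) : Tendsto (fun t =>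
  P.globalOp ψ t f x) (𝓝[>] (0 : ℝ)) (𝓝 ((∑ j, ψ j x) • f x)) := by
  rw [sum_smul]
  refine tendsto_finsetSum _ fun j _ => ?_
  have e : ψ j x • f x = ∑ k ∈ range (m + 1), seeley m k • (ψ j x • f x) := by
    rw [← sum_smul, seeley_moment_zero, one_smul]
  rw [e]
  refine tendsto_finsetSum _ fun k _ => Tendsto.const_smul ?_ _
  have e2 : ψ j x • f x = ∫ y, stdBump E y • (fun _ : E => ψ j x • f x) y := by
    rw [integral_smul_const, integral_stdBump, one_smul]
  rw [e2]
  obtain ⟨Bψ, -, hb⟩ := exists_bound_iterD (hψ j) (hc j) 0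
  have hcont : Continuous fun z => ψ j z • f z := (hψ j).continuous.smul hf
  refine tendsto_integral_bump_smul (B := Bψ * B) ?_ ?_ fun y => ?_
  · refine Eventually.of_forall fun t => Continuous.aestronglyMeasurable ?_
    exact continuous_stdBump.smul (hcont.comp (by fun_prop))
  · refine Eventually.of_forall fun t y => ?_
    have := hb 0 le_rfl (x + (2 ^ k * t) • (P.p j + y))
    rw [norm_iteratedFDeriv_zero] at this
    rw [norm_smul]
    exact mul_le_mul this (hB _) (norm_nonneg _) ((norm_nonneg _).trans this)
  · refine Tendsto.mono_left ?_ nhdsWithin_le_nhds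
    have : Continuous fun t : ℝ => (fun z => ψ j z • f z) (x + (2 ^ k * t) • (P.p j + y)) :=
      hcont.comp (by fun_prop)
    exact this.tendsto' 0 _ (by simp)

/-- The derivatives of the cut-off functions in the direction `w`. -/
def gradχ (w : E) (j : Fin P.num) (z : E) : ℝ := fderiv ℝ (P.χ j) z w

lemma contDiff_gradχ (w : E) (j : Fin P.num) : ContDiff ℝ ∞ (P.gradχ w j) := ((P.smooth
  j).fderiv_right (by simp)).clm_apply contDiff_const

lemma tsupport_gradχ_subset (w : E) (j : Fin P.num) : tsupport (P.gradχ w j) ⊆ tsupport (P.χ j) :=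
  tsupport_fderiv_apply_subset ℝ w

lemma hasCompactSupport_gradχ (w : E) (j : Fin P.num) : HasCompactSupport (P.gradχ w j) := (P.supp
  j).isCompact.of_isClosed_subset (isClosed_tsupport _) (P.tsupport_gradχ_subset w j)

lemma exists_bound_gradχ (N : ℕ) : ∃ B : ℝ, 1 ≤ B ∧ ∀ w, ‖w‖ ≤ 1 → ∀ j, ∀ i ≤ N, ∀ x, ‖∇ i (P.gradχ
  w j) x‖ ≤ B := by
  choose B hB hb using fun j => exists_bound_iterD (P.smooth j) (P.supp j) (N + 1)
  refine ⟨1 + ∑ j, B j, by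
    have := sum_nonneg fun j (_ : j ∈ Finset.univ) => zero_le_one.trans (hB j)
    linarith, fun w hw j i hi x => ?_⟩
  have h1 := norm_iteratedFDeriv_clm_apply_const (N := (i : ℕ∞ω)) (x := x) (f := fderiv ℝ (P.χ j))
    (c := w) (n := i) (((P.smooth j).fderiv_right (m := i)
    (mod_cast nat_le_infty (i + 1))).contDiffAt) le_rfl
  rw [norm_iteratedFDeriv_fderiv] at h1
  have h2 := hb j (i + 1) (by omega) x
  have h3 : B j ≤ ∑ j, B j := single_le_sum (fun j _ => zero_le_one.trans (hB j)) (Finset.mem_univ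
    j)
  calc _ ≤ ‖w‖ * ‖∇ (i + 1) (P.χ j) x‖ := h1
    _ ≤ 1 * B j := mul_le_mul hw h2 (norm_nonneg _) zero_le_one
    _ ≤ _ := by linarith

lemma gradχ_neg (w : E) (j : Fin P.num) (z : E) : P.gradχ (-w) j z = -P.gradχ w j z := by
  simp [gradχ]

lemma globalOp_gradχ_neg (w : E) (t : ℝ) (f : E → ℂ) (x : E) : P.globalOp (P.gradχ (-w)) t f x =
  -P.globalOp (P.gradχ w) t f x := by
  rw [globalOp, globalOp, ← Finset.sum_neg_distrib]
  refine sum_congr rfl fun j _ => ?_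
  have e : (fun z => P.gradχ (-w) j z • f z) = fun z => (-1 : ℂ) * (P.gradχ w j z • f z) := by
    ext z; rw [gradχ_neg, neg_smul, neg_one_mul]
  rw [e, moserAvg, cavg_const_mul, neg_one_mul]; rfl

variable {P} {G : Fin P.num → Set E}

lemma Fits.sum_gradχ (hG : P.Fits D G) (hx : x ∈ thickening (P.c * P.τ) D) (w : E) : ∑ j, P.gradχ w
  j x = 0 := by
  have h1 : (fun x => ∑ j, P.χ j x) =ᶠ[𝓝 x] fun _ => 1 := eventually_of_mem
    (isOpen_thickening.mem_nhds hx) hG.sum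
  have h2 := h1.fderiv_eq (𝕜 := ℝ)
  rw [fderiv_fun_sum fun j _ => ((P.smooth j).differentiable (by simp)).differentiableAt] at h2
  have := congrArg (fun L => L w) h2
  simpa [gradχ, sum_apply] using this

lemma Fits.gradCommutator_eq (hG : P.Fits D G) (h0 : 0 < t) (ht : t ≤ P.τ) {w : E} (hu : ContDiffOn
  ℝ 1 u D) (hub : BddMeas (D.indicator u)) (hdb : BddMeas (D.indicator fun y => fderiv ℝ u y w)) (hx
  : x ∈ thickening (P.c * t) D) : gradCommutator (P.op D) t w u x = P.globalOp (P.gradχ w) t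
  (D.indicator u) x := by
  have e : P.op D t u = P.globalOp P.χ t (D.indicator u) := funext fun x => P.op_eq h0 ht hub x
  rw [gradCommutator, e, P.op_eq h0 ht hdb]
  have hd : ∀ j, ContDiff ℝ ∞ (moserAvg m (P.p j) t fun z => P.χ j z • D.indicator u z) := fun j =>
    by
      obtain ⟨hm, B, hB⟩ := hub.smul_cutoff (P.smooth j) (P.supp j)
      exact contDiff_cavg _ _ _ h0 hm hB
  have e2 : fderiv ℝ (P.globalOp P.χ t (D.indicator u)) x w = ∑ j, fderiv ℝ (moserAvg m (P.p j) t
    fun z => P.χ j z • D.indicator u z) x w := by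
    have : P.globalOp P.χ t (D.indicator u) = fun x => ∑ j, moserAvg m (P.p j) t (fun z => P.χ j z •
      D.indicator u z) x := rfl
    rw [this, fderiv_fun_sum fun j _ => ((hd j).differentiable (by simp)).differentiableAt,
      sum_apply]
  rw [e2, sub_eq_iff_eq_add, globalOp, globalOp, ← sum_add_distrib]
  refine sum_congr rfl fun j _ => ?_
  set O : Set E := D ∪ (tsupport (P.χ j))ᶜ with hOdef
  have hO : IsOpen O := hG.isOpen.union (isClosed_tsupport _).isOpen_compl
  have hs : ∀ k ≤ m, Sees (P.p j) (2 ^ k * t) O x := fun k hk y hy => by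
    by_cases h : x + (2 ^ k * t) • (P.p j + y) ∈ tsupport (P.χ j)
    · exact Or.inl (hG.mem h0 ht hx hk hy h)
    · exact Or.inr h
  have hz : ∀ z, z ∉ tsupport (P.χ j) → (fun z => P.χ j z • D.indicator u z) =ᶠ[𝓝 z] fun _ => 0 :=
    fun z hz => by
    filter_upwards [notMem_tsupport_iff_eventuallyEq.1 hz] with y hy
    rw [hy, Pi.zero_apply, zero_smul]
  have hev : ∀ z ∈ D, D.indicator u =ᶠ[𝓝 z] u := fun z hz =>
    (eqOn_indicator D u).eventuallyEq_of_mem (hG.isOpen.mem_nhds hz)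
  have hf : ContDiffOn ℝ 1 (fun z => P.χ j z • D.indicator u z) O := by
    intro z hzO
    by_cases h : z ∈ D
    · exact (((P.smooth j).of_le (by simp)).contDiffAt.smul ((hu.contDiffAt (hG.isOpen.mem_nhds
        h)).congr_of_eventuallyEq (hev z h))).contDiffWithinAt
    · exact (contDiffAt_const.congr_of_eventuallyEq (hz z (hzO.resolve_left h))).contDiffWithinAt
  rw [fderiv_moserAvg_apply hO hf hs]
  have hcongr : EqOn (fun z => fderiv ℝ (fun z => P.χ j z • D.indicator u z) z w) (fun z => P.gradχ
    w j z • D.indicator u z + P.χ j z • D.indicator (fun y => fderiv ℝ u y w) z) O := by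
    intro z hzO
    by_cases h : z ∈ D
    · have hud : HasFDerivAt (D.indicator u) (fderiv ℝ u z) z := (((hu.contDiffAt
        (hG.isOpen.mem_nhds h)).differentiableAt (by simp)).hasFDerivAt).congr_of_eventuallyEq (hev
        z h)
      have hχd := (((P.smooth j).differentiable (by simp)).differentiableAt (x := z)).hasFDerivAt
      have := hχd.fun_smul hud
      simp only [this.fderiv, indicator_of_mem h]
      simp [gradχ, add_comm]
    · have hzχ := hzO.resolve_left h
      simp only [(hz z hzχ).fderiv_eq, indicator_of_notMem h]
      simp
  rw [moserAvg, cavg_congr (fun k hk => hs k (by omega)) hcongr]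
  exact cavg_add (hub.smul_cutoff (P.contDiff_gradχ w j) (P.hasCompactSupport_gradχ w j))
    (hdb.smul_cutoff (P.smooth j) (P.supp j)) _ _ _ h0 x

end LocalCover

lemma enorm_le_of_forall {C b : ℝ} (hC : 0 < C) (hb : 0 < b) {X Y : ℝ≥0∞} (h : ∀ A : ℝ, 0 ≤ A → Y ≤
  ofReal A → X ≤ ofReal (C * (b * A))) : X ≤ (C.toNNReal : ℝ≥0∞) * ofReal b * Y := by
  have e : (C.toNNReal : ℝ≥0∞) = ofReal C := rfl
  by_cases hY : Y = ⊤
  · rw [hY, ENNReal.mul_top]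
    · exact le_top
    · rw [e, ← ofReal_mul hC.le]
      exact (ENNReal.ofReal_pos.2 (mul_pos hC hb)).ne'
  · have := h Y.toReal toReal_nonneg (ofReal_toReal hY).ge
    rwa [ofReal_mul hC.le, ofReal_mul hb.le, ofReal_toReal hY, ← mul_assoc] at this

lemma norm_iterD_ofReal {ψ : E → ℝ} {i : ℕ} (hψ : ContDiff ℝ ∞ ψ) (x : E) : ‖∇ i (fun x => ((ψ x :
  ℝ) : ℂ)) x‖ = ‖∇ i ψ x‖ := Complex.ofRealLI.norm_iteratedFDeriv_comp_left (hψ.of_le (nat_le_infty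
  i)).contDiffAt le_rfl

namespace LocalCover

variable (P : LocalCover E m)

lemma _root_.MoserSmoothing.NormScale.data_smul (Λ : NormScale E) (hr : r ∈ Λ.ord) (hN :
  ⌊r⌋₊ + 2 ≤ N) {ψ : E → ℝ} (hψ : ContDiff ℝ ∞ ψ) (hB : ∀ i ≤ N, ∀ x, ‖∇ i ψ x‖ ≤ B) (hf : Λ.Data N r A f) :
  Λ.Data N r (2 ^ N * B * A) fun x => ψ x • f x := by
  simp_rw [← Complex.coe_smul, smul_eq_mul]
  exact Λ.data_mul r hr N hN A B (fun z => ((ψ z : ℝ) : ℂ)) f (Complex.ofRealCLM.contDiff.comp hψ)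
    (fun i hi x => by rw [norm_iterD_ofReal hψ]; exact hB i hi x) hf

lemma exists_data_ext (Λ : NormScale E) (hs : s ∈ Λ.ord) (hN : ⌊s⌋₊ + 2 ≤ N) : ∃ C : ℝ, 0 < C ∧
  ∀ (D : Set E) (G : Fin P.num → Set E) (u : E → ℂ) (A : ℝ), P.Fits D G → 0 ≤ A → Λ.nrm s D u ≤
  ofReal A → Λ.Data N s (C * A) (P.ext D G u) := by
  choose C hC h using fun j => Λ.localize s hs N (P.p j) _ (P.smooth j) (P.supp j) _ P.ρ_pos
  choose B hB hb using fun j => exists_bound_iterD (P.smooth' j) (P.supp' j) N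
  refine ⟨1 + ∑ j, 2 ^ N * B j * C j, by
    have := sum_nonneg fun j (_ : j ∈ Finset.univ) => show 0 ≤ 2 ^ N * B j * C j by
      have := hB j
      have := hC j
      positivity
    linarith, fun D G u A hG hA hu => Λ.data_mono N s _ _ _ ?_ (Λ.data_sum N s P.num _ _ fun j =>
      Λ.data_smul hs hN (P.smooth' j) (hb j) (h j P.c (G j) D u A (hG.fit j) hG.isCompact_closure hA
      hu))⟩
  rw [add_mul, one_mul, sum_mul]
  simp_rw [← mul_assoc]
  linarith

lemma exists_reg_globalOp (Λ : NormScale E) (hr : r ∈ Λ.ord) (hs : s ∈ Λ.ord) (hsr : s ≤ r) (hN :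
  ⌊r⌋₊ + 2 ≤ N) (B : ℝ) : ∃ K : ℝ, 0 < K ∧ ∀ ψ : Fin P.num → E → ℝ, (∀ j, ContDiff ℝ ∞ (ψ j)) → (∀
  j, ∀ i ≤ N, ∀ x, ‖∇ i (ψ j) x‖ ≤ B) → ∀ t : ℝ, 0 < t → t ≤ 1 → ∀ A f, 0 ≤ A → Λ.Data N s A f →
  Λ.Reg N r (K * t ^ (s - r) * A) (P.globalOp ψ t f) := by
  choose K hK h using fun j => Λ.avg m N (P.p j) r hr s hs hsr hN
  refine ⟨1 + ∑ j, K j * (2 ^ N * |B|), by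
    have := sum_nonneg fun j (_ : j ∈ Finset.univ) =>
      mul_nonneg (hK j).le (by positivity : 0 ≤ 2 ^ N * |B|)
    linarith, fun ψ hψ hB t h0 h1 A f hA hf => ?_⟩
  have hsN : ⌊s⌋₊ + 2 ≤ N := le_trans (by have := Nat.floor_mono hsr; omega) hN
  have key : ∀ j, Λ.Reg N r (K j * t ^ (s - r) * (2 ^ N * |B| * A)) (moserAvg m (P.p j) t fun z => ψ
    j z • f z) := fun j => by
    exact h j t h0 h1 _ _ (Λ.data_smul hs hsN (hψ j) (fun i hi x => (hB j i hi x).trans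
      (le_abs_self B)) hf)
  refine Λ.reg_mono N r _ _ _ ?_ (Λ.reg_sum N r P.num _ _ key)
  have ht : 0 ≤ t ^ (s - r) * A := by positivity
  calc _ = (∑ j, K j * (2 ^ N * |B|)) * (t ^ (s - r) * A) := by
        rw [sum_mul]; exact sum_congr rfl fun j _ => by ring
    _ ≤ _ := by rw [mul_assoc]; gcongr; linarith

lemma exists_reg_sub_globalOp (Λ : NormScale E) (hr : r ∈ Λ.ord) (hs : s ∈ Λ.ord) (hrs : r ≤ s) (hsr
  : s ≤ r + m) (hN : ⌊r⌋₊ + 2 ≤ N) (hNs : ⌊s⌋₊ + 2 ≤ N) (B : ℝ) : ∃ K : ℝ, 0 < K ∧ ∀ ψ : Fin P.num →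
  E → ℝ, (∀ j, ContDiff ℝ ∞ (ψ j)) → (∀ j, ∀ i ≤ N + m, ∀ x, ‖∇ i (ψ j) x‖ ≤ B) → ∀ t : ℝ, 0 < t → ∀
  A f, 0 ≤ A → Λ.Data (N + m) s A f → Λ.Reg N r (K * t ^ (s - r) * A) fun x => (∑ j, ψ j x) • f x -
  P.globalOp ψ t f x := by
  choose K hK h using fun j => Λ.sub_avg m N (P.p j) r hr s hs hrs hsr hN
  refine ⟨1 + ∑ j, K j * (2 ^ (N + m) * |B|), by
    have := sum_nonneg fun j (_ : j ∈ Finset.univ) =>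
      mul_nonneg (hK j).le (by positivity : 0 ≤ 2 ^ (N + m) * |B|)
    linarith, fun ψ hψ hB t h0 A f hA hf => ?_⟩
  have key : ∀ j, Λ.Reg N r (K j * t ^ (s - r) * (2 ^ (N + m) * |B| * A)) (fun x => ψ j x • f x -
    moserAvg m (P.p j) t (fun z => ψ j z • f z) x) := fun j => by
    exact h j t h0 _ (fun z => ψ j z • f z) (Λ.data_smul hs (by omega) (hψ j) (fun i hi x =>
      (hB j i hi x).trans (le_abs_self B)) hf)
  have e : (fun x => (∑ j, ψ j x) • f x - P.globalOp ψ t f x) = fun x => ∑ j, (ψ j x • f x -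
    moserAvg m (P.p j) t (fun z => ψ j z • f z) x) := by
    ext x; rw [sum_smul, sum_sub_distrib]; rfl
  rw [e]
  refine Λ.reg_mono N r _ _ _ ?_ (Λ.reg_sum N r P.num _ _ key)
  have ht : 0 ≤ t ^ (s - r) * A := by positivity
  calc _ = (∑ j, K j * (2 ^ (N + m) * |B|)) * (t ^ (s - r) * A) := by
        rw [sum_mul]; exact sum_congr rfl fun j _ => by ring
    _ ≤ _ := by rw [mul_assoc]; gcongr; linarith

lemma exists_bound_χ (N : ℕ) : ∃ B : ℝ, ∀ j, ∀ i ≤ N, ∀ x, ‖∇ i (P.χ j) x‖ ≤ B := by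
  choose B hB hb using fun j => exists_bound_iterD (P.smooth j) (P.supp j) N
  exact ⟨∑ j, B j, fun j i hi x => (hb j i hi x).trans (single_le_sum (fun j _ => zero_le_one.trans
    (hB j)) (Finset.mem_univ j))⟩

lemma norm_χ_le : ∃ B : ℝ, ∀ j x, ‖P.χ j x‖ ≤ B := by
  obtain ⟨B, hB⟩ := P.exists_bound_χ 0
  exact ⟨B, fun j x => by simpa using hB j 0 le_rfl x⟩

lemma hasCompactSupport_ext (D : Set E) (G : Fin P.num → Set E) (u : E → ℂ) : HasCompactSupport
  (P.ext D G u) := by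
  refine HasCompactSupport.intro (isCompact_iUnion fun j => P.supp' j) fun x hx => ?_
  refine sum_eq_zero fun j _ => ?_
  rw [image_eq_zero_of_notMem_tsupport fun h => hx (mem_iUnion.2 ⟨j, h⟩), zero_smul]

variable {P} {G : Fin P.num → Set E}

lemma Fits.bddMeas (hG : P.Fits D G) (hu : ContUpToBoundary D u) : BddMeas (D.indicator u) :=
  bddMeas_of_contUpToBoundary hG.isOpen hG.isCompact_closure hu

lemma Fits.tendsto_ext (hG : P.Fits D G) (hu : ContUpToBoundary D u) (j : Fin P.num) : BddMeas
  (localize (P.χ j) D u) ∧ Continuous (coneExt (G j) (P.p j) (localize (P.χ j) D u)) ∧ ∀ x, Tendsto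
  (fun J : ℕ => ∑ i ∈ range J, extPiece (G j) (P.p j) (localize (P.χ j) D u) i x) atTop (𝓝 (coneExt
  (G j) (P.p j) (localize (P.χ j) D u) x)) := by
  obtain ⟨A, hA, h⟩ := exists_holderNorm_zero_le hG.isCompact_closure hu
  obtain ⟨C, hC, h1⟩ := exists_ckBound_localize 0 0 (P.p j) (P.smooth j) (P.supp j) P.ρ_pos
  obtain ⟨h2, h3, -, h4⟩ := h1 P.c (G j) D u A (hG.fit j) hG.isCompact_closure hA h
  exact ⟨h2, h3.1.continuous, h4⟩

lemma Fits.continuous_ext (hG : P.Fits D G) (hu : ContUpToBoundary D u) : Continuous (P.ext D G u)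
  := continuous_finsetSum _ fun j _ => (P.smooth' j).continuous.smul (hG.tendsto_ext hu j).2.1

lemma Fits.exists_norm_ext_le (hG : P.Fits D G) (hu : ContUpToBoundary D u) : ∃ B : ℝ, ∀ x, ‖P.ext D
  G u x‖ ≤ B := (P.hasCompactSupport_ext D G u).exists_bound_of_continuous (hG.continuous_ext hu)

lemma Fits.ext_eqOn_of_contUpToBoundary (hG : P.Fits D G) (hu : ContUpToBoundary D u) : EqOn (P.ext
  D G u) u D := by
  obtain ⟨-, B, hB⟩ := hG.bddMeas hu
  have h := hu
  obtain ⟨g, hg, hgu⟩ := h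
  refine hG.ext_eqOn ((hg.mono subset_closure).congr hgu) (B := B) fun x hx => ?_
  have := hB x
  rwa [indicator_of_mem hx] at this

lemma Fits.isOperatorOn_ext (hG : P.Fits D G) : IsOperatorOn D (P.ext D G) := by
  refine ⟨fun u u' h => P.ext_congr G h, fun u u' hu hu' => ?_, fun a u hu => ?_⟩
  · have hs : ContUpToBoundary D (u + u') := by
      obtain ⟨g, hg, hgu⟩ := hu
      obtain ⟨g', hg', hgu'⟩ := hu'
      exact ⟨g + g', hg.add hg', fun x hx => by simp [hgu hx, hgu' hx]⟩
    ext x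
    rw [Pi.add_apply, ext, ext, ext, ← sum_add_distrib]
    refine sum_congr rfl fun j _ => ?_
    rw [← smul_add]
    congr 1
    obtain ⟨m1, -, t1⟩ := hG.tendsto_ext hu j
    obtain ⟨m2, -, t2⟩ := hG.tendsto_ext hu' j
    refine tendsto_nhds_unique ((hG.tendsto_ext hs j).2.2 x) ?_
    have e : localize (P.χ j) D (u + u') = fun x => localize (P.χ j) D u x + localize (P.χ j) D u' x
      := by
      ext x; simp only [localize, indicator_add', Pi.add_apply, smul_add]
    simp_rw [e, extPiece_add m1 m2, sum_add_distrib]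
    exact (t1 x).add (t2 x)
  · have hs : ContUpToBoundary D (a • u) := by
      obtain ⟨g, hg, hgu⟩ := hu
      exact ⟨a • g, hg.const_smul a, fun x hx => by simp [hgu hx]⟩
    ext x
    rw [Pi.smul_apply, smul_eq_mul, ext, ext, mul_sum]
    refine sum_congr rfl fun j _ => ?_
    rw [mul_smul_comm]
    congr 1
    obtain ⟨m1, -, t1⟩ := hG.tendsto_ext hu j
    refine tendsto_nhds_unique ((hG.tendsto_ext hs j).2.2 x) ?_
    have e : localize (P.χ j) D (a • u) = fun x => a * localize (P.χ j) D u x := by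
      ext x
      rw [localize, show D.indicator (a • u) x = a * D.indicator u x from indicator_const_smul_apply
        D a u x, localize, mul_smul_comm]
    simp_rw [e, extPiece_const_mul, ← mul_sum]
    exact (t1 x).const_mul a

lemma exists_nrm_ext_le (P : LocalCover E m) (Λ : NormScale E) {a : ℝ} (ha : a ∈ Λ.ord) : ∃ K : ℝ≥0,
  ∀ (D : Set E) (G : Fin P.num → Set E), P.Fits D G → ∀ u, Λ.nrm a univ (P.ext D G u) ≤ K * Λ.nrm a
  D u := by
  obtain ⟨C₁, h₁0, h₁⟩ := P.exists_data_ext Λ ha (N := ⌊a⌋₊ + 2) le_rfl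
  obtain ⟨C₂, h₂0, h₂⟩ := Λ.reg_of_data a ha a ha le_rfl (⌊a⌋₊ + 2) le_rfl
  obtain ⟨C₃, h₃0, h₃⟩ := Λ.le_of_reg a ha (⌊a⌋₊ + 2) le_rfl
  have hK : 0 < C₃ * C₂ * C₁ := by positivity
  refine ⟨(C₃ * C₂ * C₁).toNNReal, fun D G hG u => ?_⟩
  have := enorm_le_of_forall (X := Λ.nrm a univ (P.ext D G u)) (Y := Λ.nrm a D u) hK one_pos fun A
    hA hu => (h₃ _ _ (h₂ _ _ (h₁ D G u A hG hA hu))).trans_eq (by congr 1; ring)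
  rwa [ENNReal.ofReal_one, mul_one] at this

variable (P) in
theorem exists_isExtension : ∃ A : ℝ → ℝ≥0, ∀ (D : Set E) (G : Fin P.num → Set E), P.Fits D G →
  IsExtension D A (P.ext D G) := by
  choose! K₁ h₁ using fun a (ha : a ∈ (zygmundScale E).ord) => P.exists_nrm_ext_le _ ha
  choose! K₂ h₂ using fun a (ha : a ∈ (holderScale E).ord) => P.exists_nrm_ext_le _ ha
  refine ⟨fun a => K₁ a + K₂ a, fun D G hG => ⟨hG.isOperatorOn_ext, fun u hu =>
    hG.ext_eqOn_of_contUpToBoundary hu, fun u hu => hG.continuous_ext hu, fun u _ =>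
    P.hasCompactSupport_ext D G u, fun a ha u => (h₁ a ha D G hG u).trans ?_, fun a ha u => (h₂ a ha
    D G hG u).trans ?_⟩⟩
  · gcongr; exacts [le_self_add, le_rfl]
  · gcongr; exacts [le_add_self, le_rfl]

lemma Fits.contUpToBoundary (hG : P.Fits D G) (Λ : NormScale E) (hr : r ∈ Λ.ord) (hu : Λ.nrm r D u ≠
  ⊤) : ContUpToBoundary D u := by
  have hle : Λ.nrm r D u ≤ ofReal (Λ.nrm r D u).toReal := (ofReal_toReal hu).ge
  obtain ⟨C, -, h⟩ := P.exists_data_ext Λ hr (N := ⌊r⌋₊ + 2) le_rfl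
  obtain ⟨h1, h2⟩ := Λ.bdd r hr D u _ toReal_nonneg hle
  exact (Continuous.contUpToBoundary (Λ.continuous r hr _ _ _ (h D G u _ hG toReal_nonneg
    hle))).congr (hG.ext_eqOn h1 h2)

lemma Fits.op_eqOn (hG : P.Fits D G) (h0 : 0 < t) (ht : t ≤ P.τ) (hu : ContUpToBoundary D u) (hf :
  EqOn f u D) : EqOn (P.op D t u) (P.globalOp P.χ t f) (thickening (P.c * t) D) := fun x hx => by
  rw [P.op_eq h0 ht (hG.bddMeas hu)]
  exact hG.globalOp_congr h0 ht (fun _ => Subset.rfl) ((eqOn_indicator D u).trans hf.symm) hx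

lemma Fits.contDiff_op (hG : P.Fits D G) (h0 : 0 < t) (ht : t ≤ P.τ) (hu : ContUpToBoundary D u) :
  ContDiff ℝ ∞ (P.op D t u) := by
  rw [show P.op D t u = P.globalOp P.χ t (D.indicator u) from funext (P.op_eq h0 ht (hG.bddMeas
    hu))]
  exact P.contDiff_globalOp P.smooth P.supp (hG.bddMeas hu) h0

lemma Fits.isOperatorOn_op (hG : P.Fits D G) (h0 : 0 < t) : IsOperatorOn D (P.op D t) := by
  refine ⟨fun u u' h => P.op_congr h, fun u u' hu hu' => ?_, fun a u hu => ?_⟩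
  · by_cases ht : t ≤ P.τ
    · have hm := hG.bddMeas hu
      have hm' := hG.bddMeas hu'
      have e : D.indicator (u + u') = fun x => D.indicator u x + D.indicator u' x := indicator_add'
        D u u'
      ext x
      rw [Pi.add_apply, P.op_eq h0 ht hm, P.op_eq h0 ht hm', P.op_eq h0 ht
        (by rw [e]; exact hm.add hm'), globalOp, globalOp, globalOp, ← sum_add_distrib]
      refine sum_congr rfl fun j _ => ?_
      simp_rw [e, smul_add]
      exact cavg_add (hm.smul_cutoff (P.smooth j) (P.supp j)) (hm'.smul_cutoff (P.smooth j) (P.supp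
        j)) _ _ _ h0 x
    · simp only [P.op_of_lt (not_le.1 ht)]
      ext x; simp
  · by_cases ht : t ≤ P.τ
    · have hm := hG.bddMeas hu
      have e : D.indicator (a • u) = fun x => a * D.indicator u x := by
        ext x; exact indicator_const_smul_apply D a u x
      ext x
      rw [Pi.smul_apply, smul_eq_mul, P.op_eq h0 ht hm, P.op_eq h0 ht (by rw [e]; exact hm.smul a),
        globalOp, globalOp, mul_sum]
      refine sum_congr rfl fun j _ => ?_
      simp_rw [e, ← mul_smul_comm]
      exact cavg_const_mul _ a _ _ _ _ x
    · simp only [P.op_of_lt (not_le.1 ht)]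
      ext x; simp

lemma Fits.tendsto_op (hG : P.Fits D G) (hu : ContUpToBoundary D u) : (∃ B : ℝ, ∀ t, 0 < t → t ≤ P.τ
  → ∀ x, ‖P.op D t u x‖ ≤ B) ∧ ∀ x ∈ D, Tendsto (fun t => P.op D t u x) (𝓝[>] (0 : ℝ)) (𝓝 (u x)) :=
  by
  constructor
  · obtain ⟨-, B, hB⟩ := hG.bddMeas hu
    obtain ⟨Bχ, hχ⟩ := P.norm_χ_le
    refine ⟨P.num * (absMoment (seeley m) (m + 1) 0 * (Bχ * B)), fun t h0 ht x => ?_⟩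
    rw [P.op_eq h0 ht (hG.bddMeas hu)]
    exact P.norm_globalOp_le hχ hB t x
  · intro x hx
    have hpos : 0 < P.c * P.τ := mul_pos (by linarith [P.one_le_c]) P.τ_pos
    obtain ⟨B, hB⟩ := hG.exists_norm_ext_le hu
    have h := P.tendsto_globalOp_self P.smooth P.supp (hG.continuous_ext hu) hB x
    rw [hG.sum x (self_subset_thickening hpos _ hx), one_smul, hG.ext_eqOn_of_contUpToBoundary hu
      hx] at h
    refine h.congr' ?_
    filter_upwards [Ioo_mem_nhdsGT P.τ_pos] with t ht
    exact (hG.op_eqOn ht.1 ht.2.le hu (hG.ext_eqOn_of_contUpToBoundary hu) (self_subset_thickening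
      (mul_pos (by linarith [P.one_le_c]) ht.1) _ hx)).symm

lemma Fits.tendsto_globalOp_op (hG : P.Fits D G) {ψ : Fin P.num → E → ℝ} (hψ : ∀ j, ContDiff ℝ ∞ (ψ
  j)) (hc : ∀ j, HasCompactSupport (ψ j)) (ht : 0 < t) (hu : ContUpToBoundary D u) (x : E) : Tendsto
  (fun ε => P.globalOp ψ t (D.indicator (P.op D ε u)) x) (𝓝[>] (0 : ℝ)) (𝓝 (P.globalOp ψ t
  (D.indicator u) x)) := by
  obtain ⟨⟨B, hB⟩, hlim⟩ := hG.tendsto_op hu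
  refine P.tendsto_globalOp (l := 𝓝[>] (0 : ℝ)) (F := fun ε => D.indicator (P.op D ε u)) hψ hc (B :=
    |B|) ht ?_ ?_ (fun y => ?_) x
  · filter_upwards [Ioo_mem_nhdsGT P.τ_pos] with ε hε
    exact hG.bddMeas (Continuous.contUpToBoundary (hG.contDiff_op hε.1 hε.2.le hu).continuous)
  · filter_upwards [Ioo_mem_nhdsGT P.τ_pos] with ε hε y
    by_cases hy : y ∈ D
    · rw [indicator_of_mem hy]; exact (hB ε hε.1 hε.2.le y).trans (le_abs_self B)
    · rw [indicator_of_notMem hy, norm_zero]; exact abs_nonneg B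
  · by_cases hy : y ∈ D
    · simp_rw [indicator_of_mem hy]; exact hlim y hy
    · simp_rw [indicator_of_notMem hy]; exact tendsto_const_nhds

lemma _root_.ContDiff.c1UpToBoundary (hu : ContDiff ℝ ∞ u) (D : Set E) : C1UpToBoundary D u :=
  ⟨(hu.of_le (by simp)).contDiffOn, Continuous.contUpToBoundary hu.continuous, fun w =>
    Continuous.contUpToBoundary ((hu.continuous_fderiv (by simp)).clm_apply continuous_const)⟩

lemma Fits.isGradCommutator (hG : P.Fits D G) (h0 : 0 < t) (ht : t ≤ P.τ) (hu : ContUpToBoundary D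
  u) (w : E) : IsGradCommutator D (P.op D) t w u (P.globalOp (P.gradχ w) t (D.indicator u)) := by
  have hc1 : ∀ v, C1UpToBoundary D v → ∀ x ∈ thickening t D, gradCommutator (P.op D) t w v x =
    P.globalOp (P.gradχ w) t (D.indicator v) x := fun v hv x hx => hG.gradCommutator_eq h0 ht hv.1
    (hG.bddMeas hv.2.1) (hG.bddMeas (hv.2.2 w)) (thickening_mono (by nlinarith [P.one_le_c]) _ hx)
  refine ⟨fun x hx => ?_, fun hv x hx => (hc1 u hv x hx).symm⟩
  refine (hG.tendsto_globalOp_op (P.contDiff_gradχ w) (P.hasCompactSupport_gradχ w) h0 hu x).congr'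
    ?_
  filter_upwards [Ioo_mem_nhdsGT P.τ_pos] with ε hε
  exact (hc1 _ ((hG.contDiff_op hε.1 hε.2.le hu).c1UpToBoundary D) x hx).symm

end LocalCover

namespace LocalCover

variable (P : LocalCover E m) (Λ : NormScale E)

lemma thickening_subset_thickening_mul (ht : 0 < t) (D : Set E) : thickening t D ⊆ thickening (P.c *
  t) D := thickening_mono (by nlinarith [P.one_le_c]) _

lemma nrm_thickening_le {b : ℝ≥0∞} (hfg : EqOn f g (thickening t D)) (h : Λ.nrm r univ g ≤ b) :
  Λ.nrm r (thickening t D) f ≤ b := by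
  rw [Λ.congr r _ isOpen_thickening f g hfg]
  exact (Λ.mono r _ _ (subset_univ _) g).trans h

lemma exists_bound (hr : r ∈ Λ.ord) (hs : s ∈ Λ.ord) (hsr : s ≤ r) : ∃ K : ℝ≥0, ∀ (D : Set E) (G :
  Fin P.num → Set E), P.Fits D G → ∀ t, 0 < t → t ≤ 1 → ∀ u, Λ.nrm r (thickening t D) (P.op D t u) ≤
  K * ofReal (t ^ (s - r)) * Λ.nrm s D u := by
  set N := ⌊r⌋₊ + 2
  have hsN : ⌊s⌋₊ + 2 ≤ N := Nat.add_le_add_right (Nat.floor_mono hsr) 2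
  obtain ⟨C₁, h₁0, h₁⟩ := P.exists_data_ext Λ hs hsN
  obtain ⟨B, hB⟩ := P.exists_bound_χ N
  obtain ⟨C₂, h₂0, h₂⟩ := P.exists_reg_globalOp Λ hr hs hsr le_rfl B
  obtain ⟨C₃, h₃0, h₃⟩ := Λ.le_of_reg r hr N le_rfl
  refine ⟨(C₃ * C₂ * C₁).toNNReal, fun D G hG t h0 h1 u => ?_⟩
  refine enorm_le_of_forall (by positivity) (by positivity) fun A hA hu => ?_
  by_cases ht : t ≤ P.τ
  · obtain ⟨b1, b2⟩ := Λ.bdd s hs D u A hA hu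
    have hc := hG.contUpToBoundary Λ hs (hu.trans_lt ENNReal.ofReal_lt_top).ne
    refine nrm_thickening_le Λ ((hG.op_eqOn h0 ht hc (hG.ext_eqOn b1 b2)).mono
      (P.thickening_subset_thickening_mul h0 D)) ?_
    refine (h₃ _ _ (h₂ P.χ P.smooth hB t h0 h1 _ _ (by positivity) (h₁ D G u A hG hA hu))).trans_eq
      (by congr 1; ring)
  · rw [P.op_of_lt (not_le.1 ht), Λ.zero]; exact zero_le

lemma exists_approx (hr : r ∈ Λ.ord) (hs : s ∈ Λ.ord) (hrs : r ≤ s) (hsr : s ≤ r + m) : ∃ K : ℝ≥0, ∀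
  (D : Set E) (G : Fin P.num → Set E), P.Fits D G → ∀ t, 0 < t → t ≤ 1 → ∀ u, Λ.nrm r (thickening t
  D) (P.ext D G u - P.op D t (P.ext D G u)) ≤ K * ofReal (t ^ (s - r)) * Λ.nrm s D u := by
  set N := ⌊s⌋₊ + 2
  have hrN : ⌊r⌋₊ + 2 ≤ N := Nat.add_le_add_right (Nat.floor_mono hrs) 2
  obtain ⟨C₁, h₁0, h₁⟩ := P.exists_data_ext Λ hs (N := N + m) (by omega)
  obtain ⟨B, hB⟩ := P.exists_bound_χ (N + m)
  obtain ⟨C₂, h₂0, h₂⟩ := P.exists_reg_sub_globalOp Λ hr hs hrs hsr hrN le_rfl B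
  obtain ⟨C₃, h₃0, h₃⟩ := Λ.le_of_reg r hr N hrN
  obtain ⟨C₄, h₄0, h₄⟩ := Λ.reg_of_data r hr s hs hrs (N + m) (by omega)
  obtain ⟨C₅, h₅0, h₅⟩ := Λ.le_of_reg r hr (N + m) (by omega)
  have hτ := P.τ_pos
  refine ⟨(C₃ * C₂ * C₁ + C₅ * C₄ * C₁ * P.τ ^ (r - s)).toNNReal, fun D G hG t h0 h1 u => ?_⟩
  refine enorm_le_of_forall (by positivity) (by positivity) fun A hA hu => ?_
  obtain ⟨b1, b2⟩ := Λ.bdd s hs D u A hA hu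
  have hc := hG.contUpToBoundary Λ hs (hu.trans_lt ENNReal.ofReal_lt_top).ne
  have hTc := hG.continuous_ext hc
  by_cases ht : t ≤ P.τ
  · have he : EqOn (P.ext D G u - P.op D t (P.ext D G u)) (fun x => (∑ j, P.χ j x) • P.ext D G u x -
      P.globalOp P.χ t (P.ext D G u) x) (thickening t D) := fun x hx => by
      have hx' := P.thickening_subset_thickening_mul h0 D hx
      have hx2 := thickening_mono (mul_le_mul_of_nonneg_left ht
        (by linarith [P.one_le_c] : 0 ≤ P.c)) D hx'
      rw [Pi.sub_apply, hG.op_eqOn h0 ht (Continuous.contUpToBoundary hTc) (fun _ _ => rfl) hx']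
      simp only [hG.sum x hx2, one_smul]
    refine nrm_thickening_le Λ he ((h₃ _ _ (h₂ P.χ P.smooth hB t h0 _ _ (by positivity) (h₁ D G u A
      hG hA hu))).trans (ofReal_le_ofReal ?_))
    have h5 : 0 ≤ C₅ * C₄ * C₁ * P.τ ^ (r - s) := by positivity
    have h6 : 0 ≤ t ^ (s - r) * A := by positivity
    calc _ = (C₃ * C₂ * C₁) * (t ^ (s - r) * A) := by ring
      _ ≤ _ := by gcongr; linarith
  · have he : P.ext D G u - P.op D t (P.ext D G u) = P.ext D G u := by
      ext x; rw [P.op_of_lt (not_le.1 ht), Pi.sub_apply, sub_zero]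
    rw [he]
    refine (Λ.mono r _ _ (subset_univ _) _).trans ((h₅ _ _ (h₄ _ _ (h₁ D G u A hG hA hu))).trans
      (ofReal_le_ofReal ?_))
    have h1 : 1 ≤ P.τ ^ (r - s) * t ^ (s - r) := by
      rw [← neg_sub, Real.rpow_neg hτ.le, inv_mul_eq_div, one_le_div (by positivity)]
      exact rpow_le_rpow hτ.le (not_le.1 ht).le (by linarith)
    have h5 : 0 ≤ C₃ * C₂ * C₁ * (t ^ (s - r) * A) := by positivity
    have h6 : 0 ≤ C₅ * C₄ * C₁ * A := by positivity
    calc _ = (C₅ * C₄ * C₁ * A) * 1 := by ring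
      _ ≤ (C₅ * C₄ * C₁ * A) * (P.τ ^ (r - s) * t ^ (s - r)) := mul_le_mul_of_nonneg_left h1 h6
      _ ≤ C₃ * C₂ * C₁ * (t ^ (s - r) * A) + (C₅ * C₄ * C₁ * A) * (P.τ ^ (r - s) * t ^ (s - r)) :=
        le_add_of_nonneg_left h5
      _ = _ := by ring

variable {P} in
lemma Fits.globalOp_gradχ_eq {G : Fin P.num → Set E} (hG : P.Fits D G) (h0 : 0 < t) (ht : t ≤ P.τ)
  (w : E) (hf : EqOn f u D) (hx : x ∈ thickening (P.c * t) D) : P.globalOp (P.gradχ w) t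
  (D.indicator u) x = P.globalOp (P.gradχ w) t f x ∧ P.globalOp (P.gradχ w) t f x = (∑ j, P.gradχ
  (-w) j x) • f x - P.globalOp (P.gradχ (-w)) t f x := by
  have hx2 := thickening_mono (mul_le_mul_of_nonneg_left ht (by linarith [P.one_le_c] : 0 ≤ P.c)) D
    hx
  refine ⟨hG.globalOp_congr h0 ht (P.tsupport_gradχ_subset w) ((eqOn_indicator D u).trans hf.symm)
    hx, ?_⟩
  rw [hG.sum_gradχ hx2, zero_smul, P.globalOp_gradχ_neg, zero_sub, neg_neg]

lemma exists_reg_gradχ (hr : r ∈ Λ.ord) (hs : s ∈ Λ.ord) (hrs : r ≤ s + m) (hN : ⌊s⌋₊ + 2 ≤ N) (hNr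
  : ⌊r⌋₊ + 2 ≤ N) : ∃ (K : ℝ) (N' : ℕ), 0 < K ∧ ⌊r⌋₊ + 2 ≤ N' ∧ ∀ (D : Set E) (G : Fin P.num → Set
  E), P.Fits D G → ∀ t, 0 < t → t ≤ P.τ → ∀ w : E, ‖w‖ ≤ 1 → ∀ (A : ℝ) (u f : E → ℂ), 0 ≤ A → Λ.Data
  N' r A f → EqOn f u D → ∃ F, Λ.Reg N s (K * t ^ (r - s) * A) F ∧ EqOn (P.globalOp (P.gradχ w) t
  (D.indicator u)) F (thickening (P.c * t) D) := by
  obtain ⟨B, -, hB⟩ := P.exists_bound_gradχ (N + m)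
  rcases le_total r s with h | h
  · obtain ⟨K, hK, h1⟩ := P.exists_reg_globalOp Λ hs hr h hN B
    refine ⟨K, N, hK, hNr, fun D G hG t h0 ht w hw A u f hA hf hfu => ⟨_, h1 (P.gradχ w)
      (P.contDiff_gradχ w) (fun j i hi => hB w hw j i (by omega)) t h0 (ht.trans P.τ_le_one) A f hA
      hf, fun x hx => (hG.globalOp_gradχ_eq h0 ht w hfu hx).1⟩⟩
  · obtain ⟨K, hK, h1⟩ := P.exists_reg_sub_globalOp Λ hs hr h hrs hN hNr B
    refine ⟨K, N + m, hK,
      by omega, fun D G hG t h0 ht w hw A u f hA hf hfu => ⟨_, h1 (P.gradχ (-w)) (P.contDiff_gradχ (-w)) (fun j i hi => hB (-w) (by rwa [norm_neg]) j i hi) t h0 A f hA hf, fun x hx => ?_⟩⟩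
    obtain ⟨e1, e2⟩ := hG.globalOp_gradχ_eq h0 ht w hfu hx
    rw [e1, e2]

lemma exists_commutator (hr : r ∈ Λ.ord) (hs : s ∈ Λ.ord) (hrs : |r - s| < m) : ∃ K : ℝ≥0, ∀ (D :
  Set E) (G : Fin P.num → Set E), P.Fits D G → ∀ t, 0 < t → t ≤ 1 → ∀ w : E, ‖w‖ ≤ 1 → ∀ u, Λ.nrm r
  D u ≠ ⊤ → ∃ W, IsGradCommutator D (P.op D) t w u W ∧ Λ.nrm s (thickening t D) W ≤ K * ofReal (t ^
  (r - s)) * Λ.nrm r D u := by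
  set N := ⌊r⌋₊ + ⌊s⌋₊ + 2
  obtain ⟨C₂, N', h₂0, hN', h₂⟩ := P.exists_reg_gradχ Λ hr hs (N := N)
    (by linarith [(abs_lt.1 hrs).2]) (by omega) (by omega)
  obtain ⟨C₁, h₁0, h₁⟩ := P.exists_data_ext Λ hr hN'
  obtain ⟨C₃, h₃0, h₃⟩ := Λ.le_of_reg s hs N (by omega)
  refine ⟨(C₃ * C₂ * C₁).toNNReal, fun D G hG t h0 h1 w hw u hu => ?_⟩
  by_cases ht : t ≤ P.τ
  · refine ⟨_, hG.isGradCommutator h0 ht (hG.contUpToBoundary Λ hr hu) w, enorm_le_of_forall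
      (by positivity) (by positivity) fun A hA hu => ?_⟩
    obtain ⟨b1, b2⟩ := Λ.bdd r hr D u A hA hu
    obtain ⟨F, hF, hFe⟩ := h₂ D G hG t h0 ht w hw (C₁ * A) u _ (by positivity) (h₁ D G u A hG hA hu)
      (hG.ext_eqOn b1 b2)
    refine nrm_thickening_le Λ (hFe.mono (P.thickening_subset_thickening_mul h0 D)) ?_
    exact (h₃ _ _ hF).trans_eq (by congr 1; ring)
  · have hz : ∀ v x, gradCommutator (P.op D) t w v x = 0 := fun v x => by
      simp [gradCommutator, P.op_of_lt (not_le.1 ht)]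
    refine ⟨fun _ => 0, ⟨fun x _ => ?_, fun _ x _ => (hz u x).symm⟩, ?_⟩
    · simp_rw [hz]; exact tendsto_const_nhds
    · rw [Λ.zero]; exact zero_le

theorem exists_smoothingBounds : ∃ C : ℝ → ℝ → ℝ≥0, ∀ (D : Set E) (G : Fin P.num → Set E), P.Fits D
  G → ∀ C', (∀ r s, C r s ≤ C' r s) → SmoothingBounds Λ.nrm Λ.ord m C' D (P.op D) (P.ext D G) := by
  choose! K₁ h₁ using fun r s (h : r ∈ Λ.ord ∧ s ∈ Λ.ord ∧ s ≤ r) =>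
    P.exists_bound Λ h.1 h.2.1 h.2.2
  choose! K₂ h₂ using fun r s (h : r ∈ Λ.ord ∧ s ∈ Λ.ord ∧ r ≤ s ∧ s ≤ r + m) =>
    P.exists_approx Λ h.1 h.2.1 h.2.2.1 h.2.2.2
  choose! K₃ h₃ using fun r s (h : r ∈ Λ.ord ∧ s ∈ Λ.ord ∧ |r - s| < m) =>
    P.exists_commutator Λ h.1 h.2.1 h.2.2
  refine ⟨fun r s => K₁ r s + K₂ r s + K₃ r s, fun D G hG C' hC' => ⟨?_, ?_, ?_⟩⟩
  · intro r hr s hs hsr t h0 ht u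
    refine (h₁ r s ⟨hr, hs, hsr⟩ D G hG t h0 ht u).trans ?_
    gcongr
    exact (le_self_add.trans le_self_add).trans (hC' r s)
  · intro r hr s hs hrs hsr t h0 ht u
    refine (h₂ r s ⟨hr, hs, hrs, hsr⟩ D G hG t h0 ht u).trans ?_
    gcongr
    exact (le_add_self.trans le_self_add).trans (hC' r s)
  · intro r hr s hs hrs t h0 ht w hw u hu
    obtain ⟨W, hW, hW'⟩ := h₃ r s ⟨hr, hs, hrs⟩ D G hG t h0 ht w hw u hu
    refine ⟨W, hW, hW'.trans ?_⟩
    gcongr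
    exact le_add_self.trans (hC' r s)

theorem exists_isMoserSmoothing : ∃ (A : ℝ → ℝ≥0) (C : ℝ → ℝ → ℝ≥0), ∀ (D : Set E) (G : Fin P.num →
  Set E), P.Fits D G → ∀ A' C', (∀ a, A a ≤ A' a) → (∀ r s, C r s ≤ C' r s) → IsMoserSmoothing m P.τ
  A' C' D (P.op D) (P.ext D G) := by
  obtain ⟨A, hA⟩ := P.exists_isExtension
  obtain ⟨C₁, h₁⟩ := P.exists_smoothingBounds (zygmundScale E)
  obtain ⟨C₂, h₂⟩ := P.exists_smoothingBounds (holderScale E)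
  refine ⟨A, fun r s => C₁ r s + C₂ r s, fun D G hG A' C' hA' hC' => ?_⟩
  have hext := hA D G hG
  refine ⟨⟨hext.operator, hext.eqOn, hext.continuous, hext.supp, fun a ha u =>
    (hext.zygmund a ha u).trans (by gcongr; exact hA' a), fun a ha u =>
    (hext.holder a ha u).trans (by gcongr; exact hA' a)⟩,
    ⟨hG.kernel, fun t _ ht => P.op_eq_smoothing hG ht⟩, fun t h0 _ => hG.isOperatorOn_op h0,
    fun t h0 _ u hu => ?_,
    h₁ D G hG C' fun r s => le_self_add.trans (hC' r s),
    h₂ D G hG C' fun r s => le_add_self.trans (hC' r s)⟩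
  by_cases ht : t ≤ P.τ
  · exact (hG.contDiff_op h0 ht hu).contDiffOn
  · rw [P.op_of_lt (not_le.1 ht)]; exact contDiffOn_const

end LocalCover

theorem LipschitzCover.exists_isMoserSmoothing (L : LipschitzCover E) (m : ℕ) : ∃ (τ : ℝ) (A : ℝ →
  ℝ≥0) (C : ℝ → ℝ → ℝ≥0), 0 < τ ∧ τ ≤ 1 ∧ ∀ D : Set E, L.Describes D → ∃ S T, IsMoserSmoothing m τ A
  C D S T := by
  obtain ⟨P, -, hP⟩ := L.exists_localCover m le_rfl
  obtain ⟨A, C, h⟩ := P.exists_isMoserSmoothing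
  refine ⟨P.τ, A, C, P.τ_pos, P.τ_le_one, fun D hD => ?_⟩
  obtain ⟨G, hG⟩ := hP D hD
  exact ⟨_, _, h D G hG A C (fun _ => le_rfl) fun _ _ => le_rfl⟩

end Operators

section UniformBounds

variable {n : ℕ} {ι : Type*} {r s : ℝ} {b : ι → ℝ} {B B' : ι → Set (Cn n)}
  {h h' : ι → Cn n → ℂ}

/-- The functions `h a` agree on `B a` with functions on the whole space whose norms of order `r`
are bounded by a constant times `b a`. -/
def UB (r : ℝ) (b : ι → ℝ) (B : ι → Set (Cn n)) (h : ι → Cn n → ℂ) : Prop := ∀ N, ∃ K : ℝ, 0 ≤ K ∧ ∀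
  a, ∃ H, HasDyadic r N (K * b a) H ∧ EqOn (h a) H (B a)

lemma UB.congr (hu : UB r b B h) (hB : ∀ a, B' a ⊆ B a) (hh : ∀ a, EqOn (h' a) (h a) (B' a)) : UB r
  b B' h' := fun N => by
  obtain ⟨K, hK, H⟩ := hu N
  refine ⟨K, hK, fun a => ?_⟩
  obtain ⟨f, h1, h2⟩ := H a
  exact ⟨f, h1, (hh a).trans (h2.mono (hB a))⟩

lemma UB.sum {σ : Type*} (S : Finset σ) {h : σ → ι → Cn n → ℂ} (hu : ∀ p ∈ S, UB r b B (h p)) : UB r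
  b B fun a z => ∑ p ∈ S, h p a z := fun N => by
  have h1 : ∀ p, ∃ K : ℝ, 0 ≤ K ∧ (p ∈ S → ∀ a, ∃ H, HasDyadic r N (K * b a) H ∧ EqOn (h p a) H (B
    a)) := fun p => by
    by_cases hp : p ∈ S
    · obtain ⟨K, hK, H⟩ := hu p hp N
      exact ⟨K, hK, fun _ => H⟩
    · exact ⟨0, le_rfl, fun h => absurd h hp⟩
  choose K hK H using h1
  refine ⟨∑ p ∈ S, K p, sum_nonneg fun p _ => hK p, fun a => ?_⟩
  choose! f hf using fun p hp => H p hp a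
  refine ⟨fun z => ∑ p ∈ S, f p z, ?_, fun z hz => sum_congr rfl fun p hp => (hf p hp).2 hz⟩
  rw [sum_mul]
  exact HasDyadic.sum S fun p hp => (hf p hp).1

lemma UB.add (hu : UB r b B h) (hu' : UB r b B h') : UB r b B fun a z => h a z + h' a z := by
  refine (UB.sum Finset.univ (h := fun p : Bool => if p then h else h') fun p _ => ?_).congr (fun a
    => Subset.rfl) fun a z _ => by simp
  cases p <;> simpa

lemma UB.mul {μ : Cn n → ℂ} (hμ : ContDiff ℝ ∞ μ) (hc : HasCompactSupport μ) (hu : UB r b B h) : UB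
  r b B fun a z => μ z * h a z := fun N => by
  obtain ⟨K, hK, H⟩ := hu N
  obtain ⟨C, hC, hb⟩ := exists_bound_iterD hμ hc N
  refine ⟨2 ^ N * C * K, by positivity, fun a => ?_⟩
  obtain ⟨f, h1, h2⟩ := H a
  exact ⟨_, (h1.mul hμ hb).mono le_rfl (by rw [← mul_assoc]), fun z hz => congrArg (μ z * ·) (h2
    hz)⟩

variable {m : ℕ} (P : LocalCover (Cn n) m) {D : ι → Set (Cn n)} {G : ι → Fin P.num → Set (Cn n)}
  {t : ι → ℝ} {u : ι → Cn n → ℂ}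

lemma UB.ext (hb : ∀ a, 0 ≤ b a) (hG : ∀ a, P.Fits (D a) (G a)) (hs : 0 < s) (hu : UB s b D u) : UB
  s b (fun _ => univ) fun a => P.ext (D a) (G a) (u a) := fun N => by
  obtain ⟨K, hK, H⟩ := hu (max N (zk s + 2))
  obtain ⟨C, hC, h1⟩ := zygmundNorm_le_of_hasDyadic (E := Cn n) hs (le_max_right N (zk s + 2))
  obtain ⟨C', hC', h2⟩ := P.exists_data_ext (zygmundScale _) hs (N := N + ⌊s⌋₊ + 2) (by omega)
  refine ⟨C' * (C * K), by positivity, fun a => ⟨_, ?_, fun z _ => rfl⟩⟩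
  obtain ⟨f, h3, h4⟩ := H a
  have h5 := h2 (D a) (G a) (u a) (C * (K * b a)) (hG a) (mul_nonneg hC.le (mul_nonneg hK (hb a)))
    ((zygmundNorm_congr (hG a).isOpen h4).trans_le ((zygmundNorm_mono (subset_univ _) f).trans (h1 _
    _ h3)))
  exact HasDyadic.mono h5 (by omega) (le_of_eq (by ring))

lemma UB.op (hb : ∀ a, 0 ≤ b a) (hG : ∀ a, P.Fits (D a) (G a)) (ht : ∀ a, 0 < t a) (htτ : ∀ a, t a ≤
  P.τ) (hr : 0 < r) (hs : 0 < s) (hsr : s ≤ r) (hc : ∀ a, ContUpToBoundary (D a) (u a)) (hu : UB s b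
  D u) : UB r (fun a => t a ^ (s - r) * b a) (fun a => thickening (P.c * t a) (D a)) fun a => P.op
  (D a) (t a) (u a) := fun N => by
  obtain ⟨K, hK, H⟩ := hu (max N (⌊r⌋₊ + 2))
  obtain ⟨Bχ, hB⟩ := P.exists_bound_χ (max N (⌊r⌋₊ + 2))
  obtain ⟨C, hC, h1⟩ := P.exists_reg_globalOp (zygmundScale (Cn n)) hr hs hsr (le_max_right N (⌊r⌋₊
    + 2)) Bχ
  refine ⟨C * K, by positivity, fun a => ?_⟩
  obtain ⟨f, h3, h4⟩ := H a
  refine ⟨_, ((show HasDyadic _ _ _ _ from h1 P.χ P.smooth hB (t a) (ht a) ((htτ a).trans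
    P.τ_le_one) _ f (mul_nonneg hK (hb a)) h3).mono (le_max_left _ _) (le_of_eq (by ring))), (hG
    a).op_eqOn (ht a) (htτ a) (hc a) h4.symm⟩

lemma UB.sub_op (hb : ∀ a, 0 ≤ b a) (hG : ∀ a, P.Fits (D a) (G a)) (ht : ∀ a, 0 < t a) (htτ : ∀ a, t
  a ≤ P.τ) (hr : 0 < r) (hs : 0 < s) (hrs : r ≤ s) (hsr : s ≤ r + m) (hc : ∀ a, ContUpToBoundary (D
  a) (u a)) (hB : ∀ a, D a ⊆ B a) (hB' : ∀ a, B a ⊆ thickening (P.c * t a) (D a)) (hh : UB s b B h)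
  (hu : ∀ a, EqOn (h a) (u a) (D a)) : UB r (fun a => t a ^ (s - r) * b a) B fun a z => h a z - P.op
  (D a) (t a) (u a) z := fun N => by
  set N' := max N (max (⌊r⌋₊ + 2) (⌊s⌋₊ + 2)) with hN'
  obtain ⟨K, hK, H⟩ := hh (N' + m)
  obtain ⟨Bχ, hχ⟩ := P.exists_bound_χ (N' + m)
  obtain ⟨C, hC, h1⟩ := P.exists_reg_sub_globalOp (zygmundScale (Cn n)) hr hs hrs hsr (N := N')
    (by omega) (by omega) Bχ
  refine ⟨C * K, by positivity, fun a => ?_⟩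
  obtain ⟨f, h3, h4⟩ := H a
  refine ⟨_, ((show HasDyadic _ _ _ _ from h1 P.χ P.smooth hχ (t a) (ht a) _ f (mul_nonneg hK (hb
    a)) h3).mono (by omega) (le_of_eq (by ring))), fun z hz => ?_⟩
  have hz' := hB' a hz
  have hsum := (hG a).sum z (thickening_mono (mul_le_mul_of_nonneg_left (htτ a)
    (by linarith [P.one_le_c])) _ hz')
  change h a z - P.op (D a) (t a) (u a) z = (∑ j, P.χ j z) • f z - _
  rw [hsum, one_smul, h4 hz, (hG a).op_eqOn (ht a) (htτ a) (hc a) ((h4.mono (hB a)).symm.trans (hu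
    a)) hz']

lemma UB.gradχ (hb : ∀ a, 0 ≤ b a) (hG : ∀ a, P.Fits (D a) (G a)) (ht : ∀ a, 0 < t a) (htτ : ∀ a, t
  a ≤ P.τ) (hr : 0 < r) (hs : 0 < s) (hrs : r ≤ s + m) {w : Cn n} (hw : ‖w‖ ≤ 1) (hu : UB r b D u) :
  UB s (fun a => t a ^ (r - s) * b a) (fun a => thickening (P.c * t a) (D a)) fun a => P.globalOp
  (P.gradχ w) (t a) ((D a).indicator (u a)) := fun N => by
  set N' := max N (max (⌊r⌋₊ + 2) (⌊s⌋₊ + 2)) with hN'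
  obtain ⟨C, N₁, hC, -, h1⟩ := P.exists_reg_gradχ (zygmundScale (Cn n)) hr hs hrs (N := N')
    (by omega) (by omega)
  obtain ⟨K, hK, H⟩ := hu N₁
  refine ⟨C * K, by positivity, fun a => ?_⟩
  obtain ⟨f, h3, h4⟩ := H a
  obtain ⟨g, h5, h6⟩ := h1 (D a) (G a) (hG a) (t a) (ht a) (htτ a) w hw _ (u a) f (mul_nonneg hK (hb
    a)) h3 h4.symm
  exact ⟨g, (show HasDyadic _ _ _ _ from h5).mono (by omega) (le_of_eq (by ring)), h6⟩

end UniformBounds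

section UpToBoundary

variable {n : ℕ} {D : Set (Cn n)} {u u' : Cn n → ℂ} {a : Cn n → ℂ}

lemma ContUpToBoundary.add (hu : ContUpToBoundary D u) (hu' : ContUpToBoundary D u') :
  ContUpToBoundary D fun z => u z + u' z := by
  obtain ⟨g, h1, h2⟩ := hu
  obtain ⟨g', h1', h2'⟩ := hu'
  exact ⟨_, h1.add h1', fun z hz => congrArg₂ (· + ·) (h2 hz) (h2' hz)⟩

lemma ContUpToBoundary.mul (ha : Continuous a) (hu : ContUpToBoundary D u) : ContUpToBoundary D fun
  z => a z * u z := by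
  obtain ⟨g, h1, h2⟩ := hu
  exact ⟨_, ha.continuousOn.mul h1, fun z hz => congrArg (a z * ·) (h2 hz)⟩

lemma C1UpToBoundary.congr (hD : IsOpen D) (hu : C1UpToBoundary D u) (h : EqOn u' u D) :
  C1UpToBoundary D u' := ⟨hu.1.congr h, (contUpToBoundary_congr h).2 hu.2.1, fun w =>
  (contUpToBoundary_congr fun z hz => by
    rw [(h.eventuallyEq_of_mem (hD.mem_nhds hz)).fderiv_eq]).2 (hu.2.2 w)⟩

lemma C1UpToBoundary.mul (hD : IsOpen D) (ha : ContDiff ℝ ∞ a) (hu : C1UpToBoundary D u) :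
  C1UpToBoundary D fun z => a z * u z := by
  refine ⟨(ha.contDiffOn.of_le (by simp)).mul hu.1, hu.2.1.mul ha.continuous, fun w => ?_⟩
  have hw : Continuous fun z => fderiv ℝ a z w := (ha.continuous_fderiv (by simp)).clm_apply
    continuous_const
  refine (contUpToBoundary_congr fun z hz => ?_).2 (((hu.2.2 w).mul ha.continuous).add (hu.2.1.mul
    hw))
  rw [fderiv_fun_mul (ha.differentiable (by simp) z) ((hu.1.differentiableOn
    (by simp)).differentiableAt (hD.mem_nhds hz))]
  simp [mul_comm]

end UpToBoundary

section ConjugateForms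

variable {n q : ℕ}

/-- The standard basis vectors. -/
abbrev stdVec (i : Fin n) : Cn n := EuclideanSpace.single i (1 : ℂ)

/-- The value of `d z̄^{J_1} ∧ ⋯ ∧ d z̄^{J_q}` on the vectors `c`. -/
def cdet (J : Fin q → Fin n) (c : Fin q → Cn n) : ℂ := Matrix.det (Matrix.of fun a b : Fin q =>
  (starRingEnd ℂ) (c b (J a)))

/-- `cdet J` as an alternating map. -/
def cdetMap (J : Fin q → Fin n) : AlternatingMap ℝ (Cn n) ℂ (Fin q) := AlternatingMap.compLinearMap
  { Matrix.detRowAlternating.toMultilinearMap.restrictScalars ℝ with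
      map_eq_zero_of_eq' := (Matrix.detRowAlternating (n := Fin q) (R := ℂ)).map_eq_zero_of_eq' }
        (LinearMap.pi fun a => Complex.conjAe.toLinearMap ∘ₗ ((EuclideanSpace.proj (J a) : Cn n
        →L[ℂ] ℂ).restrictScalars ℝ).toLinearMap)

lemma cdetMap_apply (J : Fin q → Fin n) (c : Fin q → Cn n) : cdetMap J c = cdet J c := by
  rw [cdet, ← Matrix.det_transpose]
  rfl

lemma cdet_update_I (J : Fin q → Fin n) (c : Fin q → Cn n) (i : Fin q) : cdet J (Function.update c i
  (Complex.I • c i)) = -(Complex.I * cdet J c) := by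
  unfold cdet
  have key : (Matrix.of fun a b : Fin q =>
      (starRingEnd ℂ) ((Function.update c i (Complex.I • c i)) b (J a))) =
      (Matrix.of fun a b : Fin q => (starRingEnd ℂ) (c b (J a))).updateCol i ((-Complex.I) • fun a
        => (starRingEnd ℂ) (c i (J a))) := by
    ext a b
    by_cases h : b = i
    · subst h; simp
    · simp [h]
  rw [key, Matrix.det_updateCol_smul, ← neg_mul]
  congr 2
  ext a b
  by_cases h : b = i
  · subst h; simp
  · simp [h]

lemma cdet_cons (i : Fin n) (J : Fin q → Fin n) (c : Fin (q + 1) → Cn n) : cdet (Fin.cons i J) c = ∑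
  a : Fin (q + 1), (-1 : ℂ) ^ (a : ℕ) * ((starRingEnd ℂ) (c a i) * cdet J fun b => c (a.succAbove
  b)) := by
  rw [cdet, Matrix.det_succ_row_zero]
  refine sum_congr rfl fun a _ => ?_
  simp only [Matrix.of_apply, Fin.cons_zero, mul_assoc]
  rfl

lemma cdet_stdVec (J I : MultiIndex q n) : cdet J.1 (fun b => stdVec (I.1 b)) = if J = I then 1 else
  0 := by
  split_ifs with h
  · subst h
    rw [cdet, ← Matrix.det_one (n := Fin q)]
    congr 1
    ext a b
    simp [Matrix.one_apply, J.2.injective.eq_iff]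
  · have : ∃ a, J.1 a ∉ Set.range I.1 := by
      by_contra! hc
      refine h (Subtype.ext ((J.2.range_inj I.2).1 ?_))
      refine Set.eq_of_subset_of_ncard_le (Set.range_subset_iff.2 hc) ?_ (Set.toFinite _)
      rw [← Set.image_univ, ← Set.image_univ, Set.ncard_image_of_injective _ J.2.injective,
        Set.ncard_image_of_injective _ I.2.injective]
    obtain ⟨a, ha⟩ := this
    refine Matrix.det_eq_zero_of_row_eq_zero a fun b => ?_
    have : J.1 a ≠ I.1 b := fun h => ha ⟨b, h.symm⟩
    simp [this]

variable {W : Type*} [AddCommGroup W] [Module ℂ W]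

lemma sum_cdet_smul (α : AlternatingMap ℝ (Cn n) W (Fin q))
    (hα : ∀ w i, α (Function.update w i (Complex.I • w i)) = -(Complex.I • α w))
    (c : Fin q → Cn n) :
    α c = ∑ J : MultiIndex q n, cdet J.1 c • α fun a => stdVec (J.1 a) := by
  have hI : ∀ w i (x : Cn n), α (Function.update w i (Complex.I • x)) =
      -(Complex.I • α (Function.update w i x)) := fun w i x => by
    have := hα (Function.update w i x) i
    simpa using this
  have hsm : ∀ (w : Fin q → Cn n) i (s : ℂ) (x : Cn n), α (Function.update w i (s • x)) =
      (starRingEnd ℂ) s • α (Function.update w i x) := fun w i s x => by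
    have hs : s • x = s.re • x + s.im • (Complex.I • x) := by
      conv_lhs => rw [← Complex.re_add_im s, add_smul, mul_smul]
      norm_cast
    rw [hs, α.map_update_add, α.map_update_smul, α.map_update_smul, hI]
    conv_rhs => rw [← Complex.re_add_im ((starRingEnd ℂ) s), add_smul, mul_smul]
    simp only [Complex.conj_re, Complex.conj_im, Complex.ofReal_neg, Complex.coe_smul, smul_neg,
      neg_smul]
  let cj : Cn n → Cn n := fun x => WithLp.toLp 2 fun i => (starRingEnd ℂ) (x i)
  have cj_up : ∀ (w : Fin q → Cn n) i x, (fun b => cj (Function.update w i x b)) =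
      Function.update (fun b => cj (w b)) i (cj x) := fun w i x => by
    ext b : 1
    by_cases h : b = i
    · subst h; simp
    · simp [h]
  let β : AlternatingMap ℂ (Cn n) W (Fin q) :=
    { toFun := fun w => α fun b => cj (w b)
      map_update_add' := by
        intro inst w i x y
        rw [Subsingleton.elim inst (instDecidableEqFin q), cj_up, cj_up, cj_up,
          ← α.map_update_add]
        congr 2; ext; simp [cj]
      map_update_smul' := by
        intro inst w i s x
        rw [Subsingleton.elim inst (instDecidableEqFin q), cj_up, cj_up]
        have : cj (s • x) = (starRingEnd ℂ) s • cj x := by ext; simp [cj]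
        rw [this, hsm, Complex.conj_conj]
      map_eq_zero_of_eq' := fun w i j h hij => α.map_eq_zero_of_eq _ (by simp [h]) hij }
  let γ : AlternatingMap ℂ (Cn n) W (Fin q) := ∑ J : MultiIndex q n,
    (LinearMap.toSpanSingleton ℂ W (α fun a => stdVec (J.1 a))).compAlternatingMap
      ((Matrix.detRowAlternating (n := Fin q) (R := ℂ)).compLinearMap
        (LinearMap.pi fun a => (EuclideanSpace.proj (J.1 a) : Cn n →L[ℂ] ℂ).toLinearMap))
  have hγ : ∀ w, γ w = ∑ J : MultiIndex q n, cdet J.1 (fun b => cj (w b)) •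
      α fun a => stdVec (J.1 a) := fun w => by
    let ev : AlternatingMap ℂ (Cn n) W (Fin q) →+ W := ⟨⟨fun δ => δ w, rfl⟩, fun _ _ => rfl⟩
    refine (map_sum ev _ _).trans ?_
    refine sum_congr rfl fun J _ => ?_
    rw [cdet, ← Matrix.det_transpose]
    simp only [cj, Complex.conj_conj]
    rfl
  have hcj : ∀ x, cj (cj x) = x := fun x => by ext; simp [cj]
  have hstd : ∀ i : Fin n, cj (stdVec i) = stdVec i := fun i => by
    ext j
    simp [cj, apply_ite]
  suffices β = γ by
    have h := hγ (fun b => cj (c b))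
    rw [← this] at h
    simpa only [β, AlternatingMap.coe_mk, MultilinearMap.coe_mk, hcj] using h
  refine Module.Basis.ext_alternating (EuclideanSpace.basisFun (Fin n) ℂ).toBasis fun f hf => ?_
  have hb : (fun i => (EuclideanSpace.basisFun (Fin n) ℂ).toBasis (f i)) = fun i => stdVec (f i) := by
    ext i : 1; simp
  let J₀ : MultiIndex q n := ⟨f ∘ Tuple.sort f, (Tuple.monotone_sort f).strictMono_of_injective
    (hf.comp (Tuple.sort f).injective)⟩
  have hf0 : (fun i => stdVec (f i)) = (fun i => stdVec (J₀.1 i)) ∘ (Tuple.sort f).symm := by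
    ext i : 1; simp [J₀]
  have hb0 : β (fun i => stdVec (J₀.1 i)) = γ fun i => stdVec (J₀.1 i) := by
    rw [hγ]
    simp only [hstd, cdet_stdVec, ite_smul, one_smul, zero_smul, Finset.sum_ite_eq',
      Finset.mem_univ, if_true]
    simp only [β, AlternatingMap.coe_mk, MultilinearMap.coe_mk, hstd]
  rw [hb, hf0, β.map_perm, γ.map_perm, hb0]

end ConjugateForms

section Dbar

variable {n q : ℕ} {F : Type*} [NormedAddCommGroup F] [NormedSpace ℂ F]

lemma dbarDir_smul_right (g : Cn n → F) (z : Cn n) (s : ℂ) (w : Cn n) : dbarDir g z (s • w) =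
  (starRingEnd ℂ) s • dbarDir g z w := by
  have hs : s • w = s.re • w + s.im • (Complex.I • w) := by
    conv_lhs => rw [← Complex.re_add_im s, add_smul, mul_smul]
    norm_cast
  have hs' : Complex.I • s • w = s.re • (Complex.I • w) - s.im • w := by
    rw [hs, smul_add, smul_comm _ s.re, smul_comm _ s.im, smul_smul Complex.I, Complex.I_mul_I,
      neg_one_smul, smul_neg, sub_eq_add_neg]
  unfold dbarDir
  rw [hs', hs, map_add, map_sub]
  simp only [map_smul (fderiv ℝ g z) s.re, map_smul (fderiv ℝ g z) s.im]
  simp only [← Complex.coe_smul]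
  conv_rhs => rw [← Complex.re_add_im ((starRingEnd ℂ) s)]
  simp only [Complex.conj_re, Complex.conj_im, Complex.ofReal_neg]
  match_scalars
  · linear_combination (-(1 / 2) * (s.im : ℂ)) * Complex.I_mul_I * 0
  · linear_combination (1 / 2 * (s.im : ℂ)) * Complex.I_mul_I

lemma dbarDir_add_right (g : Cn n → F) (z w w' : Cn n) : dbarDir g z (w + w') = dbarDir g z w +
  dbarDir g z w' := by
  simp only [dbarDir, smul_add, map_add]; abel

lemma dbarDir_eq_sum (g : Cn n → F) (z w : Cn n) : dbarDir g z w = ∑ i, (starRingEnd ℂ) (w i) •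
  dbarDir g z (stdVec i) := by
  let L : Cn n →+ F := ⟨⟨dbarDir g z, by simp [dbarDir]⟩, dbarDir_add_right g z⟩
  have hw : w = ∑ i, w i • stdVec i := by
    simpa using ((EuclideanSpace.basisFun (Fin n) ℂ).sum_repr w).symm
  conv_lhs => rw [hw]
  refine (map_sum L _ _).trans (sum_congr rfl fun i _ => dbarDir_smul_right _ _ _ _)

lemma dbarDir_congr {g g' : Cn n → F} {z : Cn n} (h : g =ᶠ[𝓝 z] g') (w : Cn n) : dbarDir g z w =
  dbarDir g' z w := by
  rw [dbarDir, dbarDir, h.fderiv_eq]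

lemma dbarDir_sum {ι : Type*} (s : Finset ι) {g : ι → Cn n → F} {z : Cn n} (h : ∀ i ∈ s,
  DifferentiableAt ℝ (g i) z) (w : Cn n) : dbarDir (fun y => ∑ i ∈ s, g i y) z w = ∑ i ∈ s, dbarDir
  (g i) z w := by
  simp only [dbarDir, fderiv_fun_sum h, sum_apply, smul_sum, smul_add, sum_add_distrib]

lemma dbarDir_smul {a : Cn n → ℂ} {g : Cn n → F} {z : Cn n} (ha : DifferentiableAt ℝ a z) (hg :
  DifferentiableAt ℝ g z) (w : Cn n) : dbarDir (fun y => a y • g y) z w = dbarDir a z w • g z + a z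
  • dbarDir g z w := by
  simp only [dbarDir, fderiv_fun_smul ha hg, add_apply, smul_apply,
    ContinuousLinearMap.smulRight_apply, smul_eq_mul]
  module

lemma dbarDir_mul {a b : Cn n → ℂ} {z : Cn n} (ha : DifferentiableAt ℝ a z) (hb : DifferentiableAt ℝ
  b z) (w : Cn n) : dbarDir (fun y => a y * b y) z w = dbarDir a z w * b z + a z * dbarDir b z w :=
  dbarDir_smul ha hb w

lemma dbarDir_of_differentiableAt {g : Cn n → F} {z : Cn n} (hg : DifferentiableAt ℂ g z) (w : Cn n)
  : dbarDir g z w = 0 := by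
  simp only [dbarDir, hg.fderiv_restrictScalars ℝ, ContinuousLinearMap.coe_restrictScalars',
    map_smul, smul_smul, Complex.I_mul_I, neg_one_smul, add_neg_cancel, smul_zero]

lemma dbarDir_conj {δ : Cn n → ℂ} {z : Cn n} (hδ : DifferentiableAt ℂ δ z) (w : Cn n) : dbarDir (fun
  y => (starRingEnd ℂ) (δ y)) z w = (starRingEnd ℂ) (fderiv ℂ δ z w) := by
  have h : HasFDerivAt (fun y => (starRingEnd ℂ) (δ y)) (Complex.conjCLE.toContinuousLinearMap ∘L
    (fderiv ℂ δ z).restrictScalars ℝ) z := Complex.conjCLE.toContinuousLinearMap.hasFDerivAt.comp z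
    (hδ.hasFDerivAt.restrictScalars ℝ)
  rw [dbarDir, h.fderiv]
  simp [← mul_assoc]
  ring

lemma dbarDir_comp {h : Cn n → F} {Θ : Cn n → Cn n} {z : Cn n} (hh : DifferentiableAt ℝ h (Θ z)) (hΘ
  : DifferentiableAt ℂ Θ z) (w : Cn n) : dbarDir (fun y => h (Θ y)) z w = dbarDir h (Θ z) (fderiv ℂ
  Θ z w) := by
  have h1 := hh.hasFDerivAt.comp z (hΘ.hasFDerivAt.restrictScalars ℝ)
  rw [dbarDir, dbarDir, show (fun y => h (Θ y)) = h ∘ Θ from rfl, h1.fderiv]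
  simp

/-- The determinant of the coordinates with the indices `J`. -/
def detForm (J : Fin q → Fin n) : Cn n [⋀^Fin q]→L[ℂ] ℂ := { (Matrix.detRowAlternating (n := Fin q)
  (R := ℂ)).compLinearMap (LinearMap.pi fun a => (EuclideanSpace.proj (J a) : Cn n →L[ℂ]
  ℂ).toLinearMap) with
    cont := by
      change Continuous fun c : Fin q → Cn n => Matrix.det (Matrix.of fun b a => c b (J a))
      fun_prop }

lemma conj_detForm (J : Fin q → Fin n) (c : Fin q → Cn n) : (starRingEnd ℂ) (detForm J c) = cdet J c
  := by
  rw [cdet, ← Matrix.det_transpose]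
  exact RingHom.map_det _ _

variable {Θ : Cn n → Cn n} {z : Cn n}

lemma differentiableAt_detForm (hΘ : ContDiffAt ℂ 2 Θ z) (J : Fin q → Fin n) : DifferentiableAt ℂ
  (fun y => (detForm J).compContinuousLinearMap (fderiv ℂ Θ y)) z := by
  have h : DifferentiableAt ℂ (fderiv ℂ Θ) z := (hΘ.fderiv_right (m := 1)
    (by norm_num)).differentiableAt (by norm_num)
  exact (differentiableAt_const (detForm J)).continuousAlternatingMapCompContinuousLinearMap h

lemma sum_dbarDir_cdet (hΘ : ContDiffAt ℂ 2 Θ z) (J : Fin q → Fin n) (c : Fin (q + 1) → Cn n) : ∑ a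
  : Fin (q + 1), (-1 : ℂ) ^ (a : ℕ) * dbarDir (fun y => cdet J fun b => fderiv ℂ Θ y (c (a.succAbove
  b))) z (c a) = 0 := by
  have h0 : DifferentiableAt ℂ (fun _ : Cn n => detForm J) (Θ z) := differentiableAt_const _
  have h1 := extDeriv_pullback h0 hΘ (by simp)
  have h2 : extDeriv (fun _ : Cn n => detForm J) (Θ z) = 0 := by
    ext v
    rw [extDeriv_apply h0]
    simp
  have hd := differentiableAt_detForm hΘ J
  have h3 := congrArg (fun f => f c) h1
  simp only [h2] at h3
  rw [extDeriv_apply hd] at h3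
  have h4 := congrArg (starRingEnd ℂ) h3
  rw [map_sum] at h4
  refine Eq.trans (sum_congr rfl fun a _ => ?_) (h4.trans (by simp))
  simp only [← conj_detForm]
  refine (congrArg _ (dbarDir_conj (hd.continuousAlternatingMap_apply_const (a.removeNth c)) (c
    a))).trans ?_
  simp

end Dbar

section Forms

variable {n : ℕ} {X : Type*} [TopologicalSpace X] [T2Space X] [ChartedSpace (Cn n) X]
  [IsManifold 𝓘(ℂ, Cn n) ω X]
  {F : Type*} [NormedAddCommGroup F] [NormedSpace ℂ F]
  {V : X → Type*} [TopologicalSpace (TotalSpace F V)] [∀ x, AddCommGroup (V x)]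
  [∀ x, Module ℂ (V x)] [∀ x, TopologicalSpace (V x)] [FiberBundle F V] [VectorBundle ℂ F V]
  [ContMDiffVectorBundle ω F V 𝓘(ℂ, Cn n)] {q q' m : ℕ}
  {κ : Type*} [Fintype κ] {rk : ℕ} {P : ChartCover n F V κ rk}

variable {M : Set X} {k l : κ} {z : Cn n} {t : ℝ} {v : FormField n V q} {x : X} {h α : Cn n → ℂ}

lemma mdifferentiable_of_mem_maximalAtlas {ψ : OpenPartialHomeomorph X (Cn n)} (hψ : ψ ∈
  IsManifold.maximalAtlas 𝓘(ℂ, Cn n) ω X) : ψ.MDifferentiable 𝓘(ℂ, Cn n) 𝓘(ℂ, Cn n) :=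
  ⟨(contMDiffOn_of_mem_maximalAtlas hψ).mdifferentiableOn (by simp),
  (contMDiffOn_symm_of_mem_maximalAtlas hψ).mdifferentiableOn (by simp)⟩

variable {ψ ψ' : OpenPartialHomeomorph X (Cn n)}

lemma contDiffAt_transition (hψ : ψ ∈ IsManifold.maximalAtlas 𝓘(ℂ, Cn n) ω X) (hψ' : ψ' ∈
  IsManifold.maximalAtlas 𝓘(ℂ, Cn n) ω X) (hz : z ∈ ψ.target) (hz' : ψ.symm z ∈ ψ'.source) :
  ContDiffAt ℂ ω (fun y => ψ' (ψ.symm y)) z := by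
  have h1 := (contMDiffOn_symm_of_mem_maximalAtlas hψ).contMDiffAt (ψ.open_target.mem_nhds hz)
  have h2 := (contMDiffOn_of_mem_maximalAtlas hψ').contMDiffAt (ψ'.open_source.mem_nhds hz')
  exact (ContMDiffAt.comp z h2 h1).contDiffAt

/-- The differential of a chart. -/
def dchart (ψ : OpenPartialHomeomorph X (Cn n)) (x : X) (w : TangentSpace 𝓘(ℂ, Cn n) x) : Cn n :=
  mfderiv 𝓘(ℂ, Cn n) 𝓘(ℂ, Cn n) ψ x w

/-- The differential of the inverse of a chart. -/
def dsymm (ψ : OpenPartialHomeomorph X (Cn n)) (z c : Cn n) : TangentSpace 𝓘(ℂ, Cn n) (ψ.symm z) :=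
  mfderiv 𝓘(ℂ, Cn n) 𝓘(ℂ, Cn n) ψ.symm z c

lemma dchart_dsymm (hψ : ψ ∈ IsManifold.maximalAtlas 𝓘(ℂ, Cn n) ω X) (hψ' : ψ' ∈
  IsManifold.maximalAtlas 𝓘(ℂ, Cn n) ω X) (hz : z ∈ ψ.target) (hz' : ψ.symm z ∈ ψ'.source) (c : Cn
  n) : dchart ψ' (ψ.symm z) (dsymm ψ z c) = fderiv ℂ (fun y => ψ' (ψ.symm y)) z c := by
  have h := mfderiv_comp z ((mdifferentiable_of_mem_maximalAtlas hψ').mdifferentiableAt hz')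
    ((mdifferentiable_of_mem_maximalAtlas hψ).mdifferentiableAt_symm hz)
  rw [← mfderiv_eq_fderiv]
  exact (congrArg (fun L => L c) h).symm

lemma dsymm_dchart (hψ : ψ ∈ IsManifold.maximalAtlas 𝓘(ℂ, Cn n) ω X) (hz : z ∈ ψ.target) (w :
  TangentSpace 𝓘(ℂ, Cn n) (ψ.symm z)) : dsymm ψ z (dchart ψ (ψ.symm z) w) = w := by
  have h := congrArg (fun L => L w) ((mdifferentiable_of_mem_maximalAtlas hψ).symm_comp_deriv
    (ψ.map_target hz))
  change mfderiv 𝓘(ℂ, Cn n) 𝓘(ℂ, Cn n) ψ.symm (ψ (ψ.symm z)) (dchart ψ (ψ.symm z) w) = w at h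
  rw [ψ.right_inv hz] at h
  exact h

lemma dchart_dsymm_self (hψ : ψ ∈ IsManifold.maximalAtlas 𝓘(ℂ, Cn n) ω X) (hz : z ∈ ψ.target) (c :
  Cn n) : dchart ψ (ψ.symm z) (dsymm ψ z c) = c := congrArg (fun L => L c)
  ((mdifferentiable_of_mem_maximalAtlas hψ).comp_symm_deriv hz)

lemma fderiv_transition_dchart (hψ : ψ ∈ IsManifold.maximalAtlas 𝓘(ℂ, Cn n) ω X) (hψ' : ψ' ∈
  IsManifold.maximalAtlas 𝓘(ℂ, Cn n) ω X) (hx : x ∈ ψ.source) (hx' : x ∈ ψ'.source) (w :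
  TangentSpace 𝓘(ℂ, Cn n) x) : fderiv ℂ (fun y => ψ' (ψ.symm y)) (ψ x) (dchart ψ x w) = dchart ψ' x
  w := by
  obtain ⟨z, hz, rfl⟩ : ∃ z ∈ ψ.target, ψ.symm z = x := ⟨ψ x, ψ.map_source hx, ψ.left_inv hx⟩
  have h := dchart_dsymm hψ hψ' hz hx' (dchart ψ (ψ.symm z) w)
  rw [dsymm_dchart hψ hz] at h
  rw [h, ψ.right_inv hz]

/-- The coordinate representation of a form at `x₀`, inserting constant vectors. -/
def locRep (v : FormField n V q) (x₀ : X) (c : Fin q → Cn n) (z : Cn n) : F := ((trivializationAt F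
  V x₀) ⟨(chartAt (Cn n) x₀).symm z, v ((chartAt (Cn n) x₀).symm z) fun b => dsymm (chartAt (Cn n)
  x₀) z (c b)⟩).2

/-- `v` is differentiable at `x₀` and `∂̄v` has the value `W` there. -/
structure HasDbar (F : Type*) [NormedAddCommGroup F] [NormedSpace ℂ F]
    {V : X → Type*} [TopologicalSpace (TotalSpace F V)] [∀ x, AddCommGroup (V x)]
    [∀ x, Module ℂ (V x)] [∀ x, TopologicalSpace (V x)] [FiberBundle F V] {q : ℕ}
    (v : FormField n V q) (x₀ : X)
    (W : (Fin (q + 1) → TangentSpace 𝓘(ℂ, Cn n) x₀) → V x₀) : Prop where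
  diff : ∀ c, DifferentiableAt ℝ (locRep (F := F) v x₀ c) (chartAt (Cn n) x₀ x₀)
  eq : ∀ w, dbar (F := F) v x₀ w = W w

lemma eventually_chart_symm {x₀ : X} {p : X → Prop} (h : ∀ᶠ x in 𝓝 x₀, p x) : ∀ᶠ z in 𝓝 (chartAt (Cn
  n) x₀ x₀), p ((chartAt (Cn n) x₀).symm z) := by
  have h1 := (chartAt (Cn n) x₀).continuousAt_symm (mem_chart_target (Cn n) x₀)
  rw [ContinuousAt, (chartAt (Cn n) x₀).left_inv (mem_chart_source _ x₀)] at h1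
  exact h1.eventually h

lemma dbar_eq (v : FormField n V q) (x₀ : X) (w : Fin (q + 1) → TangentSpace 𝓘(ℂ, Cn n) x₀) : dbar
  (F := F) v x₀ w = (trivializationAt F V x₀).symm x₀ (∑ a : Fin (q + 1), (-1 : ℂ) ^ (a : ℕ) •
  dbarDir (locRep (F := F) v x₀ fun b =>
        dchart (chartAt (Cn n) x₀) x₀ (w (a.succAbove b)))
        (chartAt (Cn n) x₀ x₀) (dchart (chartAt (Cn n) x₀) x₀ (w a))) := rfl

lemma HasDbar.congr {v' : FormField n V q} {x₀ : X} {W : (Fin (q + 1) → TangentSpace 𝓘(ℂ, Cn n) x₀)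
  → V x₀} (h : HasDbar F v x₀ W) (hv : ∀ᶠ x in 𝓝 x₀, ∀ w, v' x w = v x w) : HasDbar F v' x₀ W := by
  have key : ∀ c, locRep (F := F) v' x₀ c =ᶠ[𝓝 (chartAt (Cn n) x₀ x₀)] locRep v x₀ c := fun c => by
    filter_upwards [eventually_chart_symm hv] with z hz
    rw [locRep, locRep, hz]
  refine ⟨fun c => (h.diff c).congr_of_eventuallyEq (key c), fun w => ?_⟩
  rw [← h.eq, dbar_eq, dbar_eq]
  simp only [dbarDir_congr (key _)]

lemma locRep_sum {ι : Type*} (s : Finset ι) (v : ι → FormField n V q) (x₀ : X) (c : Fin q → Cn n) :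
  locRep (F := F) (fun x w => ∑ i ∈ s, v i x w) x₀ c =ᶠ[𝓝 (chartAt (Cn n) x₀ x₀)] fun z => ∑ i ∈ s,
  locRep (F := F) (v i) x₀ c z := by
  filter_upwards [eventually_chart_symm ((trivializationAt F V x₀).open_baseSet.mem_nhds
    (mem_baseSet_trivializationAt F V x₀))] with z hz
  simp only [locRep]
  have h := (trivializationAt F V x₀).coe_linearMapAt_of_mem (R := ℂ) hz
  have h' := fun u => congrFun h u
  simp only [← h']
  exact map_sum _ _ _

lemma HasDbar.sum {ι : Type*} (s : Finset ι) {v : ι → FormField n V q} {x₀ : X} {W : ι → (Fin (q +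
  1) → TangentSpace 𝓘(ℂ, Cn n) x₀) → V x₀} (h : ∀ i ∈ s, HasDbar F (v i) x₀ (W i)) : HasDbar F (fun
  x w => ∑ i ∈ s, v i x w) x₀ fun w => ∑ i ∈ s, W i w := by
  refine ⟨fun c => (DifferentiableAt.fun_sum fun i hi => (h i hi).diff c).congr_of_eventuallyEq
    (locRep_sum s v x₀ c), fun w => ?_⟩
  rw [← sum_congr rfl fun i hi => (h i hi).eq w, dbar_eq]
  simp only [dbarDir_congr (locRep_sum s v x₀ _), dbarDir_sum s fun i hi => (h i hi).diff _]
  have hs := fun u => congrFun ((trivializationAt F V x₀).coe_symmₗ (R := ℂ)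
    (mem_baseSet_trivializationAt F V x₀)) u
  simp only [dbar_eq, ← hs, ← map_sum, smul_sum]
  rw [sum_comm]

namespace ChartCover

variable (P)

/-- The pullback of a function by a chart, extended by zero. -/
def pull (k : κ) (h : Cn n → ℂ) (x : X) : ℂ := (P.ψ k).source.indicator (fun x => h (P.ψ k x)) x

/-- The form `h d z̄_k^J ⊗ e_{k,j}`, extended by zero. -/
def term (k : κ) (J : Fin q → Fin n) (j : Fin rk) (h : Cn n → ℂ) : FormField n V q := fun x w =>
  (P.pull k h x * cdet J fun b => dchart (P.ψ k) x (w b)) • P.e k j x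

lemma contDiffAt_frame (k : κ) (j : Fin rk) {x₀ : X} (hψ : ψ ∈ IsManifold.maximalAtlas 𝓘(ℂ, Cn n) ω
  X) (hz : z ∈ ψ.target) (hx : ψ.symm z = x₀) (hk : x₀ ∈ (P.ψ k).source) : ContDiffAt ℂ ω (fun y =>
  (trivializationAt F V x₀ ⟨ψ.symm y, P.e k j (ψ.symm y)⟩).2) z := by
  subst hx
  have h1 := ((P.frame k).contMDiffOn j).contMDiffAt ((P.ψ k).open_source.mem_nhds hk)
  rw [contMDiffAt_section] at h1
  exact (ContMDiffAt.comp z h1 ((contMDiffOn_symm_of_mem_maximalAtlas hψ).contMDiffAt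
    (ψ.open_target.mem_nhds hz))).contDiffAt

lemma hasDbar_term_of_mem (k : κ) (J : Fin q → Fin n) (j : Fin rk) {x₀ : X} (hx : x₀ ∈ (P.ψ
  k).source) (hh : DifferentiableAt ℝ h (P.ψ k x₀)) : HasDbar F (P.term k J j h) x₀ fun w =>
      ∑ i, P.term k (Fin.cons i J) j (fun z => dbarDir h z (stdVec i)) x₀ w := by
  set φ := chartAt (Cn n) x₀ with hφ
  set T := trivializationAt F V x₀ with hT
  have hxφ : x₀ ∈ φ.source := mem_chart_source _ x₀
  have hφm : φ ∈ IsManifold.maximalAtlas 𝓘(ℂ, Cn n) ω X := IsManifold.subset_maximalAtlas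
    (chart_mem_atlas _ x₀)
  set z₀ := φ x₀ with hz₀
  have hz₀t : z₀ ∈ φ.target := φ.map_source hxφ
  have hsymm : φ.symm z₀ = x₀ := φ.left_inv hxφ
  set Θ : Cn n → Cn n := fun y => P.ψ k (φ.symm y) with hΘdef
  have hΘz : Θ z₀ = P.ψ k x₀ := congrArg (P.ψ k) hsymm
  have hΘ : ContDiffAt ℂ 2 Θ z₀ := (contDiffAt_transition hφm (P.ψ_mem k) hz₀t
    (by rwa [hsymm])).of_le (by simp)
  have hΘd : DifferentiableAt ℂ Θ z₀ := hΘ.differentiableAt (by norm_num)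
  set ê : Cn n → F := fun z => (T ⟨φ.symm z, P.e k j (φ.symm z)⟩).2 with hê
  have hêd : DifferentiableAt ℂ ê z₀ := (P.contDiffAt_frame k j hφm hz₀t hsymm hx).differentiableAt
    (by simp)
  set A : (Fin q → Cn n) → Cn n → ℂ := fun c z => cdet J fun b => fderiv ℂ Θ z (c b) with hA
  have hAd : ∀ c, DifferentiableAt ℝ (A c) z₀ := fun c => by
    have h1 := ((differentiableAt_detForm hΘ J).continuousAlternatingMap_apply_const
      c).restrictScalars ℝ
    have h2 := Complex.conjCLE.toContinuousLinearMap.differentiableAt.comp z₀ h1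
    refine h2.congr_of_eventuallyEq (Eventually.of_forall fun z => ?_)
    exact (conj_detForm J _).symm
  have hhd : DifferentiableAt ℝ (fun z => h (Θ z)) z₀ := DifferentiableAt.comp z₀ (by rwa [hΘz])
    (hΘd.restrictScalars ℝ)
  have hloc : ∀ c, locRep (F := F) (P.term k J j h) x₀ c =ᶠ[𝓝 z₀] fun z => h (Θ z) • (A c z • ê z)
    := fun c => by
    filter_upwards [eventually_chart_symm (T.open_baseSet.mem_nhds (mem_baseSet_trivializationAt F V
      x₀)), eventually_chart_symm ((P.ψ k).open_source.mem_nhds hx), φ.open_target.mem_nhds hz₀t]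
      with z h1 h2 h3
    have hl := fun u => congrFun (T.coe_linearMapAt_of_mem (R := ℂ) h1) u
    have hp : P.pull k h (φ.symm z) = h (Θ z) := indicator_of_mem h2 _
    have hd : ∀ b, dchart (P.ψ k) (φ.symm z) (dsymm φ z (c b)) = fderiv ℂ Θ z (c b) := fun b =>
      dchart_dsymm hφm (P.ψ_mem k) h3 h2 (c b)
    change (T ⟨φ.symm z, (P.pull k h (φ.symm z) * cdet J fun b => dchart (P.ψ k) (φ.symm z) (dsymm φ
      z (c b))) • P.e k j (φ.symm z)⟩).2 = _
    simp only [hp, hd]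
    exact (hl _).symm.trans ((map_smul _ _ _).trans (by rw [hl, mul_smul]))
  have hdiff : ∀ c, DifferentiableAt ℝ (fun z => A c z • ê z) z₀ := fun c =>
    (hAd c).smul (hêd.restrictScalars ℝ)
  refine ⟨fun c => (hhd.smul (hdiff c)).congr_of_eventuallyEq (hloc c), fun w => ?_⟩
  set c : Fin (q + 1) → Cn n := fun a => dchart φ x₀ (w a) with hc
  have hfd : ∀ a, fderiv ℂ Θ z₀ (c a) = dchart (P.ψ k) x₀ (w a) := fun a =>
    fderiv_transition_dchart hφm (P.ψ_mem k) hxφ hx (w a)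
  have key : ∑ a : Fin (q + 1), (-1 : ℂ) ^ (a : ℕ) • dbarDir (locRep (F := F) (P.term k J j h) x₀
    fun b => c (a.succAbove b)) z₀ (c a) = (∑ i, dbarDir h (P.ψ k x₀) (stdVec i) * cdet (Fin.cons i
    J) fun b => dchart (P.ψ k) x₀ (w b)) • ê z₀ := by
    have h1 : ∀ a : Fin (q + 1), (-1 : ℂ) ^ (a : ℕ) • dbarDir (locRep (F := F) (P.term k J j h) x₀
      fun b => c (a.succAbove b)) z₀ (c a) = (∑ i, dbarDir h (P.ψ k x₀) (stdVec i) * ((-1 : ℂ) ^ (a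
      : ℕ) * ((starRingEnd ℂ) (dchart (P.ψ k) x₀ (w a) i) * cdet J fun b => dchart (P.ψ k) x₀ (w
      (a.succAbove b))))) • ê z₀ + h (Θ z₀) • ((-1 : ℂ) ^ (a : ℕ) * dbarDir (A fun b => c
      (a.succAbove b)) z₀ (c a)) • ê z₀ := fun a => by
        rw [dbarDir_congr (hloc _), dbarDir_smul hhd (hdiff _), dbarDir_smul (hAd _)
          (hêd.restrictScalars ℝ), dbarDir_of_differentiableAt hêd, dbarDir_comp (by rwa [hΘz]) hΘd,
          hfd, dbarDir_eq_sum, hΘz]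
        simp only [hA, hfd, smul_zero, add_zero, smul_add, smul_smul, sum_mul, mul_sum, smul_eq_mul]
        congr 2
        · exact sum_congr rfl fun i _ => by ring
        · ring
    rw [sum_congr rfl fun a _ => h1 a, sum_add_distrib, ← sum_smul, ← smul_sum, ← sum_smul,
      sum_dbarDir_cdet hΘ, zero_smul, smul_zero, add_zero, sum_comm]
    congr 1
    exact sum_congr rfl fun i _ => by rw [cdet_cons, mul_sum]
  have hs := fun u => congrFun (T.coe_symmₗ (R := ℂ) (mem_baseSet_trivializationAt F V x₀)) u
  have hê0 : T.symm x₀ (ê z₀) = P.e k j x₀ := by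
    have : ê z₀ = (T ⟨x₀, P.e k j x₀⟩).2 := congrArg (fun y => (T ⟨y, P.e k j y⟩).2) hsymm
    rw [this]
    exact T.symm_apply_apply_mk (mem_baseSet_trivializationAt F V x₀) _
  rw [dbar_eq, ← hφ, ← hT, key, ← hs, map_smul, hs, hê0, sum_smul]
  simp only [term, pull, indicator_of_mem hx]

variable {P} in
lemma mem_source (h : x ∈ tsupport (P.χ k)) : x ∈ (P.ψ k).source := P.closure_U_subset k
  (subset_closure (P.χ_supp k h))

variable {P} in
lemma pull_eq_zero (h0 : ∀ x ∈ (P.ψ k).source, x ∉ tsupport (P.χ k) → h (P.ψ k x) = 0) (hx : x ∉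
  tsupport (P.χ k)) : P.pull k h x = 0 := by
  by_cases hs : x ∈ (P.ψ k).source
  · rw [pull, indicator_of_mem hs, h0 x hs hx]
  · exact indicator_of_notMem hs _

lemma hasDbar_term (k : κ) (J : Fin q → Fin n) (j : Fin rk) (hh : Differentiable ℝ h) (h0 : ∀ x ∈
  (P.ψ k).source, x ∉ tsupport (P.χ k) → h (P.ψ k x) = 0) (x₀ : X) : HasDbar F (P.term k J j h) x₀
  fun w =>
      ∑ i, P.term k (Fin.cons i J) j (fun z => dbarDir h z (stdVec i)) x₀ w := by
  by_cases hx : x₀ ∈ (P.ψ k).source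
  · exact P.hasDbar_term_of_mem k J j hx (hh _)
  · have hz : HasDbar F (fun x w => ∑ i ∈ (∅ : Finset κ), (0 : V x)  : FormField n V q) x₀ (fun w =>
      ∑ i ∈ (∅ : Finset κ), 0) := HasDbar.sum ∅ (by simp)
    have := hz.congr (v' := P.term k J j h) (by
      filter_upwards [(isClosed_tsupport _).isOpen_compl.mem_nhds fun h => hx (mem_source h)] with x
        hx w
      simp [term, pull_eq_zero h0 hx])
    convert this using 2
    simp [term, pull, hx]

end ChartCover

variable [FiniteDimensional ℂ F]

lemma IsZeroForm.sum {ι : Type*} (s : Finset ι) {v : ι → FormField n V q} (h : ∀ i ∈ s, IsZeroForm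
  (v i) x) : IsZeroForm (fun x w => ∑ i ∈ s, v i x w) x := by
  choose! α hα using h
  have ev : ∀ w, (∑ i ∈ s, α i) w = ∑ i ∈ s, α i w := fun w =>
    map_sum (⟨⟨fun δ => δ w, rfl⟩, fun _ _ => rfl⟩ : AlternatingMap ℝ (TangentSpace 𝓘(ℂ, Cn n) x) (V
      x) (Fin q) →+ V x) _ _
  refine ⟨∑ i ∈ s, α i, fun w => ?_, fun w a => ?_⟩
  · rw [ev]
    exact sum_congr rfl fun i hi => (hα i hi).1 w
  · rw [ev, ev, smul_sum, ← Finset.sum_neg_distrib]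
    exact sum_congr rfl fun i hi => (hα i hi).2 w a

namespace ChartCover

variable (P)

lemma isZeroForm_term (k : κ) (J : Fin q → Fin n) (j : Fin rk) (h : Cn n → ℂ) (x : X) : IsZeroForm
  (P.term k J j h) x := by
  let A : TangentSpace 𝓘(ℂ, Cn n) x →ₗ[ℂ] Cn n := ⟨⟨dchart (P.ψ k) x, map_add (mfderiv 𝓘(ℂ, Cn n)
    𝓘(ℂ, Cn n) (P.ψ k) x)⟩, map_smul (mfderiv 𝓘(ℂ, Cn n) 𝓘(ℂ, Cn n) (P.ψ k) x)⟩
  let B : AlternatingMap ℝ (TangentSpace 𝓘(ℂ, Cn n) x) (V x) (Fin q) := ((LinearMap.toSpanSingleton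
    ℂ (V x) (P.pull k h x • P.e k j x)).restrictScalars ℝ).compAlternatingMap ((cdetMap
    J).compLinearMap (A.restrictScalars ℝ))
  have hB : ∀ w, B w = P.term k J j h x w := fun w => by
    change cdetMap J (fun b => A (w b)) • P.pull k h x • P.e k j x = _
    rw [cdetMap_apply, smul_smul, mul_comm]
    rfl
  refine ⟨B, fun w => (hB w).symm, fun w i => ?_⟩
  rw [hB, hB, term, term, smul_smul, ← neg_smul]
  have : (fun b => dchart (P.ψ k) x (Function.update w i (Complex.I • w i) b)) = Function.update
    (fun b => dchart (P.ψ k) x (w b)) i (Complex.I • dchart (P.ψ k) x (w i)) := by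
    ext b : 1
    by_cases h : b = i
    · subst h
      rw [Function.update_self, Function.update_self]
      exact map_smul A Complex.I (w b)
    · simp [h]
  rw [this, cdet_update_I]
  congr 1
  ring

lemma eq_sum_term (hx : x ∈ (P.ψ k).source) (hv : IsZeroForm v x) (w : Fin q → TangentSpace 𝓘(ℂ, Cn
  n) x) : v x w = ∑ I : MultiIndex q n, ∑ j, P.term k I.1 j (P.coeff v k I j) x w := by
  obtain ⟨z, hz, rfl⟩ : ∃ z ∈ (P.ψ k).target, (P.ψ k).symm z = x := ⟨P.ψ k x, (P.ψ k).map_source hx,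
    (P.ψ k).left_inv hx⟩
  obtain ⟨α, h1, h2⟩ := hv
  let A : Cn n →ₗ[ℂ] TangentSpace 𝓘(ℂ, Cn n) ((P.ψ k).symm z) := ⟨⟨dsymm (P.ψ k) z, map_add (mfderiv
    𝓘(ℂ, Cn n) 𝓘(ℂ, Cn n) (P.ψ k).symm z)⟩, map_smul (mfderiv 𝓘(ℂ, Cn n) 𝓘(ℂ, Cn n) (P.ψ k).symm z)⟩
  let β := α.compLinearMap (A.restrictScalars ℝ)
  have hβ : ∀ c i, β (Function.update c i (Complex.I • c i)) = -(Complex.I • β c) := fun c i => by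
    have := h2 (fun b => A (c b)) i
    refine Eq.trans (congrArg α ?_) this
    ext b : 1
    by_cases h : b = i
    · subst h
      simp
    · simp [h]
  have h3 : v ((P.ψ k).symm z) w = β fun b => dchart (P.ψ k) ((P.ψ k).symm z) (w b) := by
    rw [h1]
    exact congrArg α (funext fun b => (dsymm_dchart (P.ψ_mem k) hz (w b)).symm)
  rw [h3, sum_cdet_smul β hβ]
  refine sum_congr rfl fun I _ => ?_
  have h4 : (β fun a => stdVec (I.1 a)) = ∑ j, P.coeff v k I j z • P.e k j ((P.ψ k).symm z) := by
    have h5 : (β fun a => stdVec (I.1 a)) = v ((P.ψ k).symm z) fun a => dsymm (P.ψ k) z (stdVec (I.1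
      a)) := (h1 _).symm
    classical
    rw [h5]
    have h6 := (P.frame k).coeff_sum_eq (Function.update (fun x => (0 : V x)) ((P.ψ k).symm z) (v
      ((P.ψ k).symm z) fun a => dsymm (P.ψ k) z (stdVec (I.1 a)))) hx
    rw [Function.update_self] at h6
    exact h6
  rw [h4, smul_sum]
  refine sum_congr rfl fun j _ => ?_
  rw [term, pull, indicator_of_mem hx, (P.ψ k).right_inv hz, smul_smul, mul_comm]

lemma coeff_sum {ι : Type*} (s : Finset ι) (v : ι → FormField n V q) (k : κ) (I : MultiIndex q n) (j
  : Fin rk) (z : Cn n) : P.coeff (fun x w => ∑ i ∈ s, v i x w) k I j z = ∑ i ∈ s, P.coeff (v i) k I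
  j z := map_sum _ _ _

lemma coeff_term (k : κ) (J : Fin q → Fin n) (j : Fin rk) (h : Cn n → ℂ) (l : κ) (I : MultiIndex q
  n) (i : Fin rk) (z : Cn n) : P.coeff (P.term k J j h) l I i z = P.pull k h ((P.ψ l).symm z) *
  (cdet J (fun b => dchart (P.ψ k) ((P.ψ l).symm z) (dsymm (P.ψ l) z (stdVec (I.1 b)))) * (P.frame
  l).coeff i ((P.ψ l).symm z) (P.e k j ((P.ψ l).symm z))) := by
  rw [← mul_assoc, ← smul_eq_mul (_ * _)]
  exact map_smul _ _ _

lemma coeff_term_self (k : κ) (J : Fin q → Fin n) (j : Fin rk) (h : Cn n → ℂ) (I : MultiIndex q n)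
  (i : Fin rk) (hz : z ∈ (P.ψ k).target) : P.coeff (P.term k J j h) k I i z = if i = j then h z *
  cdet J (fun b => stdVec (I.1 b)) else 0 := by
  have hs := (P.ψ k).map_target hz
  rw [coeff_term, pull, indicator_of_mem hs, (P.ψ k).right_inv hz]
  simp only [dchart_dsymm_self (P.ψ_mem k) hz]
  have : (P.frame k).coeff i ((P.ψ k).symm z) (P.e k j ((P.ψ k).symm z)) = if i = j then 1 else 0 :=
    by
    rw [(P.frame k).coeff_apply_of_mem hs (P.e k j), ← (P.frame k).toBasisAt_coe hs,
      Module.Basis.repr_self]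
    simp [Finsupp.single_apply, eq_comm]
  rw [this]
  split_ifs <;> simp

lemma contDiffAt_coeff_frame (l k : κ) (i j : Fin rk) (hz : z ∈ (P.ψ l).target) (hk : (P.ψ l).symm z
  ∈ (P.ψ k).source) : ContDiffAt ℝ ∞ (fun y => (P.frame l).coeff i ((P.ψ l).symm y) (P.e k j ((P.ψ
  l).symm y))) z := by
  set T := trivializationAt F V ((P.ψ l).symm z) with hT
  have hl := (P.ψ l).map_target hz
  have he := fun j => P.contDiffAt_frame l j (P.ψ_mem l) hz rfl hl
  have hek := P.contDiffAt_frame k j (P.ψ_mem l) hz rfl hk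
  let A : Cn n → (Fin rk → ℂ) →L[ℂ] F := fun y => ∑ j : Fin rk, (ContinuousLinearMap.proj (R := ℂ)
    (φ := fun _ : Fin rk => ℂ) j).smulRight (T ⟨(P.ψ l).symm y, P.e l j ((P.ψ l).symm y)⟩).2
  have hA : ContDiffAt ℂ ω A z := ContDiffAt.sum fun j _ =>
    (ContinuousLinearMap.smulRightL ℂ (Fin rk → ℂ) F (ContinuousLinearMap.proj
      j)).contDiff.contDiffAt.comp z (he j)
  have hinv : ∀ y, y ∈ (P.ψ l).target → (P.ψ l).symm y ∈ T.baseSet → ∃ e : (Fin rk → ℂ) ≃L[ℂ] F, (e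
    : (Fin rk → ℂ) →L[ℂ] F) = A y ∧ ∀ u : V ((P.ψ l).symm y), e.symm (T ⟨(P.ψ l).symm y, u⟩).2 i =
    (P.frame l).coeff i ((P.ψ l).symm y) u := by
    intro y hy hb
    have hs := (P.ψ l).map_target hy
    let e := (((P.frame l).toBasisAt hs).equivFun.symm.trans (T.linearEquivAt ℂ _
      hb)).toContinuousLinearEquiv
    refine ⟨e, ?_, fun u => ?_⟩
    · ext c
      simp [e, A, Module.Basis.equivFun_symm_apply]
    · simp [e, IsLocalFrameOn.coeff, hs, T.symm_apply_apply_mk hb]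
  have hev : ∀ᶠ y in 𝓝 z, y ∈ (P.ψ l).target ∧ (P.ψ l).symm y ∈ T.baseSet := ((P.ψ
    l).open_target.eventually_mem hz).and (((P.ψ l).continuousAt_symm hz).eventually
    (T.open_baseSet.eventually_mem (mem_baseSet_trivializationAt F V _)))
  obtain ⟨e₀, he₀, -⟩ := hinv z hz (mem_baseSet_trivializationAt F V _)
  have h1 : ContDiffAt ℂ ω (fun y => (A y).inverse) z := by
    refine ContDiffAt.comp (g := ContinuousLinearMap.inverse) z ?_ hA
    rw [← he₀]
    exact contDiffAt_map_inverse e₀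
  have h2 := ((ContinuousLinearMap.proj (R := ℂ) (φ := fun _ : Fin rk => ℂ)
    i).contDiff.contDiffAt.comp z (h1.clm_apply hek)).restrict_scalars ℝ
  refine (h2.of_le (by simp)).congr_of_eventuallyEq ?_
  filter_upwards [hev] with y hy
  obtain ⟨e, h3, h4⟩ := hinv y hy.1 hy.2
  simp only [Function.comp, ← h3, ContinuousLinearMap.inverse_equiv]
  exact (h4 _).symm

end ChartCover

lemma exists_pos_le_of_finite {ι : Type*} [Finite ι] (f : ι → ℝ) (hf : ∀ i, 0 < f i) : ∃ δ : ℝ, 0 <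
  δ ∧ ∀ i, δ ≤ f i := by
  have h : Tendsto (fun δ : ℝ => δ) (𝓝[>] 0) (𝓝 0) := nhdsWithin_le_nhds
  obtain ⟨δ, h1, h2⟩ := ((eventually_all.2 fun i => h.eventually_le_const (hf i)).and
    self_mem_nhdsWithin).exists
  exact ⟨δ, h2, h1⟩

lemma contDiff_of_forall_mem_tsupport {W : Type*} [NormedAddCommGroup W] [NormedSpace ℝ W] {f : Cn n
  → W} (h : ∀ z ∈ tsupport f, ContDiffAt ℝ ∞ f z) : ContDiff ℝ ∞ f := contMDiff_iff_contDiff.1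
  (contMDiff_of_tsupport fun z hz => (h z hz).contMDiffAt)

lemma contDiff_cutoff_smul {W : Type*} [NormedAddCommGroup W] [NormedSpace ℝ W] {η : Cn n → ℝ} {g :
  Cn n → W} (hη : ContDiff ℝ ∞ η) (hg : ∀ z ∈ tsupport η, ContDiffAt ℝ ∞ g z) : ContDiff ℝ ∞ fun z
  => η z • g z := contDiff_of_forall_mem_tsupport fun z hz => hη.contDiffAt.smul (hg z
  (tsupport_smul_subset_left η g hz))

namespace ChartCover

variable (P)

/-- Cut-off functions for the charts, and globally defined smooth maps that agree with the chart
transitions near the supports of the partition of unity. -/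
structure Transit where
  τ : ℝ
  τ_pos : 0 < τ
  c : ℝ
  one_le_c : 1 ≤ c
  θ : κ → Cn n → ℝ
  θ_smooth : ∀ l, ContDiff ℝ ∞ (θ l)
  θ_supp : ∀ l, HasCompactSupport (θ l)
  θ_target : ∀ l, tsupport (θ l) ⊆ (P.ψ l).target
  θ_one : ∀ l, ∀ z ∈ thickening τ (P.ψ l '' P.U l), θ l z = 1
  Φ : κ → κ → Cn n → Cn n
  Φ_smooth : ∀ l k, ContDiff ℝ ∞ (Φ l k)
  Φ_supp : ∀ l k, HasCompactSupport (Φ l k)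
  Φ_eq : ∀ l k, ∀ z ∈ tsupport (θ l), (P.ψ l).symm z ∈ tsupport (P.χ k) → ∀ w, dist w z < τ →
    w ∈ (P.ψ l).target ∧ (P.ψ l).symm w ∈ P.U k ∧ Φ l k w = P.ψ k ((P.ψ l).symm w)
  lip : ∀ l k z w, ‖Φ l k z - Φ l k w‖ ≤ c * ‖z - w‖

lemma isCompact_tsupport_χ (k : κ) : IsCompact (tsupport (P.χ k)) := (P.isCompact_closure_U
  k).of_isClosed_subset (isClosed_tsupport _) ((P.χ_supp k).trans subset_closure)

lemma exists_transit : Nonempty P.Transit := by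
  choose θ h1 h2 h3 δ h4 h5 using fun l => exists_cutoff ((P.isCompact_closure_U
    l).image_of_continuousOn ((P.ψ l).continuousOn.mono (P.closure_U_subset l))) (P.ψ l).open_target
    ((image_mono (P.closure_U_subset l)).trans (P.ψ l).image_source_eq_target.subset)
  have hZ : ∀ l k, IsCompact (tsupport (θ l) ∩ (P.ψ l).symm ⁻¹' tsupport (P.χ k)) := fun l k =>
    IsCompact.of_isClosed_subset (h2 l) (((P.ψ l).continuousOn_symm.mono (h3
      l)).preimage_isClosed_of_isClosed (isClosed_tsupport _) (isClosed_tsupport _))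
      inter_subset_left
  choose η g1 g2 g3 ε g4 g5 using fun l k => exists_cutoff (hZ l k) ((P.ψ
    l).isOpen_inter_preimage_symm (P.isOpen_U k)) (fun z hz => ⟨h3 l hz.1, P.χ_supp k hz.2⟩)
  have hΦ : ∀ l k, ContDiff ℝ ∞ fun z => η l k z • P.ψ k ((P.ψ l).symm z) := fun l k =>
    contDiff_cutoff_smul (g1 l k) fun z hz => ((contDiffAt_transition (P.ψ_mem l) (P.ψ_mem k) (g3 l
      k hz).1 (P.closure_U_subset k (subset_closure (g3 l k hz).2))).restrict_scalars ℝ).of_le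
      (by simp)
  have hΦs : ∀ l k, HasCompactSupport fun z => η l k z • P.ψ k ((P.ψ l).symm z) := fun l k =>
    (g2 l k).smul_right
  choose B hB1 hB using fun l k => exists_bound_iterD (hΦ l k) (hΦs l k) 1
  obtain ⟨τ₁, t1, t2⟩ := exists_pos_le_of_finite δ h4
  obtain ⟨τ₂, t3, t4⟩ := exists_pos_le_of_finite (fun p : κ × κ => ε p.1 p.2) fun p => g4 p.1 p.2
  have hBn : ∀ p : κ × κ, 0 ≤ B p.1 p.2 := fun p => zero_le_one.trans (hB1 p.1 p.2)
  refine ⟨{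
    τ := min τ₁ τ₂
    τ_pos := lt_min t1 t3
    c := 1 + ∑ p : κ × κ, B p.1 p.2
    one_le_c := le_add_of_nonneg_right (sum_nonneg fun p _ => hBn p)
    θ := θ
    θ_smooth := h1
    θ_supp := h2
    θ_target := h3
    θ_one := fun l z hz => h5 l z (thickening_subset_of_subset _ (image_mono subset_closure)
      (thickening_mono ((min_le_left _ _).trans (t2 l)) _ hz))
    Φ := fun l k z => η l k z • P.ψ k ((P.ψ l).symm z)
    Φ_smooth := hΦ
    Φ_supp := hΦs
    Φ_eq := fun l k z hz hz' w hw => by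
      have : η l k w = 1 := g5 l k w (mem_thickening_iff.2 ⟨z, ⟨hz, hz'⟩, hw.trans_le ((min_le_right
        _ _).trans (t4 (l, k)))⟩)
      have hO := g3 l k (subset_tsupport _ (by rw [Function.mem_support, this]; norm_num))
      exact ⟨hO.1, hO.2, by rw [this, one_smul]⟩
    lip := fun l k z w => by
      have := norm_sub_le_of_iterD ((hΦ l k).of_le (by simp)) (hB l k 1 le_rfl) z w
      refine this.trans (mul_le_mul_of_nonneg_right ?_ (norm_nonneg _))
      have := single_le_sum (fun p _ => hBn p) (Finset.mem_univ (l, k))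
      linarith }⟩

/-- The function `χ_k^{1/2}` in the chart `ψ_k`. -/
def sq (k : κ) (z : Cn n) : ℂ := (P.ψ k).target.indicator (fun z => ((√(P.χ k ((P.ψ k).symm z)) : ℝ)
  : ℂ)) z

/-- A smooth function whose support is, in the chart `ψ_k`, contained in that of `χ_k`. -/
structure IsCut (k : κ) (α : Cn n → ℂ) : Prop where
  smooth : ContDiff ℝ ∞ α
  supp : tsupport α ⊆ P.ψ k '' tsupport (P.χ k)

variable {P}

lemma IsCut.hasCompactSupport (h : P.IsCut k α) : HasCompactSupport α := ((P.isCompact_tsupport_χ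
  k).image_of_continuousOn ((P.ψ k).continuousOn.mono ((P.χ_supp k).trans (subset_closure.trans
  (P.closure_U_subset k))))).of_isClosed_subset (isClosed_tsupport _) h.supp

lemma IsCut.eq_zero (h : P.IsCut k α) (hx : x ∈ (P.ψ k).source) (hx' : x ∉ tsupport (P.χ k)) : α
  (P.ψ k x) = 0 := by
  by_contra h0
  obtain ⟨y, hy, hxy⟩ := h.supp (subset_tsupport _ h0)
  exact hx' ((P.ψ k).injOn (mem_source hy) hx hxy ▸ hy)

lemma IsCut.mul {β : Cn n → ℂ} (h : P.IsCut k α) (hβ : ContDiff ℝ ∞ β) : P.IsCut k fun z => α z * β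
  z := ⟨h.smooth.mul hβ, (tsupport_mul_subset_left (f := α) (g := β)).trans h.supp⟩

lemma IsCut.dbarDir (h : P.IsCut k α) (w : Cn n) : P.IsCut k fun z => dbarDir α z w := by
  have hf : ∀ w, ContDiff ℝ ∞ fun z => fderiv ℝ α z w := fun w =>
    (h.smooth.fderiv_right (by simp)).clm_apply contDiff_const
  refine ⟨((hf _).add ((hf _).const_smul Complex.I)).const_smul (1 / 2 : ℂ), ?_⟩
  refine (closure_minimal (fun z hz => ?_) (isClosed_tsupport α)).trans h.supp
  by_contra hn
  refine hz ?_
  change MoserSmoothing.dbarDir α z w = 0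
  rw [dbarDir_congr (notMem_tsupport_iff_eventuallyEq.1 hn)]
  simp [MoserSmoothing.dbarDir]

variable (P) in
lemma isCut_sq (k : κ) : P.IsCut k (P.sq k) := by
  have hs : tsupport (P.sq k) ⊆ P.ψ k '' tsupport (P.χ k) := by
    refine closure_minimal (fun z hz => ?_) (IsCompact.isClosed ((P.isCompact_tsupport_χ
      k).image_of_continuousOn ((P.ψ k).continuousOn.mono fun x hx => mem_source hx)))
    have hz' := mem_of_indicator_ne_zero hz
    rw [Function.mem_support, sq, indicator_of_mem hz'] at hz
    refine ⟨(P.ψ k).symm z, subset_tsupport _ fun h0 => hz ?_, (P.ψ k).right_inv hz'⟩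
    rw [h0, Real.sqrt_zero, Complex.ofReal_zero]
  refine ⟨contDiff_of_forall_mem_tsupport fun z hz => ?_, hs⟩
  obtain ⟨x, hx, rfl⟩ := hs hz
  have hxs := mem_source hx
  have hm := P.χ_sqrt_smooth k x
  rw [contMDiffAt_iff] at hm
  have h1 : ContDiffAt ℝ ∞ (fun y => √(P.χ k ((chartAt (Cn n) x).symm y))) (chartAt (Cn n) x x) :=
    by
    simpa [Function.comp_def, contDiffWithinAt_univ, chartAt_self_eq] using hm.2
  have h2 := ((contDiffAt_transition (P.ψ_mem k) (IsManifold.subset_maximalAtlas (chart_mem_atlas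
    (Cn n) x)) ((P.ψ k).map_source hxs)
    (by rw [(P.ψ k).left_inv hxs]; exact mem_chart_source _ x)).restrict_scalars ℝ).of_le (m := ∞)
    (by simp)
  have h3 := Complex.ofRealCLM.contDiff.contDiffAt.comp (P.ψ k x) (ContDiffAt.comp (P.ψ k x) (g :=
    fun y => √(P.χ k ((chartAt (Cn n) x).symm y))) (by rwa [(P.ψ k).left_inv hxs]) h2)
  refine h3.congr_of_eventuallyEq ?_
  filter_upwards [(P.ψ k).open_target.mem_nhds ((P.ψ k).map_source hxs), ((P.ψ k).continuousAt_symm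
    ((P.ψ k).map_source hxs)).eventually ((chartAt (Cn n) x).open_source.eventually_mem
    (by rw [(P.ψ k).left_inv hxs]; exact mem_chart_source _ x))] with y hy hy'
  simp only [sq, indicator_of_mem hy, Function.comp_apply, (chartAt (Cn n) x).left_inv hy',
    Complex.ofRealCLM_apply]

variable {M : Set X} {l k : κ} {z : Cn n}

namespace Transit

variable (G : P.Transit)

lemma mem_tsupport (h : z ∈ thickening G.τ (P.ψ l '' P.U l)) : z ∈ tsupport (G.θ l) :=
  subset_tsupport _ (by rw [Function.mem_support, G.θ_one l z h]; exact one_ne_zero)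

lemma nbhdD_subset (ht : t ≤ G.τ) : P.nbhdD M t l ⊆ thickening G.τ (P.ψ l '' P.U l) :=
  (thickening_mono ht _).trans (thickening_subset_of_subset _ (image_mono inter_subset_left))

lemma Φ_self (hz : z ∈ tsupport (G.θ l)) (hz' : (P.ψ l).symm z ∈ tsupport (P.χ k)) : G.Φ l k z = P.ψ
  k ((P.ψ l).symm z) := (G.Φ_eq l k z hz hz' z (by rw [dist_self]; exact G.τ_pos)).2.2

lemma mem_thickening (ht : t ≤ G.τ) (hz : z ∈ P.nbhdD M t l) (hz' : (P.ψ l).symm z ∈ tsupport (P.χ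
  k)) : G.Φ l k z ∈ P.nbhdD M (G.c * t) k := by
  have hθ := G.mem_tsupport (G.nbhdD_subset ht hz)
  obtain ⟨w, ⟨x, hx, rfl⟩, hw⟩ := mem_thickening_iff.1 hz
  have hs := (P.ψ l).left_inv (P.closure_U_subset l (subset_closure hx.1))
  obtain ⟨-, h2, h3⟩ := G.Φ_eq l k z hθ hz' _ (by rw [dist_comm]; exact hw.trans_le ht)
  rw [hs] at h2 h3
  refine mem_thickening_iff.2 ⟨P.ψ k x, ⟨x, ⟨h2, hx.2⟩, rfl⟩, ?_⟩
  rw [← h3, dist_eq_norm]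
  refine (G.lip l k _ _).trans_lt (mul_lt_mul_of_pos_left ?_ (by linarith [G.one_le_c]))
  rwa [← dist_eq_norm]

lemma exists_coeff_eq (hα : P.IsCut k α) (J : Fin q → Fin n) (j : Fin rk) (l : κ) (I : MultiIndex q
  n) (i : Fin rk) : ∃ μ : Cn n → ℂ, ContDiff ℝ ∞ μ ∧ HasCompactSupport μ ∧ (∀ z, μ z ≠ 0 → (P.ψ
  l).symm z ∈ tsupport (P.χ k)) ∧ ∀ h : Cn n → ℂ, ∀ z ∈ thickening G.τ (P.ψ l '' P.U l), P.coeff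
  (P.term k J j fun y => α y * h y) l I i z = μ z * h (G.Φ l k z) := by
  set g : Cn n → ℂ := P.coeff (P.term k J j α) l I i with hg
  have hg0 : ∀ z, (P.ψ l).symm z ∉ tsupport (P.χ k) → g z = 0 := fun z hz => by
    rw [hg, coeff_term, pull_eq_zero (fun x h1 h2 => hα.eq_zero h1 h2) hz, zero_mul]
  refine ⟨fun z => G.θ l z • g z, contDiff_cutoff_smul (G.θ_smooth l) fun z hz => ?_, (G.θ_supp
    l).smul_right, fun z hz => ?_, fun h z hz => ?_⟩
  · have hzt := G.θ_target l hz
    by_cases hk : (P.ψ l).symm z ∈ (P.ψ k).source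
    · set Θ : Cn n → Cn n := fun y => P.ψ k ((P.ψ l).symm y) with hΘ
      have hΘd := contDiffAt_transition (P.ψ_mem l) (P.ψ_mem k) hzt hk
      have h1 : ContDiffAt ℝ ∞ (fun y => α (Θ y)) z := hα.smooth.contDiffAt.comp z
        ((hΘd.restrict_scalars ℝ).of_le (by simp))
      have h2 : ContDiffAt ℝ ∞ (fun y => cdet J fun b => fderiv ℂ Θ y (stdVec (I.1 b))) z := by
        simp only [← conj_detForm]
        have h0 : ∀ b, ContDiffAt ℂ ∞ (fun y => fderiv ℂ Θ y (stdVec (I.1 b))) z := fun b =>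
          (hΘd.fderiv_right (m := ∞) (by simp)).clm_apply contDiffAt_const
        have h3 := (((detForm J).toContinuousMultilinearMap.contDiff (n := ∞)).contDiffAt.comp z
          (contDiffAt_pi.2 h0)).restrict_scalars ℝ
        exact Complex.conjCLE.contDiff.contDiffAt.comp z h3
      have h3 := P.contDiffAt_coeff_frame l k i j hzt hk
      refine (h1.mul (h2.mul h3)).congr_of_eventuallyEq ?_
      filter_upwards [(P.ψ l).open_target.mem_nhds hzt, ((P.ψ l).continuousAt_symm hzt).eventually
        ((P.ψ k).open_source.eventually_mem hk)] with y hy hy'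
      rw [hg, coeff_term, pull, indicator_of_mem hy']
      simp only [dchart_dsymm (P.ψ_mem l) (P.ψ_mem k) hy hy', hΘ]
    · have : g =ᶠ[𝓝 z] fun _ => 0 := by
        filter_upwards [((P.ψ l).continuousAt_symm hzt).eventually ((isClosed_tsupport (P.χ
          k)).isOpen_compl.eventually_mem fun h => hk (mem_source h))] with y hy
        exact hg0 y hy
      exact contDiffAt_const.congr_of_eventuallyEq this
  · by_contra hn
    exact hz (by simp only [hg0 z hn, smul_zero])
  · simp only [G.θ_one l z hz, one_smul]
    by_cases hk : (P.ψ l).symm z ∈ tsupport (P.χ k)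
    · rw [hg, coeff_term, coeff_term, pull, pull, indicator_of_mem (mem_source hk), indicator_of_mem
        (mem_source hk), G.Φ_self (G.mem_tsupport hz) hk]
      ring
    · rw [hg0 z hk, zero_mul, coeff_term, pull_eq_zero (fun x h1 h2 => by
        rw [hα.eq_zero h1 h2, zero_mul]) hk, zero_mul]

end Transit

end ChartCover

lemma IsOperatorOn.sum {D : Set (Cn n)} {T : (Cn n → ℂ) → Cn n → ℂ} (hT : IsOperatorOn D T) {ι :
  Type*} (s : Finset ι) (c : ι → ℂ) {u : ι → Cn n → ℂ} (hu : ∀ i, ContUpToBoundary D (u i)) : T (fun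
  z => ∑ i ∈ s, c i * u i z) = fun z => ∑ i ∈ s, c i * T (u i) z := by
  have h0 : ContUpToBoundary D (0 : Cn n → ℂ) := Continuous.contUpToBoundary continuous_const
  have key : ContUpToBoundary D (fun z => ∑ i ∈ s, c i * u i z) ∧ T (fun z => ∑ i ∈ s, c i * u i z)
    = fun z => ∑ i ∈ s, c i * T (u i) z := by
    classical
    induction s using Finset.induction_on with
    | empty =>
      refine ⟨by simp only [Finset.sum_empty]; exact h0, ?_⟩
      have := hT.smul 0 0 h0
      rw [zero_smul, zero_smul] at this
      simp only [Finset.sum_empty]; exact this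
    | insert i s hi ih =>
      simp only [Finset.sum_insert hi]
      have h1 : ContUpToBoundary D fun z => c i * u i z := (hu i).mul continuous_const
      refine ⟨h1.add ih.1, ?_⟩
      have h2 := hT.add _ _ h1 ih.1
      have h3 := hT.smul (c i) (u i) (hu i)
      change T (fun z => c i * u i z) = fun z => c i * T (u i) z at h3
      rw [h3, ih.2] at h2
      exact h2
  exact key.2

namespace ChartCover

lemma term_congr {J : Fin q → Fin n} {j : Fin rk} {h' : Cn n → ℂ} (hh : x ∈ (P.ψ k).source → h (P.ψ
  k x) = h' (P.ψ k x)) (w : Fin q → TangentSpace 𝓘(ℂ, Cn n) x) : P.term k J j h x w = P.term k J j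
  h' x w := by
  by_cases hx : x ∈ (P.ψ k).source
  · simp only [term, pull, indicator_of_mem hx, hh hx]
  · simp only [term, pull, indicator_of_notMem hx]

lemma term_add (k : κ) (J : Fin q → Fin n) (j : Fin rk) (h h' : Cn n → ℂ) (x : X) (w : Fin q →
  TangentSpace 𝓘(ℂ, Cn n) x) : P.term k J j (fun z => h z + h' z) x w = P.term k J j h x w + P.term
  k J j h' x w := by
  simp only [term, ← add_smul, ← add_mul]
  congr 2
  by_cases hx : x ∈ (P.ψ k).source <;> simp [pull, hx]

lemma term_mul (J : Fin q → Fin n) (j : Fin rk) (a h : Cn n → ℂ) (hx : x ∈ (P.ψ k).source) (w : Fin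
  q → TangentSpace 𝓘(ℂ, Cn n) x) : P.term k J j (fun z => a z * h z) x w = a (P.ψ k x) • P.term k J
  j h x w := by
  simp only [term, pull, indicator_of_mem hx, smul_smul, mul_assoc]

lemma term_eq_zero {J : Fin q → Fin n} {j : Fin rk} (hx : x ∈ (P.ψ k).source → h (P.ψ k x) = 0) (w :
  Fin q → TangentSpace 𝓘(ℂ, Cn n) x) : P.term k J j h x w = 0 := by
  rw [term_congr (h' := fun _ => 0) hx]
  by_cases hs : x ∈ (P.ψ k).source <;> simp [term, pull, hs]

lemma tendsto_coeff_term {ι : Type*} {f : Filter ι} {J : Fin q → Fin n} {j : Fin rk} {h : ι → Cn n →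
  ℂ} {h₀ : Cn n → ℂ} (hh : (P.ψ l).symm z ∈ (P.ψ k).source → Tendsto (fun ε => h ε (P.ψ k ((P.ψ
  l).symm z))) f (𝓝 (h₀ (P.ψ k ((P.ψ l).symm z))))) (I : MultiIndex q n) (i : Fin rk) : Tendsto (fun
  ε => P.coeff (P.term k J j (h ε)) l I i z) f (𝓝 (P.coeff (P.term k J j h₀) l I i z)) := by
  simp only [coeff_term]
  refine Tendsto.mul_const _ ?_
  by_cases hx : (P.ψ l).symm z ∈ (P.ψ k).source
  · simpa only [pull, indicator_of_mem hx] using hh hx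
  · simp only [pull, indicator_of_notMem hx, tendsto_const_nhds]

lemma sq_apply (hx : x ∈ (P.ψ k).source) : P.sq k (P.ψ k x) = √(P.χ k x) := by
  rw [sq, indicator_of_mem ((P.ψ k).map_source hx), (P.ψ k).left_inv hx]

lemma mem_D (hx : x ∈ tsupport (P.χ k)) (hM : x ∈ M) : P.ψ k x ∈ P.D M k := ⟨x, ⟨P.χ_supp k hx, hM⟩,
  rfl⟩

lemma sq_mul_sq (k : κ) (hx : x ∈ (P.ψ k).source) : P.sq k (P.ψ k x) * P.sq k (P.ψ k x) = (P.χ k x :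
  ℂ) := by
  rw [sq_apply hx, ← Complex.ofReal_mul, Real.mul_self_sqrt (P.χ_nonneg k x)]

variable (P) in
/-- The coefficient `χ_k^{1/2} v^j_{k,I}` in the chart `ψ_k`. -/
def loc (v : FormField n V q) (p : κ × MultiIndex q n × Fin rk) (z : Cn n) : ℂ := P.sq p.1 z *
  P.coeff v p.1 p.2.1 p.2.2 z

lemma glue_eq {T : κ → (Cn n → ℂ) → Cn n → ℂ} (hT : ∀ k, IsOperatorOn (P.D M k) (T k)) (v :
  FormField n V q) : P.glue T v = fun x w => ∑ p : κ × MultiIndex q n × Fin rk, P.term p.1 p.2.1.1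
  p.2.2 (fun z => P.sq p.1 z * T p.1 (P.loc v p) z) x w := by
  funext x w
  simp only [glue, Fintype.sum_prod_type]
  refine sum_congr rfl fun k _ => sum_congr rfl fun I _ =>
    sum_congr rfl fun j _ => ?_
  by_cases hx : x ∈ (P.ψ k).source
  · rw [(hT k).congr (P.loc v (k, I, j)) (fun z => ((√(P.χ k ((P.ψ k).symm z)) : ℝ) : ℂ) * P.coeff v
      k I j z) fun z hz => ?_]
    · rw [term, pull, indicator_of_mem hx, sq_apply hx]
      rfl
    · obtain ⟨y, hy, rfl⟩ := hz
      have hys := P.closure_U_subset k (subset_closure hy.1)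
      simp only [loc, sq_apply hys, (P.ψ k).left_inv hys]
  · have h0 : P.χ k x = 0 := image_eq_zero_of_notMem_tsupport fun h => hx (mem_source h)
    rw [term_eq_zero fun h => absurd h hx, h0]
    simp

lemma sum_term_self (hM : M ⊆ P.region) (hx : x ∈ M) (hv : IsZeroForm v x) {h : κ × MultiIndex q n ×
  Fin rk → Cn n → ℂ} (hh : ∀ p, EqOn (h p) (P.loc v p) (P.D M p.1)) (w : Fin q → TangentSpace 𝓘(ℂ,
  Cn n) x) : ∑ p : κ × MultiIndex q n × Fin rk, P.term p.1 p.2.1.1 p.2.2 (fun z => P.sq p.1 z * h p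
  z) x w = v x w := by
  have key : ∀ k, ∑ I : MultiIndex q n, ∑ j : Fin rk, P.term k I.1 j (fun z => P.sq k z * h (k, I,
    j) z) x w = (P.χ k x : ℂ) • v x w := fun k => by
    by_cases hk : x ∈ tsupport (P.χ k)
    · have hs := mem_source hk
      rw [P.eq_sum_term hs hv, smul_sum]
      refine sum_congr rfl fun I _ => ?_
      rw [smul_sum]
      refine sum_congr rfl fun j _ => ?_
      rw [← sq_mul_sq k hs, mul_smul, ← term_mul _ _ _ _ hs, ← term_mul _ _ _ _ hs]
      exact term_congr (fun _ => by rw [hh (k, I, j) (mem_D hk hx)]; rfl) w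
    · rw [image_eq_zero_of_notMem_tsupport hk, Complex.ofReal_zero, zero_smul]
      refine sum_eq_zero fun I _ => sum_eq_zero fun j _ => term_eq_zero (fun hs => ?_) w
      rw [(P.isCut_sq k).eq_zero hs hk, zero_mul]
  simp only [Fintype.sum_prod_type, key, ← sum_smul, ← Complex.ofReal_sum, P.χ_sum x (hM hx),
    Complex.ofReal_one, one_smul]

variable (P) in
/-- Local covers for the sets `D_k` that fit to the chart transitions. -/
structure Smoother (m : ℕ) where
  G : P.Transit
  Q : κ → LocalCover (Cn n) m
  τ : ℝ
  τ_eq : ∀ k, (Q k).τ = τ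
  τ_le : τ ≤ G.τ
  c_eq : ∀ k, (Q k).c = G.c

namespace Smoother

variable (σ : P.Smoother m)

/-- The data `σ` can be used for the open set `M`. -/
structure Fits (M : Set X) (g : ∀ k, Fin (σ.Q k).num → Set (Cn n)) : Prop where
  isOpen : IsOpen M
  subset : M ⊆ P.region
  fits : ∀ k, (σ.Q k).Fits (P.D M k) (g k)

/-- The local smoothing operators. -/
def S (M : Set X) (k : κ) (t : ℝ) : (Cn n → ℂ) → Cn n → ℂ := (σ.Q k).op (P.D M k) t

variable {σ} {g : ∀ k, Fin (σ.Q k).num → Set (Cn n)} {t : ℝ} {v : FormField n V q}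

lemma Fits.isOperatorOn (hg : σ.Fits M g) (h0 : 0 < t) (k : κ) : IsOperatorOn (P.D M k) (σ.S M k t)
  := (hg.fits k).isOperatorOn_op h0

lemma Fits.smoothing_eq (hg : σ.Fits M g) (h0 : 0 < t) (v : FormField n V q) : P.smoothing (σ.S M) t
  v = fun x w => ∑ p : κ × MultiIndex q n × Fin rk, P.term p.1 p.2.1.1 p.2.2 (fun z => P.sq p.1 z *
  σ.S M p.1 t (P.loc v p) z) x w := glue_eq (fun k => hg.isOperatorOn h0 k) v

lemma contUpToBoundary_loc {p : κ × MultiIndex q n × Fin rk} (hv : ContUpToBoundary (P.D M p.1)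
  (P.coeff v p.1 p.2.1 p.2.2)) : ContUpToBoundary (P.D M p.1) (P.loc v p) := hv.mul (P.isCut_sq
  p.1).smooth.continuous

lemma D_subset (l : κ) : P.D M l ⊆ thickening σ.G.τ (P.ψ l '' P.U l) := (image_mono
  inter_subset_left).trans (self_subset_thickening σ.G.τ_pos _)

variable (σ) in
lemma exists_coeff_smoothing (l : κ) (I : MultiIndex q n) (i : Fin rk) : ∃ μ : κ × MultiIndex q n ×
  Fin rk → Cn n → ℂ, (∀ p, ContDiff ℝ ∞ (μ p)) ∧ (∀ p, HasCompactSupport (μ p)) ∧ ∀ M g, σ.Fits M g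
  → ∀ t, 0 < t → ∀ v : FormField n V q, EqOn (P.coeff (P.smoothing (σ.S M) t v) l I i) (fun z => ∑
  p, μ p z * σ.S M p.1 t (P.loc v p) (σ.G.Φ l p.1 z)) (thickening σ.G.τ (P.ψ l '' P.U l)) := by
  choose μ h1 h2 _ h4 using fun p : κ × MultiIndex q n × Fin rk =>
    σ.G.exists_coeff_eq (P.isCut_sq p.1) p.2.1.1 p.2.2 l I i
  refine ⟨μ, h1, h2, fun M g hg t h0 v z hz => ?_⟩
  rw [hg.smoothing_eq h0, coeff_sum]
  exact sum_congr rfl fun p _ => h4 p _ z hz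

lemma Fits.contDiff_S (hg : σ.Fits M g) (h0 : 0 < t) (ht : t ≤ σ.τ) {u : Cn n → ℂ} (hu :
  ContUpToBoundary (P.D M k) u) : ContDiff ℝ ∞ (σ.S M k t u) := (hg.fits k).contDiff_op h0 (ht.trans
  (σ.τ_eq k).ge) hu

lemma Fits.exists_contDiff (hg : σ.Fits M g) (h0 : 0 < t) (ht : t ≤ σ.τ) (hv : ∀ k I j,
  ContUpToBoundary (P.D M k) (P.coeff v k I j)) (l : κ) (I : MultiIndex q n) (i : Fin rk) : ∃ H : Cn
  n → ℂ, ContDiff ℝ ∞ H ∧ EqOn (P.coeff (P.smoothing (σ.S M) t v) l I i) H (thickening σ.G.τ (P.ψ l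
  '' P.U l)) := by
  obtain ⟨μ, h1, -, h3⟩ := σ.exists_coeff_smoothing l I i
  exact ⟨_, ContDiff.sum fun p _ => (h1 p).mul ((hg.contDiff_S h0 ht (contUpToBoundary_loc (hv _ _
    _))).comp (σ.G.Φ_smooth l p.1)), h3 M g hg t h0 v⟩

lemma Fits.isZeroForm_smoothing (hg : σ.Fits M g) (h0 : 0 < t) (v : FormField n V q) (x : X) :
  IsZeroForm (P.smoothing (σ.S M) t v) x := by
  rw [hg.smoothing_eq h0]
  exact IsZeroForm.sum _ fun p _ => P.isZeroForm_term _ _ _ _ x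

lemma Fits.isSmoothForm (hg : σ.Fits M g) (h0 : 0 < t) (ht : t ≤ σ.τ) (hv : ∀ k I j,
  ContUpToBoundary (P.D M k) (P.coeff v k I j)) : P.IsSmoothForm M t (P.smoothing (σ.S M) t v) := by
  refine ⟨fun x _ => hg.isZeroForm_smoothing h0 v x, fun l I i => ?_⟩
  obtain ⟨H, h1, h2⟩ := hg.exists_contDiff h0 ht hv l I i
  exact h1.contDiffOn.congr (h2.mono (σ.G.nbhdD_subset (ht.trans σ.τ_le)))

lemma Fits.isC1Form (hg : σ.Fits M g) (h0 : 0 < t) (ht : t ≤ σ.τ) (hv : ∀ k I j, ContUpToBoundary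
  (P.D M k) (P.coeff v k I j)) : P.IsC1Form M (P.smoothing (σ.S M) t v) := by
  refine ⟨fun x _ => hg.isZeroForm_smoothing h0 v x, fun l I i => ?_⟩
  obtain ⟨H, h1, h2⟩ := hg.exists_contDiff h0 ht hv l I i
  exact (h1.c1UpToBoundary _).congr (hg.fits l).isOpen (h2.mono (D_subset l))

lemma Fits.tendsto_coeff_smoothing (hg : σ.Fits M g) (hz : ∀ x ∈ M, IsZeroForm v x) (hv : ∀ k I j,
  ContUpToBoundary (P.D M k) (P.coeff v k I j)) (l : κ) (I : MultiIndex q n) (i : Fin rk) : (∃ B :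
  ℝ, ∀ ε, 0 < ε → ε ≤ σ.τ → ∀ z ∈ P.D M l, ‖P.coeff (P.smoothing (σ.S M) ε v) l I i z‖ ≤ B) ∧ ∀ z ∈
  P.D M l, Tendsto (fun ε => P.coeff (P.smoothing (σ.S M) ε v) l I i z) (𝓝[>] (0 : ℝ)) (𝓝 (P.coeff v
  l I i z)) := by
  have h1 := fun p => (hg.fits p.1).tendsto_op (contUpToBoundary_loc (p := p) (hv _ _ _))
  refine ⟨?_, ?_⟩
  · obtain ⟨μ, h2, h3, h4⟩ := σ.exists_coeff_smoothing (q := q) l I i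
    choose B hB using fun p => (h1 p).1
    choose C hC using fun p => (h3 p).exists_bound_of_continuous (h2 p).continuous
    refine ⟨∑ p, C p * B p, fun ε h0 hε z hz => ?_⟩
    rw [h4 M g hg ε h0 v (D_subset l hz)]
    refine norm_sum_le_of_le _ fun p _ => ?_
    rw [norm_mul]
    exact mul_le_mul (hC p z) (hB p ε h0 (hε.trans (σ.τ_eq _).ge) _) (norm_nonneg _) ((norm_nonneg
      _).trans (hC p z))
  · rintro _ ⟨x, hx, rfl⟩
    have hxs := (P.ψ l).left_inv (P.closure_U_subset l (subset_closure hx.1))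
    have h2 : P.coeff v l I i (P.ψ l x) = P.coeff (fun x w => ∑ p : κ × MultiIndex q n × Fin rk,
      P.term p.1 p.2.1.1 p.2.2 (fun z => P.sq p.1 z * P.loc v p z) x w) l I i (P.ψ l x) := by
      refine congrArg _ (sum_term_self hg.subset (by rw [hxs]; exact hx.2) (hz _ ?_) (fun p =>
        eqOn_refl _ _) _).symm
      rw [hxs]; exact hx.2
    rw [h2, coeff_sum]
    refine (tendsto_finsetSum _ fun p _ => tendsto_coeff_term (h := fun ε z => P.sq p.1 z * σ.S M
      p.1 ε (P.loc v p) z) (fun hs => ?_) I i).congr' ?_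
    · rw [hxs] at hs ⊢
      by_cases hk : x ∈ tsupport (P.χ p.1)
      · exact ((h1 p).2 _ (mem_D hk hx.2)).const_mul _
      · simp only [(P.isCut_sq p.1).eq_zero hs hk, zero_mul, tendsto_const_nhds]
    · filter_upwards [self_mem_nhdsWithin] with ε h0
      rw [hg.smoothing_eq h0, coeff_sum]

end Smoother

end ChartCover

lemma LocalCover.Fits.dbarDir_op {n m : ℕ} {Q : LocalCover (Cn n) m} {D : Set (Cn n)} {G : Fin Q.num
  → Set (Cn n)} (hG : Q.Fits D G) (h0 : 0 < t) (ht : t ≤ Q.τ) {u : Cn n → ℂ} (hu : C1UpToBoundary D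
  u) {y : Cn n} (hy : y ∈ thickening (Q.c * t) D) (e : Cn n) : dbarDir (Q.op D t u) y e = 1 / 2 *
  (Q.globalOp (Q.gradχ e) t (D.indicator u) y + Complex.I * Q.globalOp (Q.gradχ (Complex.I • e)) t
  (D.indicator u) y) + Q.op D t (fun z => dbarDir u z e) y := by
  have h1 := fun w => hG.gradCommutator_eq h0 ht hu.1 (hG.bddMeas hu.2.1) (hG.bddMeas (hu.2.2 w)) hy
  have hT := hG.isOperatorOn_op h0 (t := t)
  have hI : ContUpToBoundary D (Complex.I • fun z => fderiv ℝ u z (Complex.I • e)) := (hu.2.2 _).mul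
    continuous_const
  have h2 : Q.op D t (fun z => dbarDir u z e) = _ := hT.smul (1 / 2) ((fun z => fderiv ℝ u z e) +
    Complex.I • fun z => fderiv ℝ u z (Complex.I • e)) ((hu.2.2 _).add hI)
  rw [hT.add _ _ (hu.2.2 _) hI, hT.smul _ _ (hu.2.2 _)] at h2
  rw [h2, ← h1, ← h1, gradCommutator, gradCommutator]
  simp only [dbarDir, Pi.smul_apply, Pi.add_apply, smul_eq_mul]
  ring

lemma cdet_eq_sum (K : Fin q → Fin n) (c : Fin q → Cn n) : cdet K c = ∑ J : MultiIndex q n, cdet J.1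
  c * cdet K fun a => stdVec (J.1 a) := by
  simpa only [cdetMap_apply, smul_eq_mul] using sum_cdet_smul (cdetMap K) (fun w i =>
    by simp only [cdetMap_apply, cdet_update_I, smul_eq_mul]) c

namespace ChartCover

lemma sum_term_cdet {ι : Type*} [Fintype ι] (k : κ) (K : ι → Fin q → Fin n) (j : Fin rk) (h : Cn n →
  ℂ) (g : ι → Cn n → ℂ) (x : X) (w : Fin q → TangentSpace 𝓘(ℂ, Cn n) x) : ∑ J : MultiIndex q n,
  P.term k J.1 j (fun z => h z * ∑ a, cdet (K a) (fun b => stdVec (J.1 b)) * g a z) x w = ∑ a,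
  P.term k (K a) j (fun z => h z * g a z) x w := by
  by_cases hx : x ∈ (P.ψ k).source
  · simp only [term, pull, indicator_of_mem hx, ← sum_smul]
    congr 1
    simp only [cdet_eq_sum (K _) (fun b => dchart (P.ψ k) x (w b)), mul_sum, sum_mul]
    rw [sum_comm]
    exact sum_congr rfl fun a _ => sum_congr rfl fun J _ => by ring
  · simp [term, pull, hx]

lemma coeff_dbar (hM : IsOpen M) (hv : P.IsC1Form M v) (hD : IsOpen (P.D M k)) (J : MultiIndex (q +
  1) n) (j : Fin rk) (hz : z ∈ P.D M k) : P.coeff (dbar (F := F) v) k J j z = ∑ a : MultiIndex q n ×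
  Fin n, cdet (Fin.cons a.2 a.1.1) (fun b => stdVec (J.1 b)) * dbarDir (P.coeff v k a.1 j) z (stdVec
  a.2) := by
  obtain ⟨x, hx, rfl⟩ := hz
  have hs := P.closure_U_subset k (subset_closure hx.1)
  have hzt := (P.ψ k).map_source hs
  have h1 : HasDbar F (fun x w => ∑ p : MultiIndex q n × Fin rk, P.term k p.1.1 p.2 (P.coeff v k p.1
    p.2) x w) x fun w => ∑ p : MultiIndex q n × Fin rk, ∑ i, P.term k (Fin.cons i p.1.1) p.2 (fun z
    => dbarDir (P.coeff v k p.1 p.2) z (stdVec i)) x w := HasDbar.sum _ fun p _ =>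
    P.hasDbar_term_of_mem k p.1.1 p.2 hs (((hv.2 k p.1 p.2).1.differentiableOn
    (by simp)).differentiableAt (hD.mem_nhds ⟨x, hx, rfl⟩))
  have h2 := h1.congr (v' := v) (by
    filter_upwards [hM.mem_nhds hx.2, (P.ψ k).open_source.mem_nhds hs] with y hy hy' w
    rw [P.eq_sum_term hy' (hv.1 y hy), Fintype.sum_prod_type])
  have h3 : P.coeff (dbar (F := F) v) k J j (P.ψ k x) = P.coeff (fun x w =>
      ∑ p : MultiIndex q n × Fin rk, ∑ i, P.term k (Fin.cons i p.1.1) p.2 (fun z => dbarDir (P.coeff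
        v k p.1 p.2) z (stdVec i)) x w) k J j (P.ψ k x) := by
    have h4 : ∀ y, y = x → ∀ w, dbar (F := F) v y w = ∑ p : MultiIndex q n × Fin rk, ∑ i, P.term k
      (Fin.cons i p.1.1) p.2 (fun z => dbarDir (P.coeff v k p.1 p.2) z (stdVec i)) y w := by
      rintro _ rfl
      exact h2.eq
    exact congrArg ((P.frame k).coeff j ((P.ψ k).symm (P.ψ k x))) (h4 _ ((P.ψ k).left_inv hs) _)
  rw [h3, coeff_sum]
  simp only [coeff_sum, P.coeff_term_self k _ _ _ _ _ hzt, Fintype.sum_prod_type]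
  refine sum_congr rfl fun I _ => ?_
  rw [sum_comm]
  refine sum_congr rfl fun i _ => ?_
  rw [Finset.sum_ite_eq, if_pos (Finset.mem_univ _), mul_comm]

lemma Transit.mem_nbhdD (G : P.Transit) (ht : t ≤ G.τ) (hx : x ∈ P.nbhd M t) (hk : x ∈ tsupport (P.χ
  k)) : P.ψ k x ∈ P.nbhdD M (G.c * t) k := by
  obtain ⟨l, z, hz, rfl⟩ := mem_iUnion.1 hx
  rw [← G.Φ_self (G.mem_tsupport (G.nbhdD_subset ht hz)) hk]
  exact G.mem_thickening ht hz hk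

namespace Smoother

variable (σ : P.Smoother m)

/-- The contribution of the coefficient with the index `p` and of `∂/∂z̄_i` to the commutator. -/
def com (M : Set X) (t : ℝ) (v : FormField n V q) (p : κ × MultiIndex q n × Fin rk) (i : Fin n) (y :
  Cn n) : ℂ := P.sq p.1 y * (1 / 2 * ((σ.Q p.1).globalOp ((σ.Q p.1).gradχ (stdVec i)) t ((P.D M
  p.1).indicator (P.loc v p)) y + Complex.I * (σ.Q p.1).globalOp ((σ.Q p.1).gradχ (Complex.I •
  stdVec i)) t ((P.D M p.1).indicator (P.loc v p)) y)) + dbarDir (P.sq p.1) y (stdVec i) * σ.S M p.1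
  t (P.loc v p) y + P.sq p.1 y * σ.S M p.1 t (fun z => dbarDir (P.sq p.1) z (stdVec i) * P.coeff v
  p.1 p.2.1 p.2.2 z) y

/-- The commutator `[∂̄, S^t] v`. -/
def comForm (M : Set X) (t : ℝ) (v : FormField n V q) : FormField n V (q + 1) := fun x w =>
  ∑ p : κ × MultiIndex q n × Fin rk, ∑ i, P.term p.1 (Fin.cons i p.2.1.1) p.2.2 (σ.com M t v p i) x
    w

variable {σ} {g : ∀ k, Fin (σ.Q k).num → Set (Cn n)} {t : ℝ} {v : FormField n V q}

lemma coeff_comForm (l : κ) (J : MultiIndex (q + 1) n) (j : Fin rk) (z : Cn n) : P.coeff (σ.comForm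
  M t v) l J j z = ∑ p : κ × MultiIndex q n × Fin rk, ∑ i, P.coeff (P.term p.1 (Fin.cons i p.2.1.1)
  p.2.2 (σ.com M t v p i)) l J j z := (coeff_sum _ _ _ _ _ _ _).trans (sum_congr rfl fun _ _ =>
  coeff_sum _ _ _ _ _ _ _)

lemma com_eq_zero (p : κ × MultiIndex q n × Fin rk) (i : Fin n) (hs : x ∈ (P.ψ p.1).source) (hx : x
  ∉ tsupport (P.χ p.1)) : σ.com M t v p i (P.ψ p.1 x) = 0 := by
  simp only [com, (P.isCut_sq p.1).eq_zero hs hx, ((P.isCut_sq p.1).dbarDir (stdVec i)).eq_zero hs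
    hx, zero_mul, add_zero]

lemma Fits.dbarDir_sq_mul (hg : σ.Fits M g) (h0 : 0 < t) (ht : t ≤ σ.τ) (hv : P.IsC1Form M v)
    (p : κ × MultiIndex q n × Fin rk) (i : Fin n) (hx : x ∈ P.nbhd M t)
    (hs : x ∈ (P.ψ p.1).source) :
    dbarDir (fun z => P.sq p.1 z * σ.S M p.1 t (P.loc v p) z) (P.ψ p.1 x) (stdVec i) =
      σ.com M t v p i (P.ψ p.1 x) + P.sq p.1 (P.ψ p.1 x) * σ.S M p.1 t (fun z => P.sq p.1 z *
        dbarDir (P.coeff v p.1 p.2.1 p.2.2) z (stdVec i)) (P.ψ p.1 x) := by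
  have hf := hv.2 p.1 p.2.1 p.2.2
  have hc := P.isCut_sq p.1
  have hD := (hg.fits p.1).isOpen
  rw [dbarDir_mul (hc.smooth.differentiable (by simp) _)
    ((hg.contDiff_S h0 ht (contUpToBoundary_loc hf.2.1)).differentiable (by simp) _)]
  by_cases hk : x ∈ tsupport (P.χ p.1)
  · have hy := σ.G.mem_nbhdD (ht.trans σ.τ_le) hx hk
    rw [nbhdD, ← σ.c_eq p.1] at hy
    have hT := hg.isOperatorOn h0 p.1
    have h1 : σ.S M p.1 t (fun z => dbarDir (P.loc v p) z (stdVec i)) = σ.S M p.1 t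
        ((fun z => dbarDir (P.sq p.1) z (stdVec i) * P.coeff v p.1 p.2.1 p.2.2 z) + fun z =>
          P.sq p.1 z * dbarDir (P.coeff v p.1 p.2.1 p.2.2) z (stdVec i)) :=
      hT.congr _ _ fun z hz => dbarDir_mul (hc.smooth.differentiable (by simp) _)
        ((hf.1.differentiableOn (by simp)).differentiableAt (hD.mem_nhds hz)) _
    have h2 : ContUpToBoundary (P.D M p.1) fun z => dbarDir (P.coeff v p.1 p.2.1 p.2.2) z (stdVec i) :=
      ((hf.2.2 _).add ((hf.2.2 _).mul continuous_const)).mul continuous_const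
    rw [hT.add _ _ (hf.2.1.mul (hc.dbarDir _).smooth.continuous) (h2.mul hc.smooth.continuous)] at h1
    have h3 := (hg.fits p.1).dbarDir_op h0 (ht.trans (σ.τ_eq _).ge)
      (show C1UpToBoundary _ (P.loc v p) from hf.mul hD hc.smooth) hy (stdVec i)
    change dbarDir (σ.S M p.1 t (P.loc v p)) _ _ = _ + σ.S M p.1 t
      (fun z => dbarDir (P.loc v p) z (stdVec i)) _ at h3
    rw [h3, h1, com, Pi.add_apply]
    ring
  · rw [com_eq_zero p i hs hk, hc.eq_zero hs hk, (hc.dbarDir _).eq_zero hs hk]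
    simp

lemma Fits.dbarCommutator_eq (hg : σ.Fits M g) (h0 : 0 < t) (ht : t ≤ σ.τ) (hv : P.IsC1Form M v) (hx
  : x ∈ P.nbhd M t) (w : Fin (q + 1) → TangentSpace 𝓘(ℂ, Cn n) x) : P.dbarCommutator (σ.S M) t v x w
  = σ.comForm M t v x w := by
  have h1 : HasDbar F (P.smoothing (σ.S M) t v) x fun w => ∑ p : κ × MultiIndex q n × Fin rk, ∑ i,
    P.term p.1 (Fin.cons i p.2.1.1) p.2.2 (fun z => dbarDir (fun z => P.sq p.1 z * σ.S M p.1 t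
    (P.loc v p) z) z (stdVec i)) x w := by
    rw [hg.smoothing_eq h0]
    exact HasDbar.sum _ fun p _ => P.hasDbar_term _ _ _ (((P.isCut_sq p.1).smooth.mul (hg.contDiff_S
      h0 ht (contUpToBoundary_loc (hv.2 _ _ _).2.1))).differentiable (by simp)) (fun y h1 h2 =>
      by rw [(P.isCut_sq p.1).eq_zero h1 h2, zero_mul]) x
  have h2 : ∀ p : κ × MultiIndex (q + 1) n × Fin rk, σ.S M p.1 t (P.loc (dbar (F := F) v) p) = fun z
    => ∑ a : MultiIndex q n × Fin n, cdet (Fin.cons a.2 a.1.1) (fun b => stdVec (p.2.1.1 b)) * σ.S M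
    p.1 t (fun z => P.sq p.1 z * dbarDir (P.coeff v p.1 a.1 p.2.2) z (stdVec a.2)) z := fun p => by
    rw [← (hg.isOperatorOn h0 p.1).sum _ _ fun a => ?_]
    · refine (hg.isOperatorOn h0 p.1).congr _ _ fun z hz => ?_
      simp only [loc]
      rw [coeff_dbar hg.isOpen hv (hg.fits p.1).isOpen _ _ hz, mul_sum]
      exact sum_congr rfl fun a _ => by ring
    · have hf := hv.2 p.1 a.1 p.2.2
      exact (((hf.2.2 _).add ((hf.2.2 _).mul continuous_const)).mul continuous_const).mul
        (P.isCut_sq p.1).smooth.continuous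
  have h3 : P.smoothing (σ.S M) t (dbar (F := F) v) x w = ∑ p : κ × MultiIndex q n × Fin rk, ∑ i,
    P.term p.1 (Fin.cons i p.2.1.1) p.2.2 (fun z => P.sq p.1 z * σ.S M p.1 t (fun z =>
        P.sq p.1 z * dbarDir (P.coeff v p.1 p.2.1 p.2.2) z (stdVec i)) z) x w := by
    rw [hg.smoothing_eq h0]
    simp only [h2, Fintype.sum_prod_type]
    refine sum_congr rfl fun k _ => ?_
    rw [sum_comm, sum_comm (s := (Finset.univ : Finset (MultiIndex q n)))]
    refine sum_congr rfl fun j _ => ?_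
    have := sum_term_cdet (P := P) k (fun a : MultiIndex q n × Fin n => Fin.cons a.2 a.1.1) j (P.sq
      k) (fun a => σ.S M k t fun z => P.sq k z * dbarDir (P.coeff v k a.1 j) z (stdVec a.2)) x w
    simpa only [Fintype.sum_prod_type] using this
  rw [dbarCommutator, h1.eq, h3, sub_eq_iff_eq_add, comForm]
  simp only [← sum_add_distrib, ← term_add]
  exact sum_congr rfl fun p _ => sum_congr rfl fun i _ =>
    term_congr (fun hs => hg.dbarDir_sq_mul h0 ht hv p i hx hs) w

lemma Fits.tendsto_globalOp_smoothing (hg : σ.Fits M g) (hz : ∀ x ∈ M, IsZeroForm v x) (hv : ∀ k I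
  j, ContUpToBoundary (P.D M k) (P.coeff v k I j)) (h0 : 0 < t) (hα : P.IsCut k α) {ψ : Fin (σ.Q
  k).num → Cn n → ℝ} (hψ : ∀ j, ContDiff ℝ ∞ (ψ j)) (hc : ∀ j, HasCompactSupport (ψ j)) (I :
  MultiIndex q n) (j : Fin rk) (y : Cn n) : Tendsto (fun ε => (σ.Q k).globalOp ψ t ((P.D M
  k).indicator fun z =>
      α z * P.coeff (P.smoothing (σ.S M) ε v) k I j z) y) (𝓝[>] (0 : ℝ))
      (𝓝 ((σ.Q k).globalOp ψ t ((P.D M k).indicator fun z => α z * P.coeff v k I j z) y)) := by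
  obtain ⟨⟨B, hB⟩, hlim⟩ := hg.tendsto_coeff_smoothing hz hv k I j
  obtain ⟨C, hC⟩ := hα.hasCompactSupport.exists_bound_of_continuous hα.smooth.continuous
  have hτ : ∀ᶠ ε in 𝓝[>] (0 : ℝ), 0 < ε ∧ ε ≤ σ.τ := by
    have : 0 < σ.τ := σ.τ_eq k ▸ (σ.Q k).τ_pos
    exact Ioc_mem_nhdsGT this
  refine (σ.Q k).tendsto_globalOp (l := 𝓝[>] (0 : ℝ)) (B := C * |B|) hψ hc h0 ?_ ?_ (fun z => ?_) y
  · filter_upwards [hτ] with ε hε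
    exact (hg.fits k).bddMeas (((hg.isC1Form hε.1 hε.2 hv).2 k I j).2.1.mul hα.smooth.continuous)
  · filter_upwards [hτ] with ε hε z
    have hC0 := (norm_nonneg _).trans (hC z)
    by_cases hzD : z ∈ P.D M k
    · rw [indicator_of_mem hzD, norm_mul]
      exact mul_le_mul (hC z) ((hB ε hε.1 hε.2 z hzD).trans (le_abs_self B)) (norm_nonneg _) hC0
    · rw [indicator_of_notMem hzD, norm_zero]
      positivity
  · by_cases hzD : z ∈ P.D M k
    · simpa only [indicator_of_mem hzD] using (hlim z hzD).const_mul (α z)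
    · simp only [indicator_of_notMem hzD, tendsto_const_nhds]

lemma Fits.isDbarCommutator (hg : σ.Fits M g) (h0 : 0 < t) (ht : t ≤ σ.τ) (hz : ∀ x ∈ M, IsZeroForm
  v x) (hv : ∀ k I j, ContUpToBoundary (P.D M k) (P.coeff v k I j)) : P.IsDbarCommutator M (σ.S M) t
  v (σ.comForm M t v) := by
  refine ⟨fun x _ => IsZeroForm.sum _ fun p _ => IsZeroForm.sum _ fun i _ =>
    P.isZeroForm_term _ _ _ _ x, fun l J j z hzl => ?_, fun hv' x hx w =>
    (hg.dbarCommutator_eq h0 ht hv' hx w).symm⟩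
  have hτ : ∀ᶠ ε in 𝓝[>] (0 : ℝ), 0 < ε ∧ ε ≤ σ.τ := Ioc_mem_nhdsGT (h0.trans_le ht)
  have key : Tendsto (fun ε => P.coeff (σ.comForm M t (P.smoothing (σ.S M) ε v)) l J j z) (𝓝[>] (0 :
    ℝ)) (𝓝 (P.coeff (σ.comForm M t v) l J j z)) := by
    simp only [coeff_comForm]
    refine tendsto_finsetSum _ fun p _ => tendsto_finsetSum _ fun i _ =>
      tendsto_coeff_term (fun _ => ?_) J j
    have hc := P.isCut_sq p.1
    have htQ := ht.trans (σ.τ_eq p.1).ge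
    have hgl := fun {α} (hα : P.IsCut p.1 α) => fun {ψ} hψ hψ' => hg.tendsto_globalOp_smoothing hz
      hv h0 hα (ψ := ψ) hψ hψ' p.2.1 p.2.2 (P.ψ p.1 ((P.ψ l).symm z))
    have hgr := fun w => hgl hc ((σ.Q p.1).contDiff_gradχ w) ((σ.Q p.1).hasCompactSupport_gradχ w)
    have hop : ∀ {α}, P.IsCut p.1 α → Tendsto (fun ε => σ.S M p.1 t (fun z =>
        α z * P.coeff (P.smoothing (σ.S M) ε v) p.1 p.2.1 p.2.2 z) (P.ψ p.1 ((P.ψ l).symm z)))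
        (𝓝[>] (0 : ℝ)) (𝓝 (σ.S M p.1 t (fun z => α z * P.coeff v p.1 p.2.1 p.2.2 z) (P.ψ p.1 ((P.ψ
          l).symm z)))) := fun {α} hα => by
      have hcα := hα.smooth.continuous
      rw [S, (σ.Q p.1).op_eq h0 htQ ((hg.fits p.1).bddMeas ((hv _ _ _).mul hcα))]
      refine (hgl hα (σ.Q p.1).smooth (σ.Q p.1).supp).congr' ?_
      filter_upwards [hτ] with ε hε
      exact ((σ.Q p.1).op_eq h0 htQ ((hg.fits p.1).bddMeas (((hg.isC1Form hε.1 hε.2 hv).2 _ _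
        _).2.1.mul hcα)) _).symm
    exact ((((hgr _).add ((hgr _).const_mul _)).const_mul _).const_mul _ |>.add ((hop hc).const_mul
      _)).add ((hop (hc.dbarDir _)).const_mul _)
  refine key.congr' ?_
  filter_upwards [hτ] with ε hε
  refine congrArg _ (hg.dbarCommutator_eq h0 ht (hg.isC1Form hε.1 hε.2 hv) ?_ _).symm
  exact mem_iUnion.2 ⟨l, z, hzl, rfl⟩

end Smoother

end ChartCover

namespace ChartCover

lemma dbarDir_χ (k : κ) (hl : x ∈ (P.ψ l).source) : DifferentiableAt ℝ (fun y => ((P.χ k ((P.ψ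
  l).symm y) : ℝ) : ℂ)) (P.ψ l x) ∧ (x ∈ (P.ψ k).source → ∀ w : TangentSpace 𝓘(ℂ, Cn n) x, dbarDir
  (fun y => ((P.χ k ((P.ψ l).symm y) : ℝ) : ℂ)) (P.ψ l x) (dchart (P.ψ l) x w) = dbarDir (fun z =>
  P.sq k z * P.sq k z) (P.ψ k x) (dchart (P.ψ k) x w)) ∧ (x ∉ tsupport (P.χ k) → ∀ c, dbarDir (fun y
  => ((P.χ k ((P.ψ l).symm y) : ℝ) : ℂ)) (P.ψ l x) c = 0) := by
  have hzt := (P.ψ l).map_source hl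
  have hx := (P.ψ l).left_inv hl
  have hcs := (P.ψ l).continuousAt_symm hzt
  have h0 : x ∉ tsupport (P.χ k) → (fun y => ((P.χ k ((P.ψ l).symm y) : ℝ) : ℂ)) =ᶠ[𝓝 (P.ψ l x)] fun
    _ => 0 := fun hk => by
    filter_upwards [hcs.eventually ((isClosed_tsupport (P.χ k)).isOpen_compl.eventually_mem
      (by rwa [hx]))] with y hy
    rw [image_eq_zero_of_notMem_tsupport hy, Complex.ofReal_zero]
  have hq : Differentiable ℝ fun z => P.sq k z * P.sq k z := ((P.isCut_sq k).smooth.mul (P.isCut_sq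
    k).smooth).differentiable (by simp)
  have h1 : x ∈ (P.ψ k).source → (fun y => ((P.χ k ((P.ψ l).symm y) : ℝ) : ℂ)) =ᶠ[𝓝 (P.ψ l x)] fun y
    => P.sq k (P.ψ k ((P.ψ l).symm y)) * P.sq k (P.ψ k ((P.ψ l).symm y)) := fun hk => by
    filter_upwards [hcs.eventually ((P.ψ k).open_source.eventually_mem (by rwa [hx]))] with y hy
    exact (sq_mul_sq k hy).symm
  have h2 : x ∈ (P.ψ k).source → DifferentiableAt ℂ (fun y => P.ψ k ((P.ψ l).symm y)) (P.ψ l x) :=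
    fun hk => (contDiffAt_transition (P.ψ_mem l) (P.ψ_mem k) hzt (by rwa [hx])).differentiableAt
    (by simp)
  refine ⟨?_, fun hk w => ?_, fun hk c => ?_⟩
  · by_cases hk : x ∈ tsupport (P.χ k)
    · have hs := mem_source hk
      exact (DifferentiableAt.comp (P.ψ l x) (hq _) ((h2 hs).restrictScalars
        ℝ)).congr_of_eventuallyEq (h1 hs)
    · exact (differentiableAt_const 0).congr_of_eventuallyEq (h0 hk)
  · rw [dbarDir_congr (h1 hk), dbarDir_comp (h := fun z => P.sq k z * P.sq k z) (hq _) (h2 hk),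
      fderiv_transition_dchart (P.ψ_mem l) (P.ψ_mem k) hl hk, hx]
  · rw [dbarDir_congr (h0 hk)]
    simp [dbarDir]

lemma sum_term_dbarDir_sq (hM : M ⊆ P.region) (hx : x ∈ M) (hl : x ∈ (P.ψ l).source) (hv :
  IsZeroForm v x) {h : κ × MultiIndex q n × Fin rk → Cn n → ℂ} (hh : ∀ p, EqOn (h p) (P.coeff v p.1
  p.2.1 p.2.2) (P.D M p.1)) (w : Fin (q + 1) → TangentSpace 𝓘(ℂ, Cn n) x) : ∑ p : κ × MultiIndex q n
  × Fin rk, ∑ i, P.term p.1 (Fin.cons i p.2.1.1) p.2.2 (fun z => dbarDir (P.sq p.1) z (stdVec i) *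
  (2 * P.sq p.1 z) * h p z) x w = 0 := by
  set γ : κ → Cn n → ℂ := fun k y => ((P.χ k ((P.ψ l).symm y) : ℝ) : ℂ) with hγ
  have key : ∀ k, ∑ I : MultiIndex q n, ∑ j : Fin rk, ∑ i, P.term k (Fin.cons i I.1) j (fun z =>
    dbarDir (P.sq k) z (stdVec i) * (2 * P.sq k z) * h (k, I, j) z) x w = ∑ a : Fin (q + 1), ((-1 :
    ℂ) ^ (a : ℕ) * dbarDir (γ k) (P.ψ l x) (dchart (P.ψ l) x (w a))) • v x fun b => w (a.succAbove
    b) := fun k => by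
    obtain ⟨-, h1, h2⟩ := P.dbarDir_χ k hl
    by_cases hk : x ∈ tsupport (P.χ k)
    · have hs := mem_source hk
      have hd := (P.isCut_sq k).smooth.differentiable (by simp) (P.ψ k x)
      simp only [P.eq_sum_term hs hv, smul_sum]
      rw [eq_comm, sum_comm]
      refine sum_congr rfl fun I _ => ?_
      rw [sum_comm]
      refine sum_congr rfl fun j _ => ?_
      simp only [term, pull, indicator_of_mem hs, smul_smul, ← sum_smul, hγ, h1 hs, hh (k, I, j)
        (mem_D hk hx)]
      congr 1
      simp only [dbarDir_eq_sum _ _ (dchart _ _ _), dbarDir_mul hd hd, cdet_cons, mul_sum, sum_mul,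
        smul_eq_mul]
      rw [sum_comm]
      exact sum_congr rfl fun i _ => sum_congr rfl fun a _ => by ring
    · simp only [hγ, h2 hk, mul_zero, zero_smul, Finset.sum_const_zero]
      refine sum_eq_zero fun I _ => sum_eq_zero fun j _ => sum_eq_zero fun i _ => term_eq_zero (fun
        hs => ?_) w
      rw [(P.isCut_sq k).eq_zero hs hk, mul_zero, mul_zero, zero_mul]
  have hsum : ∀ c, ∑ k, dbarDir (γ k) (P.ψ l x) c = 0 := fun c => by
    rw [← dbarDir_sum _ fun k _ => (P.dbarDir_χ k hl).1, dbarDir_congr (g' := fun _ => 1)]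
    · simp [dbarDir]
    · filter_upwards [((P.ψ l).continuousAt_symm ((P.ψ l).map_source hl)).eventually
        (P.isOpen_region.eventually_mem (by rw [(P.ψ l).left_inv hl]; exact hM hx))] with y hy
      rw [← Complex.ofReal_sum, P.χ_sum _ hy, Complex.ofReal_one]
  simp only [Fintype.sum_prod_type, key]
  rw [sum_comm]
  refine sum_eq_zero fun a _ => ?_
  rw [← sum_smul, ← mul_sum, hsum, mul_zero, zero_smul]

namespace Smoother

variable (σ : P.Smoother m)

/-- The local extension operators. -/
def T (M : Set X) (g : ∀ k, Fin (σ.Q k).num → Set (Cn n)) (k : κ) : (Cn n → ℂ) → Cn n → ℂ := (σ.Q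
  k).ext (P.D M k) (g k)

variable {σ} in
lemma Fits.glue_apply {g : ∀ k, Fin (σ.Q k).num → Set (Cn n)} (hg : σ.Fits M g) (hv : ∀ k I j,
  ContUpToBoundary (P.D M k) (P.coeff v k I j)) (hx : x ∈ M) (hz : IsZeroForm v x) : P.glue (σ.T M
  g) v x = v x := by
  funext w
  rw [glue_eq (M := M) (T := σ.T M g) fun k => (hg.fits k).isOperatorOn_ext]
  exact sum_term_self hg.subset hx hz (fun p =>
    (hg.fits p.1).ext_eqOn_of_contUpToBoundary (contUpToBoundary_loc (hv _ _ _))) w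

/-- A domain, a parameter, and a form whose norm of order `s` is bounded by `A`. -/
structure Inst (q : ℕ) (s : ℝ) where
  M : Set X
  g : ∀ k, Fin (σ.Q k).num → Set (Cn n)
  fits : σ.Fits M g
  t : ℝ
  t_pos : 0 < t
  t_le : t ≤ σ.τ
  v : FormField n V q
  zero : ∀ x ∈ M, IsZeroForm v x
  A : ℝ
  A_nonneg : 0 ≤ A
  le : P.formNorm (P.D M) s v ≤ ofReal A

variable {σ} {s r : ℝ} {b : σ.Inst q s → ℝ}

lemma Inst.cont (a : σ.Inst q s) (hs : 0 < s) (k : κ) (I : MultiIndex q n) (j : Fin rk) :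
  ContUpToBoundary (P.D a.M k) (P.coeff a.v k I j) := by
  refine (a.fits.fits k).contUpToBoundary (zygmundScale (Cn n)) (r := s) hs (ne_top_of_le_ne_top
    ENNReal.ofReal_ne_top (le_trans ?_ a.le))
  exact le_iSup_of_le k (le_iSup_of_le I (le_iSup_of_le j le_rfl))

lemma Inst.t_le_Q (a : σ.Inst q s) (k : κ) : a.t ≤ (σ.Q k).τ := a.t_le.trans (σ.τ_eq k).ge

lemma Inst.nbhdD_subset (a : σ.Inst q s) (k : κ) : P.nbhdD a.M a.t k ⊆ thickening ((σ.Q k).c * a.t)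
  (P.D a.M k) := (σ.Q k).thickening_subset_thickening_mul a.t_pos _

lemma Inst.D_subset (a : σ.Inst q s) (k : κ) : P.D a.M k ⊆ thickening ((σ.Q k).c * a.t) (P.D a.M k)
  := (self_subset_thickening a.t_pos _).trans (a.nbhdD_subset k)

/-- The extension of a coefficient. -/
def Inst.extend (a : σ.Inst q s) (p : κ × MultiIndex q n × Fin rk) : Cn n → ℂ := σ.T a.M a.g p.1
  (P.coeff a.v p.1 p.2.1 p.2.2)

lemma Inst.extend_eqOn (a : σ.Inst q s) (hs : 0 < s) (p : κ × MultiIndex q n × Fin rk) : EqOn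
  (a.extend p) (P.coeff a.v p.1 p.2.1 p.2.2) (P.D a.M p.1) := (a.fits.fits
  p.1).ext_eqOn_of_contUpToBoundary (a.cont hs _ _ _)

lemma ub_extend (hs : 0 < s) (p : κ × MultiIndex q n × Fin rk) : UB s (fun a : σ.Inst q s => a.A)
  (fun _ => univ) fun a => a.extend p := fun N => by
  obtain ⟨C, hC, h⟩ := (σ.Q p.1).exists_data_ext (zygmundScale _) hs (N := N + ⌊s⌋₊ + 2) (by omega)
  refine ⟨C, hC.le, fun a => ⟨_, HasDyadic.mono (h _ _ _ a.A (a.fits.fits p.1) a.A_nonneg (le_trans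
    ?_ a.le)) (by omega) le_rfl, fun _ _ => rfl⟩⟩
  exact le_iSup_of_le p.1 (le_iSup_of_le p.2.1 (le_iSup_of_le p.2.2 le_rfl))

lemma ub_mul_extend (hs : 0 < s) (p : κ × MultiIndex q n × Fin rk) (hα : P.IsCut p.1 α) : UB s (fun
  a : σ.Inst q s => a.A) (fun _ => univ) fun a z => α z * a.extend p z := (ub_extend hs p).mul
  hα.smooth hα.hasCompactSupport

lemma ub_loc (hs : 0 < s) (p : κ × MultiIndex q n × Fin rk) : UB s (fun a : σ.Inst q s => a.A) (fun
  a => P.D a.M p.1) fun a => P.loc a.v p := (ub_mul_extend hs p (P.isCut_sq p.1)).congr (fun _ =>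
  subset_univ _) fun a z hz =>
    congrArg (P.sq p.1 z * ·) (a.extend_eqOn hs p hz).symm

/-- Uniform bounds for the coefficients of forms. -/
def FormUB (r : ℝ) (b : σ.Inst q s → ℝ) (W : σ.Inst q s → FormField n V q') : Prop := ∀ l I i, UB r
  b (fun a => P.nbhdD a.M a.t l) fun a => P.coeff (W a) l I i

lemma FormUB.sum {ι : Type*} [Fintype ι] {W : ι → σ.Inst q s → FormField n V q'} (h : ∀ p, FormUB r
  b (W p)) : FormUB r b fun a x w => ∑ p, W p a x w := fun l I i =>
  (UB.sum Finset.univ fun p _ => h p l I i).congr (fun _ => Subset.rfl) fun _ _ _ =>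
    coeff_sum _ _ _ _ _ _ _

lemma FormUB.add {W W' : σ.Inst q s → FormField n V q'} (h : FormUB r b W) (h' : FormUB r b W') :
  FormUB r b fun a x w => W a x w + W' a x w := fun l I i =>
  ((h l I i).add (h' l I i)).congr (fun _ => Subset.rfl) fun _ _ _ => map_add _ _ _

lemma FormUB.term (hα : P.IsCut k α) (J : Fin q' → Fin n) (j : Fin rk) {h : σ.Inst q s → Cn n → ℂ}
  (hh : UB r b (fun a => thickening ((σ.Q k).c * a.t) (P.D a.M k)) h) : FormUB r b fun a => P.term k
  J j fun y => α y * h a y := fun l I i N => by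
  obtain ⟨μ, h1, h2, h3, h4⟩ := σ.G.exists_coeff_eq hα J j l I i
  obtain ⟨C, hC, hCb⟩ := exists_bound_iterD h1 h2 N
  obtain ⟨B, hB, hBb⟩ := exists_bound_iterD (σ.G.Φ_smooth l k) (σ.G.Φ_supp l k) N
  obtain ⟨K, hK, H⟩ := hh N
  refine ⟨2 ^ N * C * ((N.factorial : ℝ) * B ^ N * K), by positivity, fun a => ?_⟩
  obtain ⟨f, hf, hf'⟩ := H a
  refine ⟨_, ((hf.comp hB (σ.G.Φ_smooth l k) hBb).mul h1 hCb).mono le_rfl (le_of_eq (by ring)), fun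
    z hz => ?_⟩
  have ht := a.t_le.trans σ.τ_le
  refine (h4 _ z (σ.G.nbhdD_subset ht hz)).trans ?_
  by_cases h0 : μ z = 0
  · simp only [h0, zero_mul]
  · have := σ.G.mem_thickening ht hz (h3 z h0)
    rw [nbhdD, ← σ.c_eq k] at this
    exact congrArg _ (hf' this)

lemma FormUB.exists_formNorm_le (hr : 0 < r) (hb : ∀ a, 0 ≤ b a) {W : σ.Inst q s → FormField n V q'}
  (h : FormUB r b W) : ∃ C : ℝ, 0 < C ∧ ∀ a, P.formNorm (P.nbhdD a.M a.t) r (W a) ≤ ofReal (C * b a)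
  := by
  obtain ⟨C, hC, h1⟩ := zygmundNorm_le_of_hasDyadic (E := Cn n) hr le_rfl
  choose K hK H using fun p : κ × MultiIndex q' n × Fin rk => h p.1 p.2.1 p.2.2 (zk r + 2)
  have hS : ∀ p, K p ≤ ∑ p, K p := fun p =>
    single_le_sum (fun p _ => hK p) (Finset.mem_univ p)
  refine ⟨C * (1 + ∑ p, K p), mul_pos hC (by
    have := sum_nonneg fun p (_ : p ∈ Finset.univ) => hK p
    linarith), fun a => iSup_le fun l => iSup_le fun I => iSup_le fun i => ?_⟩
  obtain ⟨f, h2, h3⟩ := H (l, I, i) a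
  rw [zygmundNorm_congr isOpen_thickening h3, mul_assoc]
  refine (zygmundNorm_mono (subset_univ _) f).trans ((h1 _ _ h2).trans (ofReal_le_ofReal ?_))
  gcongr
  · exact hb a
  · linarith [hS (l, I, i)]

lemma Inst.b_nonneg (a : σ.Inst q s) (e : ℝ) : 0 ≤ a.t ^ e * a.A := mul_nonneg (Real.rpow_nonneg
  a.t_pos.le e) a.A_nonneg

lemma formUB_smoothing (hr : 0 < r) (hs : 0 < s) (hsr : s ≤ r) : FormUB r (fun a : σ.Inst q s => a.t
  ^ (s - r) * a.A) fun a => P.smoothing (σ.S a.M) a.t a.v := by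
  have h : FormUB r (fun a : σ.Inst q s => a.t ^ (s - r) * a.A) fun a x w =>
      ∑ p : κ × MultiIndex q n × Fin rk, P.term p.1 p.2.1.1 p.2.2 (fun z => P.sq p.1 z * σ.S a.M p.1
        a.t (P.loc a.v p) z) x w := FormUB.sum fun p => FormUB.term (P.isCut_sq p.1) _ _ (UB.op (σ.Q
        p.1) (fun a => a.A_nonneg) (fun a => a.fits.fits p.1) (fun a => a.t_pos) (fun a => a.t_le_Q
        _) hr hs hsr (fun a => contUpToBoundary_loc (a.cont hs _ _ _)) (ub_loc hs p))
  simpa only [(Inst.fits _).smoothing_eq (Inst.t_pos _)] using h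

lemma formUB_approx (hr : 0 < r) (hs : 0 < s) (hrs : r ≤ s) (hsr : s ≤ r + m) : FormUB r (fun a :
  σ.Inst q s => a.t ^ (s - r) * a.A) fun a x w => P.glue (σ.T a.M a.g) a.v x w - P.smoothing (σ.S
  a.M) a.t (P.glue (σ.T a.M a.g) a.v) x w := by
  have h : FormUB r (fun a : σ.Inst q s => a.t ^ (s - r) * a.A) fun a x w =>
      ∑ p : κ × MultiIndex q n × Fin rk, P.term p.1 p.2.1.1 p.2.2 (fun z => P.sq p.1 z * (σ.T a.M
        a.g p.1 (P.loc a.v p) z - σ.S a.M p.1 a.t (P.loc a.v p) z)) x w := FormUB.sum fun p =>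
        FormUB.term (P.isCut_sq p.1) _ _ (UB.sub_op (σ.Q p.1) (fun a => a.A_nonneg) (fun a =>
        a.fits.fits p.1) (fun a => a.t_pos) (fun a => a.t_le_Q _) hr hs hrs hsr (fun a =>
        contUpToBoundary_loc (a.cont hs _ _ _)) (fun a => a.D_subset _) (fun a => Subset.rfl)
        ((UB.ext (σ.Q p.1) (fun a => a.A_nonneg) (fun a => a.fits.fits p.1) hs (ub_loc hs p)).congr
        (fun _ => subset_univ _) fun _ _ _ => rfl) fun a => (a.fits.fits
        p.1).ext_eqOn_of_contUpToBoundary (contUpToBoundary_loc (a.cont hs _ _ _)))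
  convert h using 4 with a x w
  rw [a.fits.smoothing_eq a.t_pos, glue_eq (M := a.M) (T := σ.T a.M a.g) fun k => (a.fits.fits
    k).isOperatorOn_ext, sub_eq_iff_eq_add, ← sum_add_distrib]
  refine sum_congr rfl fun p _ => ?_
  rw [← term_add]
  refine term_congr (fun _ => ?_) w
  have h2 : σ.S a.M p.1 a.t (P.loc (P.glue (σ.T a.M a.g) a.v) p) = σ.S a.M p.1 a.t (P.loc a.v p) :=
    by
    refine (a.fits.isOperatorOn a.t_pos p.1).congr _ _ ?_
    rintro _ ⟨y, hy, rfl⟩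
    have hys := (P.ψ p.1).left_inv (P.closure_U_subset _ (subset_closure hy.1))
    have hy2 : (P.ψ p.1).symm (P.ψ p.1 y) ∈ a.M := by rw [hys]; exact hy.2
    refine congrArg (P.sq p.1 _ * ·) (congrArg ((P.frame p.1).coeff p.2.2 _) ?_)
    exact congrFun (a.fits.glue_apply (a.cont hs) hy2 (a.zero _ hy2)) _
  rw [glue_eq (M := a.M) (T := σ.T a.M a.g) fun k => (a.fits.fits k).isOperatorOn_ext] at h2
  rw [h2]
  simp only [T]
  ring

lemma formUB_remainder (hr : 0 < r) (hs : 0 < s) (hrs : r ≤ s) (hsr : s ≤ r + m) : FormUB r (fun a :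
  σ.Inst q s => a.t ^ (s - r) * a.A) fun a x w =>
      ∑ p : κ × MultiIndex q n × Fin rk, ∑ i, P.term p.1 (Fin.cons i p.2.1.1) p.2.2
      (fun z => dbarDir (P.sq p.1) z (stdVec i) * (2 * P.sq p.1 z) * a.extend p z) x w := by
  intro l I i
  have h : FormUB s (fun a : σ.Inst q s => a.A) fun a x w =>
      ∑ p : κ × MultiIndex q n × Fin rk, ∑ i, P.term p.1 (Fin.cons i p.2.1.1) p.2.2
      (fun z => dbarDir (P.sq p.1) z (stdVec i) * (2 * P.sq p.1 z) * a.extend p z) x w := FormUB.sum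
        fun p => FormUB.sum fun i => FormUB.term (((P.isCut_sq p.1).dbarDir (stdVec i)).mul
        (contDiff_const.mul (P.isCut_sq p.1).smooth)) _ _ ((ub_extend hs p).congr (fun _ =>
        subset_univ _) fun _ _ _ => rfl)
  refine (UB.sub_op (σ.Q l) (u := fun _ => 0) (fun a => a.A_nonneg) (fun a => a.fits.fits l) (fun a
    => a.t_pos) (fun a => a.t_le_Q _) hr hs hrs hsr (fun a => Continuous.contUpToBoundary
    continuous_const) (fun a => self_subset_thickening a.t_pos _) (fun a => a.nbhdD_subset l) (h l I
    i) fun a z hz => ?_).congr (fun _ => Subset.rfl) fun a z _ => ?_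
  · obtain ⟨y, hy, rfl⟩ := hz
    have hs' := P.closure_U_subset _ (subset_closure hy.1)
    have hys := (P.ψ l).left_inv hs'
    refine (congrArg ((P.frame l).coeff i _) (sum_term_dbarDir_sq a.fits.subset (x := (P.ψ l).symm
      (P.ψ l y)) (by rw [hys]; exact hy.2) (l := l) (by rwa [hys]) (a.zero _
      (by rw [hys]; exact hy.2)) (a.extend_eqOn hs) _)).trans (map_zero _)
  · have : (σ.Q l).op (P.D a.M l) a.t 0 z = 0 := by simp [LocalCover.op]
    exact (sub_eq_self.2 this).symm

lemma formUB_comForm (hr : 0 < r) (hs : 0 < s) (hrs : r ≤ s) (hsr : s ≤ r + m) : FormUB r (fun a :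
  σ.Inst q s => a.t ^ (s - r) * a.A) fun a => σ.comForm a.M a.t a.v := by
  have hn : ∀ i : Fin n, ‖(stdVec i : Cn n)‖ ≤ 1 := fun i => by simp [stdVec]
  have hg : ∀ (p : κ × MultiIndex q n × Fin rk) (w : Cn n), ‖w‖ ≤ 1 → _ := fun p w hw =>
    UB.gradχ (σ.Q p.1) (fun a : σ.Inst q s => a.A_nonneg) (fun a => a.fits.fits p.1) (fun a =>
      a.t_pos) (fun a => a.t_le_Q _) hs hr hsr hw (ub_loc hs p)
  have hv : ∀ (p : κ × MultiIndex q n × Fin rk) (α : Cn n → ℂ) (hα : P.IsCut p.1 α), _ := fun p α hα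
    => UB.sub_op (σ.Q p.1) (u := fun a z => α z * P.coeff a.v p.1 p.2.1 p.2.2 z) (fun a : σ.Inst q s
    => a.A_nonneg) (fun a => a.fits.fits p.1) (fun a => a.t_pos) (fun a => a.t_le_Q _) hr hs hrs hsr
    (fun a => (a.cont hs _ _ _).mul hα.smooth.continuous) (fun a => a.D_subset _) (fun a =>
    Subset.rfl) ((ub_mul_extend hs p hα).congr (fun _ => subset_univ _) fun _ _ _ => rfl) fun a z hz
    => congrArg (α z * ·) (a.extend_eqOn hs p hz)
  have h : ∀ (p : κ × MultiIndex q n × Fin rk) (i : Fin n), _ := fun p i =>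
    have hq := P.isCut_sq p.1
    have hb := hq.dbarDir (stdVec i)
    (((FormUB.term (hq.mul (contDiff_const (c := (1 / 2 : ℂ)))) (Fin.cons i p.2.1.1) p.2.2 (hg p _
      (hn i))).add (FormUB.term (hq.mul (contDiff_const (c := (Complex.I / 2 : ℂ)))) (Fin.cons i
      p.2.1.1) p.2.2 (hg p (Complex.I • stdVec i)
      (by rw [norm_smul, Complex.norm_I, one_mul]; exact hn i)))).add (FormUB.term (hb.mul
      (contDiff_const (c := (-1 : ℂ)))) (Fin.cons i p.2.1.1) p.2.2 (hv p _ hq))).add (FormUB.term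
      (hq.mul (contDiff_const (c := (-1 : ℂ)))) (Fin.cons i p.2.1.1) p.2.2 (hv p _ hb))
  have h' := (FormUB.sum fun p => FormUB.sum fun i => h p i).add (formUB_remainder hr hs hrs hsr)
  convert h' using 4 with a x w
  simp only [← sum_add_distrib, ← term_add]
  refine sum_congr rfl fun p _ => sum_congr rfl fun i _ => term_congr (fun _ => ?_) w
  simp only [com, S]
  change _ * (_ * (_ + _)) + _ * (σ.Q p.1).op _ _ (fun z => P.sq p.1 z * P.coeff a.v p.1 p.2.1 p.2.2
    z) _ + _ = _
  ring

end Smoother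

end ChartCover

namespace ChartCover

variable (P)

lemma formNorm_eq_zero (h : n < q) (B : κ → Set (Cn n)) (r : ℝ) (v : FormField n V q) : P.formNorm B
  r v = 0 := by
  have : IsEmpty (MultiIndex q n) := ⟨fun I => by
    have := Fintype.card_le_of_injective _ I.2.injective
    simp only [Fintype.card_fin] at this
    omega⟩
  simp [formNorm]

lemma exists_smoother (m : ℕ) (L : κ → LipschitzCover (Cn n)) : ∃ σ : P.Smoother m, 0 < σ.τ ∧ σ.τ ≤
  1 ∧ ∀ M : Set X, IsOpen M → M ⊆ P.region → (∀ k, (L k).Describes (P.D M k)) → ∃ g, σ.Fits M g :=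
  by
  obtain ⟨G⟩ := P.exists_transit
  choose Q hQc hQ using fun k => (L k).exists_localCover m G.one_le_c
  obtain ⟨δ, hδ, hle⟩ := exists_pos_le_of_finite (fun k => (Q k).τ) fun k => (Q k).τ_pos
  have h0 : 0 < min 1 (min G.τ δ) := lt_min one_pos (lt_min G.τ_pos hδ)
  have h1 : ∀ k, min 1 (min G.τ δ) ≤ (Q k).τ := fun k =>
    (min_le_right _ _).trans ((min_le_right _ _).trans (hle k))
  refine ⟨⟨G, fun k => (Q k).shrink _ h0 (h1 k), min 1 (min G.τ δ), fun _ => rfl, (min_le_right _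
    _).trans (min_le_left _ _), hQc⟩, h0, min_le_left _ _, fun M hM hMr hL => ?_⟩
  choose g hg using fun k => hQ k _ (hL k)
  exact ⟨g, hM, hMr, fun k => (hg k).shrink h0 (h1 k)⟩

namespace Smoother

variable {P} (σ : P.Smoother m)

variable {σ} in
lemma FormUB.exists_nnreal {r s e : ℝ} (hr : 0 < r) (W : Set X → (∀ k, Fin (σ.Q k).num → Set (Cn n))
  → ℝ → FormField n V q → FormField n V q') (h : FormUB r (fun a : σ.Inst q s => a.t ^ e * a.A) fun
  a => W a.M a.g a.t a.v) : ∃ C : ℝ≥0, ∀ M g, σ.Fits M g → ∀ v : FormField n V q, (∀ x ∈ M,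
  IsZeroForm v x) → ∀ t, 0 < t → t ≤ σ.τ → P.formNorm (P.nbhdD M t) r (W M g t v) ≤ C * ofReal (t ^
  e) * P.formNorm (P.D M) s v := by
  obtain ⟨C, hC, hle⟩ := h.exists_formNorm_le hr fun a => a.b_nonneg _
  exact ⟨C.toNNReal, fun M g hg v hv t h0 ht => enorm_le_of_forall hC (Real.rpow_pos_of_pos h0 e)
    fun A hA hvA => hle ⟨M, g, hg, t, h0, ht, v, hv, A, hA, hvA⟩⟩

/-- The constants in the estimates for forms. -/
structure FormBounds (r s : ℝ) (C : ℝ≥0) (q : ℕ) : Prop where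
  bound : s ≤ r → ∀ M g, σ.Fits M g → ∀ v : FormField n V q, (∀ x ∈ M, IsZeroForm v x) →
    ∀ t, 0 < t → t ≤ σ.τ → P.formNorm (P.nbhdD M t) r (P.smoothing (σ.S M) t v) ≤
      C * ofReal (t ^ (s - r)) * P.formNorm (P.D M) s v
  approx : r ≤ s → s ≤ r + m → ∀ M g, σ.Fits M g → ∀ v : FormField n V q,
    (∀ x ∈ M, IsZeroForm v x) → ∀ t, 0 < t → t ≤ σ.τ → P.formNorm (P.nbhdD M t) r
      (fun x w => P.glue (σ.T M g) v x w - P.smoothing (σ.S M) t (P.glue (σ.T M g) v) x w) ≤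
      C * ofReal (t ^ (s - r)) * P.formNorm (P.D M) s v
  commutator : s ≤ r → r ≤ s + m → ∀ M g, σ.Fits M g → ∀ v : FormField n V q,
    (∀ x ∈ M, IsZeroForm v x) → ∀ t, 0 < t → t ≤ σ.τ → P.formNorm (P.nbhdD M t) s
      (σ.comForm M t v) ≤ C * ofReal (t ^ (r - s)) * P.formNorm (P.D M) r v

variable {σ} in
lemma FormBounds.mono {r s : ℝ} {C C' : ℝ≥0} (h : σ.FormBounds r s C q) (hC : C ≤ C') : σ.FormBounds
  r s C' q := ⟨fun h1 M g hg v hv t h0 ht => (h.bound h1 M g hg v hv t h0 ht).trans (by gcongr), fun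
  h1 h2 M g hg v hv t h0 ht => (h.approx h1 h2 M g hg v hv t h0 ht).trans (by gcongr), fun h1 h2 M g
  hg v hv t h0 ht => (h.commutator h1 h2 M g hg v hv t h0 ht).trans (by gcongr)⟩

lemma exists_formBounds (r s : ℝ) : ∃ C : ℝ≥0, 0 < r → 0 < s → ∀ q, σ.FormBounds r s C q := by
  by_cases hrs : 0 < r ∧ 0 < s
  swap
  · exact ⟨0, fun hr hs => absurd ⟨hr, hs⟩ hrs⟩
  obtain ⟨hr, hs⟩ := hrs
  have h1 : ∀ q, ∃ C : ℝ≥0, σ.FormBounds r s C q := fun q => by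
    have ex : ∀ {p : Prop} {Q : ℝ≥0 → Prop}, (p → ∃ C, Q C) → ∃ C, p → Q C := fun {p Q} h => by
      by_cases hp : p
      · obtain ⟨C, hC⟩ := h hp
        exact ⟨C, fun _ => hC⟩
      · exact ⟨0, fun h => absurd h hp⟩
    obtain ⟨C₁, h₁⟩ := ex fun h : s ≤ r => (formUB_smoothing (σ := σ) (q := q) hr hs
      h).exists_nnreal hr fun M _ t v => P.smoothing (σ.S M) t v
    obtain ⟨C₂, h₂⟩ := ex fun h : r ≤ s ∧ s ≤ r + m =>
      (formUB_approx (σ := σ) (q := q) hr hs h.1 h.2).exists_nnreal hr fun M g t v x w =>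
        P.glue (σ.T M g) v x w - P.smoothing (σ.S M) t (P.glue (σ.T M g) v) x w
    obtain ⟨C₃, h₃⟩ := ex fun h : s ≤ r ∧ r ≤ s + m =>
      (formUB_comForm (σ := σ) (q := q) hs hr h.1 h.2).exists_nnreal hs fun M _ t v => σ.comForm M t
        v
    refine ⟨C₁ + C₂ + C₃, fun h1 M g hg v hv t h0 ht => (h₁ h1 M g hg v hv t h0 ht).trans ?_, fun h1
      h2 M g hg v hv t h0 ht => (h₂ ⟨h1, h2⟩ M g hg v hv t h0 ht).trans ?_, fun h1 h2 M g hg v hv t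
      h0 ht => (h₃ ⟨h1, h2⟩ M g hg v hv t h0 ht).trans ?_⟩
    · gcongr; exact_mod_cast le_self_add.trans le_self_add
    · gcongr; exact_mod_cast le_add_self.trans le_self_add
    · gcongr; exact_mod_cast le_add_self
  choose C hC using h1
  refine ⟨∑ q ∈ range (n + 1), C q, fun _ _ q => ?_⟩
  by_cases hq : q < n + 1
  · exact (hC q).mono (single_le_sum (fun _ _ => zero_le) (mem_range.2 hq))
  · exact ⟨fun _ _ _ _ _ _ _ _ _ =>
      by rw [P.formNorm_eq_zero (by omega)]; exact zero_le, fun _ _ _ _ _ _ _ _ _ _ => by rw [P.formNorm_eq_zero (by omega)]; exact zero_le, fun _ _ _ _ _ _ _ _ _ _ => by rw [P.formNorm_eq_zero (by omega)]; exact zero_le⟩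

lemma exists_isMoserSmoothing : ∃ (A : ℝ → ℝ≥0) (C : ℝ → ℝ → ℝ≥0), ∀ C' : ℝ → ℝ → ℝ≥0, (∀ r s, C r s
  ≤ C' r s) → ∀ M g, σ.Fits M g → ∀ k, IsMoserSmoothing m σ.τ A C' (P.D M k) (σ.S M k) (σ.T M g k)
  := by
  choose A C h using fun k => (σ.Q k).exists_isMoserSmoothing
  refine ⟨fun a => ∑ k, A k a, fun r s => ∑ k, C k r s, fun C' hC M g hg k => ?_⟩
  rw [← σ.τ_eq k]
  exact h k _ _ (hg.fits k) _ _ (fun a => single_le_sum (f := fun k => A k a) (fun _ _ => zero_le)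
    (Finset.mem_univ k)) fun r s => (single_le_sum (f := fun k => C k r s) (fun _ _ => zero_le)
    (Finset.mem_univ k)).trans (hC r s)

end Smoother

end ChartCover

end Forms

end MoserSmoothing
end

theorem mainTheorem8 (m : ℕ)
    {n : ℕ} {X : Type*} [TopologicalSpace X] [T2Space X]
    [ChartedSpace (MoserSmoothing.Cn n) X] [IsManifold 𝓘(ℂ, MoserSmoothing.Cn n) ω X]
    {F : Type*} [NormedAddCommGroup F] [NormedSpace ℂ F] [FiniteDimensional ℂ F]
    {V : X → Type*} [TopologicalSpace (TotalSpace F V)] [∀ x, AddCommGroup (V x)]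
    [∀ x, Module ℂ (V x)] [∀ x, TopologicalSpace (V x)] [FiberBundle F V] [VectorBundle ℂ F V]
    [ContMDiffVectorBundle ω F V 𝓘(ℂ, MoserSmoothing.Cn n)]
    {κ : Type*} [Fintype κ] {rk : ℕ} (P : MoserSmoothing.ChartCover n F V κ rk)
    (K : Set X) (hK : IsCompact K) (hKP : K ⊆ P.region)
    (L : κ → MoserSmoothing.LipschitzCover (MoserSmoothing.Cn n)) :
    -- functions on Lipschitz domains in a Euclidean space
    (∀ (d : ℕ) (L₀ : MoserSmoothing.LipschitzCover (EuclideanSpace ℝ (Fin d))),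
      ∃ (τ : ℝ) (A : ℝ → ℝ≥0) (C : ℝ → ℝ → ℝ≥0), 0 < τ ∧ τ ≤ 1 ∧
        ∀ D : Set (EuclideanSpace ℝ (Fin d)), L₀.Describes D →
          ∃ S T, MoserSmoothing.IsMoserSmoothing m τ A C D S T) ∧
    -- bundle-valued forms on domains in the complex manifold
    (∃ (τ : ℝ) (A : ℝ → ℝ≥0) (C : ℝ → ℝ → ℝ≥0), 0 < τ ∧ τ ≤ 1 ∧
      ∀ M : Set X, IsOpen M → M ⊆ K → (∀ k, (L k).Describes (P.D M k)) →
        (∀ k, P.nbhdD M τ k ⊆ (P.ψ k).target) ∧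
        ∃ (S : κ → ℝ → (MoserSmoothing.Cn n → ℂ) → MoserSmoothing.Cn n → ℂ)
          (T : κ → (MoserSmoothing.Cn n → ℂ) → MoserSmoothing.Cn n → ℂ),
          (∀ k, MoserSmoothing.IsMoserSmoothing m τ A C (P.D M k) (S k) (T k)) ∧
          ∀ q : ℕ,
            (∀ v : MoserSmoothing.FormField n V q, P.IsContForm M v →
              (∀ x ∈ M, P.glue T v x = v x) ∧
              ∀ t, 0 < t → t ≤ τ → P.IsSmoothForm M t (P.smoothing S t v)) ∧
            ∀ v : MoserSmoothing.FormField n V q, (∀ x ∈ M, MoserSmoothing.IsZeroForm v x) →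
              ∀ t, 0 < t → t ≤ τ → ∀ r s : ℝ, 0 < r → 0 < s →
                (s ≤ r → P.formNorm (P.nbhdD M t) r (P.smoothing S t v) ≤
                  C r s * ENNReal.ofReal (t ^ (s - r)) * P.formNorm (P.D M) s v) ∧
                (r ≤ s → s ≤ r + m →
                  P.formNorm (P.nbhdD M t) r
                      (fun x w => P.glue T v x w - P.smoothing S t (P.glue T v) x w) ≤
                    C r s * ENNReal.ofReal (t ^ (s - r)) * P.formNorm (P.D M) s v) ∧
                (s ≤ r → r < s + m → P.formNorm (P.D M) r v ≠ ⊤ →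
                  ∃ W : MoserSmoothing.FormField n V (q + 1), P.IsDbarCommutator M S t v W ∧
                    P.formNorm (P.nbhdD M t) s W ≤
                      C r s * ENNReal.ofReal (t ^ (r - s)) * P.formNorm (P.D M) r v)) := by
  refine ⟨fun d L₀ => L₀.exists_isMoserSmoothing m, ?_⟩
  obtain ⟨σ, hσ0, hσ1, hσ⟩ := P.exists_smoother m L
  obtain ⟨A, C₁, h₁⟩ := σ.exists_isMoserSmoothing
  choose C₂ h₂ using σ.exists_formBounds
  refine ⟨σ.τ, A, fun r s => C₁ r s + C₂ r s, hσ0, hσ1, fun M hM hMK hL => ?_⟩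
  obtain ⟨g, hg⟩ := hσ M hM (hMK.trans hKP) hL
  refine ⟨fun k z hz => σ.G.θ_target k (σ.G.mem_tsupport (σ.G.nbhdD_subset σ.τ_le hz)), σ.S M, σ.T M g,
    h₁ _ (fun r s => le_self_add) M g hg, fun q => ⟨fun v hv =>
    ⟨fun x hx => hg.glue_apply hv.2 hx (hv.1 x hx), fun t h0 ht => hg.isSmoothForm h0 ht hv.2⟩,
    fun v hv t h0 ht r s hr hs => ?_⟩⟩
  have hB := (h₂ r s hr hs q).mono (le_add_self (a := C₂ r s) (b := C₁ r s))
  refine ⟨fun h => hB.bound h M g hg v hv t h0 ht, fun h h' => hB.approx h h' M g hg v hv t h0 ht,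
    fun h h' hne => ⟨σ.comForm M t v, hg.isDbarCommutator h0 ht hv fun k I j => ?_,
      hB.commutator h h'.le M g hg v hv t h0 ht⟩⟩
  exact (hg.fits k).contUpToBoundary (MoserSmoothing.zygmundScale _) (r := r) hr (ne_top_of_le_ne_top hne
    (le_iSup_of_le k (le_iSup_of_le I (le_iSup_of_le j le_rfl))))
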